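/- Let $\mathcal S([0,\infty))$ be the space of all $u\in C^\infty([0,\infty),\mathbb C)$ with $\sup_{x\ge 0}|x^n u^{(m)}(x)|<\infty$ for all integers $n,m\ge 0$. A solution of the Gerdjikov–Ivanov (GI) equation in the quarter plane is a smooth function $q:[0,\infty)\times[0,\infty)\to\mathbb C$ with $q(\cdot,t)\in\mathcal S([0,\infty))$ for each $t\ge 0$ and $$ i q_t+q_{xx}+i q^2\,\bar q_x+\tfrac12|q|^4q=0\qquad\text{for all } x>0,\ t>0 .$$ A triple $(\alpha,\omega,c)$ with $\alpha>0$, $\omega\in\mathbb R$, $c\in\mathbb C$ is called admissible if there is a solution $q$ of the GI equation in the quarter plane such that, as $t\to\infty$, $$ q(0,t)-\alpha e^{i\omega t}=O(t^{-5/2})\qquad\text{and}\qquad q_x(0,t)-c\,e^{i\omega t}=O(t^{-5/2}).$$ **Theorem.** Let $\alpha>0$, $\omega\in\mathbb R$, $c\in\mathbb C$, and suppose that $(\alpha,\omega,c)$ is admissible. (a) If $\alpha^6-2\alpha^2\omega+2|c|^2+4\alpha^3\operatorname{Im}c=0$, then either $$\omega\ge\frac{\alpha^4}{16}\quad\text{and}\quad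 c=\pm\alpha\sqrt{\omega-\frac{\alpha^4}{16}}-\frac{\alpha^3}{4}i\ \ \text{for one of the two signs},$$ or $$\omega=-\frac{\alpha^4}{4}\quad\text{and}\quad c=-\frac{\alpha^3}{2}i .$$ (b) If $\operatorname{Re}c=0$ and $(\operatorname{Im}c)^2+\alpha^2\omega=\frac{\alpha^6}{2}+\alpha^3\operatorname{Im}c$, then either $$\omega\le-\frac{\alpha^4}{4}\quad\text{and}\quad c=\alpha\left(\frac{\alpha^2}{2}-\sqrt{\frac{3\alpha^4}{4}-\omega}\right)i,$$ or $$\omega\le-\frac12\left(6\sqrt6+15\right)\alpha^4\quad\text{and}\quad c=\alpha\left(\frac{\alpha^2}{2}+\sqrt{\frac{3\alpha^4}{4}-\omega}\right)i .$$ -/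

import Mathlib

open scoped Asymptotics


/-- `u` belongs to the Schwartz space `𝓢([0,∞))`: it is smooth on `[0,∞)` (one-sidedly at `0`) and
`sup_{x ≥ 0} |x ^ n u⁽ᵐ⁾(x)| < ∞` for all `n, m`. Only the values of `u` on `[0,∞)` matter. -/
def IsSchwartzHalfLine (u : ℝ → ℂ) : Prop :=
  ContDiffOn ℝ ((⊤ : ℕ∞) : WithTop ℕ∞) u (Set.Ici 0) ∧
    ∀ n m : ℕ, ∃ C : ℝ, ∀ x : ℝ, 0 ≤ x →
      |x ^ n| * ‖iteratedDerivWithin m u (Set.Ici 0) x‖ ≤ C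

/-- The Gerdjikov–Ivanov equation `i q_t + q_xx + i q² (q̄)_x + ½ |q|⁴ q = 0` at `(x, t)`;
here `q x t` stands for `q(x,t)`. -/
def GIEquationAt (q : ℝ → ℝ → ℂ) (x t : ℝ) : Prop :=
  Complex.I * deriv (fun s : ℝ => q x s) t
    + iteratedDeriv 2 (fun y : ℝ => q y t) x
    + Complex.I * q x t ^ 2 * deriv (fun y : ℝ => (starRingEnd ℂ) (q y t)) x
    + (1 / 2 : ℂ) * (‖q x t‖ : ℂ) ^ 4 * q x t = 0

/-- `q` is a solution of the GI equation in the quarter plane `{x ≥ 0, t ≥ 0}`: it is smooth on the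
closed quarter plane, `q(·,t)` is in `𝓢([0,∞))` for each `t ≥ 0`, and the equation holds for
`x > 0`, `t > 0`. Only the values of `q` on the closed quarter plane matter. -/
structure IsGIQuarterPlaneSolution (q : ℝ → ℝ → ℂ) : Prop where
  smooth : ContDiffOn ℝ ((⊤ : ℕ∞) : WithTop ℕ∞) (fun p : ℝ × ℝ => q p.1 p.2) (Set.Ici 0 ×ˢ Set.Ici 0)
  schwartz : ∀ t : ℝ, 0 ≤ t → IsSchwartzHalfLine (fun x => q x t)
  equation : ∀ x t : ℝ, 0 < x → 0 < t → GIEquationAt q x t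

/-- The triple `(α, ω, c)` (with `α > 0`) is admissible for the GI equation: some quarter-plane
solution has boundary values with `q(0,t) - α e^{iωt} = O(t^{-5/2})` and
`q_x(0,t) - c e^{iωt} = O(t^{-5/2})` as `t → ∞`, where `q_x(0,t)` is the one-sided derivative. -/
def IsGIAdmissible (α ω : ℝ) (c : ℂ) : Prop :=
  0 < α ∧ ∃ q : ℝ → ℝ → ℂ, IsGIQuarterPlaneSolution q ∧
    (fun t : ℝ => q 0 t - (α : ℂ) * Complex.exp (Complex.I * (ω : ℂ) * (t : ℂ)))
      =O[Filter.atTop] (fun t : ℝ => t ^ (-(5 / 2) : ℝ)) ∧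
    (fun t : ℝ => derivWithin (fun x : ℝ => q x t) (Set.Ici 0) 0
        - c * Complex.exp (Complex.I * (ω : ℂ) * (t : ℂ)))
      =O[Filter.atTop] (fun t : ℝ => t ^ (-(5 / 2) : ℝ))

noncomputable section GerdjikovIvanov

open Set Filter Topology MeasureTheory ComplexConjugate
open Complex (I I_im I_mul_I I_ne_zero I_re I_sq abs_im_le_norm abs_re_le_norm add_im add_re
  closure_setOfPred_lt_re conjCLE conj_ofNat conj_ofReal continuous_conj continuous_im
  continuous_ofReal continuous_re differentiableOn_tsum_of_summable_norm div_ofNat_im div_ofNat_re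
  exp exp_add exp_ne_zero exp_zero im_ofNat im_ofReal_mul mem_slitPlane_iff mul_conj mul_im mul_re
  neg_im neg_re normSq_apply normSq_eq_norm_sq norm_I norm_exp norm_ofNat norm_real ofReal_im
  ofReal_one ofReal_re ofReal_zero reCLM re_le_norm re_mul_ofReal re_ofNat re_ofReal_mul real_smul
  slitPlane sub_im sub_re)
open intervalIntegral (continuousOn_primitive_interval' integral_congr integral_eq_sub_of_hasDerivAt
  integral_hasDerivAt_right integral_mono_interval integral_mono_on integral_of_le)


/-- The open quadrant `x > 0`, `t > 0`. -/
def Quadrant : Set (ℝ × ℝ) := Ioi 0 ×ˢ Ioi 0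

/-- Smoothness of a function of two real variables on the open quadrant. -/
def SmoothQ (f : ℝ → ℝ → ℂ) : Prop :=
  ContDiffOn ℝ ((⊤ : ℕ∞) : WithTop ℕ∞) (fun p : ℝ × ℝ => f p.1 p.2) Quadrant

def dx (f : ℝ → ℝ → ℂ) (x t : ℝ) : ℂ := deriv (fun y => f y t) x

def dt (f : ℝ → ℝ → ℂ) (x t : ℝ) : ℂ := deriv (fun s => f x s) t

lemma isOpen_quadrant : IsOpen Quadrant := isOpen_Ioi.prod isOpen_Ioi

lemma mem_quadrant {x t : ℝ} (hx : 0 < x) (ht : 0 < t) : (x, t) ∈ Quadrant := ⟨hx, ht⟩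

namespace SmoothQ

variable {f g : ℝ → ℝ → ℂ}

lemma congr (hf : SmoothQ f) (h : ∀ x t, 0 < x → 0 < t → g x t = f x t) : SmoothQ g :=
  ContDiffOn.congr hf (fun p hp => h p.1 p.2 hp.1 hp.2)

lemma const (c : ℂ) : SmoothQ (fun _ _ => c) := contDiffOn_const

lemma add (hf : SmoothQ f) (hg : SmoothQ g) : SmoothQ (fun x t => f x t + g x t) :=
  ContDiffOn.add hf hg

lemma mul (hf : SmoothQ f) (hg : SmoothQ g) : SmoothQ (fun x t => f x t * g x t) :=
  ContDiffOn.mul hf hg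

lemma conjQ (hf : SmoothQ f) : SmoothQ (fun x t => conj (f x t)) :=
  (conjCLE.contDiff (n := ((⊤ : ℕ∞) : WithTop ℕ∞))).comp_contDiffOn hf

lemma differentiableAt (hf : SmoothQ f) {x t : ℝ} (hx : 0 < x) (ht : 0 < t) :
    DifferentiableAt ℝ (fun p : ℝ × ℝ => f p.1 p.2) (x, t) :=
  (ContDiffOn.differentiableOn hf (by simp)).differentiableAt
    (isOpen_quadrant.mem_nhds (mem_quadrant hx ht))

lemma hasDerivAt_x_fderiv (hf : SmoothQ f) {x t : ℝ} (hx : 0 < x) (ht : 0 < t) :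
    HasDerivAt (fun y => f y t) (fderiv ℝ (fun p : ℝ × ℝ => f p.1 p.2) (x, t) (1, 0)) x := by
  have h := (hf.differentiableAt hx ht).hasFDerivAt
  exact h.comp_hasDerivAt x ((hasDerivAt_id x).prodMk (hasDerivAt_const x t))

lemma hasDerivAt_t_fderiv (hf : SmoothQ f) {x t : ℝ} (hx : 0 < x) (ht : 0 < t) :
    HasDerivAt (fun s => f x s) (fderiv ℝ (fun p : ℝ × ℝ => f p.1 p.2) (x, t) (0, 1)) t := by
  have h := (hf.differentiableAt hx ht).hasFDerivAt
  exact h.comp_hasDerivAt t ((hasDerivAt_const t x).prodMk (hasDerivAt_id t))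

lemma hasDerivAt_x (hf : SmoothQ f) {x t : ℝ} (hx : 0 < x) (ht : 0 < t) :
    HasDerivAt (fun y => f y t) (_root_.dx f x t) x :=
  (hf.hasDerivAt_x_fderiv hx ht).differentiableAt.hasDerivAt

lemma hasDerivAt_t (hf : SmoothQ f) {x t : ℝ} (hx : 0 < x) (ht : 0 < t) :
    HasDerivAt (fun s => f x s) (_root_.dt f x t) t :=
  (hf.hasDerivAt_t_fderiv hx ht).differentiableAt.hasDerivAt

lemma fderiv_smooth (hf : SmoothQ f) :
    ContDiffOn ℝ ((⊤ : ℕ∞) : WithTop ℕ∞) (fderiv ℝ (fun p : ℝ × ℝ => f p.1 p.2)) Quadrant :=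
  ContDiffOn.fderiv_of_isOpen hf isOpen_quadrant (by exact_mod_cast le_top)

lemma dx (hf : SmoothQ f) : SmoothQ (dx f) := by
  have : ContDiffOn ℝ ((⊤ : ℕ∞) : WithTop ℕ∞)
      (fun p => fderiv ℝ (fun p : ℝ × ℝ => f p.1 p.2) p (1, 0)) Quadrant :=
    hf.fderiv_smooth.clm_apply contDiffOn_const
  exact this.congr (fun p hp => (hf.hasDerivAt_x_fderiv hp.1 hp.2).deriv)

lemma dt (hf : SmoothQ f) : SmoothQ (dt f) := by
  have : ContDiffOn ℝ ((⊤ : ℕ∞) : WithTop ℕ∞)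
      (fun p => fderiv ℝ (fun p : ℝ × ℝ => f p.1 p.2) p (0, 1)) Quadrant :=
    hf.fderiv_smooth.clm_apply contDiffOn_const
  exact this.congr (fun p hp => (hf.hasDerivAt_t_fderiv hp.1 hp.2).deriv)

lemma continuousOn (hf : SmoothQ f) : ContinuousOn (fun p : ℝ × ℝ => f p.1 p.2) Quadrant :=
  ContDiffOn.continuousOn hf

lemma continuousOn_x (hf : SmoothQ f) {t : ℝ} (ht : 0 < t) :
    ContinuousOn (fun x => f x t) (Ioi 0) :=
  fun _ hx => (hf.hasDerivAt_x hx ht).continuousAt.continuousWithinAt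

lemma continuousOn_t (hf : SmoothQ f) {x : ℝ} (hx : 0 < x) :
    ContinuousOn (fun t => f x t) (Ioi 0) :=
  fun _ ht => (hf.hasDerivAt_t hx ht).continuousAt.continuousWithinAt

lemma exists_bound (hf : SmoothQ f) {a b c d : ℝ} (ha : 0 < a) (hc : 0 < c) :
    ∃ C, 0 ≤ C ∧ ∀ x ∈ Icc a b, ∀ t ∈ Icc c d, ‖f x t‖ ≤ C := by
  have hK : IsCompact (Icc a b ×ˢ Icc c d) := isCompact_Icc.prod isCompact_Icc
  have hs : Icc a b ×ˢ Icc c d ⊆ Quadrant := fun p hp =>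
    ⟨lt_of_lt_of_le ha hp.1.1, lt_of_lt_of_le hc hp.2.1⟩
  obtain ⟨C, hC⟩ := hK.exists_bound_of_continuousOn (hf.continuousOn.mono hs)
  exact ⟨max C 0, le_max_right _ _, fun x hx t ht => (hC (x, t) ⟨hx, ht⟩).trans (le_max_left _ _)⟩

lemma exists_bound_t (hf : SmoothQ f) {x c d : ℝ} (hx : 0 < x) (hc : 0 < c) :
    ∃ C, 0 ≤ C ∧ ∀ t ∈ Icc c d, ‖f x t‖ ≤ C := by
  obtain ⟨C, h0, h⟩ := hf.exists_bound (b := x) (d := d) hx hc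
  exact ⟨C, h0, h x (by simp)⟩

lemma lip_t (hf : SmoothQ f) {a b c d : ℝ} (ha : 0 < a) (hc : 0 < c) :
    ∃ C, 0 ≤ C ∧ ∀ x ∈ Icc a b, ∀ s ∈ Icc c d, ∀ t ∈ Icc c d, ‖f x t - f x s‖ ≤ C * |t - s| := by
  obtain ⟨C, h0, hC⟩ := hf.dt.exists_bound (b := b) (d := d) ha hc
  refine ⟨C, h0, fun x hx s hs t ht => ?_⟩
  simpa [Real.norm_eq_abs] using (convex_Icc c d).norm_image_sub_le_of_norm_hasDerivWithin_le
    (fun y hy => (hf.hasDerivAt_t (ha.trans_le hx.1) (hc.trans_le hy.1)).hasDerivWithinAt)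
    (hC x hx) hs ht

/-- Second order Taylor estimate in time, uniform on compact rectangles. -/
lemma taylor_t (hf : SmoothQ f) {a b c d : ℝ} (ha : 0 < a) (hc : 0 < c) :
    ∃ C, 0 ≤ C ∧ ∀ x ∈ Icc a b, ∀ s ∈ Icc c d, ∀ t ∈ Icc c d,
      ‖f x t - f x s - (t - s : ℝ) * _root_.dt f x s‖ ≤ C * (t - s) ^ 2 := by
  obtain ⟨C, h0, hC⟩ := hf.dt.lip_t (b := b) (d := d) ha hc
  refine ⟨C, h0, fun x hx s hs t ht => ?_⟩
  have hxp := lt_of_lt_of_le ha hx.1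
  have h1 := hC x hx s hs
  have h2 := (convex_uIcc s t).norm_image_sub_le_of_norm_hasDerivWithin_le
      (f := fun r => f x r - (r - s : ℝ) * _root_.dt f x s)
      (f' := fun r => _root_.dt f x r - _root_.dt f x s) (C := C * |t - s|) (x := s) (y := t)
      (fun y hy => by
        have hy' : y ∈ Icc c d := (uIcc_subset_Icc hs ht) hy
        have h3 := hf.hasDerivAt_t hxp (lt_of_lt_of_le hc hy'.1)
        have h4 : HasDerivAt (fun r : ℝ => ((r - s : ℝ) : ℂ) * _root_.dt f x s)
            (1 * _root_.dt f x s) y := by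
          have := ((hasDerivAt_id y).sub_const s).ofReal_comp
          simpa using this.mul_const (_root_.dt f x s)
        simpa using (h3.fun_sub h4).hasDerivWithinAt)
      (fun y hy => by
        have hy' : y ∈ Icc c d := (uIcc_subset_Icc hs ht) hy
        refine (h1 y hy').trans (mul_le_mul_of_nonneg_left ?_ h0)
        exact abs_sub_left_of_mem_uIcc hy)
      left_mem_uIcc right_mem_uIcc
  calc ‖f x t - f x s - (t - s : ℝ) * _root_.dt f x s‖
      = ‖f x t - (t - s : ℝ) * _root_.dt f x s - (f x s - (s - s : ℝ) * _root_.dt f x s)‖ := by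
        congr 1; push_cast; ring
    _ ≤ C * |t - s| * ‖t - s‖ := h2
    _ = C * (t - s) ^ 2 := by rw [Real.norm_eq_abs, mul_assoc, abs_mul_abs_self]; ring

lemma eventually_taylor (hf : SmoothQ f) {a b c d : ℝ} (ha : 0 < a) (hc : 0 < c) :
    ∀ᶠ K in atTop, ∀ x ∈ Icc a b, ∀ s ∈ Icc c d, ∀ t ∈ Icc c d,
      ‖f x t - f x s - (t - s : ℝ) * _root_.dt f x s‖ ≤ K * (t - s) ^ 2 ∧
      ‖f x t - f x s‖ ≤ K * |t - s| ∧ ‖f x t‖ ≤ K := by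
  obtain ⟨T, -, hT⟩ := hf.taylor_t (b := b) (d := d) ha hc
  obtain ⟨L, -, hL⟩ := hf.lip_t (b := b) (d := d) ha hc
  obtain ⟨N, -, hN⟩ := hf.exists_bound (b := b) (d := d) ha hc
  filter_upwards [eventually_ge_atTop T, eventually_ge_atTop L, eventually_ge_atTop N]
    with K h1 h2 h3 x hx s hs t ht
  exact ⟨(hT x hx s hs t ht).trans (by gcongr), (hL x hx s hs t ht).trans (by gcongr),
    (hN x hx t ht).trans h3⟩

end SmoothQ

lemma dx_dt_comm {f : ℝ → ℝ → ℂ} (hf : SmoothQ f) {x t : ℝ} (hx : 0 < x) (ht : 0 < t) :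
    dx (dt f) x t = dt (dx f) x t := by
  set F : ℝ × ℝ → ℂ := fun p => f p.1 p.2 with hF
  have hC : ContDiffAt ℝ ((⊤ : ℕ∞) : WithTop ℕ∞) F (x, t) :=
    ContDiffOn.contDiffAt hf (isOpen_quadrant.mem_nhds (mem_quadrant hx ht))
  have hsym : IsSymmSndFDerivAt ℝ F (x, t) := hC.isSymmSndFDerivAt (by
    simp only [minSmoothness_of_isRCLikeNormedField]
    exact WithTop.coe_le_coe.2 (le_top : (2 : ℕ∞) ≤ ⊤))
  have hd : DifferentiableAt ℝ (fderiv ℝ F) (x, t) :=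
    ((hf.fderiv_smooth).differentiableOn (by simp)).differentiableAt
      (isOpen_quadrant.mem_nhds (mem_quadrant hx ht))
  have key : ∀ v w : ℝ × ℝ, HasFDerivAt (fun p => fderiv ℝ F p v)
      ((ContinuousLinearMap.apply ℝ ℂ v).comp (fderiv ℝ (fderiv ℝ F) (x, t))) (x, t) := by
    intro v w
    exact (ContinuousLinearMap.apply ℝ ℂ v).hasFDerivAt.comp (x, t) hd.hasFDerivAt
  have h1 : dx (dt f) x t = fderiv ℝ (fderiv ℝ F) (x, t) (1, 0) (0, 1) := by
    have h := (key (0, 1) 0).comp_hasDerivAt x ((hasDerivAt_id x).prodMk (hasDerivAt_const x t))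
    have e : (fun y => dt f y t) =ᶠ[𝓝 x]
        ((fun p => fderiv ℝ F p (0, 1)) ∘ fun y => (id y, t)) := by
      filter_upwards [Ioi_mem_nhds hx] with y hy
      exact (hf.hasDerivAt_t_fderiv hy ht).deriv
    exact (h.congr_of_eventuallyEq e).deriv
  have h2 : dt (dx f) x t = fderiv ℝ (fderiv ℝ F) (x, t) (0, 1) (1, 0) := by
    have h := (key (1, 0) 0).comp_hasDerivAt t ((hasDerivAt_const t x).prodMk (hasDerivAt_id t))
    have e : (fun s => dx f x s) =ᶠ[𝓝 t]
        ((fun p => fderiv ℝ F p (1, 0)) ∘ fun s => (x, id s)) := by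
      filter_upwards [Ioi_mem_nhds ht] with s hs
      exact (hf.hasDerivAt_x_fderiv hx hs).deriv
    exact (h.congr_of_eventuallyEq e).deriv
  rw [h1, h2]
  exact hsym _ _

/-! ### Volterra equations on the half-line depending on a spectral parameter -/

lemma differentiableOn_integral_of_dominated {α : Type*} [MeasurableSpace α] {μ : Measure α}
    {F : ℂ → α → ℂ} {U : Set ℂ} (hU : IsOpen U) {bound : α → ℝ} (hint : Integrable bound μ)
    (hmeas : ∀ l ∈ U, AEStronglyMeasurable (F l) μ)
    (hb : ∀ᵐ s ∂μ, ∀ l ∈ U, ‖F l s‖ ≤ bound s)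
    (hd : ∀ᵐ s ∂μ, DifferentiableOn ℂ (fun l => F l s) U) :
    DifferentiableOn ℂ (fun l => ∫ s, F l s ∂μ) U := by
  intro l0 hl0
  obtain ⟨r, hr, hrU⟩ := Metric.isOpen_iff.1 hU l0 hl0
  set ε := r / 3 with hε
  have hεp : 0 < ε := by positivity
  have hsub : ∀ l ∈ Metric.ball l0 ε, Metric.closedBall l ε ⊆ U := fun l hl z hz => hrU (by
    have := dist_triangle z l l0
    simp only [Metric.mem_ball, Metric.mem_closedBall] at *
    linarith)
  have hF' : AEStronglyMeasurable (fun s => deriv (fun l => F l s) l0) μ := by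
    set z : ℕ → ℂ := fun n => l0 + ((ε / (n + 1) / 2 : ℝ) : ℂ) with hz
    have hpos : ∀ n : ℕ, 0 < ε / ((n : ℝ) + 1) / 2 := fun n => by positivity
    have hzU : ∀ n, z n ∈ U := fun n => by
      refine hsub l0 (Metric.mem_ball_self hεp) ?_
      simp only [hz, Metric.mem_closedBall, dist_eq_norm, add_sub_cancel_left, norm_real,
        Real.norm_eq_abs, abs_of_pos (hpos n)]
      have : ε / ((n : ℝ) + 1) ≤ ε := div_le_self hεp.le (by linarith [n.cast_nonneg (α := ℝ)])
      linarith
    have hlim : Tendsto z atTop (𝓝[≠] l0) := by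
      refine tendsto_nhdsWithin_iff.2 ⟨?_, Eventually.of_forall fun n => ?_⟩
      · have h1 : Tendsto (fun n : ℕ => ε / ((n : ℝ) + 1) / 2) atTop (𝓝 0) := by
          have := (tendsto_one_div_add_atTop_nhds_zero_nat (𝕜 := ℝ)).const_mul (ε / 2)
          simp only [mul_zero] at this
          refine this.congr fun n => by ring
        have h2 := (continuous_ofReal.tendsto 0).comp h1
        simpa [hz] using h2.const_add l0
      · have := (hpos n).ne'
        simp only [hz, mem_compl_iff, mem_singleton_iff, add_eq_left, Complex.ofReal_eq_zero]
        exact this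
    refine aestronglyMeasurable_of_tendsto_ae atTop
      (f := fun n s => (z n - l0)⁻¹ • (F (z n) s - F l0 s)) (fun n => ?_) ?_
    · exact AEStronglyMeasurable.const_smul ((hmeas _ (hzU n)).sub (hmeas _ hl0)) ((z n - l0)⁻¹)
    · filter_upwards [hd] with s hs
      have := ((hs l0 hl0).differentiableAt (hU.mem_nhds hl0)).hasDerivAt
      exact (hasDerivAt_iff_tendsto_slope.1 this).comp hlim
  have key := hasDerivAt_integral_of_dominated_loc_of_deriv_le (𝕜 := ℂ) (μ := μ) (F := F)
    (F' := fun l s => deriv (fun l => F l s) l) (x₀ := l0) (bound := fun s => bound s / ε)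
    (s := Metric.ball l0 ε)
    (Metric.ball_mem_nhds _ hεp)
    (by filter_upwards [hU.mem_nhds hl0] with l hl using hmeas l hl)
    (hint.mono' (hmeas _ hl0) (by filter_upwards [hb] with s hs using hs _ hl0)) hF'
    (by
      filter_upwards [hb, hd] with s hs hds l hl
      refine Complex.norm_deriv_le_of_forall_mem_sphere_norm_le hεp
        (DifferentiableOn.diffContOnCl ?_)
        (fun z hz => hs z (hsub l hl (Metric.sphere_subset_closedBall hz)))
      rw [closure_ball l hεp.ne']
      exact hds.mono (hsub l hl))
    (hint.div_const _)
    (by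
      filter_upwards [hd] with s hds l hl
      have hlU := hsub l hl (Metric.mem_closedBall_self hεp.le)
      exact ((hds l hlU).differentiableAt (hU.mem_nhds hlU)).hasDerivAt)
  exact key.2.differentiableAt.differentiableWithinAt

/-- The closed upper half plane. -/
def UHPc : Set ℂ := {l | 0 ≤ l.im}

/-- The open upper half plane. -/
def UHP : Set ℂ := {l | 0 < l.im}

lemma isOpen_UHP : IsOpen UHP := isOpen_lt continuous_const continuous_im

lemma UHP_subset : UHP ⊆ UHPc := fun l (h : 0 < l.im) => (le_of_lt h : 0 ≤ l.im)

/-- One Volterra integration step, `κ ∈ {0, 1}` selecting the oscillating or the plain kernel. -/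
def vstep (κ : ℝ) (w : ℝ → ℂ) (f : ℝ → ℂ → ℂ) (x : ℝ) (l : ℂ) : ℂ :=
  -∫ s in Ioi x, exp (2 * I * κ * l * (s - x)) * w s * f s l

/-- Regularity of a function of `(x, l)` with decay `D / (1 + x) ^ m`. -/
structure VReg (D : ℝ) (m : ℕ) (f : ℝ → ℂ → ℂ) : Prop where
  bound : ∀ x, 0 ≤ x → ∀ l ∈ UHPc, ‖f x l‖ ≤ D / (1 + x) ^ m
  contx : ∀ l ∈ UHPc, ContinuousOn (fun x => f x l) (Ici 0)
  contl : ∀ x, 0 ≤ x → ContinuousOn (f x) UHPc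
  diffl : ∀ x, 0 ≤ x → DifferentiableOn ℂ (f x) UHP

/-- `w` is a measurable function on the half line bounded by `C / (1 + x) ^ 2`. -/
structure Decay (C : ℝ) (w : ℝ → ℂ) : Prop where
  meas : AEStronglyMeasurable w (volume.restrict (Ioi 0))
  bound : ∀ x, 0 < x → ‖w x‖ ≤ C / (1 + x) ^ 2

lemma norm_exp_kernel_le {κ : ℝ} (hκ : 0 ≤ κ) {l : ℂ} (hl : l ∈ UHPc) {s x : ℝ} (h : x ≤ s) :
    ‖exp (2 * I * κ * l * (s - x))‖ ≤ 1 := by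
  have e : (2 * I * κ * l * (s - x)).re = -(2 * κ * l.im * (s - x)) := by
    have : (2 * I * κ * l * (s - x) : ℂ) = I * ((2 * κ * (s - x) : ℝ) * l) := by push_cast; ring
    rw [this, Complex.I_mul_re, im_ofReal_mul]
    ring
  rw [norm_exp, e, Real.exp_le_one_iff, neg_nonpos]
  have : 0 ≤ l.im := hl
  have : 0 ≤ s - x := by linarith
  positivity

lemma integral_inv_pow {x : ℝ} (hx : 0 ≤ x) (A : ℝ) (hA : 0 ≤ A) (m : ℕ) :
    IntegrableOn (fun s : ℝ => A / (1 + s) ^ (m + 2)) (Ioi x) ∧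
    ∫ s in Ioi x, A / (1 + s) ^ (m + 2) = A / (m + 1) / (1 + x) ^ (m + 1) := by
  have hd : ∀ s ∈ Ici x, HasDerivAt (fun s : ℝ => -(A / (m + 1) / (1 + s) ^ (m + 1)))
      (A / (1 + s) ^ (m + 2)) s := fun s hs => by
    have hs0 : (1 + s) ≠ 0 := by have : x ≤ s := hs; linarith
    have h1 : HasDerivAt (fun s : ℝ => (1 + s) ^ (m + 1)) ((m + 1 : ℕ) * (1 + s) ^ m * 1) s := by
      simpa using ((hasDerivAt_id s).const_add 1).fun_pow (m + 1)
    have h2 := ((hasDerivAt_const s (A / (m + 1))).fun_div h1 (pow_ne_zero _ hs0)).fun_neg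
    refine h2.congr_deriv ?_
    have : (m + 1 : ℝ) ≠ 0 := by positivity
    push_cast
    field_simp
    ring
  have hnn : ∀ s ∈ Ioi x, 0 ≤ A / (1 + s) ^ (m + 2) := fun s hs => by
    have : x < s := hs
    have : 0 < 1 + s := by linarith
    positivity
  have hlim : Tendsto (fun s : ℝ => -(A / (m + 1) / (1 + s) ^ (m + 1))) atTop (𝓝 0) := by
    rw [← neg_zero]
    refine Tendsto.neg ?_
    refine tendsto_const_nhds.div_atTop ?_
    exact (tendsto_pow_atTop (Nat.succ_ne_zero m)).comp (tendsto_atTop_add_const_left _ _ tendsto_id)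
  refine ⟨integrableOn_Ioi_deriv_of_nonneg' hd hnn hlim, ?_⟩
  rw [integral_Ioi_of_hasDerivAt_of_nonneg' hd hnn hlim]
  ring

lemma Decay.integrableOn {C : ℝ} {w : ℝ → ℂ} (hw : Decay C w) (hC : 0 ≤ C) {x : ℝ} (hx : 0 ≤ x) :
    IntegrableOn w (Ioi x) := by
  refine (integral_inv_pow hx C hC 0).1.mono'
    (hw.meas.mono_measure (Measure.restrict_mono (Ioi_subset_Ioi hx) le_rfl)) ?_
  refine (ae_restrict_iff' measurableSet_Ioi).2 (Eventually.of_forall fun s hs => ?_)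
  simpa using hw.bound s (lt_of_le_of_lt hx hs)

section step

variable {κ : ℝ} {C D : ℝ} {m : ℕ} {w : ℝ → ℂ} {f : ℝ → ℂ → ℂ}

lemma VReg.integrand_meas (hw : Decay C w) (hf : VReg D m f) {l : ℂ} (hl : l ∈ UHPc) {x : ℝ}
    (hx : 0 ≤ x) : AEStronglyMeasurable
      (fun s : ℝ => exp (2 * I * κ * l * (s - x)) * w s * f s l)
      (volume.restrict (Ioi x)) := by
  have h1 : Continuous (fun s : ℝ => exp (2 * I * κ * l * (s - x))) := by fun_prop
  have h2 : ContinuousOn (fun s => f s l) (Ioi x) :=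
    (hf.contx l hl).mono (fun s hs => hx.trans (le_of_lt hs))
  exact (h1.aestronglyMeasurable.mul
    (hw.meas.mono_measure (Measure.restrict_mono (Ioi_subset_Ioi hx) le_rfl))).mul
    (h2.aestronglyMeasurable measurableSet_Ioi)

lemma VReg.integrand_bound (hκ : 0 ≤ κ) (hw : Decay C w) (hf : VReg D m f) {l : ℂ}
    (hl : l ∈ UHPc) {x s : ℝ} (hx : 0 ≤ x) (hs : x < s) :
    ‖exp (2 * I * κ * l * (s - x)) * w s * f s l‖ ≤ C * D / (1 + s) ^ (m + 2) := by
  have hs0 : 0 < s := lt_of_le_of_lt hx hs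
  have h1 := norm_exp_kernel_le hκ hl hs.le
  have h2 := hw.bound s hs0
  have h3 := hf.bound s hs0.le l hl
  have hp : 0 < 1 + s := by linarith
  have hC : 0 ≤ C / (1 + s) ^ 2 := (norm_nonneg _).trans h2
  rw [norm_mul, norm_mul]
  calc _ ≤ 1 * (C / (1 + s) ^ 2) * (D / (1 + s) ^ m) := by gcongr
    _ = _ := by rw [pow_add]; field_simp

lemma VReg.integrable (hκ : 0 ≤ κ) (hw : Decay C w) (hf : VReg D m f) (hCD : 0 ≤ C * D) {l : ℂ}
    (hl : l ∈ UHPc) {x : ℝ} (hx : 0 ≤ x) : IntegrableOn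
      (fun s : ℝ => exp (2 * I * κ * l * (s - x)) * w s * f s l) (Ioi x) := by
  refine (integral_inv_pow hx (C * D) hCD m).1.mono' (hf.integrand_meas hw hl hx) ?_
  exact (ae_restrict_iff' measurableSet_Ioi).2 (Eventually.of_forall fun s hs =>
    hf.integrand_bound hκ hw hl hx hs)

lemma VReg.step (hκ : 0 ≤ κ) (hw : Decay C w) (hf : VReg D m f) (hC : 0 ≤ C) (hD : 0 ≤ D) :
    VReg (C * D / (m + 1)) (m + 1) (vstep κ w f) := by
  have hCD : 0 ≤ C * D := mul_nonneg hC hD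
  have hae : ∀ x : ℝ, 0 ≤ x → ∀ᵐ s : ℝ ∂(volume.restrict (Ioi x)), ∀ l ∈ UHPc,
      ‖exp (2 * I * κ * l * (s - x)) * w s * f s l‖ ≤ C * D / (1 + s) ^ (m + 2) := fun x hx =>
    (ae_restrict_iff' measurableSet_Ioi).2 (Eventually.of_forall fun s hs l hl =>
      hf.integrand_bound hκ hw hl hx hs)
  refine ⟨fun x hx l hl => ?_, fun l hl => ?_, fun x hx => ?_, fun x hx => ?_⟩
  · unfold vstep
    rw [norm_neg, ← (integral_inv_pow hx (C * D) hCD m).2]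
    refine norm_integral_le_of_norm_le (integral_inv_pow hx (C * D) hCD m).1 ?_
    filter_upwards [hae x hx] with s hs using hs l hl
  · have hint := hf.integrable (l := l) hκ hw hCD hl le_rfl
    have heq : ∀ x ∈ Ici (0 : ℝ), vstep κ w f x l = -(exp (-(2 * I * κ * l * x)) *
          ((∫ s in Ioi (0 : ℝ), exp (2 * I * κ * l * (s - (0 : ℝ))) * w s * f s l) -
          ∫ s in (0 : ℝ)..x, exp (2 * I * κ * l * (s - (0 : ℝ))) * w s * f s l)) := by
      intro x hx
      rw [vstep, integral_of_le hx]
      have hu : Ioi (0 : ℝ) = Ioc 0 x ∪ Ioi x := (Ioc_union_Ioi_eq_Ioi hx).symm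
      have : ∫ s in Ioi (0 : ℝ), exp (2 * I * κ * l * (s - (0 : ℝ))) * w s * f s l
          = (∫ s in Ioc 0 x, exp (2 * I * κ * l * (s - (0 : ℝ))) * w s * f s l)
          + ∫ s in Ioi x, exp (2 * I * κ * l * (s - (0 : ℝ))) * w s * f s l := by
        conv_lhs => rw [hu]
        exact setIntegral_union (Ioc_disjoint_Ioi le_rfl) measurableSet_Ioi
          (hint.mono_set Ioc_subset_Ioi_self) (hint.mono_set (Ioi_subset_Ioi hx))
      rw [this, add_sub_cancel_left, ← integral_const_mul]
      congr 1
      refine integral_congr_ae (Eventually.of_forall fun s => ?_)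
      simp only
      rw [← mul_assoc, ← mul_assoc, ← exp_add]
      congr 3
      push_cast; ring
    refine ContinuousOn.congr ?_ heq
    refine ContinuousOn.neg (ContinuousOn.mul (by fun_prop) (continuousOn_const.sub ?_))
    intro x hx
    have hx1 : (0 : ℝ) ≤ x + 1 := by have : (0 : ℝ) ≤ x := hx; linarith
    have h1 : ContinuousOn (fun x => ∫ s in (0 : ℝ)..x,
        exp (2 * I * κ * l * (s - (0 : ℝ))) * w s * f s l) (uIcc 0 (x + 1)) := by
      refine continuousOn_primitive_interval' ?_ left_mem_uIcc
      rw [intervalIntegrable_iff_integrableOn_Ioc_of_le hx1]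
      exact hint.mono_set Ioc_subset_Ioi_self
    have h2 := h1 x (by rw [uIcc_of_le hx1]; exact ⟨hx, by linarith⟩)
    refine h2.mono_of_mem_nhdsWithin ?_
    rw [uIcc_of_le hx1]
    filter_upwards [self_mem_nhdsWithin, mem_nhdsWithin_of_mem_nhds (Iio_mem_nhds (lt_add_one x))]
      with y hy hyj using ⟨hy, le_of_lt hyj⟩
  · unfold vstep
    refine ContinuousOn.neg ?_
    intro l hl
    refine continuousWithinAt_of_dominated (bound := fun s => C * D / (1 + s) ^ (m + 2)) ?_ ?_
      (integral_inv_pow hx (C * D) hCD m).1 ?_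
    · filter_upwards [self_mem_nhdsWithin] with l' hl' using hf.integrand_meas hw hl' hx
    · filter_upwards [self_mem_nhdsWithin] with l' hl'
      filter_upwards [hae x hx] with s hs using hs l' hl'
    · refine (ae_restrict_iff' measurableSet_Ioi).2 (Eventually.of_forall fun s hs => ?_)
      have h1 : Continuous (fun l : ℂ => exp (2 * I * κ * l * (s - x))) := by fun_prop
      exact ((h1.continuousWithinAt).mul continuousWithinAt_const).mul
        (hf.contl s (hx.trans (le_of_lt hs)) l hl)
  · unfold vstep
    refine DifferentiableOn.neg ?_
    refine differentiableOn_integral_of_dominated isOpen_UHP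
      (integral_inv_pow hx (C * D) hCD m).1 (fun l hl => hf.integrand_meas hw (UHP_subset hl) hx)
      ?_ ?_
    · filter_upwards [hae x hx] with s hs l hl using hs l (UHP_subset hl)
    · refine (ae_restrict_iff' measurableSet_Ioi).2 (Eventually.of_forall fun s hs => ?_)
      have h1 : Differentiable ℂ (fun l : ℂ => exp (2 * I * κ * l * (s - x))) := by fun_prop
      exact (h1.differentiableOn.mul (differentiableOn_const _)).mul
        (hf.diffl s (hx.trans (le_of_lt hs)))

end step

/-! ### Jost functions of the system `y1' = -2 i l y1 + u y2`, `y2' = v y1` -/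

/-- Picard iterates of the Volterra system for the Jost solution tending to `(0, 1)`. -/
def jostIter (u v : ℝ → ℂ) : ℕ → (ℝ → ℂ → ℂ) × (ℝ → ℂ → ℂ)
  | 0 => (fun _ _ => 0, fun _ _ => 1)
  | n + 1 => (vstep 1 u (jostIter u v n).2, vstep 0 v (jostIter u v n).1)

def jost1 (u v : ℝ → ℂ) (x : ℝ) (l : ℂ) : ℂ := ∑' n, (jostIter u v n).1 x l

def jost2 (u v : ℝ → ℂ) (x : ℝ) (l : ℂ) : ℂ := ∑' n, (jostIter u v n).2 x l

section

variable {C : ℝ} {u v : ℝ → ℂ}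

lemma jostIter_reg (hC : 0 ≤ C) (hu : Decay C u) (hv : Decay C v) (n : ℕ) :
    VReg (C ^ n / n.factorial) n (jostIter u v n).1 ∧
    VReg (C ^ n / n.factorial) n (jostIter u v n).2 := by
  induction n with
  | zero =>
    refine ⟨⟨?_, ?_, ?_, ?_⟩, ⟨?_, ?_, ?_, ?_⟩⟩
    all_goals intros
    all_goals simp [jostIter, continuousOn_const, differentiableOn_const]
  | succ n ih =>
    have e : C * (C ^ n / n.factorial) / (n + 1) = C ^ (n + 1) / (n + 1).factorial := by
      rw [Nat.factorial_succ]; push_cast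
      have : (n.factorial : ℝ) ≠ 0 := by positivity
      have : (n + 1 : ℝ) ≠ 0 := by positivity
      field_simp
      ring
    rw [← e]
    exact ⟨ih.2.step zero_le_one hu hC (by positivity), ih.1.step le_rfl hv hC (by positivity)⟩

lemma jostIter_bound (hC : 0 ≤ C) (hu : Decay C u) (hv : Decay C v) (n : ℕ) {x : ℝ} (hx : 0 ≤ x)
    {l : ℂ} (hl : l ∈ UHPc) :
    ‖(jostIter u v n).1 x l‖ ≤ C ^ n / n.factorial ∧
    ‖(jostIter u v n).2 x l‖ ≤ C ^ n / n.factorial := by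
  have h1 : C ^ n / n.factorial / (1 + x) ^ n ≤ C ^ n / n.factorial :=
    div_le_self (by positivity) (one_le_pow₀ (by linarith))
  exact ⟨((jostIter_reg hC hu hv n).1.bound x hx l hl).trans h1,
    ((jostIter_reg hC hu hv n).2.bound x hx l hl).trans h1⟩

lemma summable_jostIter (hC : 0 ≤ C) (hu : Decay C u) (hv : Decay C v) {x : ℝ} (hx : 0 ≤ x)
    {l : ℂ} (hl : l ∈ UHPc) :
    Summable (fun n => (jostIter u v n).1 x l) ∧ Summable (fun n => (jostIter u v n).2 x l) :=
  ⟨Summable.of_norm_bounded (Real.summable_pow_div_factorial C)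
    fun n => (jostIter_bound hC hu hv n hx hl).1,
   Summable.of_norm_bounded (Real.summable_pow_div_factorial C)
    fun n => (jostIter_bound hC hu hv n hx hl).2⟩

lemma tsum_tail_bound (hC : 0 ≤ C) {x : ℝ} (hx : 0 ≤ x) {f : ℕ → ℂ}
    (hf : ∀ n : ℕ, ‖f n‖ ≤ C ^ n / n.factorial / (1 + x) ^ n) :
    ‖∑' n, f (n + 1)‖ ≤ Real.exp C / (1 + x) := by
  have hs : Summable (fun n : ℕ => C ^ n / n.factorial) := Real.summable_pow_div_factorial C
  have hs1 : Summable (fun n : ℕ => C ^ (n + 1) / (n + 1).factorial) :=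
    (summable_nat_add_iff 1).2 hs
  have hle : ∀ n : ℕ, ‖f (n + 1)‖ ≤ C ^ (n + 1) / (n + 1).factorial * (1 / (1 + x)) := fun n => by
    refine (hf (n + 1)).trans ?_
    rw [div_eq_mul_one_div]
    have : (1 + x) ≤ (1 + x) ^ (n + 1) := le_self_pow₀ (by linarith) (Nat.succ_ne_zero n)
    gcongr
  have h1 := tsum_of_norm_bounded (hs1.mul_right (1 / (1 + x))).hasSum hle
  refine h1.trans ?_
  rw [tsum_mul_right, mul_one_div]
  gcongr
  have h2 : Real.exp C = ∑' n : ℕ, C ^ n / n.factorial := by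
    rw [Real.exp_eq_exp_ℝ, NormedSpace.exp_eq_tsum_div]
  rw [h2, hs.tsum_eq_zero_add]
  simp

lemma jost_bound (hC : 0 ≤ C) (hu : Decay C u) (hv : Decay C v) {x : ℝ} (hx : 0 ≤ x)
    {l : ℂ} (hl : l ∈ UHPc) :
    ‖jost1 u v x l‖ ≤ Real.exp C / (1 + x) ∧ ‖jost2 u v x l - 1‖ ≤ Real.exp C / (1 + x) := by
  have h := summable_jostIter hC hu hv hx hl
  constructor
  · rw [jost1, h.1.tsum_eq_zero_add]
    simpa [jostIter] using tsum_tail_bound hC hx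
      (fun n => (jostIter_reg hC hu hv n).1.bound x hx l hl)
  · rw [jost2, h.2.tsum_eq_zero_add]
    simpa [jostIter] using tsum_tail_bound hC hx
      (fun n => (jostIter_reg hC hu hv n).2.bound x hx l hl)

lemma jost_reg (hC : 0 ≤ C) (hu : Decay C u) (hv : Decay C v) :
    VReg (1 + Real.exp C) 0 (jost1 u v) ∧ VReg (1 + Real.exp C) 0 (jost2 u v) := by
  have hle : ∀ x : ℝ, 0 ≤ x → Real.exp C / (1 + x) ≤ Real.exp C := fun x hx =>
    div_le_self (Real.exp_nonneg _) (by linarith)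
  refine ⟨⟨fun x hx l hl => ?_, fun l hl => ?_, fun x hx => ?_, fun x hx => ?_⟩,
    ⟨fun x hx l hl => ?_, fun l hl => ?_, fun x hx => ?_, fun x hx => ?_⟩⟩
  · have := (jost_bound hC hu hv hx hl).1
    have := hle x hx
    simp only [pow_zero, div_one]
    linarith
  · exact continuousOn_tsum (fun n => (jostIter_reg hC hu hv n).1.contx l hl)
      (Real.summable_pow_div_factorial C) (fun n x hx => (jostIter_bound hC hu hv n hx hl).1)
  · exact continuousOn_tsum (fun n => (jostIter_reg hC hu hv n).1.contl x hx)
      (Real.summable_pow_div_factorial C) (fun n l hl => (jostIter_bound hC hu hv n hx hl).1)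
  · exact differentiableOn_tsum_of_summable_norm (Real.summable_pow_div_factorial C)
      (fun n => (jostIter_reg hC hu hv n).1.diffl x hx) isOpen_UHP
      (fun n l hl => (jostIter_bound hC hu hv n hx (UHP_subset hl)).1)
  · have h1 := (jost_bound hC hu hv hx hl).2
    have h2 := hle x hx
    have h3 := norm_le_insert' (jost2 u v x l) 1
    rw [norm_one] at h3
    simp only [pow_zero, div_one]
    linarith
  · exact continuousOn_tsum (fun n => (jostIter_reg hC hu hv n).2.contx l hl)
      (Real.summable_pow_div_factorial C) (fun n x hx => (jostIter_bound hC hu hv n hx hl).2)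
  · exact continuousOn_tsum (fun n => (jostIter_reg hC hu hv n).2.contl x hx)
      (Real.summable_pow_div_factorial C) (fun n l hl => (jostIter_bound hC hu hv n hx hl).2)
  · exact differentiableOn_tsum_of_summable_norm (Real.summable_pow_div_factorial C)
      (fun n => (jostIter_reg hC hu hv n).2.diffl x hx) isOpen_UHP
      (fun n l hl => (jostIter_bound hC hu hv n hx (UHP_subset hl)).2)

lemma vstep_tsum {κ : ℝ} (hκ : 0 ≤ κ) {w : ℝ → ℂ} (hC : 0 ≤ C) (hw : Decay C w)
    {f : ℕ → ℝ → ℂ → ℂ} (hf : ∀ n : ℕ, VReg (C ^ n / n.factorial) n (f n)) {x : ℝ} (hx : 0 ≤ x)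
    {l : ℂ} (hl : l ∈ UHPc) :
    ∑' n, vstep κ w (f n) x l = vstep κ w (fun s l => ∑' n, f n s l) x l := by
  have hCn : ∀ n : ℕ, 0 ≤ C * (C ^ n / n.factorial) := fun n => by positivity
  unfold vstep
  rw [tsum_neg]
  congr 1
  have hint : ∀ n, Integrable (fun s : ℝ => exp (2 * I * κ * l * (s - x)) * w s *
      f n s l) (volume.restrict (Ioi x)) := fun n => (hf n).integrable hκ hw (hCn n) hl hx
  have hsum : Summable fun n => ∫ s in Ioi x,
      ‖exp (2 * I * κ * l * (s - x)) * w s * f n s l‖ := by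
    refine Summable.of_nonneg_of_le (fun n => by positivity) (fun n => ?_)
      ((Real.summable_pow_div_factorial C).mul_left C)
    calc _ ≤ ∫ s in Ioi x, C * (C ^ n / n.factorial) / (1 + s) ^ (n + 2) := by
          refine setIntegral_mono_on (hint n).norm (integral_inv_pow hx _ (hCn n) n).1
            measurableSet_Ioi (fun s hs => (hf n).integrand_bound hκ hw hl hx hs)
      _ = C * (C ^ n / n.factorial) / (n + 1) / (1 + x) ^ (n + 1) :=
          (integral_inv_pow hx _ (hCn n) n).2
      _ ≤ C * (C ^ n / n.factorial) := by
          refine (div_le_self (div_nonneg (hCn n) (by positivity))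
            (one_le_pow₀ (by linarith))).trans (div_le_self (hCn n) ?_)
          linarith [n.cast_nonneg (α := ℝ)]
  rw [(hasSum_integral_of_summable_integral_norm hint hsum).tsum_eq]
  refine integral_congr_ae (Eventually.of_forall fun s => ?_)
  simp only [tsum_mul_left]

/-- The Volterra integral equations of the Jost solution. -/
lemma jost_volterra (hC : 0 ≤ C) (hu : Decay C u) (hv : Decay C v) {x : ℝ} (hx : 0 ≤ x)
    {l : ℂ} (hl : l ∈ UHPc) :
    jost1 u v x l = vstep 1 u (jost2 u v) x l ∧
    jost2 u v x l = 1 + vstep 0 v (jost1 u v) x l := by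
  have h := summable_jostIter hC hu hv hx hl
  constructor
  · rw [jost1, h.1.tsum_eq_zero_add]
    simp only [jostIter, zero_add]
    exact vstep_tsum zero_le_one hC hu (fun n => (jostIter_reg hC hu hv n).2) hx hl
  · rw [jost2, h.2.tsum_eq_zero_add]
    simp only [jostIter]
    congr 1
    exact vstep_tsum le_rfl hC hv (fun n => (jostIter_reg hC hu hv n).1) hx hl

lemma hasDerivAt_vstep {κ : ℝ} (hκ : 0 ≤ κ) {w : ℝ → ℂ} {D : ℝ} (hCD : 0 ≤ C * D)
    (hw : Decay C w) {f : ℝ → ℂ → ℂ} (hf : VReg D 0 f) {x : ℝ} (hx : 0 < x) {l : ℂ}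
    (hl : l ∈ UHPc) (hwx : ContinuousAt w x) :
    HasDerivAt (fun y => vstep κ w f y l) (-(2 * I * κ * l) * vstep κ w f x l + w x * f x l) x := by
  set g : ℝ → ℂ := fun s => exp (2 * I * κ * l * (s - (0 : ℝ))) * w s * f s l with hg
  have hint : IntegrableOn g (Ioi 0) := hf.integrable hκ hw hCD hl le_rfl
  set J := ∫ s in Ioi (0 : ℝ), g s with hJ
  have heq : ∀ y, 0 ≤ y → vstep κ w f y l =
      -(exp (-(2 * I * κ * l * y)) * (J - ∫ s in (0 : ℝ)..y, g s)) := by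
    intro y hy
    rw [vstep, integral_of_le hy]
    have hun : Ioi (0 : ℝ) = Ioc 0 y ∪ Ioi y := (Ioc_union_Ioi_eq_Ioi hy).symm
    have : J = (∫ s in Ioc 0 y, g s) + ∫ s in Ioi y, g s := by
      rw [hJ]
      conv_lhs => rw [hun]
      exact setIntegral_union (Ioc_disjoint_Ioi le_rfl) measurableSet_Ioi
        (hint.mono_set Ioc_subset_Ioi_self) (hint.mono_set (Ioi_subset_Ioi hy))
    rw [this, add_sub_cancel_left, ← integral_const_mul]
    congr 1
    refine integral_congr_ae (Eventually.of_forall fun s => ?_)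
    simp only [hg]
    rw [← mul_assoc, ← mul_assoc, ← exp_add]
    congr 3
    push_cast; ring
  have hgx : ContinuousAt g x := by
    have h1 : Continuous (fun s : ℝ => exp (2 * I * κ * l * (s - (0 : ℝ)))) := by fun_prop
    exact (h1.continuousAt.mul hwx).mul ((hf.contx l hl).continuousAt (Ici_mem_nhds hx))
  have hprim : HasDerivAt (fun y => ∫ s in (0 : ℝ)..y, g s) (g x) x := by
    refine integral_hasDerivAt_right ?_ ?_ hgx
    · rw [intervalIntegrable_iff_integrableOn_Ioc_of_le hx.le]
      exact hint.mono_set Ioc_subset_Ioi_self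
    · exact ⟨Ioi 0, Ioi_mem_nhds hx, hint.aestronglyMeasurable⟩
  have hexp : HasDerivAt (fun y : ℝ => exp (-(2 * I * κ * l * y)))
      (exp (-(2 * I * κ * l * x)) * (-(2 * I * κ * l * 1))) x :=
    (((Complex.ofRealCLM.hasDerivAt (x := x)).const_mul (2 * I * κ * l)).fun_neg).cexp
  have hd := (hexp.fun_mul (hprim.const_sub J)).fun_neg
  refine (hd.congr_of_eventuallyEq ?_).congr_deriv ?_
  · filter_upwards [Ioi_mem_nhds hx] with y hy using heq y (le_of_lt hy)
  · rw [heq x hx.le]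
    have h3 : exp (-(2 * I * κ * l * x)) * g x = w x * f x l := by
      simp only [hg]
      rw [← mul_assoc, ← mul_assoc, ← exp_add]
      have : -(2 * I * κ * l * x) + 2 * I * κ * l * (x - (0 : ℝ)) = 0 := by push_cast; ring
      rw [this, exp_zero, one_mul]
    rw [← h3]
    ring

lemma hasDerivAt_jost (hC : 0 ≤ C) (hu : Decay C u) (hv : Decay C v) {x : ℝ} (hx : 0 < x)
    {l : ℂ} (hl : l ∈ UHPc) (hux : ContinuousAt u x) (hvx : ContinuousAt v x) :
    HasDerivAt (fun y => jost1 u v y l) (-(2 * I * l) * jost1 u v x l + u x * jost2 u v x l) x ∧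
    HasDerivAt (fun y => jost2 u v y l) (v x * jost1 u v x l) x := by
  have hr := jost_reg hC hu hv
  have hD : 0 ≤ C * (1 + Real.exp C) := mul_nonneg hC (by positivity)
  have h1 := hasDerivAt_vstep zero_le_one hD hu hr.2 hx hl hux
  have h2 := hasDerivAt_vstep le_rfl hD hv hr.1 hx hl hvx
  constructor
  · refine (h1.congr_of_eventuallyEq ?_).congr_deriv ?_
    · filter_upwards [Ioi_mem_nhds hx] with y hy using (jost_volterra hC hu hv (le_of_lt hy) hl).1
    · rw [← (jost_volterra hC hu hv hx.le hl).1]; simp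
  · refine ((h2.const_add 1).congr_of_eventuallyEq ?_).congr_deriv ?_
    · filter_upwards [Ioi_mem_nhds hx] with y hy using (jost_volterra hC hu hv (le_of_lt hy) hl).2
    · simp

end

/-! ### The Lax pair of the GI equation on the open quadrant -/

/-- A smooth solution of the GI equation on the open quadrant, decaying in `x` for each `t`. -/
structure GISol (q : ℝ → ℝ → ℂ) : Prop where
  smooth : SmoothQ q
  decay : ∀ t, 0 < t → ∃ C, 0 ≤ C ∧ ∀ x, 0 < x → ‖q x t‖ ≤ C / (1 + x) ^ 2 ∧
    ‖dx q x t‖ ≤ C / (1 + x) ^ 2 ∧ ‖dx (dx q) x t‖ ≤ C / (1 + x) ^ 2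
  eq : ∀ x t, 0 < x → 0 < t → dt q x t = I * (dx (dx q) x t +
    I * q x t ^ 2 * conj (dx q x t) + 1 / 2 * (q x t ^ 3 * conj (q x t) ^ 2))

section lax

variable (q : ℝ → ℝ → ℂ) (l : ℂ)

def laxA11 (x t : ℝ) : ℂ := -(2 * I * l) + -(I / 2) * (q x t * conj (q x t))

def laxA12 (x t : ℝ) : ℂ := q x t

def laxA21 (x t : ℝ) : ℂ := l * conj (q x t)

def laxA22 (x t : ℝ) : ℂ := I / 2 * (q x t * conj (q x t))

def laxB22 (x t : ℝ) : ℂ := I * l * (q x t * conj (q x t)) +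
    -(1 / 2) * (dx q x t * conj (q x t) + -1 * (q x t * conj (dx q x t))) +
    -(I / 4) * ((q x t * conj (q x t)) * (q x t * conj (q x t)))

def laxB11 (x t : ℝ) : ℂ := -(4 * I * l ^ 2) + -1 * laxB22 q l x t

def laxB12 (x t : ℝ) : ℂ := 2 * l * q x t + I * dx q x t

def laxB21 (x t : ℝ) : ℂ := 2 * l ^ 2 * conj (q x t) + -(I * l) * conj (dx q x t)

end lax

section smooth

variable {q : ℝ → ℝ → ℂ} {l : ℂ}

lemma SmoothQ.const_mul {f : ℝ → ℝ → ℂ} (c : ℂ) (hf : SmoothQ f) :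
    SmoothQ (fun x t => c * f x t) := (SmoothQ.const c).mul hf

lemma smooth_laxA11 (hq : SmoothQ q) : SmoothQ (laxA11 q l) :=
  (SmoothQ.const _).add (SmoothQ.const_mul _ (hq.mul hq.conjQ))

lemma smooth_laxA12 (hq : SmoothQ q) : SmoothQ (laxA12 q) := hq

lemma smooth_laxA21 (hq : SmoothQ q) : SmoothQ (laxA21 q l) := SmoothQ.const_mul _ hq.conjQ

lemma smooth_laxA22 (hq : SmoothQ q) : SmoothQ (laxA22 q) := SmoothQ.const_mul _ (hq.mul hq.conjQ)

lemma smooth_laxB22 (hq : SmoothQ q) : SmoothQ (laxB22 q l) :=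
  ((SmoothQ.const_mul _ (hq.mul hq.conjQ)).add (SmoothQ.const_mul _
    ((hq.dx.mul hq.conjQ).add (SmoothQ.const_mul _ (hq.mul hq.dx.conjQ))))).add
    (SmoothQ.const_mul _ ((hq.mul hq.conjQ).mul (hq.mul hq.conjQ)))

lemma smooth_laxB11 (hq : SmoothQ q) : SmoothQ (laxB11 q l) :=
  (SmoothQ.const _).add (SmoothQ.const_mul _ (smooth_laxB22 hq))

lemma smooth_laxB12 (hq : SmoothQ q) : SmoothQ (laxB12 q l) :=
  (SmoothQ.const_mul _ hq).add (SmoothQ.const_mul _ hq.dx)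

lemma smooth_laxB21 (hq : SmoothQ q) : SmoothQ (laxB21 q l) :=
  (SmoothQ.const_mul _ hq.conjQ).add (SmoothQ.const_mul _ hq.dx.conjQ)

end smooth

lemma HasDerivAt.conjC {f : ℝ → ℂ} {f' : ℂ} {x : ℝ} (h : HasDerivAt f f' x) :
    HasDerivAt (fun y => conj (f y)) (conj f') x := by
  exact (conjCLE.toContinuousLinearMap.hasFDerivAt (x := f x)).comp_hasDerivAt x h

/-- The zero curvature equations. -/
lemma GISol.zero_curvature {q : ℝ → ℝ → ℂ} (hq : GISol q) (l : ℂ) {x t : ℝ} (hx : 0 < x)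
    (ht : 0 < t) :
    (dt (laxA11 q l) x t = dx (laxB11 q l) x t
      - (laxA12 q x t * laxB21 q l x t - laxB12 q l x t * laxA21 q l x t)) ∧
    (dt (laxA12 q) x t = dx (laxB12 q l) x t
      - (laxA11 q l x t * laxB12 q l x t + laxA12 q x t * laxB22 q l x t
        - laxB11 q l x t * laxA12 q x t - laxB12 q l x t * laxA22 q x t)) ∧
    (dt (laxA21 q l) x t = dx (laxB21 q l) x t
      - (laxA21 q l x t * laxB11 q l x t + laxA22 q x t * laxB21 q l x t
        - laxB21 q l x t * laxA11 q l x t - laxB22 q l x t * laxA21 q l x t)) ∧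
    (dt (laxA22 q) x t = dx (laxB22 q l) x t
      - (laxA21 q l x t * laxB12 q l x t - laxB21 q l x t * laxA12 q x t)) := by
  have hs := hq.smooth
  have et := hq.eq x t hx ht
  have ect : conj (dt q x t) = -I * (conj (dx (dx q) x t) -
      I * conj (q x t) ^ 2 * dx q x t + 1 / 2 * (conj (q x t) ^ 3 * q x t ^ 2)) := by
    rw [et]; simp [conj_ofNat]; ring
  have dqt := hs.hasDerivAt_t hx ht
  have dqx := hs.hasDerivAt_x hx ht
  have dqxx := hs.dx.hasDerivAt_x hx ht
  have I2 : I ^ 2 = -1 := I_sq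
  have hρt := dqt.fun_mul dqt.conjC
  have hρx := dqx.fun_mul dqx.conjC
  have dB22 : dx (laxB22 q l) x t = _ := (((hρx.const_mul (I * l)).fun_add
      (((dqxx.fun_mul dqx.conjC).fun_add ((dqx.fun_mul dqxx.conjC).const_mul (-1))).const_mul
        (-(1 / 2)))).fun_add ((hρx.fun_mul hρx).const_mul (-(I / 4)))).deriv
  have dB11 : dx (laxB11 q l) x t = -1 * dx (laxB22 q l) x t :=
    ((((smooth_laxB22 (l := l) hs).hasDerivAt_x hx ht).const_mul (-1)).const_add
      (-(4 * I * l ^ 2))).deriv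
  have dB12 : dx (laxB12 q l) x t = _ := ((dqx.const_mul (2 * l)).fun_add (dqxx.const_mul I)).deriv
  have dB21 : dx (laxB21 q l) x t = _ :=
    ((dqx.conjC.const_mul (2 * l ^ 2)).fun_add (dqxx.conjC.const_mul (-(I * l)))).deriv
  have dA11 : dt (laxA11 q l) x t = _ := ((hρt.const_mul (-(I / 2))).const_add (-(2 * I * l))).deriv
  have dA12 : dt (laxA12 q) x t = dt q x t := rfl
  have dA21 : dt (laxA21 q l) x t = _ := (dqt.conjC.const_mul l).deriv
  have dA22 : dt (laxA22 q) x t = _ := (hρt.const_mul (I / 2)).deriv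
  rw [dB11, dA11, dA12, dA21, dA22, dB22, dB12, dB21]
  simp only [laxA11, laxA12, laxA21, laxA22, laxB11, laxB12, laxB21, laxB22]
  rw [ect, et]
  generalize q x t = a
  generalize conj a = b
  generalize dx q x t = ai
  generalize conj ai = b1
  generalize dx (dx q) x t = aj
  generalize conj aj = b2
  have I3 : I ^ 3 = -I := by rw [pow_succ, I2]; ring
  refine ⟨?_, ?_, ?_, ?_⟩ <;> ring_nf <;> simp only [I2, I3] <;> ring

/-! ### Backward energy estimate for the `x`-part -/

lemma backward_gronwall {E E' c P : ℝ → ℝ} {a b R : ℝ} (hab : a ≤ b)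
    (hE : ContinuousOn E (Icc a b)) (hE' : ∀ x ∈ Ioo a b, HasDerivAt E (E' x) x)
    (hP : ContinuousOn P (Icc a b)) (hP' : ∀ x ∈ Ioo a b, HasDerivAt P (c x) x)
    (h : ∀ x ∈ Ioo a b, -(E' x) ≤ c x * (E x + R)) :
    E a + R ≤ (E b + R) * Real.exp (P b - P a) := by
  have hmono : MonotoneOn (fun x => (E x + R) * Real.exp (P x)) (Icc a b) := by
    have hder : ∀ x ∈ Ioo a b, HasDerivAt (fun x => (E x + R) * Real.exp (P x))
        (E' x * Real.exp (P x) + (E x + R) * (Real.exp (P x) * c x)) x := fun x hx =>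
      ((hE' x hx).add_const R).fun_mul (hP' x hx).exp
    refine monotoneOn_of_deriv_nonneg (convex_Icc a b)
      ((hE.add continuousOn_const).mul (Real.continuous_exp.comp_continuousOn hP)) ?_ ?_
    · rw [interior_Icc]
      exact fun x hx => (hder x hx).differentiableAt.differentiableWithinAt
    · rw [interior_Icc]
      intro x hx
      rw [(hder x hx).deriv]
      have h1 := h x hx
      have h2 := Real.exp_pos (P x)
      nlinarith
  have h1 := hmono (left_mem_Icc.2 hab) (right_mem_Icc.2 hab) hab
  simp only at h1
  rw [Real.exp_sub, ← mul_div_assoc, le_div_iff₀ (Real.exp_pos _)]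
  exact h1

lemma hasDerivAt_norm_sq {f : ℝ → ℂ} {f' : ℂ} {x : ℝ} (h : HasDerivAt f f' x) :
    HasDerivAt (fun y => ‖f y‖ ^ 2) (2 * (conj (f x) * f').re) x := by
  have h1 := h.norm_sq
  simpa [Complex.inner, mul_comm] using h1

/-- Backward energy estimate for the `x`-system. -/
lemma energy_backward {qf a1 a2 : ℝ → ℂ} {l : ℂ} {x0 X : ℝ}
    (hX : x0 ≤ X) (hl : l ∈ UHP) (hq : ContinuousOn qf (Icc x0 X))
    (h1c : ContinuousOn a1 (Icc x0 X)) (h2c : ContinuousOn a2 (Icc x0 X))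
    (h₁ : ∀ x ∈ Ioo x0 X, HasDerivAt a1 ((-(2 * I * l) + -(I / 2) *
      (qf x * conj (qf x))) * a1 x + qf x * a2 x) x)
    (h₂ : ∀ x ∈ Ioo x0 X, HasDerivAt a2 (l * conj (qf x) * a1 x +
      I / 2 * (qf x * conj (qf x)) * a2 x) x) :
    ‖a2 x0‖ ^ 2 + ‖l‖ * ‖a1 x0‖ ^ 2 ≤ (‖a2 X‖ ^ 2 + ‖l‖ * ‖a1 X‖ ^ 2) *
        Real.exp (‖l‖ / l.im * (∫ x in x0..X, ‖qf x‖ ^ 2)) := by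
  have hη : 0 < l.im := hl
  have hK0 : 0 < ‖l‖ := norm_pos_iff.2 fun h => by simp [h] at hη
  set c := ‖l‖ / l.im with hc
  have hcp : 0 < c := by positivity
  set E : ℝ → ℝ := fun x => ‖a2 x‖ ^ 2 + ‖l‖ * ‖a1 x‖ ^ 2 with hE
  set P : ℝ → ℝ := fun x => c * (∫ y in x0..x, ‖qf y‖ ^ 2) with hP
  have hqn : ContinuousOn (fun x => ‖qf x‖ ^ 2) (uIcc x0 X) := by
    rw [uIcc_of_le hX]; exact hq.norm.pow 2
  have hPd : ∀ x ∈ Ioo x0 X, HasDerivAt P (c * ‖qf x‖ ^ 2) x := by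
    intro x hx
    have h1 : HasDerivAt (fun x => ∫ y in x0..x, ‖qf y‖ ^ 2) (‖qf x‖ ^ 2) x := by
      refine integral_hasDerivAt_right ((hqn.mono ?_).intervalIntegrable) ?_ ?_
      · rw [uIcc_of_le hX, uIcc_of_le hx.1.le]; exact Icc_subset_Icc le_rfl hx.2.le
      · exact ContinuousOn.stronglyMeasurableAtFilter isOpen_Ioo
          ((hq.norm.pow 2).mono Ioo_subset_Icc_self) x hx
      · exact (hq.norm.pow 2).continuousAt (Icc_mem_nhds hx.1 hx.2)
    exact h1.const_mul c
  have hPc : ContinuousOn P (Icc x0 X) := by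
    refine ContinuousOn.mul continuousOn_const ?_
    have := continuousOn_primitive_interval' (μ := volume)
      (hqn.intervalIntegrable) left_mem_uIcc
    rwa [uIcc_of_le hX] at this
  have key := backward_gronwall (E := E) (P := P) (R := 0) (c := fun x => c * ‖qf x‖ ^ 2) hX
    ((h2c.norm.pow 2).add (continuousOn_const.mul (h1c.norm.pow 2)))
    (fun x hx => (hasDerivAt_norm_sq (h₂ x hx)).fun_add
      ((hasDerivAt_norm_sq (h₁ x hx)).const_mul ‖l‖)) hPc hPd ?_
  · simpa [hP, hE] using key
  · intro x hx
    set Q := ‖qf x‖ with hQ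
    set A := ‖a1 x‖ with hA
    set B := ‖a2 x‖ with hB
    have e1 : (conj (a1 x) * ((-(2 * I * l) + -(I / 2) *
        (qf x * conj (qf x))) * a1 x + qf x * a2 x)).re
        = 2 * l.im * A ^ 2 + (conj (a1 x) * qf x * a2 x).re := by
      have : conj (a1 x) * ((-(2 * I * l) + -(I / 2) * (qf x * conj (qf x))) * a1 x + qf x * a2 x) =
        ((-(2 * I * l) + -(I / 2) * (qf x * conj (qf x))) *
          (a1 x * conj (a1 x))) + conj (a1 x) * qf x * a2 x := by ring
      rw [this, mul_conj, mul_conj, add_re,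
        re_mul_ofReal, normSq_eq_norm_sq, normSq_eq_norm_sq, ← hA]
      congr 2
      simp only [add_re, neg_re, mul_re, I_re, I_im,
        ofReal_re, ofReal_im, re_ofNat, im_ofNat, mul_im,
        neg_im, div_ofNat_re, div_ofNat_im]
      ring
    have e2 : (conj (a2 x) * (l * conj (qf x) * a1 x + I / 2 * (qf x * conj (qf x)) * a2 x)).re
        = (conj (a2 x) * (l * conj (qf x) * a1 x)).re := by
      have : conj (a2 x) * (l * conj (qf x) * a1 x + I / 2 * (qf x * conj (qf x)) * a2 x) =
        conj (a2 x) * (l * conj (qf x) * a1 x) +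
          I / 2 * (qf x * conj (qf x)) * (a2 x * conj (a2 x)) := by ring
      rw [this, mul_conj, mul_conj, add_re, re_mul_ofReal, re_mul_ofReal]
      simp
    have n1 : -(A * Q * B) ≤ (conj (a1 x) * qf x * a2 x).re := by
      have := abs_re_le_norm (conj (a1 x) * qf x * a2 x)
      simp only [norm_mul, RCLike.norm_conj] at this
      exact (abs_le.1 this).1
    have n3 : -(B * (‖l‖ * Q * A)) ≤ (conj (a2 x) * (l * conj (qf x) * a1 x)).re := by
      have := abs_re_le_norm (conj (a2 x) * (l * conj (qf x) * a1 x))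
      simp only [norm_mul, RCLike.norm_conj] at this
      exact (abs_le.1 this).1
    rw [e1, e2]
    have k1 := mul_le_mul_of_nonneg_left n1 hK0.le
    have m6 : 0 ≤ c * Q ^ 2 * (‖l‖ * A ^ 2) := by positivity
    have m1 : 4 * ‖l‖ * (A * Q * B) ≤ 4 * l.im * ‖l‖ * A ^ 2 + c * Q ^ 2 * B ^ 2 := by
      have h7 : 0 ≤ ‖l‖ / l.im * (2 * l.im * A - Q * B) ^ 2 := by positivity
      have : ‖l‖ / l.im * (2 * l.im * A - Q * B) ^ 2 =
          4 * l.im * ‖l‖ * A ^ 2 - 4 * ‖l‖ * (A * Q * B) + c * Q ^ 2 * B ^ 2 := by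
        rw [hc]; field_simp; ring
      linarith
    have ex : c * Q ^ 2 * (E x + 0) = c * Q ^ 2 * B ^ 2 + c * Q ^ 2 * (‖l‖ * A ^ 2) := by
      simp only [hE]; ring
    rw [ex]
    linarith

/-! ### Linear ordinary differential equations -/

open scoped NNReal in
lemma exists_ode_short {V : Type*} [NormedAddCommGroup V] [NormedSpace ℝ V] [CompleteSpace V]
    {f : ℝ → V → V} {K : ℝ≥0} {a b t0 : ℝ} (h₀ : t0 ∈ Icc a b)
    (hL : ∀ t ∈ Icc a b, LipschitzWith K (f t)) (h0 : ∀ t ∈ Icc a b, f t 0 = 0)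
    (hc : ∀ y, ContinuousOn (fun t => f t y) (Icc a b)) (hs : 2 * (K * (b - a)) ≤ 1) (y0 : V) :
    ∃ y : ℝ → V, y t0 = y0 ∧ ∀ t ∈ Icc a b, HasDerivWithinAt y (f t (y t)) (Icc a b) t := by
  have hPL : IsPicardLindelof f (⟨t0, h₀⟩ : Icc a b) y0 ‖y0‖₊ 0 (K * (2 * ‖y0‖₊)) K := by
    refine ⟨fun t ht => (hL t ht).lipschitzOnWith, fun y _ => hc y, fun t ht y hy => ?_, ?_⟩
    · have h1 := (hL t ht).dist_le_mul y 0
      rw [h0 t ht, dist_zero_right, dist_zero_right] at h1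
      have h2 : ‖y‖ ≤ 2 * ‖y0‖ := by
        have := norm_le_of_mem_closedBall hy
        simp at this; linarith
      push_cast
      exact h1.trans (by gcongr)
    · have h1 : max (b - t0) (t0 - a) ≤ b - a := by
        simp only [max_le_iff]; constructor <;> linarith [h₀.1, h₀.2]
      push_cast
      simp only [sub_zero]
      calc (K : ℝ) * (2 * ‖y0‖) * max (b - t0) (t0 - a) ≤ K * (2 * ‖y0‖) * (b - a) := by gcongr
        _ = 2 * (K * (b - a)) * ‖y0‖ := by ring
        _ ≤ 1 * ‖y0‖ := by gcongr
        _ = ‖y0‖ := one_mul _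
  simpa using hPL.exists_eq_forall_mem_Icc_hasDerivWithinAt₀

lemma glue_ode {V : Type*} [NormedAddCommGroup V] [NormedSpace ℝ V]
    {f : ℝ → V → V} {a m b : ℝ} (ham : a ≤ m) (hmb : m ≤ b) {y z : ℝ → V} (hyz : y m = z m)
    (hy : ∀ t ∈ Icc a m, HasDerivWithinAt y (f t (y t)) (Icc a m) t)
    (hz : ∀ t ∈ Icc m b, HasDerivWithinAt z (f t (z t)) (Icc m b) t) :
    ∃ w : ℝ → V, (∀ t ∈ Icc a m, w t = y t) ∧ (∀ t ∈ Icc m b, w t = z t) ∧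
      ∀ t ∈ Icc a b, HasDerivWithinAt w (f t (w t)) (Icc a b) t := by
  set w : ℝ → V := fun t => if t ≤ m then y t else z t with hw
  have w1 : ∀ t ∈ Icc a m, w t = y t := fun t ht => by simp [hw, ht.2]
  have w2 : ∀ t ∈ Icc m b, w t = z t := fun t ht => by
    by_cases h : t ≤ m
    · have : t = m := le_antisymm h ht.1
      subst this
      simpa [hw] using hyz
    · simp [hw, h]
  refine ⟨w, w1, w2, fun t ht => ?_⟩
  have d1 : ∀ t ∈ Icc a m, HasDerivWithinAt w (f t (w t)) (Icc a m) t := fun t ht => by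
    rw [w1 t ht]; exact (hy t ht).congr w1 (w1 t ht)
  have d2 : ∀ t ∈ Icc m b, HasDerivWithinAt w (f t (w t)) (Icc m b) t := fun t ht => by
    rw [w2 t ht]; exact (hz t ht).congr w2 (w2 t ht)
  rcases lt_trichotomy t m with h | h | h
  · refine (d1 t ⟨ht.1, h.le⟩).mono_of_mem_nhdsWithin ?_
    filter_upwards [self_mem_nhdsWithin, mem_nhdsWithin_of_mem_nhds (Iio_mem_nhds h)] with s h1 h2
    exact ⟨h1.1, le_of_lt h2⟩
  · subst h
    have := (d1 t ⟨ham, le_rfl⟩).union (d2 t ⟨le_rfl, hmb⟩)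
    rwa [Icc_union_Icc_eq_Icc ham hmb] at this
  · refine (d2 t ⟨h.le, ht.2⟩).mono_of_mem_nhdsWithin ?_
    filter_upwards [self_mem_nhdsWithin, mem_nhdsWithin_of_mem_nhds (Ioi_mem_nhds h)] with s h1 h2
    exact ⟨le_of_lt h2, h1.2⟩

open scoped NNReal in
lemma exists_ode {V : Type*} [NormedAddCommGroup V] [NormedSpace ℝ V] [CompleteSpace V]
    {f : ℝ → V → V} {K : ℝ≥0} {a b t0 : ℝ} (h₀ : t0 ∈ Icc a b)
    (hL : ∀ t ∈ Icc a b, LipschitzWith K (f t)) (h0 : ∀ t ∈ Icc a b, f t 0 = 0)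
    (hc : ∀ y, ContinuousOn (fun t => f t y) (Icc a b)) (y0 : V) :
    ∃ y : ℝ → V, y t0 = y0 ∧ ∀ t ∈ Icc a b, HasDerivWithinAt y (f t (y t)) (Icc a b) t := by
  obtain ⟨n, hn⟩ := exists_nat_ge (2 * (K * (b - a)))
  induction n generalizing a t0 y0 with
  | zero => exact exists_ode_short h₀ hL h0 hc (hn.trans (by simp)) y0
  | succ n ih =>
    by_cases hsh : 2 * (K * (b - a)) ≤ 1
    · exact exists_ode_short h₀ hL h0 hc hsh y0
    push Not at hsh
    have hK : 0 < (K : ℝ) := by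
      rcases eq_or_lt_of_le K.coe_nonneg with h | h
      · rw [← h] at hsh; simp at hsh; linarith
      · exact h
    set m := a + 1 / (2 * K) with hm
    have ham : a ≤ m := by rw [hm]; have : 0 < 1 / (2 * (K : ℝ)) := by positivity
                           linarith
    have hmK : 2 * (K * (m - a)) = 1 := by rw [hm]; field_simp; ring
    have hmb : m ≤ b := by
      have : 0 ≤ 2 * (K : ℝ) * (b - m) := by linarith
      have := nonneg_of_mul_nonneg_right this (by positivity : 0 < 2 * (K : ℝ))
      linarith
    have s1 : Icc a m ⊆ Icc a b := Icc_subset_Icc le_rfl hmb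
    have s2 : Icc m b ⊆ Icc a b := Icc_subset_Icc ham le_rfl
    have hn' : 2 * (K * (b - m)) ≤ (n : ℝ) := by push_cast at hn; linarith
    by_cases ht : t0 ≤ m
    · obtain ⟨y, hy0, hy⟩ := exists_ode_short (f := f) (K := K) (a := a) (b := m) (t0 := t0)
        ⟨h₀.1, ht⟩ (fun t h => hL t (s1 h)) (fun t h => h0 t (s1 h)) (fun y => (hc y).mono s1)
        hmK.le y0
      obtain ⟨z, hz0, hz⟩ := ih (a := m) (t0 := m) ⟨le_rfl, hmb⟩ (fun t h => hL t (s2 h))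
        (fun t h => h0 t (s2 h)) (fun y => (hc y).mono s2) (y m) hn'
      obtain ⟨w, w1, w2, hw⟩ := glue_ode ham hmb hz0.symm hy hz
      exact ⟨w, by rw [w1 t0 ⟨h₀.1, ht⟩, hy0], hw⟩
    · push Not at ht
      obtain ⟨z, hz0, hz⟩ := ih (a := m) (t0 := t0) ⟨ht.le, h₀.2⟩ (fun t h => hL t (s2 h))
        (fun t h => h0 t (s2 h)) (fun y => (hc y).mono s2) y0 hn'
      obtain ⟨y, hy0, hy⟩ := exists_ode_short (f := f) (K := K) (a := a) (b := m) (t0 := m)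
        ⟨ham, le_rfl⟩ (fun t h => hL t (s1 h)) (fun t h => h0 t (s1 h)) (fun y => (hc y).mono s1)
        hmK.le (z m)
      obtain ⟨w, w1, w2, hw⟩ := glue_ode ham hmb hy0 hy hz
      exact ⟨w, by rw [w2 t0 ⟨ht.le, h₀.2⟩, hz0], hw⟩

lemma norm_lin2_le {a b y z : ℂ} {M : ℝ} (ha : ‖a‖ ≤ M) (hb : ‖b‖ ≤ M) :
    ‖a * y + b * z‖ ≤ 2 * M * max ‖y‖ ‖z‖ := by
  have hM : 0 ≤ M := (norm_nonneg _).trans ha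
  calc ‖a * y + b * z‖ ≤ ‖a‖ * ‖y‖ + ‖b‖ * ‖z‖ := by
        rw [← norm_mul, ← norm_mul]; exact norm_add_le _ _
    _ ≤ M * max ‖y‖ ‖z‖ + M * max ‖y‖ ‖z‖ := by
        gcongr
        · exact le_max_left _ _
        · exact le_max_right _ _
    _ = _ := by ring

/-- `(y1, y2)` solves the linear system with coefficients `a11, a12, a21, a22` on `s`. -/
def LinSys (a11 a12 a21 a22 y1 y2 : ℝ → ℂ) (s : Set ℝ) : Prop := ∀ t ∈ s,
  HasDerivWithinAt y1 (a11 t * y1 t + a12 t * y2 t) s t ∧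
  HasDerivWithinAt y2 (a21 t * y1 t + a22 t * y2 t) s t

/-- The coefficients `a11, a12, a21, a22` are continuous on `s`. -/
def ContSys (a11 a12 a21 a22 : ℝ → ℂ) (s : Set ℝ) : Prop :=
  ContinuousOn a11 s ∧ ContinuousOn a12 s ∧ ContinuousOn a21 s ∧ ContinuousOn a22 s

lemma ContinuousOn.eventually_bound {E : Type*} [SeminormedAddCommGroup E] {f : ℝ → E} {a b : ℝ}
    (h : ContinuousOn f (Icc a b)) : ∀ᶠ M in atTop, ∀ t ∈ Icc a b, ‖f t‖ ≤ M := by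
  obtain ⟨M, hM⟩ := isCompact_Icc.exists_bound_of_continuousOn h
  filter_upwards [eventually_ge_atTop M] with N hN t ht using (hM t ht).trans hN

lemma eventually_norm_sub_le {α β E : Type*} [TopologicalSpace α] [TopologicalSpace β]
    [SeminormedAddCommGroup E] {f : α → β → E} {s : Set α} {k : Set β} {p₀ : α} (hk : IsCompact k)
    (hf : ContinuousOn (fun p : α × β => f p.1 p.2) (s ×ˢ k)) (hs : p₀ ∈ s) {ε : ℝ} (hε : 0 < ε) :
    ∀ᶠ p in 𝓝[s] p₀, ∀ x ∈ k, ‖f p x - f p₀ x‖ ≤ ε := by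
  obtain ⟨v, hv, h⟩ := hk.mem_uniformity_of_prod hf hs (Metric.dist_mem_uniformity hε)
  filter_upwards [hv] with p hp x hx
  have := h p hp x hx
  rw [mem_ofPred_eq, dist_eq_norm] at this
  exact this.le

section

variable {a11 a12 a21 a22 y1 y2 z1 z2 : ℝ → ℂ} {a b t0 : ℝ} {s r : Set ℝ}

lemma ContSys.exists_bound (h : ContSys a11 a12 a21 a22 (Icc a b)) : ∃ M, 0 ≤ M ∧ ∀ t ∈ Icc a b,
    ‖a11 t‖ ≤ M ∧ ‖a12 t‖ ≤ M ∧ ‖a21 t‖ ≤ M ∧ ‖a22 t‖ ≤ M := by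
  obtain ⟨M, h0, h1, h2, h3, h4⟩ := ((eventually_ge_atTop 0).and (h.1.eventually_bound.and
    (h.2.1.eventually_bound.and (h.2.2.1.eventually_bound.and h.2.2.2.eventually_bound)))).exists
  exact ⟨M, h0, fun t ht => ⟨h1 t ht, h2 t ht, h3 t ht, h4 t ht⟩⟩

lemma LinSys.mono (h : LinSys a11 a12 a21 a22 y1 y2 s) (hr : r ⊆ s) :
    LinSys a11 a12 a21 a22 y1 y2 r := fun t ht =>
  ⟨(h t (hr ht)).1.mono hr, (h t (hr ht)).2.mono hr⟩

lemma LinSys.continuousOn (h : LinSys a11 a12 a21 a22 y1 y2 s) :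
    ContinuousOn y1 s ∧ ContinuousOn y2 s :=
  ⟨fun t ht => (h t ht).1.continuousWithinAt, fun t ht => (h t ht).2.continuousWithinAt⟩

lemma LinSys.congr (h : LinSys a11 a12 a21 a22 y1 y2 s) (e : ∀ t ∈ s, y1 t = z1 t ∧ y2 t = z2 t) :
    LinSys a11 a12 a21 a22 z1 z2 s := fun t ht => by
  rw [← (e t ht).1, ← (e t ht).2]
  exact ⟨(h t ht).1.congr (fun r hr => (e r hr).1.symm) (e t ht).1.symm,
    (h t ht).2.congr (fun r hr => (e r hr).2.symm) (e t ht).2.symm⟩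

/-- The solution of a linear `2 × 2` system on a compact interval. -/
lemma ContSys.exists_sol (h : ContSys a11 a12 a21 a22 (Icc a b)) (h₀ : t0 ∈ Icc a b) (c d : ℂ) :
    ∃ y1 y2 : ℝ → ℂ, y1 t0 = c ∧ y2 t0 = d ∧ LinSys a11 a12 a21 a22 y1 y2 (Icc a b) := by
  obtain ⟨M, hM, hb⟩ := h.exists_bound
  obtain ⟨h11, h12, h21, h22⟩ := h
  obtain ⟨y, hy0, hy⟩ := exists_ode (V := ℂ × ℂ) (K := ⟨2 * M, by positivity⟩)
    (f := fun t p => (a11 t * p.1 + a12 t * p.2, a21 t * p.1 + a22 t * p.2)) h₀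
    (fun t ht => by
      obtain ⟨k1, k2, k3, k4⟩ := hb t ht
      have e : ∀ {α β : ℂ} (p q : ℂ × ℂ), ‖α‖ ≤ M → ‖β‖ ≤ M →
          ‖α * p.1 + β * p.2 - (α * q.1 + β * q.2)‖ ≤ 2 * M * ‖p - q‖ := fun p q hα hβ => by
        convert norm_lin2_le (y := (p - q).1) (z := (p - q).2) hα hβ using 2
        · simp only [Prod.fst_sub, Prod.snd_sub]; ring
        · exact Prod.norm_def _
      refine LipschitzWith.of_dist_le_mul fun p q => ?_
      rw [dist_eq_norm, dist_eq_norm]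
      exact max_le (e p q k1 k2) (e p q k3 k4))
    (fun t _ => by simp) (fun y => by fun_prop) (c, d)
  exact ⟨fun t => (y t).1, fun t => (y t).2, by simp [hy0], by simp [hy0], fun t ht =>
    ⟨(hasFDerivAt_fst (𝕜 := ℝ) (p := y t)).comp_hasDerivWithinAt t (hy t ht),
    (hasFDerivAt_snd (𝕜 := ℝ) (p := y t)).comp_hasDerivWithinAt t (hy t ht)⟩⟩

end

lemma gronwallBound_le {δ K ε x : ℝ} (hK : 0 ≤ K) (hε : 0 ≤ ε) :
    gronwallBound δ K ε x ≤ (δ + ε * x) * Real.exp (K * x) := by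
  rcases eq_or_lt_of_le hK with h | h
  · rw [← h, gronwallBound_K0]; simp
  · rw [gronwallBound_of_K_ne_0 h.ne']
    have h1 : Real.exp (K * x) - 1 ≤ K * x * Real.exp (K * x) := by
      have := Real.add_one_le_exp (-(K * x))
      have h2 : Real.exp (-(K * x)) * Real.exp (K * x) = 1 := by rw [← Real.exp_add]; simp
      nlinarith [Real.exp_pos (K * x)]
    have h3 : ε / K * (Real.exp (K * x) - 1) ≤ ε / K * (K * x * Real.exp (K * x)) := by gcongr
    have h4 : ε / K * (K * x * Real.exp (K * x)) = ε * x * Real.exp (K * x) := by field_simp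
    nlinarith

/-- Grönwall's inequality for an inhomogeneous `2 × 2` system. -/
lemma gronwall2 {a11 a12 a21 a22 y1 y2 r₁ r₂ : ℝ → ℂ} {a b M r δ : ℝ}
    (hy1 : ∀ t ∈ Icc a b, HasDerivWithinAt y1 (a11 t * y1 t + a12 t * y2 t + r₁ t) (Icc a b) t)
    (hy2 : ∀ t ∈ Icc a b, HasDerivWithinAt y2 (a21 t * y1 t + a22 t * y2 t + r₂ t) (Icc a b) t)
    (hM : ∀ t ∈ Icc a b, ‖a11 t‖ ≤ M ∧ ‖a12 t‖ ≤ M ∧ ‖a21 t‖ ≤ M ∧ ‖a22 t‖ ≤ M)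
    (hr : ∀ t ∈ Icc a b, ‖r₁ t‖ ≤ r ∧ ‖r₂ t‖ ≤ r) (h₁ : ‖y1 a‖ ≤ δ) (h₂ : ‖y2 a‖ ≤ δ) :
    ∀ t ∈ Icc a b, ‖y1 t‖ ≤ (δ + r * (b - a)) * Real.exp (2 * M * (b - a)) ∧
      ‖y2 t‖ ≤ (δ + r * (b - a)) * Real.exp (2 * M * (b - a)) := by
  intro t ht
  have hM0 : 0 ≤ M := (norm_nonneg _).trans (hM t ht).1
  have hr0 : 0 ≤ r := (norm_nonneg _).trans (hr t ht).1
  have hδ0 : 0 ≤ δ := (norm_nonneg _).trans h₁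
  have key := norm_le_gronwallBound_of_norm_deriv_right_le (f := fun t => (y1 t, y2 t))
    (f' := fun t => (a11 t * y1 t + a12 t * y2 t + r₁ t, a21 t * y1 t + a22 t * y2 t + r₂ t))
    (δ := δ) (K := 2 * M) (ε := r) (a := a) (b := b)
    (fun t ht => ((hy1 t ht).continuousWithinAt).prodMk ((hy2 t ht).continuousWithinAt))
    (fun t ht => by
      have ht' := Ico_subset_Icc_self ht
      have := (hy1 t ht').prodMk (hy2 t ht')
      refine this.mono_of_mem_nhdsWithin ?_
      filter_upwards [self_mem_nhdsWithin, mem_nhdsWithin_of_mem_nhds (Iio_mem_nhds ht.2)]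
        with s h1 h2
      exact ⟨ht.1.trans h1, le_of_lt h2⟩)
    (by simp only [Prod.norm_def]; exact max_le h₁ h₂)
    (fun t ht => by
      have ht' := Ico_subset_Icc_self ht
      obtain ⟨k1, k2, k3, k4⟩ := hM t ht'
      simp only [Prod.norm_def]
      refine max_le ?_ ?_
      · exact (norm_add_le _ _).trans (add_le_add (norm_lin2_le k1 k2) (hr t ht').1)
      · exact (norm_add_le _ _).trans (add_le_add (norm_lin2_le k3 k4) (hr t ht').2)) t ht
  have h3 : gronwallBound δ (2 * M) r (t - a) ≤
      (δ + r * (b - a)) * Real.exp (2 * M * (b - a)) := by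
    refine (gronwallBound_le (by positivity) hr0).trans ?_
    have h5 : t - a ≤ b - a := by linarith [ht.2]
    have h6 : 0 ≤ b - a := by linarith [ht.1, ht.2]
    gcongr
  simp only [Prod.norm_def] at key
  exact ⟨(le_max_left _ _).trans (key.trans h3), (le_max_right _ _).trans (key.trans h3)⟩

/-- Uniqueness for linear `2 × 2` systems. -/
lemma LinSys.unique {a11 a12 a21 a22 y1 y2 z1 z2 : ℝ → ℂ} {a b : ℝ}
    (hc : ContSys a11 a12 a21 a22 (Icc a b)) (hy : LinSys a11 a12 a21 a22 y1 y2 (Icc a b))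
    (hz : LinSys a11 a12 a21 a22 z1 z2 (Icc a b)) (h1 : y1 a = z1 a) (h2 : y2 a = z2 a) :
    ∀ t ∈ Icc a b, y1 t = z1 t ∧ y2 t = z2 t := by
  intro t ht
  obtain ⟨M, -, hM⟩ := hc.exists_bound
  simpa [sub_eq_zero] using gronwall2 (δ := 0) (r := 0) (r₁ := 0) (r₂ := 0)
    (y1 := fun t => y1 t - z1 t) (y2 := fun t => y2 t - z2 t)
    (fun s hs => ((hy s hs).1.fun_sub (hz s hs).1).congr_deriv (by simp; ring))
    (fun s hs => ((hy s hs).2.fun_sub (hz s hs).2).congr_deriv (by simp; ring))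
    hM (fun s _ => by simp) (by simp [h1]) (by simp [h2]) t ht

/-- A pointwise limit of solutions solves the limit system if the coefficients converge
uniformly. -/
lemma LinSys.limit {ι : Type*} {F : Filter ι} [F.NeBot] {a11 a12 a21 a22 y1 y2 : ι → ℝ → ℂ}
    {b11 b12 b21 b22 z1 z2 : ℝ → ℂ} {a b : ℝ} (hab : a ≤ b)
    (hb : ContSys b11 b12 b21 b22 (Icc a b))
    (ha : ∀ ε > 0, ∀ᶠ n in F, ∀ t ∈ Icc a b, ‖a11 n t - b11 t‖ ≤ ε ∧ ‖a12 n t - b12 t‖ ≤ ε ∧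
      ‖a21 n t - b21 t‖ ≤ ε ∧ ‖a22 n t - b22 t‖ ≤ ε)
    (hy : ∀ᶠ n in F, LinSys (a11 n) (a12 n) (a21 n) (a22 n) (y1 n) (y2 n) (Icc a b))
    (hz : ∀ t ∈ Icc a b, Tendsto (fun n => y1 n t) F (𝓝 (z1 t)) ∧
      Tendsto (fun n => y2 n t) F (𝓝 (z2 t))) :
    LinSys b11 b12 b21 b22 z1 z2 (Icc a b) := by
  have hlo := left_mem_Icc.2 hab
  obtain ⟨w1, w2, i1, i2, hw⟩ := hb.exists_sol hlo (z1 a) (z2 a)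
  obtain ⟨M, -, hM⟩ := hb.exists_bound
  obtain ⟨W, W1, W2⟩ :=
    (hw.continuousOn.1.eventually_bound.and hw.continuousOn.2.eventually_bound).exists
  refine hw.congr fun t ht => ?_
  set B : ℝ → ℝ := fun ε => (ε + 2 * ε * W * (b - a)) * Real.exp (2 * (M + 1) * (b - a)) with hB
  have key : ∀ ε ∈ Ioo (0 : ℝ) 1, ∀ᶠ n in F, ‖y1 n t - w1 t‖ ≤ B ε ∧ ‖y2 n t - w2 t‖ ≤ B ε := by
    intro ε hε
    have ev := fun {f : ι → ℂ} {c : ℂ} (h : Tendsto f F (𝓝 c)) =>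
      (tendsto_iff_norm_sub_tendsto_zero.1 h).eventually (gt_mem_nhds hε.1)
    filter_upwards [ha ε hε.1, hy, ev (hz a hlo).1, ev (hz a hlo).2] with n hn hyn e1 e2
    have add : ∀ {α β : ℂ}, ‖α - β‖ ≤ ε → ‖β‖ ≤ M → ‖α‖ ≤ M + 1 := fun {α β} h h' => by
      linarith [norm_le_norm_add_norm_sub' α β, hε.2]
    have src : ∀ {α β : ℂ} {s : ℝ}, s ∈ Icc a b → ‖α‖ ≤ ε → ‖β‖ ≤ ε →
        ‖α * w1 s + β * w2 s‖ ≤ 2 * ε * W := fun hs hα hβ =>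
      (norm_lin2_le hα hβ).trans (mul_le_mul_of_nonneg_left (max_le (W1 _ hs) (W2 _ hs))
        (by linarith [hε.1]))
    exact gronwall2 (y1 := fun t => y1 n t - w1 t) (y2 := fun t => y2 n t - w2 t) (M := M + 1)
      (r₁ := fun t => (a11 n t - b11 t) * w1 t + (a12 n t - b12 t) * w2 t)
      (r₂ := fun t => (a21 n t - b21 t) * w1 t + (a22 n t - b22 t) * w2 t)
      (fun s hs => ((hyn s hs).1.fun_sub (hw s hs).1).congr_deriv (by ring))
      (fun s hs => ((hyn s hs).2.fun_sub (hw s hs).2).congr_deriv (by ring))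
      (fun s hs => ⟨add (hn s hs).1 (hM s hs).1, add (hn s hs).2.1 (hM s hs).2.1,
        add (hn s hs).2.2.1 (hM s hs).2.2.1, add (hn s hs).2.2.2 (hM s hs).2.2.2⟩)
      (fun s hs => ⟨src hs (hn s hs).1 (hn s hs).2.1, src hs (hn s hs).2.2.1 (hn s hs).2.2.2⟩)
      (by rw [i1]; exact e1.le) (by rw [i2]; exact e2.le) t ht
  have lim : Tendsto B (𝓝[>] 0) (𝓝 0) := by
    have : Continuous B := by fun_prop
    simpa [hB] using (this.tendsto 0).mono_left nhdsWithin_le_nhds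
  have eq : ∀ {f : ι → ℂ} {v w : ℂ}, Tendsto f F (𝓝 v) →
      (∀ ε ∈ Ioo (0 : ℝ) 1, ∀ᶠ n in F, ‖f n - w‖ ≤ B ε) → w = v := by
    intro f v w hf h
    have : ‖v - w‖ ≤ 0 := by
      refine ge_of_tendsto lim ?_
      filter_upwards [Ioo_mem_nhdsGT one_pos] with ε hε
      exact le_of_tendsto (hf.sub_const w).norm (h ε hε)
    exact (sub_eq_zero.1 (norm_le_zero_iff.1 this)).symm
  exact ⟨eq (hz t ht).1 fun ε hε => (key ε hε).mono fun _ h => h.1,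
    eq (hz t ht).2 fun ε hε => (key ε hε).mono fun _ h => h.2⟩

/-! ### Compatible flows -/

/-- A smooth zero curvature pair of `2 × 2` connections on the open quadrant. -/
structure ZeroCurv (A11 A12 A21 A22 B11 B12 B21 B22 : ℝ → ℝ → ℂ) : Prop where
  sA11 : SmoothQ A11
  sA12 : SmoothQ A12
  sA21 : SmoothQ A21
  sA22 : SmoothQ A22
  sB11 : SmoothQ B11
  sB12 : SmoothQ B12
  sB21 : SmoothQ B21
  sB22 : SmoothQ B22
  e11 : ∀ x t, 0 < x → 0 < t → dt A11 x t = dx B11 x t - (A12 x t * B21 x t - B12 x t * A21 x t)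
  e12 : ∀ x t, 0 < x → 0 < t → dt A12 x t = dx B12 x t
    - (A11 x t * B12 x t + A12 x t * B22 x t - B11 x t * A12 x t - B12 x t * A22 x t)
  e21 : ∀ x t, 0 < x → 0 < t → dt A21 x t = dx B21 x t
    - (A21 x t * B11 x t + A22 x t * B21 x t - B21 x t * A11 x t - B22 x t * A21 x t)
  e22 : ∀ x t, 0 < x → 0 < t → dt A22 x t = dx B22 x t - (A21 x t * B12 x t - B21 x t * A12 x t)

lemma GISol.zeroCurv {q : ℝ → ℝ → ℂ} (hq : GISol q) (l : ℂ) :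
    ZeroCurv (laxA11 q l) (laxA12 q) (laxA21 q l) (laxA22 q)
      (laxB11 q l) (laxB12 q l) (laxB21 q l) (laxB22 q l) where
  sA11 := smooth_laxA11 hq.smooth
  sA12 := smooth_laxA12 hq.smooth
  sA21 := smooth_laxA21 hq.smooth
  sA22 := smooth_laxA22 hq.smooth
  sB11 := smooth_laxB11 hq.smooth
  sB12 := smooth_laxB12 hq.smooth
  sB21 := smooth_laxB21 hq.smooth
  sB22 := smooth_laxB22 hq.smooth
  e11 _ _ hx ht := (hq.zero_curvature l hx ht).1
  e12 _ _ hx ht := (hq.zero_curvature l hx ht).2.1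
  e21 _ _ hx ht := (hq.zero_curvature l hx ht).2.2.1
  e22 _ _ hx ht := (hq.zero_curvature l hx ht).2.2.2

section

variable {A11 A12 A21 A22 B11 B12 B21 B22 : ℝ → ℝ → ℂ}

lemma source_bound {α α' β β' σ σ' f g p r : ℂ} {h T M C N : ℝ} (hM0 : 0 ≤ M)
    (h1 : ‖α' - α - h * σ‖ ≤ T * h ^ 2) (h2 : ‖β' - β - h * σ'‖ ≤ T * h ^ 2)
    (k1 : ‖α' - α‖ ≤ M * |h|) (k2 : ‖β' - β‖ ≤ M * |h|)
    (hf : ‖f‖ ≤ N) (hg : ‖g‖ ≤ N) (hp : ‖p‖ ≤ C) (hr : ‖r‖ ≤ C) :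
    ‖(α' - α - h * σ) * f + (β' - β - h * σ') * g +
      h * ((α' - α) * p + (β' - β) * r)‖ ≤ (2 * T * N + 2 * M * C) * h ^ 2 := by
  have hC0 : 0 ≤ C := (norm_nonneg _).trans hp
  have hN0 : 0 ≤ N := (norm_nonneg _).trans hf
  have hT0 : 0 ≤ T * h ^ 2 := (norm_nonneg _).trans h1
  have hM' : 0 ≤ M * |h| := (norm_nonneg _).trans k1
  have e1 : ‖(α' - α - h * σ) * f‖ ≤ T * h ^ 2 * N := by rw [norm_mul]; gcongr
  have e2 : ‖(β' - β - h * σ') * g‖ ≤ T * h ^ 2 * N := by rw [norm_mul]; gcongr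
  have e3 : ‖(h : ℂ) * ((α' - α) * p + (β' - β) * r)‖ ≤ |h| * (M * |h| * C + M * |h| * C) := by
    rw [norm_mul, norm_real, Real.norm_eq_abs]
    refine mul_le_mul_of_nonneg_left ((norm_add_le _ _).trans ?_) (abs_nonneg _)
    rw [norm_mul, norm_mul]
    gcongr
  have e4 : |h| * (M * |h| * C + M * |h| * C) = 2 * M * C * h ^ 2 := by rw [← sq_abs h]; ring
  refine (norm_add_le _ _).trans ((add_le_add (norm_add_le _ _) le_rfl).trans ?_)
  linarith

lemma hasDerivWithinAt_of_bound {f : ℝ → ℂ} {f' : ℂ} {s : Set ℝ} {t : ℝ}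
    (h : ∀ ε > 0, ∀ᶠ r in 𝓝[s] t, ‖f r - f t - ((r - t : ℝ) : ℂ) * f'‖ ≤ ε * |r - t|) :
    HasDerivWithinAt f f' s t := by
  rw [hasDerivWithinAt_iff_isLittleO, Asymptotics.isLittleO_iff]
  intro ε hε
  filter_upwards [h ε hε] with r hr
  simpa [Real.norm_eq_abs, real_smul] using hr

lemma HasDerivWithinAt.exists_bound {f : ℝ → ℂ} {f' : ℂ} {s : Set ℝ} {t : ℝ}
    (h : HasDerivWithinAt f f' s t) {ε : ℝ} (hε : 0 < ε) :
    ∀ᶠ r in 𝓝[s] t, ‖f r - f t - ((r - t : ℝ) : ℂ) * f'‖ ≤ ε * |r - t| := by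
  rw [hasDerivWithinAt_iff_isLittleO, Asymptotics.isLittleO_iff] at h
  filter_upwards [h hε] with r hr
  simpa [Real.norm_eq_abs, real_smul] using hr

/-- If `F` solves the `t`-system at `x0` and the `x`-system for every `t`, it solves the `t`-system
at every `x ≥ x0`. -/
lemma ZeroCurv.flow (Z : ZeroCurv A11 A12 A21 A22 B11 B12 B21 B22) {F1 F2 : ℝ → ℝ → ℂ}
    {x0 X a b : ℝ} (hx0 : 0 < x0) (ha : 0 < a)
    (ht : LinSys (B11 x0) (B12 x0) (B21 x0) (B22 x0) (F1 x0) (F2 x0) (Icc a b))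
    (hx : ∀ t ∈ Icc a b, LinSys (A11 · t) (A12 · t) (A21 · t) (A22 · t) (F1 · t) (F2 · t)
      (Icc x0 X)) {x : ℝ} (hxX : x ∈ Icc x0 X) :
    LinSys (B11 x) (B12 x) (B21 x) (B22 x) (F1 x) (F2 x) (Icc a b) := by
  intro t htab
  have ev := fun {f : ℝ → ℝ → ℂ} (hf : SmoothQ f) =>
    hf.eventually_taylor (b := X) (d := b) hx0 ha
  obtain ⟨K, hK, k11, k12, k21, k22⟩ := ((eventually_ge_atTop 0).and ((ev Z.sA11).and
    ((ev Z.sA12).and ((ev Z.sA21).and (ev Z.sA22))))).exists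
  obtain ⟨c1, c2⟩ := (hx t htab).continuousOn
  have htp : 0 < t := ha.trans_le htab.1
  have sub : Icc x0 X ⊆ Ioi 0 := fun y hy => hx0.trans_le hy.1
  have cB : ∀ {f : ℝ → ℝ → ℂ}, SmoothQ f → ContinuousOn (fun y => f y t) (Icc x0 X) :=
    fun hf => (hf.continuousOn_x htp).mono sub
  set p₁ : ℝ → ℂ := fun y => B11 y t * F1 y t + B12 y t * F2 y t with hp1
  set p₂ : ℝ → ℂ := fun y => B21 y t * F1 y t + B22 y t * F2 y t with hp2
  have cp1 : ContinuousOn p₁ (Icc x0 X) := ((cB Z.sB11).mul c1).add ((cB Z.sB12).mul c2)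
  have cp2 : ContinuousOn p₂ (Icc x0 X) := ((cB Z.sB21).mul c1).add ((cB Z.sB22).mul c2)
  obtain ⟨C, hC1, hC2, hC3, hC4⟩ := (c1.eventually_bound.and (c2.eventually_bound.and
    (cp1.eventually_bound.and cp2.eventually_bound))).exists
  have hC0 : 0 ≤ C := (norm_nonneg _).trans (hC1 x hxX)
  set D := 2 * K * C + 2 * K * C with hD
  have hD0 : 0 ≤ D := by positivity
  set G := Real.exp (2 * K * (X - x0)) with hG
  have main : ∀ s ∈ Icc a b, ∀ ε, ‖F1 x0 s - F1 x0 t - ((s - t : ℝ) : ℂ) * p₁ x0‖ ≤ ε * |s - t| →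
      ‖F2 x0 s - F2 x0 t - ((s - t : ℝ) : ℂ) * p₂ x0‖ ≤ ε * |s - t| →
      ‖F1 x s - F1 x t - ((s - t : ℝ) : ℂ) * p₁ x‖ ≤
          (ε * |s - t| + D * (s - t) ^ 2 * (X - x0)) * G ∧
      ‖F2 x s - F2 x t - ((s - t : ℝ) : ℂ) * p₂ x‖ ≤
          (ε * |s - t| + D * (s - t) ^ 2 * (X - x0)) * G := by
    intro s hs ε hε1 hε2
    have dB : ∀ {f : ℝ → ℝ → ℂ}, SmoothQ f → ∀ y ∈ Icc x0 X,
        HasDerivWithinAt (fun y => f y t) (dx f y t) (Icc x0 X) y := fun hf y hy =>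
      (hf.hasDerivAt_x (sub hy) htp).hasDerivWithinAt
    refine gronwall2 (M := K)
      (y1 := fun y => F1 y s - F1 y t - ((s - t : ℝ) : ℂ) * p₁ y)
      (y2 := fun y => F2 y s - F2 y t - ((s - t : ℝ) : ℂ) * p₂ y)
      (a11 := (A11 · s)) (a12 := (A12 · s)) (a21 := (A21 · s)) (a22 := (A22 · s))
      (r₁ := fun y => (A11 y s - A11 y t - ((s - t : ℝ) : ℂ) * dt A11 y t) * F1 y t +
        (A12 y s - A12 y t - ((s - t : ℝ) : ℂ) * dt A12 y t) * F2 y t +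
        ((s - t : ℝ) : ℂ) * ((A11 y s - A11 y t) * p₁ y + (A12 y s - A12 y t) * p₂ y))
      (r₂ := fun y => (A21 y s - A21 y t - ((s - t : ℝ) : ℂ) * dt A21 y t) * F1 y t +
        (A22 y s - A22 y t - ((s - t : ℝ) : ℂ) * dt A22 y t) * F2 y t +
        ((s - t : ℝ) : ℂ) * ((A21 y s - A21 y t) * p₁ y + (A22 y s - A22 y t) * p₂ y))
      (fun y hy => ?_) (fun y hy => ?_) (fun y hy => ⟨(k11 y hy t htab s hs).2.2,
        (k12 y hy t htab s hs).2.2, (k21 y hy t htab s hs).2.2, (k22 y hy t htab s hs).2.2⟩)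
      (fun y hy => ⟨source_bound hK (k11 y hy t htab s hs).1 (k12 y hy t htab s hs).1
          (k11 y hy t htab s hs).2.1 (k12 y hy t htab s hs).2.1 (hC1 y hy) (hC2 y hy) (hC3 y hy)
          (hC4 y hy),
        source_bound hK (k21 y hy t htab s hs).1 (k22 y hy t htab s hs).1
          (k21 y hy t htab s hs).2.1 (k22 y hy t htab s hs).2.1 (hC1 y hy) (hC2 y hy) (hC3 y hy)
          (hC4 y hy)⟩) hε1 hε2 x hxX
    · refine (((hx s hs y hy).1.fun_sub (hx t htab y hy).1).fun_sub
        ((((dB Z.sB11 y hy).fun_mul (hx t htab y hy).1).fun_add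
          ((dB Z.sB12 y hy).fun_mul (hx t htab y hy).2)).const_mul _)).congr_deriv ?_
      rw [Z.e11 y t (sub hy) htp, Z.e12 y t (sub hy) htp]
      simp only [hp1, hp2]
      ring
    · refine (((hx s hs y hy).2.fun_sub (hx t htab y hy).2).fun_sub
        ((((dB Z.sB21 y hy).fun_mul (hx t htab y hy).1).fun_add
          ((dB Z.sB22 y hy).fun_mul (hx t htab y hy).2)).const_mul _)).congr_deriv ?_
      rw [Z.e21 y t (sub hy) htp, Z.e22 y t (sub hy) htp]
      simp only [hp1, hp2]
      ring
  have hG0 : 0 < G := Real.exp_pos _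
  have small : ∀ ε > 0, ∀ᶠ s in 𝓝[Icc a b] t, s ∈ Icc a b ∧
      ‖F1 x0 s - F1 x0 t - ((s - t : ℝ) : ℂ) * p₁ x0‖ ≤ ε / (2 * G) * |s - t| ∧
      ‖F2 x0 s - F2 x0 t - ((s - t : ℝ) : ℂ) * p₂ x0‖ ≤ ε / (2 * G) * |s - t| ∧
      (ε / (2 * G) * |s - t| + D * (s - t) ^ 2 * (X - x0)) * G ≤ ε * |s - t| := by
    intro ε hε
    have hlim : Tendsto (fun s : ℝ => D * |s - t| * (X - x0)) (𝓝[Icc a b] t) (𝓝 0) := by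
      have : Continuous (fun s : ℝ => D * |s - t| * (X - x0)) := by fun_prop
      have h := this.tendsto t
      simp only [sub_self, abs_zero, mul_zero, zero_mul] at h
      exact h.mono_left nhdsWithin_le_nhds
    filter_upwards [self_mem_nhdsWithin, (ht t htab).1.exists_bound (ε := ε / (2 * G))
      (by positivity), (ht t htab).2.exists_bound (ε := ε / (2 * G)) (by positivity),
      hlim.eventually (Iic_mem_nhds (show (0 : ℝ) < ε / (2 * G) by positivity))] with s h1 h2 h3 h4
    refine ⟨h1, h2, h3, ?_⟩
    have h5 : D * (s - t) ^ 2 * (X - x0) = D * |s - t| * (X - x0) * |s - t| := by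
      rw [← sq_abs (s - t)]; ring
    rw [h5, ← add_mul]
    calc (ε / (2 * G) + D * |s - t| * (X - x0)) * |s - t| * G
        ≤ (ε / (2 * G) + ε / (2 * G)) * |s - t| * G := by gcongr
      _ = ε * |s - t| := by field_simp; ring
  constructor
  · refine hasDerivWithinAt_of_bound fun ε hε => ?_
    filter_upwards [small ε hε] with s hs
    exact ((main s hs.1 _ hs.2.1 hs.2.2.1).1).trans hs.2.2.2
  · refine hasDerivWithinAt_of_bound fun ε hε => ?_
    filter_upwards [small ε hε] with s hs
    exact ((main s hs.1 _ hs.2.1 hs.2.2.1).2).trans hs.2.2.2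

/-- Extension of a solution of the `t`-system at `x0` to a compatible flow. -/
lemma ZeroCurv.extend_flow (Z : ZeroCurv A11 A12 A21 A22 B11 B12 B21 B22)
    {x0 X a b : ℝ} (hx0 : 0 < x0) (ha : 0 < a) (hX : x0 ≤ X) {y1 y2 : ℝ → ℂ}
    (hy : LinSys (B11 x0) (B12 x0) (B21 x0) (B22 x0) y1 y2 (Icc a b)) :
    ∃ F1 F2 : ℝ → ℝ → ℂ, (∀ t ∈ Icc a b, F1 x0 t = y1 t ∧ F2 x0 t = y2 t) ∧
      (∀ t ∈ Icc a b, LinSys (A11 · t) (A12 · t) (A21 · t) (A22 · t) (F1 · t) (F2 · t)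
        (Icc x0 X)) ∧
      ∀ x ∈ Icc x0 X, LinSys (B11 x) (B12 x) (B21 x) (B22 x) (F1 x) (F2 x) (Icc a b) := by
  have ex : ∀ t, ∃ z1 z2 : ℝ → ℂ, t ∈ Icc a b → (z1 x0 = y1 t ∧ z2 x0 = y2 t ∧
      LinSys (A11 · t) (A12 · t) (A21 · t) (A22 · t) z1 z2 (Icc x0 X)) := by
    intro t
    by_cases htab : t ∈ Icc a b
    · have cx : ∀ {f : ℝ → ℝ → ℂ}, SmoothQ f → ContinuousOn (fun y => f y t) (Icc x0 X) := fun hf =>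
        (hf.continuousOn_x (ha.trans_le htab.1)).mono fun y hy => hx0.trans_le hy.1
      obtain ⟨z1, z2, h⟩ := ContSys.exists_sol ⟨cx Z.sA11, cx Z.sA12, cx Z.sA21, cx Z.sA22⟩
        (left_mem_Icc.2 hX) (y1 t) (y2 t)
      exact ⟨z1, z2, fun _ => h⟩
    · exact ⟨0, 0, fun h => absurd h htab⟩
  choose z1 z2 hz using ex
  exact ⟨fun x t => z1 t x, fun x t => z2 t x, fun t ht => ⟨(hz t ht).1, (hz t ht).2.1⟩,
    fun t ht => (hz t ht).2.2, fun x hx => Z.flow hx0 ha (hy.congr fun r hr =>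
      ⟨(hz r hr).1.symm, (hz r hr).2.1.symm⟩) (fun t ht => (hz t ht).2.2) hx⟩

end

/-! ### The Jost solution of the GI Lax pair -/

def gaugeV (q : ℝ → ℝ → ℂ) (x t : ℝ) : ℂ :=
  -(I / 2) * conj (dx q x t) + -(1 / 4) * (q x t * conj (q x t) ^ 2)

def aknsV (q : ℝ → ℝ → ℂ) (t x : ℝ) : ℂ := gaugeV q x t

def aknsU (q : ℝ → ℝ → ℂ) (t x : ℝ) : ℂ := q x t

/-- First component of the Jost solution. -/
def giJ1 (q : ℝ → ℝ → ℂ) (l : ℂ) (x t : ℝ) : ℂ := jost1 (aknsU q t) (aknsV q t) x l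

/-- Second component of the Jost solution in the AKNS gauge. -/
def akJ2 (q : ℝ → ℝ → ℂ) (l : ℂ) (x t : ℝ) : ℂ := jost2 (aknsU q t) (aknsV q t) x l

/-- Second component of the Jost solution. -/
def giJ2 (q : ℝ → ℝ → ℂ) (l : ℂ) (x t : ℝ) : ℂ := akJ2 q l x t + I / 2 * conj (q x t) * giJ1 q l x t

section

variable {q : ℝ → ℝ → ℂ}

lemma GISol.smooth_gaugeV (hq : GISol q) : SmoothQ (gaugeV q) :=
  (SmoothQ.const_mul _ hq.smooth.dx.conjQ).add (SmoothQ.const_mul _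
    ((hq.smooth.mul (hq.smooth.conjQ.mul hq.smooth.conjQ)).congr fun x t _ _ => by ring))

lemma GISol.exists_decay (hq : GISol q) {t : ℝ} (ht : 0 < t) :
    ∃ C, 0 ≤ C ∧ Decay C (aknsU q t) ∧ Decay C (aknsV q t) ∧ Decay C (fun x => dx q x t) ∧
      Decay C (fun x => dx (dx q) x t) := by
  obtain ⟨C, hC, h⟩ := hq.decay t ht
  have hm : ∀ {f : ℝ → ℝ → ℂ}, SmoothQ f →
      AEStronglyMeasurable (fun x => f x t) (volume.restrict (Ioi 0)) := fun hf =>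
    (hf.continuousOn_x ht).aestronglyMeasurable measurableSet_Ioi
  have hle : C ≤ C + C ^ 3 := by have : 0 ≤ C ^ 3 := by positivity
                                 linarith
  refine ⟨C + C ^ 3, by positivity, ⟨hm hq.smooth, fun x hx => ?_⟩,
    ⟨hm hq.smooth_gaugeV, fun x hx => ?_⟩, ⟨hm hq.smooth.dx, fun x hx => ?_⟩,
    ⟨hm hq.smooth.dx.dx, fun x hx => ?_⟩⟩
  · exact (h x hx).1.trans (by gcongr)
  · obtain ⟨h1, h2, -⟩ := h x hx
    have hd : 1 ≤ (1 + x) ^ 2 := one_le_pow₀ (by linarith)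
    have h3 : ‖q x t‖ ≤ C := h1.trans (div_le_self hC hd)
    have n1 : ‖-(I / 2) * conj (dx q x t)‖ ≤ C / (1 + x) ^ 2 := by
      simp only [norm_mul, norm_neg, norm_div, norm_I, RCLike.norm_conj, norm_ofNat]
      linarith [norm_nonneg (dx q x t)]
    have n2 : ‖-(1 / 4) * (q x t * conj (q x t) ^ 2)‖ ≤ C ^ 3 / (1 + x) ^ 2 := by
      simp only [norm_mul, norm_neg, norm_div, norm_pow, RCLike.norm_conj, norm_ofNat, norm_one]
      have : ‖q x t‖ * ‖q x t‖ ^ 2 ≤ C / (1 + x) ^ 2 * C ^ 2 := by gcongr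
      have e : C / (1 + x) ^ 2 * C ^ 2 = C ^ 3 / (1 + x) ^ 2 := by ring
      have : 0 ≤ ‖q x t‖ * ‖q x t‖ ^ 2 := by positivity
      linarith
    calc ‖aknsV q t x‖ ≤ _ := norm_add_le _ _
      _ ≤ C / (1 + x) ^ 2 + C ^ 3 / (1 + x) ^ 2 := add_le_add n1 n2
      _ = _ := by ring
  · exact (h x hx).2.1.trans (by gcongr)
  · exact (h x hx).2.2.trans (by gcongr)

lemma GISol.continuousAt_x {f : ℝ → ℝ → ℂ} (hf : SmoothQ f) {x t : ℝ} (hx : 0 < x) (ht : 0 < t) :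
    ContinuousAt (fun y => f y t) x := (hf.hasDerivAt_x hx ht).continuousAt

lemma GISol.hasDerivAt_akns (hq : GISol q) {l : ℂ} (hl : l ∈ UHPc) {x t : ℝ} (hx : 0 < x)
    (ht : 0 < t) :
    HasDerivAt (fun y => giJ1 q l y t) (-(2 * I * l) * giJ1 q l x t + q x t * akJ2 q l x t) x ∧
    HasDerivAt (fun y => akJ2 q l y t) (gaugeV q x t * giJ1 q l x t) x := by
  obtain ⟨C, hC, hu, hv, -⟩ := hq.exists_decay ht
  exact hasDerivAt_jost hC hu hv hx hl (continuousAt_x hq.smooth hx ht)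
    (continuousAt_x hq.smooth_gaugeV hx ht)

lemma GISol.hasDerivAt_x (hq : GISol q) {l : ℂ} (hl : l ∈ UHPc) {x t : ℝ} (hx : 0 < x)
    (ht : 0 < t) :
    HasDerivAt (fun y => giJ1 q l y t)
      (laxA11 q l x t * giJ1 q l x t + laxA12 q x t * giJ2 q l x t) x ∧
    HasDerivAt (fun y => giJ2 q l y t)
      (laxA21 q l x t * giJ1 q l x t + laxA22 q x t * giJ2 q l x t) x := by
  obtain ⟨h1, h2⟩ := hq.hasDerivAt_akns hl hx ht
  have I2 : I ^ 2 = -1 := I_sq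
  have I3 : I ^ 3 = -I := by rw [pow_succ, I2]; ring
  constructor
  · refine h1.congr_deriv ?_
    simp only [laxA11, laxA12, giJ2]; ring
  · refine (h2.fun_add ((((hq.smooth.hasDerivAt_x hx ht).conjC).const_mul
      (I / 2)).fun_mul h1)).congr_deriv ?_
    simp only [laxA21, laxA22, giJ2, gaugeV]
    ring_nf
    simp only [I2]
    ring

/-- Bounds for the Jost solution, uniform in `l`. -/
lemma GISol.jost_bound (hq : GISol q) {t : ℝ} (ht : 0 < t) :
    ∃ C, 0 ≤ C ∧ ∀ x, 0 < x → ∀ l ∈ UHPc, ‖giJ1 q l x t‖ ≤ C / (1 + x) ∧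
      ‖akJ2 q l x t - 1‖ ≤ C / (1 + x) ∧ ‖giJ2 q l x t - 1‖ ≤ C / (1 + x) := by
  obtain ⟨C, hC, hu, hv, -⟩ := hq.exists_decay ht
  refine ⟨Real.exp C + C * Real.exp C, by positivity, fun x hx l hl => ?_⟩
  obtain ⟨h1, h2⟩ := _root_.jost_bound hC hu hv hx.le hl
  have hq1 : ‖q x t‖ ≤ C := (hu.bound x hx).trans (div_le_self hC (one_le_pow₀ (by linarith)))
  have hle : Real.exp C / (1 + x) ≤ (Real.exp C + C * Real.exp C) / (1 + x) := by
    gcongr; have : 0 ≤ C * Real.exp C := by positivity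
    linarith
  refine ⟨h1.trans hle, h2.trans hle, ?_⟩
  have e : giJ2 q l x t - 1 = (akJ2 q l x t - 1) +
    I / 2 * conj (q x t) * giJ1 q l x t := by simp only [giJ2]; ring
  have n1 : ‖I / 2 * conj (q x t) * giJ1 q l x t‖ ≤ C * (Real.exp C / (1 + x)) := by
    simp only [norm_mul, norm_div, norm_I, RCLike.norm_conj, norm_ofNat]
    have : 1 / 2 * ‖q x t‖ ≤ C := by linarith [norm_nonneg (q x t)]
    exact mul_le_mul this h1 (norm_nonneg _) hC
  rw [e]
  refine (norm_add_le _ _).trans ((add_le_add h2 n1).trans_eq ?_)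
  ring

lemma GISol.tendsto_jost (hq : GISol q) {t : ℝ} (ht : 0 < t) {l : ℂ} (hl : l ∈ UHPc) :
    Tendsto (fun x => giJ1 q l x t) atTop (𝓝 0) ∧
    Tendsto (fun x => giJ2 q l x t) atTop (𝓝 1) := by
  obtain ⟨C, hC, h⟩ := hq.jost_bound ht
  have hlim : Tendsto (fun x : ℝ => C / (1 + x)) atTop (𝓝 0) :=
    tendsto_const_nhds.div_atTop (tendsto_atTop_add_const_left _ _ tendsto_id)
  constructor
  · rw [tendsto_zero_iff_norm_tendsto_zero]
    refine squeeze_zero' (Eventually.of_forall fun _ => norm_nonneg _) ?_ hlim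
    filter_upwards [eventually_gt_atTop 0] with x hx using (h x hx l hl).1
  · rw [tendsto_iff_norm_sub_tendsto_zero]
    refine squeeze_zero' (Eventually.of_forall fun _ => norm_nonneg _) ?_ hlim
    filter_upwards [eventually_gt_atTop 0] with x hx using (h x hx l hl).2.2

lemma GISol.jost_regular (hq : GISol q) {x t : ℝ} (hx : 0 < x) (ht : 0 < t) :
    ContinuousOn (fun l => giJ1 q l x t) UHPc ∧ ContinuousOn (fun l => giJ2 q l x t) UHPc ∧
    DifferentiableOn ℂ (fun l => giJ1 q l x t) UHP ∧
    DifferentiableOn ℂ (fun l => giJ2 q l x t) UHP := by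
  obtain ⟨C, hC, hu, hv, -⟩ := hq.exists_decay ht
  obtain ⟨h1, h2⟩ := jost_reg hC hu hv
  refine ⟨h1.contl x hx.le, (h2.contl x hx.le).add (continuousOn_const.mul (h1.contl x hx.le)),
    h1.diffl x hx.le, (h2.diffl x hx.le).add ((h1.diffl x hx.le).const_mul _)⟩

/-- Conservation law on the real axis. -/
lemma GISol.jost_real (hq : GISol q) {x t : ℝ} (hx : 0 < x) (ht : 0 < t) (l : ℝ) :
    ‖giJ2 q l x t‖ ^ 2 - l * ‖giJ1 q l x t‖ ^ 2 = 1 := by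
  have hl : (l : ℂ) ∈ UHPc := by simp [UHPc]
  set E : ℝ → ℝ := fun y => ‖giJ2 q l y t‖ ^ 2 - l * ‖giJ1 q l y t‖ ^ 2 with hE
  have hd : ∀ y, 0 < y → HasDerivAt E 0 y := by
    intro y hy
    obtain ⟨h1, h2⟩ := hq.hasDerivAt_x hl hy ht
    refine ((hasDerivAt_norm_sq h2).fun_sub ((hasDerivAt_norm_sq h1).const_mul l)).congr_deriv ?_
    simp only [laxA11, laxA12, laxA21, laxA22]
    generalize giJ1 q l y t = a
    generalize giJ2 q l y t = b
    generalize q y t = c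
    simp only [add_re, neg_re, mul_re, I_re, I_im, ofReal_re, ofReal_im, re_ofNat, im_ofNat, mul_im,
        neg_im, div_ofNat_re, div_ofNat_im, add_im,
        Complex.conj_re, Complex.conj_im]
    ring
  have hcst : ∀ y, x ≤ y → E y = E x := by
    intro y hxy
    exact (constant_of_derivWithin_zero (a := x) (b := y)
      (fun z hz => (hd z (hx.trans_le hz.1)).differentiableAt.differentiableWithinAt)
      (fun z hz => by
        have hz' : z ∈ Icc x y := Ico_subset_Icc_self hz
        exact ((hd z (hx.trans_le hz.1)).hasDerivWithinAt).derivWithin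
          (uniqueDiffOn_Icc (hz.1.trans_lt hz.2) z hz')) y ⟨hxy, le_rfl⟩)
  obtain ⟨ti, t2⟩ := hq.tendsto_jost ht hl
  have h3 : Tendsto E atTop (𝓝 (‖(1 : ℂ)‖ ^ 2 - l * ‖(0 : ℂ)‖ ^ 2)) :=
    (t2.norm.pow 2).sub ((ti.norm.pow 2).const_mul l)
  have h4 : Tendsto E atTop (𝓝 (E x)) := tendsto_const_nhds.congr' (by
    filter_upwards [eventually_ge_atTop x] with y hy using (hcst y hy).symm)
  have := tendsto_nhds_unique h4 h3
  simpa [hE] using this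

/-- The coefficients of the `t`-part of the Lax pair in terms of the Dirichlet and Neumann values. -/
def bdB22 (l u w : ℂ) : ℂ := I * l * (u * conj u) + -(1 / 2) * (w * conj u + -1 * (u * conj w)) +
    -(I / 4) * ((u * conj u) * (u * conj u))

def bdB11 (l u w : ℂ) : ℂ := -(4 * I * l ^ 2) + -1 * bdB22 l u w

def bdB12 (l u w : ℂ) : ℂ := 2 * l * u + I * w

def bdB21 (l u w : ℂ) : ℂ := 2 * l ^ 2 * conj u + -(I * l) * conj w

lemma ContinuousOn.bdB {X : Type*} [TopologicalSpace X] {s : Set X} {l u w : X → ℂ}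
    (hl : ContinuousOn l s) (hu : ContinuousOn u s) (hw : ContinuousOn w s) :
    ContinuousOn (fun p => bdB11 (l p) (u p) (w p)) s ∧
    ContinuousOn (fun p => bdB12 (l p) (u p) (w p)) s ∧
    ContinuousOn (fun p => bdB21 (l p) (u p) (w p)) s ∧
    ContinuousOn (fun p => bdB22 (l p) (u p) (w p)) s := by
  have h3 : ContinuousOn (fun p => conj (u p)) s := continuous_conj.comp_continuousOn hu
  have h4 : ContinuousOn (fun p => conj (w p)) s := continuous_conj.comp_continuousOn hw
  simp only [bdB11, bdB12, bdB21, bdB22]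
  refine ⟨?_, ?_, ?_, ?_⟩ <;> fun_prop

lemma contOn_B (hs : SmoothQ q) (l : ℂ) {x a b : ℝ} (hx : 0 < x) (ha : 0 < a) :
    ContSys (laxB11 q l x) (laxB12 q l x) (laxB21 q l x) (laxB22 q l x) (Icc a b) := by
  have c := fun {f : ℝ → ℝ → ℂ} (hf : SmoothQ f) =>
    (hf.continuousOn_t hx).mono fun t (ht : t ∈ Icc a b) => ha.trans_le ht.1
  exact ⟨c (smooth_laxB11 hs), c (smooth_laxB12 hs), c (smooth_laxB21 hs), c (smooth_laxB22 hs)⟩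

lemma contOn_A (hs : SmoothQ q) (l : ℂ) {t a b : ℝ} (ht : 0 < t) (ha : 0 < a) :
    ContSys (laxA11 q l · t) (laxA12 q · t) (laxA21 q l · t) (laxA22 q · t) (Icc a b) := by
  have c := fun {f : ℝ → ℝ → ℂ} (hf : SmoothQ f) =>
    (hf.continuousOn_x ht).mono fun t (ht : t ∈ Icc a b) => ha.trans_le ht.1
  exact ⟨c (smooth_laxA11 hs), c (smooth_laxA12 hs), c (smooth_laxA21 hs), c (smooth_laxA22 hs)⟩

lemma GISol.jost_within (hq : GISol q) {l : ℂ} (hl : l ∈ UHPc) {t a b : ℝ} (ht : 0 < t)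
    (ha : 0 < a) : LinSys (laxA11 q l · t) (laxA12 q · t) (laxA21 q l · t) (laxA22 q · t)
      (giJ1 q l · t) (giJ2 q l · t) (Icc a b) := fun _ hx =>
  ⟨(hq.hasDerivAt_x hl (ha.trans_le hx.1) ht).1.hasDerivWithinAt,
    (hq.hasDerivAt_x hl (ha.trans_le hx.1) ht).2.hasDerivWithinAt⟩

lemma GISol.jost_ne_zero (hq : GISol q) {l : ℂ} (hl : l ∈ UHPc) {x t : ℝ} (hx : 0 < x)
    (ht : 0 < t) : ¬ (giJ1 q l x t = 0 ∧ giJ2 q l x t = 0) := by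
  rintro ⟨h1, h2⟩
  obtain ⟨ti, t2⟩ := hq.tendsto_jost ht hl
  have hz : ∀ y, x ≤ y → giJ2 q l y t = 0 := fun y hxy =>
    (LinSys.unique (z1 := fun _ => 0) (z2 := fun _ => 0) (contOn_A hq.smooth l ht hx) (hq.jost_within hl ht hx)
      (fun r _ => by simpa using hasDerivWithinAt_const r _ (0 : ℂ)) h1 h2 y ⟨hxy, le_rfl⟩).2
  have : Tendsto (fun x => giJ2 q l x t) atTop (𝓝 0) := tendsto_const_nhds.congr' (by
    filter_upwards [eventually_ge_atTop x] with y hy using (hz y hy).symm)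
  exact one_ne_zero (tendsto_nhds_unique t2 this)

/-- Mass on `[x, ∞)`. -/
def tailMass (q : ℝ → ℝ → ℂ) (x t : ℝ) : ℝ := ∫ y in Ioi x, ‖q y t‖ ^ 2

lemma GISol.integrable_mass (hq : GISol q) {x t : ℝ} (hx : 0 ≤ x) (ht : 0 < t) :
    IntegrableOn (fun y => ‖q y t‖ ^ 2) (Ioi x) := by
  obtain ⟨C, hC, hu, -⟩ := hq.exists_decay ht
  have h1 := (hu.integrableOn hC hx).norm
  refine (h1.const_mul C).mono' (h1.aestronglyMeasurable.pow 2) ?_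
  filter_upwards [self_mem_ae_restrict measurableSet_Ioi] with y hy
  have hy0 : 0 < y := hx.trans_lt hy
  have : ‖q y t‖ ≤ C := (hu.bound y hy0).trans (div_le_self hC (one_le_pow₀ (by linarith)))
  simp only [aknsU, Real.norm_eq_abs, abs_pow, abs_norm]
  nlinarith [norm_nonneg (q y t)]

lemma tailMass_nonneg (q : ℝ → ℝ → ℂ) (x t : ℝ) : 0 ≤ tailMass q x t :=
  integral_nonneg fun _ => by positivity

lemma GISol.tailMass_sub (hq : GISol q) {x y t : ℝ} (hx : 0 ≤ x) (hxy : x ≤ y) (ht : 0 < t) :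
    tailMass q x t = (∫ z in x..y, ‖q z t‖ ^ 2) + tailMass q y t := by
  have h1 := hq.integrable_mass hx ht
  rw [tailMass, tailMass, integral_of_le hxy, ← Ioc_union_Ioi_eq_Ioi hxy,
    setIntegral_union (Ioc_disjoint_Ioi le_rfl) measurableSet_Ioi
      (h1.mono_set Ioc_subset_Ioi_self) (h1.mono_set (Ioi_subset_Ioi hxy))]

lemma GISol.tendsto_tailMass (hq : GISol q) {t : ℝ} (ht : 0 < t) :
    Tendsto (fun x => tailMass q x t) atTop (𝓝 0) := by
  have h1 := hq.integrable_mass le_rfl ht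
  have h2 := intervalIntegral_tendsto_integral_Ioi 0 h1 tendsto_id
  have h3 : Tendsto (fun x => tailMass q 0 t - ∫ z in (0 : ℝ)..x, ‖q z t‖ ^ 2) atTop
      (𝓝 (tailMass q 0 t - tailMass q 0 t)) := tendsto_const_nhds.sub h2
  rw [sub_self] at h3
  refine h3.congr' ?_
  filter_upwards [eventually_ge_atTop 0] with x hx
  rw [hq.tailMass_sub le_rfl hx ht]; ring

/-- Energy estimate of the Jost solution by the mass. -/
lemma GISol.jost_energy (hq : GISol q) {l : ℂ} (hl : l ∈ UHP) {x t : ℝ} (hx : 0 < x)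
    (ht : 0 < t) : ‖giJ2 q l x t‖ ^ 2 + ‖l‖ * ‖giJ1 q l x t‖ ^ 2 ≤
      Real.exp (‖l‖ / l.im * tailMass q x t) := by
  have hl' := UHP_subset hl
  have him : 0 < l.im := hl
  obtain ⟨ti, t2⟩ := hq.tendsto_jost ht hl'
  have h3 : Tendsto (fun X => (‖giJ2 q l X t‖ ^ 2 + ‖l‖ * ‖giJ1 q l X t‖ ^ 2) *
      Real.exp (‖l‖ / l.im * tailMass q x t)) atTop (𝓝 ((‖(1 : ℂ)‖ ^ 2 + ‖l‖ * ‖(0 : ℂ)‖ ^ 2) *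
      Real.exp (‖l‖ / l.im * tailMass q x t))) :=
    ((t2.norm.pow 2).add ((ti.norm.pow 2).const_mul ‖l‖)).mul_const _
  simp only [norm_one, norm_zero, one_pow, ne_eq, OfNat.ofNat_ne_zero, not_false_eq_true, zero_pow,
    mul_zero, add_zero, one_mul] at h3
  refine ge_of_tendsto h3 ?_
  filter_upwards [eventually_ge_atTop x] with X hX
  have sub : Icc x X ⊆ Ioi 0 := fun y hy => hx.trans_le hy.1
  have := energy_backward (qf := fun x => q x t) hX hl ((hq.smooth.continuousOn_x ht).mono sub)
    (fun y hy => (hq.hasDerivAt_x hl' (sub hy) ht).1.continuousAt.continuousWithinAt)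
    (fun y hy => (hq.hasDerivAt_x hl' (sub hy) ht).2.continuousAt.continuousWithinAt)
    (fun y hy => (hq.hasDerivAt_x hl' (sub (Ioo_subset_Icc_self hy)) ht).1)
    (fun y hy => (hq.hasDerivAt_x hl' (sub (Ioo_subset_Icc_self hy)) ht).2)
  refine this.trans ?_
  have h4 : ∫ y in x..X, ‖q y t‖ ^ 2 ≤ tailMass q x t := by
    rw [hq.tailMass_sub hx.le hX ht]; linarith [tailMass_nonneg q X t]
  gcongr

end

/-! ### Balance laws and the virial estimate -/

lemma swap_of_continuousOn {E : Type*} [NormedAddCommGroup E] [NormedSpace ℝ E]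
    {F : ℝ → ℝ → E} {a b c d : ℝ} (hab : a ≤ b) (hcd : c ≤ d)
    (hF : ContinuousOn (fun p : ℝ × ℝ => F p.1 p.2) (Icc a b ×ˢ Icc c d)) :
    ∫ x in a..b, ∫ r in c..d, F x r = ∫ r in c..d, ∫ x in a..b, F x r := by
  refine MeasureTheory.intervalIntegral_intervalIntegral_swap ?_
  rw [uIoc_of_le hab, uIoc_of_le hcd]
  exact (hF.integrableOn_compact (isCompact_Icc.prod isCompact_Icc)).mono_set
    (prod_mono Ioc_subset_Icc_self Ioc_subset_Icc_self)

lemma continuousOn_integral_of_continuousOn {E : Type*} [NormedAddCommGroup E] [NormedSpace ℝ E]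
    {F : ℝ → ℝ → E} {a b c d : ℝ} (hcd : c ≤ d)
    (hF : ContinuousOn (fun p : ℝ × ℝ => F p.1 p.2) (Icc a b ×ˢ Icc c d)) :
    ContinuousOn (fun x => ∫ r in c..d, F x r) (Icc a b) := by
  obtain ⟨C, hC⟩ := (isCompact_Icc.prod isCompact_Icc).exists_bound_of_continuousOn hF
  have : ∀ x ∈ Icc a b, ContinuousWithinAt (fun x => ∫ r in c..d, F x r) (Icc a b) x := by
    intro x hx
    refine intervalIntegral.continuousWithinAt_of_dominated_interval (bound := fun _ => C) ?_ ?_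
      (by simp) ?_
    · filter_upwards [self_mem_nhdsWithin] with y hy
      rw [uIoc_of_le hcd]
      refine (ContinuousOn.aestronglyMeasurable (f := fun r => F y r) ?_ measurableSet_Ioc)
      exact hF.comp (f := fun r => (y, r)) (by fun_prop) fun r hr => ⟨hy, Ioc_subset_Icc_self hr⟩
    · filter_upwards [self_mem_nhdsWithin] with y hy
      refine Eventually.of_forall fun r hr => ?_
      rw [uIoc_of_le hcd] at hr
      exact hC (y, r) ⟨hy, Ioc_subset_Icc_self hr⟩
    · refine Eventually.of_forall fun r hr => ?_
      rw [uIoc_of_le hcd] at hr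
      exact (hF (x, r) ⟨hx, Ioc_subset_Icc_self hr⟩).comp (f := fun y => (y, r)) (by fun_prop)
        fun y hy => ⟨hy, Ioc_subset_Icc_self hr⟩
  exact this

lemma rect_subset_quadrant {a b c d : ℝ} (ha : 0 < a) (hc : 0 < c) :
    Icc a b ×ˢ Icc c d ⊆ Quadrant :=
  fun _ hp => ⟨ha.trans_le hp.1.1, hc.trans_le hp.2.1⟩

/-- Integrated form of a conservation law, against a weight. -/
lemma balance_law {f Φ : ℝ → ℝ → ℂ} (hf : SmoothQ f) (hΦ : SmoothQ Φ)
    (h : ∀ x t, 0 < x → 0 < t → dt f x t = -dx Φ x t) {w w' : ℝ → ℝ}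
    (hw : ∀ x, HasDerivAt w (w' x) x) (hw' : Continuous w') {a b s t : ℝ} (ha : 0 < a) (hab : a ≤ b)
    (hs : 0 < s) (hst : s ≤ t) :
    (∫ x in a..b, (w x : ℂ) * f x t) - ∫ x in a..b, (w x : ℂ) * f x s =
      ∫ r in s..t, ((w a : ℂ) * Φ a r - w b * Φ b r + ∫ x in a..b, (w' x : ℂ) * Φ x r) := by
  have ht : 0 < t := hs.trans_le hst
  have hwc : Continuous w := continuous_iff_continuousAt.2 fun x => (hw x).continuousAt
  have subx : uIcc a b ⊆ Ioi 0 := by rw [uIcc_of_le hab]; exact fun y hy => ha.trans_le hy.1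
  have subt : uIcc s t ⊆ Ioi 0 := by rw [uIcc_of_le hst]; exact fun y hy => hs.trans_le hy.1
  have cx : ∀ {g : ℝ → ℝ → ℂ}, SmoothQ g → ∀ r, 0 < r → ContinuousOn (fun x => g x r) (uIcc a b) :=
    fun hg r hr => (hg.continuousOn_x hr).mono subx
  have wc : Continuous fun x => (w x : ℂ) := continuous_ofReal.comp hwc
  have wc' : Continuous fun x => (w' x : ℂ) := continuous_ofReal.comp hw'
  have i1 : ∀ r, 0 < r → IntervalIntegrable (fun x => (w x : ℂ) * f x r) volume a b := fun r hr =>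
    (wc.continuousOn.mul (cx hf r hr)).intervalIntegrable
  rw [← intervalIntegral.integral_sub (i1 t ht) (i1 s hs)]
  have e1 : ∫ x in a..b, ((w x : ℂ) * f x t - w x * f x s) =
      ∫ x in a..b, ∫ r in s..t, -((w x : ℂ) * dx Φ x r) := by
    refine integral_congr fun x hx => ?_
    have hxo : 0 < x := subx hx
    have := integral_eq_sub_of_hasDerivAt (f := fun r => f x r)
      (f' := fun r => -dx Φ x r) (a := s) (b := t)
      (fun r hr => (hf.hasDerivAt_t hxo (subt hr)).congr_deriv (h x r hxo (subt hr)))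
      (((hΦ.dx.continuousOn_t hxo).mono subt).neg.intervalIntegrable)
    rw [← mul_sub, ← this, ← intervalIntegral.integral_const_mul]
    refine integral_congr fun r _ => ?_
    ring
  rw [e1, swap_of_continuousOn hab hst]
  · refine integral_congr fun r hr => ?_
    have hr0 : 0 < r := subt hr
    have ibp := intervalIntegral.integral_mul_deriv_eq_deriv_mul (a := a) (b := b)
      (u := fun x => (w x : ℂ)) (u' := fun x => (w' x : ℂ)) (v := fun x => Φ x r)
      (v' := fun x => dx Φ x r) (fun x _ => (hw x).ofReal_comp)
      (fun x hx => hΦ.hasDerivAt_x (subx hx) hr0) (wc'.intervalIntegrable _ _)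
      ((cx hΦ.dx r hr0).intervalIntegrable)
    simp only [intervalIntegral.integral_neg]
    rw [ibp]; ring
  · exact ((wc.comp continuous_fst).continuousOn.mul
      (hΦ.dx.continuousOn.mono (rect_subset_quadrant ha hs))).neg

section densities

variable (q : ℝ → ℝ → ℂ)

def rhoC (x t : ℝ) : ℂ := q x t * conj (q x t)

def momC (x t : ℝ) : ℂ := -(I / 2) * (dx q x t * conj (q x t) + -1 * (q x t * conj (dx q x t)))

/-- Mass flux. -/
def massFlux (x t : ℝ) : ℂ := 2 * momC q x t + 1 / 2 * (rhoC q x t * rhoC q x t)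

/-- Momentum density. -/
def momDensity (x t : ℝ) : ℂ := momC q x t + 1 / 2 * (rhoC q x t * rhoC q x t)

/-- Momentum flux. -/
def momFlux (x t : ℝ) : ℂ :=
  2 * (dx q x t * conj (dx q x t)) + rhoC q x t * momC q x t + -(1 / 2) * dx (dx (rhoC q)) x t

end densities

section

variable {q : ℝ → ℝ → ℂ}

lemma smooth_rhoC (hq : SmoothQ q) : SmoothQ (rhoC q) := hq.mul hq.conjQ

lemma smooth_momC (hq : SmoothQ q) : SmoothQ (momC q) :=
  SmoothQ.const_mul _ ((hq.dx.mul hq.conjQ).add (SmoothQ.const_mul _ (hq.mul hq.dx.conjQ)))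

lemma smooth_massFlux (hq : SmoothQ q) : SmoothQ (massFlux q) :=
  (SmoothQ.const_mul _ (smooth_momC hq)).add
    (SmoothQ.const_mul _ ((smooth_rhoC hq).mul (smooth_rhoC hq)))

lemma smooth_momDensity (hq : SmoothQ q) : SmoothQ (momDensity q) :=
  (smooth_momC hq).add (SmoothQ.const_mul _ ((smooth_rhoC hq).mul (smooth_rhoC hq)))

lemma smooth_momFlux (hq : SmoothQ q) : SmoothQ (momFlux q) :=
  ((SmoothQ.const_mul _ (hq.dx.mul hq.dx.conjQ)).add ((smooth_rhoC hq).mul (smooth_momC hq))).add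
    (SmoothQ.const_mul _ (smooth_rhoC hq).dx.dx)

lemma rhoC_eq (x t : ℝ) : rhoC q x t = ((‖q x t‖ ^ 2 : ℝ) : ℂ) := by
  rw [rhoC, mul_conj, normSq_eq_norm_sq]

lemma momC_eq (x t : ℝ) : momC q x t = ((conj (q x t) * dx q x t).im : ℂ) := by
  apply Complex.ext
  · simp [momC]; ring
  · simp [momC]; ring

lemma GISol.conj_eq (hq : GISol q) {x t : ℝ} (hx : 0 < x) (ht : 0 < t) :
    conj (dt q x t) = -I * (conj (dx (dx q) x t) -
      I * conj (q x t) ^ 2 * dx q x t + 1 / 2 * (conj (q x t) ^ 3 * q x t ^ 2)) := by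
  rw [hq.eq x t hx ht]; simp [conj_ofNat]; ring

lemma GISol.mass_law (hq : GISol q) (x t : ℝ) (hx : 0 < x) (ht : 0 < t) :
    dt (rhoC q) x t = -dx (massFlux q) x t := by
  have hs := hq.smooth
  have et := hq.eq x t hx ht
  have ect := hq.conj_eq hx ht
  have dqt := hs.hasDerivAt_t hx ht
  have dqx := hs.hasDerivAt_x hx ht
  have dqxx := hs.dx.hasDerivAt_x hx ht
  have I2 : I ^ 2 = -1 := I_sq
  have hρt : dt (rhoC q) x t = _ := (dqt.fun_mul dqt.conjC).deriv
  have hρx := dqx.fun_mul dqx.conjC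
  have hm := ((dqxx.fun_mul dqx.conjC).fun_add
    ((dqx.fun_mul dqxx.conjC).const_mul (-1))).const_mul (-(I / 2))
  have hF : dx (massFlux q) x t = _ :=
    ((hm.const_mul 2).fun_add ((hρx.fun_mul hρx).const_mul (1 / 2))).deriv
  rw [hρt, hF, ect, et]
  generalize q x t = a
  generalize conj a = b
  generalize dx q x t = ai
  generalize conj ai = b1
  generalize dx (dx q) x t = aj
  generalize conj aj = b2
  ring_nf
  simp only [I2]
  ring

lemma GISol.dt_dx (hq : GISol q) {x t : ℝ} (hx : 0 < x) (ht : 0 < t) :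
    dt (dx q) x t = I * (dx (dx (dx q)) x t + I * (2 * q x t * dx q x t *
      conj (dx q x t) + q x t ^ 2 * conj (dx (dx q) x t)) + 1 / 2 * (3 * q x t ^ 2 * dx q x t *
      conj (q x t) ^ 2 + q x t ^ 3 * (2 * conj (q x t) * conj (dx q x t)))) := by
  have hs := hq.smooth
  have dqx := hs.hasDerivAt_x hx ht
  have dqxx := hs.dx.hasDerivAt_x hx ht
  have dqxxx := hs.dx.dx.hasDerivAt_x hx ht
  rw [← dx_dt_comm hs hx ht]
  have h1 := ((dqxxx.fun_add (((dqx.fun_pow 2).const_mul I).fun_mul dqxx.conjC)).fun_add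
    (((dqx.fun_pow 3).fun_mul (dqx.conjC.fun_pow 2)).const_mul (1 / 2))).const_mul I
  have h2 := h1.congr_of_eventuallyEq (f₁ := fun y => dt q y t) (by
    filter_upwards [Ioi_mem_nhds hx] with y hy using hq.eq y t hy ht)
  have h3 : dx (dt q) x t = _ := h2.deriv
  rw [h3]
  simp
  ring

lemma GISol.momentum_law (hq : GISol q) (x t : ℝ) (hx : 0 < x) (ht : 0 < t) :
    dt (momDensity q) x t = -dx (momFlux q) x t := by
  have hs := hq.smooth
  have et := hq.eq x t hx ht
  have ect := hq.conj_eq hx ht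
  have ext := hq.dt_dx hx ht
  have ectx : conj (dt (dx q) x t) = -I * (conj (dx (dx (dx q)) x t) - I * (2 *
      conj (q x t) * conj (dx q x t) * dx q x t + conj (q x t) ^ 2 * dx (dx q) x t) +
      1 / 2 * (3 * conj (q x t) ^ 2 * conj (dx q x t) * q x t ^ 2 + conj (q x t) ^ 3 *
      (2 * q x t * dx q x t))) := by
    rw [ext]; simp [conj_ofNat]; ring
  have dqt := hs.hasDerivAt_t hx ht
  have dqxt := hs.dx.hasDerivAt_t hx ht
  have dqx := hs.hasDerivAt_x hx ht
  have dqxx := hs.dx.hasDerivAt_x hx ht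
  have dqxxx := hs.dx.dx.hasDerivAt_x hx ht
  have I2 : I ^ 2 = -1 := I_sq
  have I3 : I ^ 3 = -I := by rw [pow_succ, I2]; ring
  have hρt := dqt.fun_mul dqt.conjC
  have hρx := dqx.fun_mul dqx.conjC
  have hm := ((dqxx.fun_mul dqx.conjC).fun_add
    ((dqx.fun_mul dqxx.conjC).const_mul (-1))).const_mul (-(I / 2))
  have hmt := ((dqxt.fun_mul dqt.conjC).fun_add
    ((dqt.fun_mul dqxt.conjC).const_mul (-1))).const_mul (-(I / 2))
  have e1 : ∀ y, 0 < y → dx (rhoC q) y t = dx q y t * conj (q y t) + q y t * conj (dx q y t) :=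
    fun y hy => ((hs.hasDerivAt_x hy ht).fun_mul (hs.hasDerivAt_x hy ht).conjC).deriv
  have e2 : ∀ y, 0 < y → dx (dx (rhoC q)) y t = dx (dx q) y t * conj (q y t) +
      dx q y t * conj (dx q y t) + (dx q y t * conj (dx q y t) +
      q y t * conj (dx (dx q) y t)) := by
    intro y hy
    have d1 := hs.hasDerivAt_x hy ht
    have d2 := hs.dx.hasDerivAt_x hy ht
    exact (((d2.fun_mul d1.conjC).fun_add (d1.fun_mul d2.conjC)).congr_of_eventuallyEq (by
      filter_upwards [Ioi_mem_nhds hy] with z hz using e1 z hz)).deriv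
  have e3 := ((dqxxx.fun_mul dqx.conjC).fun_add (dqxx.fun_mul dqxx.conjC)).fun_add
      ((dqxx.fun_mul dqxx.conjC).fun_add (dqx.fun_mul dqxxx.conjC))
  have e4 := e3.congr_of_eventuallyEq (f₁ := fun y => dx (dx (rhoC q)) y t) (by
      filter_upwards [Ioi_mem_nhds hx] with z hz using e2 z hz)
  have hF : dx (momFlux q) x t = _ :=
    ((((dqxx.fun_mul dqxx.conjC).const_mul 2).fun_add (hρx.fun_mul hm)).fun_add
      (e4.const_mul (-(1 / 2)))).deriv
  have hP : dt (momDensity q) x t = _ := (hmt.fun_add ((hρt.fun_mul hρt).const_mul (1 / 2))).deriv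
  rw [hP, hF, ectx, ext, ect, et]
  generalize q x t = a
  generalize conj a = b
  generalize dx q x t = ai
  generalize conj ai = b1
  generalize dx (dx q) x t = aj
  generalize conj aj = b2
  generalize dx (dx (dx q)) x t = a3
  generalize conj a3 = b3
  ring_nf
  simp only [I2, I3]
  ring

end

/-- Cauchy–Schwarz inequality for interval integrals of continuous functions. -/
lemma sq_integral_mul_le {f g : ℝ → ℝ} {a b : ℝ} (hab : a ≤ b) (hf : ContinuousOn f (Icc a b))
    (hg : ContinuousOn g (Icc a b)) :
    (∫ x in a..b, f x * g x) ^ 2 ≤ (∫ x in a..b, f x ^ 2) * ∫ x in a..b, g x ^ 2 := by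
  rw [← uIcc_of_le hab] at hf hg
  have i1 : IntervalIntegrable (fun x => f x ^ 2) volume a b := (hf.pow 2).intervalIntegrable
  have i2 : IntervalIntegrable (fun x => f x * g x) volume a b := (hf.mul hg).intervalIntegrable
  have i3 : IntervalIntegrable (fun x => g x ^ 2) volume a b := (hg.pow 2).intervalIntegrable
  have key : ∀ η : ℝ, 0 ≤ (∫ x in a..b, f x ^ 2) * (η * η) + (-2 * ∫ x in a..b, f x * g x) * η +
      ∫ x in a..b, g x ^ 2 := by
    intro η
    have h : 0 ≤ ∫ x in a..b, (η * f x - g x) ^ 2 :=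
      intervalIntegral.integral_nonneg hab fun x _ => sq_nonneg _
    have e : ∫ x in a..b, (η * f x - g x) ^ 2 =
        ∫ x in a..b, (η ^ 2 * f x ^ 2 - 2 * η * (f x * g x) + g x ^ 2) :=
      integral_congr fun x _ => by ring
    rw [e, intervalIntegral.integral_add ((i1.const_mul _).sub (i2.const_mul _)) i3,
      intervalIntegral.integral_sub (i1.const_mul _) (i2.const_mul _),
      intervalIntegral.integral_const_mul, intervalIntegral.integral_const_mul] at h
    linarith
  have := discrim_le_zero key
  rw [discrim] at this
  linarith

/-- The localized Gagliardo–Nirenberg inequality. -/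
lemma local_gagliardo {f f' : ℝ → ℂ} {χ χ' : ℝ → ℝ} {a b ε κ : ℝ} (hab : a ≤ b)
    (hf : ∀ x ∈ Icc a b, HasDerivAt f (f' x) x) (hf' : ContinuousOn f' (Icc a b))
    (hχ : ∀ x, HasDerivAt χ (χ' x) x) (hχ' : Continuous χ') (ha : χ a = 0)
    (hχ0 : ∀ x ∈ Icc a b, 0 ≤ χ x) (hκ : ∀ x ∈ Icc a b, |χ' x| ≤ κ)
    (hε : ∫ x in a..b, ‖f x‖ ^ 2 ≤ ε) :
    ∫ x in a..b, χ x ^ 2 * ‖f x‖ ^ 6 ≤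
      8 * ε ^ 2 * (∫ x in a..b, χ x ^ 2 * ‖f' x‖ ^ 2) + 2 * κ ^ 2 * ε ^ 3 := by
  have hfc : ContinuousOn f (Icc a b) := fun x hx => (hf x hx).continuousAt.continuousWithinAt
  have hχc : Continuous χ := continuous_iff_continuousAt.2 fun x => (hχ x).continuousAt
  have hε0 : 0 ≤ ε := (intervalIntegral.integral_nonneg hab fun x _ => by positivity).trans hε
  have hκ0 : 0 ≤ κ := (abs_nonneg _).trans (hκ a (left_mem_Icc.2 hab))
  set S := ∫ x in a..b, χ x ^ 2 * ‖f' x‖ ^ 2 with hS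
  have hS0 : 0 ≤ S := intervalIntegral.integral_nonneg hab fun x _ => by positivity
  have hS1 : ∫ x in a..b, (χ x * ‖f' x‖) ^ 2 = S :=
    integral_congr fun x _ => by ring
  have cs := sq_integral_mul_le (f := fun x => χ x * ‖f' x‖) (g := fun x => ‖f x‖) hab (hχc.continuousOn.mul hf'.norm) hfc.norm
  set B := ∫ x in a..b, χ x * ‖f' x‖ * ‖f x‖ with hB
  have hB0 : 0 ≤ B := intervalIntegral.integral_nonneg hab fun x hx => by
    have := hχ0 x hx; positivity
  rw [hS1] at cs
  have cs' : B ^ 2 ≤ S * ε := cs.trans (by gcongr)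
  have hsup : ∀ x ∈ Icc a b, χ x * ‖f x‖ ^ 2 ≤ κ * ε + 2 * B := by
    intro x hx
    have subx : Icc a x ⊆ Icc a b := Icc_subset_Icc le_rfl hx.2
    have hd : ∀ y ∈ uIcc a x, HasDerivAt (fun y => χ y * ‖f y‖ ^ 2)
        (χ' y * ‖f y‖ ^ 2 + χ y * (2 * (conj (f y) * f' y).re)) y := fun y hy =>
      (hχ y).fun_mul (hasDerivAt_norm_sq (hf y (subx (uIcc_of_le hx.1 ▸ hy))))
    have hdc : ContinuousOn (fun y => χ' y * ‖f y‖ ^ 2 + χ y * (2 * (conj (f y) * f' y).re))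
        (Icc a b) := by
      refine (hχ'.continuousOn.mul (hfc.norm.pow 2)).add (hχc.continuousOn.mul
        (continuousOn_const.mul ?_))
      exact continuous_re.comp_continuousOn ((continuous_conj.comp_continuousOn hfc).mul hf')
    have h1 := integral_eq_sub_of_hasDerivAt hd
      ((hdc.mono subx).intervalIntegrable_of_Icc hx.1)
    rw [ha, zero_mul, sub_zero] at h1
    rw [← h1]
    have hbc : ContinuousOn (fun y => κ * ‖f y‖ ^ 2 + 2 * (χ y * ‖f' y‖ * ‖f y‖)) (Icc a b) :=
      (continuousOn_const.mul (hfc.norm.pow 2)).add (continuousOn_const.mul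
        ((hχc.continuousOn.mul hf'.norm).mul hfc.norm))
    have hle : ∀ y ∈ Icc a b, χ' y * ‖f y‖ ^ 2 + χ y * (2 * (conj (f y) * f' y).re) ≤
        κ * ‖f y‖ ^ 2 + 2 * (χ y * ‖f' y‖ * ‖f y‖) := by
      intro y hy
      have h2 : χ' y * ‖f y‖ ^ 2 ≤ κ * ‖f y‖ ^ 2 := by gcongr; exact (le_abs_self _).trans (hκ y hy)
      have h3 : (conj (f y) * f' y).re ≤ ‖f y‖ * ‖f' y‖ := by
        refine (re_le_norm _).trans_eq ?_
        rw [norm_mul, RCLike.norm_conj]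
      have h4 := mul_le_mul_of_nonneg_left h3 (hχ0 y hy)
      linarith
    calc ∫ y in a..x, (χ' y * ‖f y‖ ^ 2 + χ y * (2 * (conj (f y) * f' y).re))
        ≤ ∫ y in a..x, (κ * ‖f y‖ ^ 2 + 2 * (χ y * ‖f' y‖ * ‖f y‖)) :=
          integral_mono_on hx.1 ((hdc.mono subx).intervalIntegrable_of_Icc hx.1)
            ((hbc.mono subx).intervalIntegrable_of_Icc hx.1) fun y hy => hle y (subx hy)
      _ ≤ ∫ y in a..b, (κ * ‖f y‖ ^ 2 + 2 * (χ y * ‖f' y‖ * ‖f y‖)) := by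
          refine integral_mono_interval le_rfl hx.1 hx.2 ?_
            (hbc.intervalIntegrable_of_Icc hab)
          filter_upwards [self_mem_ae_restrict measurableSet_Ioc] with y hy
          have := hχ0 y (Ioc_subset_Icc_self hy)
          simp only [Pi.zero_apply]
          positivity
      _ = κ * (∫ y in a..b, ‖f y‖ ^ 2) + 2 * B := by
          rw [intervalIntegral.integral_add, intervalIntegral.integral_const_mul,
            intervalIntegral.integral_const_mul]
          · exact (continuousOn_const.mul (hfc.norm.pow 2)).intervalIntegrable_of_Icc hab
          · exact (continuousOn_const.mul
              ((hχc.continuousOn.mul hf'.norm).mul hfc.norm)).intervalIntegrable_of_Icc hab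
      _ ≤ κ * ε + 2 * B := by gcongr
  set A := κ * ε + 2 * B with hA
  have hA0 : 0 ≤ A := by positivity
  have h5 : ∫ x in a..b, χ x ^ 2 * ‖f x‖ ^ 6 ≤ ∫ x in a..b, A ^ 2 * ‖f x‖ ^ 2 := by
    refine integral_mono_on hab ?_ ?_ fun x hx => ?_
    · exact ((hχc.continuousOn.pow 2).mul (hfc.norm.pow 6)).intervalIntegrable_of_Icc hab
    · exact (continuousOn_const.mul (hfc.norm.pow 2)).intervalIntegrable_of_Icc hab
    · have h6 : 0 ≤ χ x * ‖f x‖ ^ 2 := by have := hχ0 x hx; positivity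
      calc χ x ^ 2 * ‖f x‖ ^ 6 = (χ x * ‖f x‖ ^ 2) ^ 2 * ‖f x‖ ^ 2 := by ring
        _ ≤ A ^ 2 * ‖f x‖ ^ 2 := by gcongr; exact hsup x hx
  rw [intervalIntegral.integral_const_mul] at h5
  have h7 : A ^ 2 * (∫ x in a..b, ‖f x‖ ^ 2) ≤ A ^ 2 * ε := by gcongr
  have h8 : A ^ 2 ≤ 2 * (κ * ε) ^ 2 + 2 * (2 * B) ^ 2 := by
    have := sq_nonneg (κ * ε - 2 * B)
    rw [hA]; linarith
  have h9 : A ^ 2 * ε ≤ (2 * (κ * ε) ^ 2 + 8 * (S * ε)) * ε := by gcongr; linarith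
  calc _ ≤ (2 * (κ * ε) ^ 2 + 8 * (S * ε)) * ε := h5.trans (h7.trans h9)
    _ = _ := by ring

section

variable {q : ℝ → ℝ → ℂ}

lemma norm_momC_le (x t : ℝ) : ‖momC q x t‖ ≤ ‖q x t‖ * ‖dx q x t‖ := by
  rw [momC_eq, norm_real, Real.norm_eq_abs]
  refine (abs_im_le_norm _).trans_eq ?_
  rw [norm_mul, RCLike.norm_conj]

lemma norm_rhoC (x t : ℝ) : ‖rhoC q x t‖ = ‖q x t‖ ^ 2 := by
  rw [rhoC, norm_mul, RCLike.norm_conj]; ring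

lemma GISol.integrable_momDensity (hq : GISol q) {x t : ℝ} (hx : 0 ≤ x) (ht : 0 < t) :
    IntegrableOn (fun y => momDensity q y t) (Ioi x) := by
  obtain ⟨C, hC, hu, -, hd, -⟩ := hq.exists_decay ht
  have hi := (hu.integrableOn hC hx).norm.const_mul (C + C ^ 3)
  have sub : Ioi x ⊆ Ioi 0 := Ioi_subset_Ioi hx
  refine hi.mono' (((smooth_momDensity hq.smooth).continuousOn_x ht).mono sub
    |>.aestronglyMeasurable measurableSet_Ioi) ?_
  filter_upwards [self_mem_ae_restrict measurableSet_Ioi] with y hy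
  have hy0 : 0 < y := hx.trans_lt hy
  have h1 : ‖q y t‖ ≤ C := (hu.bound y hy0).trans (div_le_self hC (one_le_pow₀ (by linarith)))
  have h2 : ‖dx q y t‖ ≤ C := (hd.bound y hy0).trans (div_le_self hC (one_le_pow₀ (by linarith)))
  have h3 : ‖momDensity q y t‖ ≤ ‖q y t‖ * ‖dx q y t‖ + 1 / 2 * (‖q y t‖ ^ 2 * ‖q y t‖ ^ 2) := by
    refine (norm_add_le _ _).trans (add_le_add (norm_momC_le y t) ?_)
    simp [norm_rhoC]
  refine h3.trans ?_
  simp only [aknsU]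
  have h4 : ‖q y t‖ * ‖dx q y t‖ ≤ C * ‖q y t‖ := by rw [mul_comm]; gcongr
  have h5 : ‖q y t‖ ^ 2 * ‖q y t‖ ^ 2 ≤ C ^ 3 * ‖q y t‖ := by
    calc ‖q y t‖ ^ 2 * ‖q y t‖ ^ 2 = ‖q y t‖ ^ 3 * ‖q y t‖ := by ring
      _ ≤ C ^ 3 * ‖q y t‖ := by gcongr
  have h6 : 0 ≤ C ^ 3 * ‖q y t‖ := by positivity
  linarith

/-- The bump `30 y² (1 - y)²`, `y = x - a`. -/
def bump (a x : ℝ) : ℝ := 30 * (x - a) ^ 2 * (1 - (x - a)) ^ 2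

/-- The smooth cut-off with derivative `-bump`. -/
def cutW (a x : ℝ) : ℝ := 1 - (10 * (x - a) ^ 3 - 15 * (x - a) ^ 4 + 6 * (x - a) ^ 5)

lemma hasDerivAt_cutW (a x : ℝ) : HasDerivAt (cutW a) (-bump a x) x := by
  have h := (hasDerivAt_id x).sub_const a
  refine ((((h.fun_pow 3).const_mul 10).fun_sub ((h.fun_pow 4).const_mul 15)).fun_add
    ((h.fun_pow 5).const_mul 6)).const_sub 1 |>.congr_deriv ?_
  simp [bump]; ring

lemma hasDerivAt_bump (a x : ℝ) : HasDerivAt (bump a)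
    (30 * (2 * (x - a) - 6 * (x - a) ^ 2 + 4 * (x - a) ^ 3)) x := by
  have h := (hasDerivAt_id x).sub_const a
  refine (((h.fun_pow 2).const_mul 30).fun_mul ((h.const_sub 1).fun_pow 2)).congr_deriv ?_
  simp; ring

lemma hasDerivAt_bump' (a x : ℝ) :
    HasDerivAt (fun x => 30 * (2 * (x - a) - 6 * (x - a) ^ 2 + 4 * (x - a) ^ 3))
    (30 * (2 - 12 * (x - a) + 12 * (x - a) ^ 2)) x := by
  have h := (hasDerivAt_id x).sub_const a
  refine ((((h.const_mul 2).fun_sub ((h.fun_pow 2).const_mul 6)).fun_add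
    ((h.fun_pow 3).const_mul 4)).const_mul 30).congr_deriv ?_
  simp; ring

lemma continuous_bump (a : ℝ) : Continuous (bump a) := by unfold bump; fun_prop

lemma bump_nonneg (a x : ℝ) : 0 ≤ bump a x := by unfold bump; positivity

lemma cutW_mem {a x : ℝ} (hx : x ∈ Icc a (a + 1)) : cutW a x ∈ Icc (0 : ℝ) 1 := by
  have h0 : cutW a a = 1 := by simp [cutW]
  have h1 : cutW a (a + 1) = 0 := by simp [cutW]; norm_num
  have anti : Antitone (cutW a) := antitone_of_deriv_nonpos
    (fun x => (hasDerivAt_cutW a x).differentiableAt)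
    (fun x => by rw [(hasDerivAt_cutW a x).deriv]; linarith [bump_nonneg a x])
  exact ⟨h1 ▸ anti hx.2, h0 ▸ anti hx.1⟩

lemma integral_bump (a : ℝ) : ∫ x in a..(a + 1), bump a x = 1 := by
  have := integral_eq_sub_of_hasDerivAt (f := fun x => -cutW a x)
    (a := a) (b := a + 1) (fun x _ => (hasDerivAt_cutW a x).fun_neg)
    (by simp only [neg_neg]; exact (continuous_bump a).intervalIntegrable _ _)
  simp only [neg_neg] at this
  rw [this]; simp [cutW]; norm_num

end

variable {q : ℝ → ℝ → ℂ}

lemma integral_bump_mul_dxx {f : ℝ → ℝ → ℂ} (hf : SmoothQ f) {a r : ℝ} (ha : 0 < a) (hr : 0 < r) :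
    ∫ x in a..(a + 1), (bump a x : ℂ) * dx (dx f) x r =
      ∫ x in a..(a + 1), ((30 * (2 - 12 * (x - a) + 12 * (x - a) ^ 2) : ℝ) : ℂ) * f x r := by
  have hab : a ≤ a + 1 := by linarith
  have sub : uIcc a (a + 1) ⊆ Ioi 0 := by rw [uIcc_of_le hab]; exact fun y hy => ha.trans_le hy.1
  have cx : ∀ {g : ℝ → ℝ → ℂ}, SmoothQ g →
      IntervalIntegrable (fun x => g x r) volume a (a + 1) := fun hg =>
    ((hg.continuousOn_x hr).mono sub).intervalIntegrable
  have i1 := intervalIntegral.integral_mul_deriv_eq_deriv_mul (a := a) (b := a + 1)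
    (u := fun x => (bump a x : ℂ)) (v := fun x => dx f x r) (v' := fun x => dx (dx f) x r)
    (fun x _ => (hasDerivAt_bump a x).ofReal_comp)
    (fun x hx => hf.dx.hasDerivAt_x (sub hx) hr)
    ((continuous_ofReal.comp (by fun_prop)).intervalIntegrable _ _) (cx hf.dx.dx)
  have i2 := intervalIntegral.integral_mul_deriv_eq_deriv_mul (a := a) (b := a + 1)
    (u := fun x => ((30 * (2 * (x - a) - 6 * (x - a) ^ 2 + 4 * (x - a) ^ 3) : ℝ) : ℂ))
    (v := fun x => f x r) (v' := fun x => dx f x r)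
    (fun x _ => (hasDerivAt_bump' a x).ofReal_comp)
    (fun x hx => hf.hasDerivAt_x (sub hx) hr)
    ((continuous_ofReal.comp (by fun_prop)).intervalIntegrable _ _) (cx hf.dx)
  rw [i1, i2]
  have b0 : bump a a = 0 := by simp [bump]
  have b1 : bump a (a + 1) = 0 := by simp [bump]
  have d0 : 30 * (2 * (a - a) - 6 * (a - a) ^ 2 + 4 * (a - a) ^ 3) = 0 := by simp
  have d1 : 30 * (2 * (a + 1 - a) - 6 * (a + 1 - a) ^ 2 + 4 * (a + 1 - a) ^ 3) = 0 := by ring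
  simp only [b0, b1, d0, d1]
  simp

/-- Weighted kinetic plus sextic density in a unit window. -/
def windowEnergy (q : ℝ → ℝ → ℂ) (a r : ℝ) : ℝ :=
  ∫ x in a..(a + 1), bump a x * (‖dx q x r‖ ^ 2 + ‖q x r‖ ^ 6)

lemma rect_swap {a b c d : ℝ} (ha : 0 < a) (hc : 0 < c) :
    MapsTo (fun p : ℝ × ℝ => (p.2, p.1)) (Icc c d ×ˢ Icc a b) Quadrant :=
  fun _ hp => rect_subset_quadrant ha hc ⟨hp.2, hp.1⟩

lemma SmoothQ.continuousOn_swap {f : ℝ → ℝ → ℂ} (hf : SmoothQ f) {a b c d : ℝ} (ha : 0 < a)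
    (hc : 0 < c) : ContinuousOn (fun p : ℝ × ℝ => f p.2 p.1) (Icc c d ×ˢ Icc a b) :=
  hf.continuousOn.comp (f := fun p : ℝ × ℝ => (p.2, p.1)) (by fun_prop) (rect_swap ha hc)

lemma continuousOn_windowEnergy (hs : SmoothQ q) {a c d : ℝ} (ha : 0 < a) (hc : 0 < c) :
    ContinuousOn (windowEnergy q a) (Icc c d) :=
  continuousOn_integral_of_continuousOn (F := fun r x => bump a x * (‖dx q x r‖ ^ 2 + ‖q x r‖ ^ 6))
    (by linarith) (((continuous_bump a).comp continuous_snd).continuousOn.mul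
      (((hs.dx.continuousOn_swap ha hc).norm.pow 2).add ((hs.continuousOn_swap ha hc).norm.pow 6)))

lemma virial_slice (hq : GISol q) {a r ε : ℝ} (ha : 0 < a) (hr : 0 < r) (hε4 : ε ≤ 1 / 4)
    (hε : ∫ x in a..(a + 1), ‖q x r‖ ^ 2 ≤ ε) :
    (∫ x in a..(a + 1), ((-bump a x : ℝ) : ℂ) * momFlux q x r).re ≤
      -(1 / 2) * windowEnergy q a r + 9 := by
  have hs := hq.smooth
  have hab : a ≤ a + 1 := by linarith
  have sub : Icc a (a + 1) ⊆ Ioi 0 := fun y hy => ha.trans_le hy.1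
  have hε0 : 0 ≤ ε := (intervalIntegral.integral_nonneg hab fun x _ => by positivity).trans hε
  have cx : ∀ {g : ℝ → ℝ → ℂ}, SmoothQ g → ContinuousOn (fun x => g x r) (Icc a (a + 1)) :=
    fun hg => (hg.continuousOn_x hr).mono sub
  have cb := (continuous_bump a).continuousOn (s := Icc a (a + 1))
  have cbC : ContinuousOn (fun x => (bump a x : ℂ)) (Icc a (a + 1)) :=
    (continuous_ofReal.comp (continuous_bump a)).continuousOn
  have ii : ∀ {g : ℝ → ℝ}, ContinuousOn g (Icc a (a + 1)) →
      IntervalIntegrable g volume a (a + 1) := fun hg => hg.intervalIntegrable_of_Icc hab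
  have iiC : ∀ {g : ℝ → ℂ}, ContinuousOn g (Icc a (a + 1)) →
      IntervalIntegrable g volume a (a + 1) := fun hg => hg.intervalIntegrable_of_Icc hab
  set S1 := ∫ x in a..(a + 1), bump a x * ‖dx q x r‖ ^ 2 with hS1
  set S3 := ∫ x in a..(a + 1), bump a x * ‖q x r‖ ^ 6 with hS3
  have c1 : ContinuousOn (fun x => bump a x * ‖dx q x r‖ ^ 2) (Icc a (a + 1)) :=
    cb.mul ((cx hs.dx).norm.pow 2)
  have c3 : ContinuousOn (fun x => bump a x * ‖q x r‖ ^ 6) (Icc a (a + 1)) :=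
    cb.mul ((cx hs).norm.pow 6)
  have hW : windowEnergy q a r = S1 + S3 := by
    rw [windowEnergy, hS1, hS3, ← intervalIntegral.integral_add (ii c1) (ii c3)]
    exact integral_congr fun x _ => by ring
  have hS10 : 0 ≤ S1 := intervalIntegral.integral_nonneg hab fun x _ =>
    mul_nonneg (bump_nonneg a x) (by positivity)
  -- Gagliardo–Nirenberg
  have gn : S3 ≤ 1 / 2 * S1 + 1 := by
    have h30 : (0 : ℝ) ≤ 30 := by norm_num
    have hb : ∀ x, (√30 * ((x - a) * (1 - (x - a)))) ^ 2 = bump a x := fun x => by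
      rw [mul_pow, Real.sq_sqrt h30, bump]; ring
    have := local_gagliardo (f := fun x => q x r) (f' := fun x => dx q x r)
      (χ := fun x => √30 * ((x - a) * (1 - (x - a))))
      (χ' := fun x => √30 * (1 - 2 * (x - a))) (a := a) (b := a + 1) (κ := √30)
      hab (fun x hx => hs.hasDerivAt_x (sub hx) hr) (cx hs.dx)
      (fun x => by
        have h := (hasDerivAt_id x).sub_const a
        refine ((h.fun_mul (h.const_sub 1)).const_mul (√30)).congr_deriv ?_
        simp; ring) (by fun_prop) (by simp)
      (fun x hx => mul_nonneg (Real.sqrt_nonneg _)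
        (mul_nonneg (by linarith [hx.1]) (by linarith [hx.2])))
      (fun x hx => by
        rw [abs_mul, abs_of_nonneg (Real.sqrt_nonneg _)]
        have : |1 - 2 * (x - a)| ≤ 1 := abs_le.2 ⟨by linarith [hx.2], by linarith [hx.1]⟩
        nlinarith [Real.sqrt_nonneg 30]) hε
    simp only [hb, Real.sq_sqrt h30] at this
    have e1 : 8 * ε ^ 2 ≤ 1 / 2 := by nlinarith
    have e2 : 2 * 30 * ε ^ 3 ≤ 1 := by
      have : ε ^ 3 ≤ (1 / 4) ^ 3 := by gcongr
      linarith
    have e3 := mul_le_mul_of_nonneg_right e1 hS10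
    linarith
  set J := ∫ x in a..(a + 1), (bump a x : ℂ) * (rhoC q x r * momC q x r) with hJ
  set K := ∫ x in a..(a + 1), (bump a x : ℂ) * dx (dx (rhoC q)) x r with hK
  have hI : ∫ x in a..(a + 1), ((-bump a x : ℝ) : ℂ) * momFlux q x r =
      -((2 * S1 : ℝ) : ℂ) - J + 1 / 2 * K := by
    have e1 : ((2 * S1 : ℝ) : ℂ) =
        ∫ x in a..(a + 1), (bump a x : ℂ) * (2 * (dx q x r * conj (dx q x r))) := by
      rw [hS1, ← intervalIntegral.integral_const_mul, ← intervalIntegral.integral_ofReal]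
      refine integral_congr fun x _ => ?_
      rw [mul_conj, normSq_eq_norm_sq]
      push_cast; ring
    have k1 : IntervalIntegrable (fun x => -((bump a x : ℂ) * (2 * (dx q x r * conj (dx q x r)))))
        volume a (a + 1) := iiC (cbC.mul ((continuousOn_const (c := (2 : ℂ))).mul
      ((cx hs.dx).mul (cx hs.dx.conjQ)))).neg
    have k2 : IntervalIntegrable (fun x => (bump a x : ℂ) * (rhoC q x r * momC q x r))
        volume a (a + 1) := iiC (cbC.mul ((cx (smooth_rhoC hs)).mul (cx (smooth_momC hs))))
    have k3 : IntervalIntegrable (fun x => 1 / 2 * ((bump a x : ℂ) * dx (dx (rhoC q)) x r))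
        volume a (a + 1) := (iiC (cbC.mul (cx (smooth_rhoC hs).dx.dx))).const_mul (1 / 2)
    rw [e1, hJ, hK, ← intervalIntegral.integral_const_mul, ← intervalIntegral.integral_neg,
      ← intervalIntegral.integral_sub k1 k2, ← intervalIntegral.integral_add (k1.sub k2) k3]
    refine integral_congr fun x _ => ?_
    simp only [momFlux]
    push_cast; ring
  have hJb : ‖J‖ ≤ 1 / 2 * S1 + 1 / 2 * S3 := by
    have : ‖J‖ ≤ ∫ x in a..(a + 1),
        (1 / 2 * (bump a x * ‖dx q x r‖ ^ 2) + 1 / 2 * (bump a x * ‖q x r‖ ^ 6)) := by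
      refine intervalIntegral.norm_integral_le_of_norm_le hab (Eventually.of_forall fun x _ => ?_)
        ((ii c1).const_mul _ |>.add ((ii c3).const_mul _))
      rw [norm_mul, norm_mul, norm_real, Real.norm_eq_abs, abs_of_nonneg (bump_nonneg a x),
        norm_rhoC]
      have h1 := mul_le_mul_of_nonneg_left (norm_momC_le (q := q) x r) (sq_nonneg ‖q x r‖)
      have h2 := sq_nonneg (‖dx q x r‖ - ‖q x r‖ ^ 3)
      have h3 : ‖q x r‖ ^ 2 * ‖momC q x r‖ ≤ 1 / 2 * ‖dx q x r‖ ^ 2 + 1 / 2 * ‖q x r‖ ^ 6 := by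
        linarith
      have := mul_le_mul_of_nonneg_left h3 (bump_nonneg a x)
      linarith
    rwa [intervalIntegral.integral_add ((ii c1).const_mul _) ((ii c3).const_mul _),
      intervalIntegral.integral_const_mul, intervalIntegral.integral_const_mul] at this
  have hKb : ‖K‖ ≤ 60 * ε := by
    rw [hK, integral_bump_mul_dxx (smooth_rhoC hs) ha hr]
    have : ‖∫ x in a..(a + 1), ((30 * (2 - 12 * (x - a) + 12 * (x - a) ^ 2) : ℝ) : ℂ) *
        rhoC q x r‖ ≤ ∫ x in a..(a + 1), 60 * ‖q x r‖ ^ 2 := by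
      refine intervalIntegral.norm_integral_le_of_norm_le hab (Eventually.of_forall fun x hx => ?_)
        (ii (continuousOn_const.mul ((cx hs).norm.pow 2)))
      rw [norm_mul, norm_real, Real.norm_eq_abs, norm_rhoC]
      gcongr
      refine abs_le.2 ⟨?_, ?_⟩
      · nlinarith [sq_nonneg (2 * (x - a) - 1)]
      · nlinarith [mul_nonneg (sub_nonneg.2 hx.1.le) (sub_nonneg.2 hx.2)]
    rw [intervalIntegral.integral_const_mul] at this
    linarith
  rw [hI, hW]
  have r1 := (abs_le.1 ((abs_re_le_norm J).trans hJb)).1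
  have r2 := (abs_le.1 ((abs_re_le_norm K).trans hKb)).2
  have : (-((2 * S1 : ℝ) : ℂ) - J + 1 / 2 * K).re = -(2 * S1) - J.re + 1 / 2 * K.re := by
    simp only [add_re, sub_re, neg_re, ofReal_re, mul_re]
    norm_num
  rw [this]
  linarith

lemma GISol.virial (hq : GISol q) {x0 t0 t1 : ℝ} (hx0 : 0 < x0) (ht0 : 0 < t0) (ht : t0 ≤ t1) :
    ∃ C, 0 ≤ C ∧ ∀ a, x0 ≤ a → (∀ r ∈ Icc t0 t1, ∫ x in a..(a + 1), ‖q x r‖ ^ 2 ≤ 1 / 4) →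
      ∫ r in t0..t1, windowEnergy q a r ≤ C := by
  have hs := hq.smooth
  have ht₁ := ht0.trans_le ht
  have hP := smooth_momDensity hs
  have hF := smooth_momFlux hs
  set M := ∫ x in Ioi x0, ‖momDensity q x t1‖ with hM
  set M' := ∫ x in Ioi x0, ‖momDensity q x t0‖ with hM'
  have hM0 : 0 ≤ M := integral_nonneg fun _ => norm_nonneg _
  have hM0' : 0 ≤ M' := integral_nonneg fun _ => norm_nonneg _
  set Q := ∫ r in t0..t1, momFlux q x0 r with hQ
  refine ⟨2 * (‖Q‖ + (2 * M + 2 * M') + 9 * (t1 - t0)), ?_, fun a ha hsmall => ?_⟩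
  · have : 0 ≤ t1 - t0 := by linarith
    positivity
  have ha0 : 0 < a := hx0.trans_le ha
  have hab : a ≤ a + 1 := by linarith
  have subt : uIcc t0 t1 ⊆ Ioi 0 := by rw [uIcc_of_le ht]; exact fun y hy => ht0.trans_le hy.1
  have b1 := balance_law hP hF hq.momentum_law (w := fun _ => 1) (w' := fun _ => 0)
    (fun x => hasDerivAt_const x 1) continuous_const hx0 ha ht0 ht
  have b2 := balance_law hP hF hq.momentum_law (w := cutW a) (w' := fun x => -bump a x)
    (hasDerivAt_cutW a) (continuous_bump a).neg ha0 hab ht0 ht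
  have w0 : cutW a a = 1 := by simp [cutW]
  have w1 : cutW a (a + 1) = 0 := by simp [cutW]; norm_num
  simp only [ofReal_one, one_mul, ofReal_zero, zero_mul,
    intervalIntegral.integral_zero, add_zero, w0, w1, sub_zero] at b1 b2
  have i0 : IntervalIntegrable (fun r => momFlux q x0 r) volume t0 t1 :=
    ((hF.continuousOn_t hx0).mono subt).intervalIntegrable
  have ia : IntervalIntegrable (fun r => momFlux q a r) volume t0 t1 :=
    ((hF.continuousOn_t ha0).mono subt).intervalIntegrable
  have cI : ContinuousOn (fun r => ∫ x in a..(a + 1), ((-bump a x : ℝ) : ℂ) * momFlux q x r)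
      (Icc t0 t1) := by
    refine continuousOn_integral_of_continuousOn (F := fun r x => ((-bump a x : ℝ) : ℂ) *
      momFlux q x r) hab ?_
    refine ContinuousOn.mul ?_ ?_
    · exact (continuous_ofReal.comp ((continuous_bump a).neg.comp continuous_snd)).continuousOn
    · exact hF.continuousOn_swap ha0 ht0
  have iI : IntervalIntegrable (fun r => ∫ x in a..(a + 1), ((-bump a x : ℝ) : ℂ) *
      momFlux q x r) volume t0 t1 := cI.intervalIntegrable_of_Icc ht
  rw [intervalIntegral.integral_sub i0 ia] at b1
  rw [intervalIntegral.integral_add ia iI] at b2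
  have bd : ∀ t, 0 < t → ‖∫ x in x0..a, momDensity q x t‖ ≤ ∫ x in Ioi x0, ‖momDensity q x t‖ ∧
      ‖∫ x in a..(a + 1), (cutW a x : ℂ) * momDensity q x t‖ ≤
        ∫ x in Ioi x0, ‖momDensity q x t‖ := by
    intro t ht
    have hi := (hq.integrable_momDensity hx0.le ht).norm
    have mono : ∀ {c d : ℝ}, x0 ≤ c → c ≤ d → ∫ x in c..d, ‖momDensity q x t‖ ≤
        ∫ x in Ioi x0, ‖momDensity q x t‖ := by
      intro c d hc hcd
      rw [integral_of_le hcd]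
      exact setIntegral_mono_set hi (Eventually.of_forall fun _ => norm_nonneg _)
        (show Ioc c d ⊆ Ioi x0 from fun y hy => hc.trans_lt hy.1).eventuallyLE
    constructor
    · exact (intervalIntegral.norm_integral_le_integral_norm ha).trans (mono le_rfl ha)
    · refine le_trans ?_ (mono ha hab)
      refine intervalIntegral.norm_integral_le_of_norm_le hab (Eventually.of_forall fun x hx => ?_)
        ?_
      · have := cutW_mem (Ioc_subset_Icc_self hx)
        rw [norm_mul, norm_real, Real.norm_eq_abs, abs_of_nonneg this.1]
        exact mul_le_of_le_one_left (norm_nonneg _) this.2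
      · exact ContinuousOn.intervalIntegrable_of_Icc hab ((hP.continuousOn_x ht).mono fun y hy =>
          ha0.trans_le hy.1).norm
  have n1 := bd t1 ht₁
  have n0 := bd t0 ht0
  set Z := ∫ r in t0..t1, ∫ x in a..(a + 1), ((-bump a x : ℝ) : ℂ) * momFlux q x r with hZ
  have hZn : ‖Z‖ ≤ ‖Q‖ + (2 * M + 2 * M') := by
    have : Z = (∫ x in x0..a, momDensity q x t1) - (∫ x in x0..a, momDensity q x t0) +
        ((∫ x in a..(a + 1), (cutW a x : ℂ) * momDensity q x t1) -
          ∫ x in a..(a + 1), (cutW a x : ℂ) * momDensity q x t0) - Q := by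
      rw [b1, b2]; ring
    rw [this]
    refine (norm_sub_le _ _).trans ?_
    have h1 := norm_add_le ((∫ x in x0..a, momDensity q x t1) - ∫ x in x0..a, momDensity q x t0)
      ((∫ x in a..(a + 1), (cutW a x : ℂ) * momDensity q x t1) -
          ∫ x in a..(a + 1), (cutW a x : ℂ) * momDensity q x t0)
    have h2 := norm_sub_le (∫ x in x0..a, momDensity q x t1) (∫ x in x0..a, momDensity q x t0)
    have h3 := norm_sub_le (∫ x in a..(a + 1), (cutW a x : ℂ) * momDensity q x t1)
      (∫ x in a..(a + 1), (cutW a x : ℂ) * momDensity q x t0)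
    linarith [n1.1, n1.2, n0.1, n0.2]
  have hZre : Z.re = ∫ r in t0..t1, (∫ x in a..(a + 1), ((-bump a x : ℝ) : ℂ) * momFlux q x r).re :=
    (reCLM.intervalIntegral_comp_comm iI).symm
  have iW : IntervalIntegrable (windowEnergy q a) volume t0 t1 :=
    (continuousOn_windowEnergy hs ha0 ht0).intervalIntegrable_of_Icc ht
  have hle : Z.re ≤ ∫ r in t0..t1, (-(1 / 2) * windowEnergy q a r + 9) := by
    rw [hZre]
    refine integral_mono_on ht ?_ ((iW.const_mul _).add
      intervalIntegrable_const) fun r hr =>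
        virial_slice hq ha0 (ht0.trans_le hr.1) le_rfl (hsmall r hr)
    exact (continuous_re.comp_continuousOn cI).intervalIntegrable_of_Icc ht
  rw [intervalIntegral.integral_add (iW.const_mul _) intervalIntegrable_const,
    intervalIntegral.integral_const_mul, intervalIntegral.integral_const] at hle
  have := (abs_le.1 ((abs_re_le_norm Z).trans hZn)).1
  simp only [smul_eq_mul] at hle
  linarith

lemma SmoothQ.continuousOn_rect {f : ℝ → ℝ → ℂ} (hf : SmoothQ f) {a b c d : ℝ} (ha : 0 < a)
    (hc : 0 < c) : ContinuousOn (fun p : ℝ × ℝ => f p.1 p.2) (Icc a b ×ˢ Icc c d) :=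
  hf.continuousOn.mono (rect_subset_quadrant ha hc)

lemma GISol.continuousOn_windowMass (hq : GISol q) {x y t0 t1 : ℝ} (hx : 0 < x) (hxy : x ≤ y)
    (ht0 : 0 < t0) : ContinuousOn (fun t => ∫ z in x..y, ‖q z t‖ ^ 2) (Icc t0 t1) :=
  continuousOn_integral_of_continuousOn (F := fun t z => ‖q z t‖ ^ 2) hxy
    ((hq.smooth.continuousOn_swap hx ht0).norm.pow 2)

lemma GISol.continuousOn_tailMass (hq : GISol q) {x y t0 t1 : ℝ} (hx : 0 < x) (hxy : x ≤ y)
    (ht0 : 0 < t0) (h : ContinuousOn (tailMass q x) (Icc t0 t1)) :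
    ContinuousOn (tailMass q y) (Icc t0 t1) := by
  refine (h.sub (hq.continuousOn_windowMass hx hxy ht0)).congr fun t ht => ?_
  have := hq.tailMass_sub hx.le hxy (ht0.trans_le ht.1)
  simp only [Pi.sub_apply]
  linarith

lemma GISol.tailMass_anti (hq : GISol q) {x y t : ℝ} (hx : 0 ≤ x) (hxy : x ≤ y) (ht : 0 < t) :
    tailMass q y t ≤ tailMass q x t := by
  rw [hq.tailMass_sub hx hxy ht]
  linarith [intervalIntegral.integral_nonneg (μ := volume) (f := fun z => ‖q z t‖ ^ 2) hxy
    fun z _ => by positivity]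

/-- Continuity of the mass gives uniformly small tails. -/
lemma GISol.uniform_tails (hq : GISol q) {x0 t0 t1 : ℝ} (hx0 : 0 < x0) (ht0 : 0 < t0)
    (h : ContinuousOn (tailMass q x0) (Icc t0 t1)) {δ : ℝ} (hδ : 0 < δ) :
    ∃ A, x0 ≤ A ∧ ∀ x, A ≤ x → ∀ t ∈ Icc t0 t1, tailMass q x t ≤ δ := by
  have hle : ∀ n : ℕ, x0 ≤ x0 + n := fun n => by linarith [n.cast_nonneg (α := ℝ)]
  have := Antitone.tendstoUniformlyOn_of_forall_tendsto (F := fun (n : ℕ) t => tailMass q (x0 + n) t)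
    (f := fun _ => 0) isCompact_Icc
    (fun n => hq.continuousOn_tailMass hx0 (hle n) ht0 h)
    (fun t ht n m hnm => hq.tailMass_anti (hx0.le.trans (hle n)) (by gcongr) (ht0.trans_le ht.1))
    continuousOn_const
    (fun t ht => (hq.tendsto_tailMass (ht0.trans_le ht.1)).comp
      (tendsto_atTop_add_const_left _ _ tendsto_natCast_atTop_atTop))
  rw [Metric.tendstoUniformlyOn_iff] at this
  obtain ⟨n, hn⟩ := (this δ hδ).exists
  refine ⟨x0 + n, hle n, fun x hx t ht => ?_⟩
  refine (hq.tailMass_anti (hx0.le.trans (hle n)) hx (ht0.trans_le ht.1)).trans ?_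
  have h1 := hn t ht
  rw [dist_zero_left, Real.norm_eq_abs] at h1
  exact (le_abs_self _).trans h1.le

lemma bump_le_two {a x : ℝ} (hx : x ∈ Icc a (a + 1)) : bump a x ≤ 2 := by
  have h : 0 ≤ (x - a) * (1 - (x - a)) := mul_nonneg (by linarith [hx.1]) (by linarith [hx.2])
  have h2 : (x - a) * (1 - (x - a)) ≤ 1 / 4 := by nlinarith [sq_nonneg (2 * (x - a) - 1)]
  have : bump a x = 30 * ((x - a) * (1 - (x - a))) ^ 2 := by unfold bump; ring
  rw [this]
  nlinarith

/-- Far away lines on which the flow is under control. -/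
lemma GISol.exists_good_line (hq : GISol q) {x0 t0 t1 : ℝ} (hx0 : 0 < x0) (ht0 : 0 < t0)
    (ht : t0 ≤ t1) (h : ContinuousOn (tailMass q x0) (Icc t0 t1)) :
    ∃ C, 0 ≤ C ∧ ∀ δ > 0, ∀ A, ∃ X, x0 ≤ X ∧ A ≤ X ∧
      ∫ r in t0..t1, (‖dx q X r‖ ^ 2 + ‖q X r‖ ^ 6) ≤ C ∧ ∫ r in t0..t1, ‖q X r‖ ^ 2 ≤ δ := by
  have hs := hq.smooth
  obtain ⟨C, hC, hv⟩ := hq.virial hx0 ht0 ht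
  refine ⟨3 * (C + 1), by positivity, fun δ hδ A => ?_⟩
  set δ' := δ / 3 with hδ'
  set T := t1 - t0 with hT
  have hT0 : 0 ≤ T := by rw [hT]; linarith
  obtain ⟨A1, hA1, htail⟩ := hq.uniform_tails hx0 ht0 h
    (show 0 < min (1 / 4) (δ' / (2 * (T + 1))) by positivity)
  set a := max A A1 with ha
  have hxa : x0 ≤ a := hA1.trans (le_max_right _ _)
  have ha0 : 0 < a := hx0.trans_le hxa
  have hab : a ≤ a + 1 := by linarith
  have hwin : ∀ r ∈ Icc t0 t1, ∫ x in a..(a + 1), ‖q x r‖ ^ 2 ≤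
      min (1 / 4) (δ' / (2 * (T + 1))) := by
    intro r hr
    have h1 := htail a (le_max_right _ _) r hr
    rw [hq.tailMass_sub ha0.le hab (ht0.trans_le hr.1)] at h1
    linarith [tailMass_nonneg q (a + 1) r]
  have hv' := hv a hxa fun r hr => (hwin r hr).trans (min_le_left _ _)
  set G : ℝ → ℝ → ℝ := fun x r =>
    (‖dx q x r‖ ^ 2 + ‖q x r‖ ^ 6) / (C + 1) + ‖q x r‖ ^ 2 / δ' with hG
  have hδ0 : 0 < δ' := by positivity
  have cG : ContinuousOn (fun p : ℝ × ℝ => G p.1 p.2) (Icc a (a + 1) ×ˢ Icc t0 t1) := by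
    have k1 := hs.continuousOn_rect (a := a) (b := a + 1) (c := t0) (d := t1) ha0 ht0
    have k2 := hs.dx.continuousOn_rect (a := a) (b := a + 1) (c := t0) (d := t1) ha0 ht0
    exact (((k2.norm.pow 2).add (k1.norm.pow 6)).div_const _).add ((k1.norm.pow 2).div_const _)
  have cb : ContinuousOn (fun p : ℝ × ℝ => bump a p.1) (Icc a (a + 1) ×ˢ Icc t0 t1) :=
    ((continuous_bump a).comp continuous_fst).continuousOn
  have cg := continuousOn_integral_of_continuousOn (F := G) ht cG
  have key : ∫ x in a..(a + 1), bump a x * ∫ r in t0..t1, G x r ≤ 2 := by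
    have e1 : ∫ x in a..(a + 1), bump a x * ∫ r in t0..t1, G x r =
        ∫ x in a..(a + 1), ∫ r in t0..t1, bump a x * G x r := by
      simp only [intervalIntegral.integral_const_mul]
    rw [e1, swap_of_continuousOn hab ht (cb.mul cG)]
    have hslice : ∀ r ∈ Icc t0 t1, ∫ x in a..(a + 1), bump a x * G x r ≤
        1 / (C + 1) * windowEnergy q a r + 1 / (T + 1) := by
      intro r hr
      have hr0 : 0 < r := ht0.trans_le hr.1
      have sub : Icc a (a + 1) ⊆ Ioi 0 := fun y hy => ha0.trans_le hy.1
      have c1 : ContinuousOn (fun x => 1 / (C + 1) * (bump a x * (‖dx q x r‖ ^ 2 + ‖q x r‖ ^ 6)))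
          (Icc a (a + 1)) := continuousOn_const.mul ((continuous_bump a).continuousOn.mul
        ((((hs.dx.continuousOn_x hr0).mono sub).norm.pow 2).add
          (((hs.continuousOn_x hr0).mono sub).norm.pow 6)))
      have c2 : ContinuousOn (fun x => 1 / δ' * (bump a x * ‖q x r‖ ^ 2)) (Icc a (a + 1)) :=
        continuousOn_const.mul ((continuous_bump a).continuousOn.mul
          (((hs.continuousOn_x hr0).mono sub).norm.pow 2))
      have c3 : ContinuousOn (fun x => 2 / δ' * ‖q x r‖ ^ 2) (Icc a (a + 1)) :=
        continuousOn_const.mul (((hs.continuousOn_x hr0).mono sub).norm.pow 2)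
      have e2 : ∫ x in a..(a + 1), bump a x * G x r = ∫ x in a..(a + 1),
          (1 / (C + 1) * (bump a x * (‖dx q x r‖ ^ 2 + ‖q x r‖ ^ 6)) +
            1 / δ' * (bump a x * ‖q x r‖ ^ 2)) :=
        integral_congr fun x _ => by simp only [hG]; ring
      rw [e2, intervalIntegral.integral_add (c1.intervalIntegrable_of_Icc hab)
        (c2.intervalIntegrable_of_Icc hab), intervalIntegral.integral_const_mul]
      have h3 : ∫ x in a..(a + 1), 1 / δ' * (bump a x * ‖q x r‖ ^ 2) ≤
          ∫ x in a..(a + 1), 2 / δ' * ‖q x r‖ ^ 2 := by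
        refine integral_mono_on hab (c2.intervalIntegrable_of_Icc hab)
          (c3.intervalIntegrable_of_Icc hab) fun x hx => ?_
        have := mul_le_mul_of_nonneg_right (bump_le_two hx) (sq_nonneg ‖q x r‖)
        calc 1 / δ' * (bump a x * ‖q x r‖ ^ 2) ≤ 1 / δ' * (2 * ‖q x r‖ ^ 2) := by gcongr
          _ = _ := by ring
      rw [intervalIntegral.integral_const_mul (2 / δ')] at h3
      have h4 : 2 / δ' * (∫ x in a..(a + 1), ‖q x r‖ ^ 2) ≤ 2 / δ' * (δ' / (2 * (T + 1))) := by
        gcongr; exact (hwin r hr).trans (min_le_right _ _)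
      have h5 : 2 / δ' * (δ' / (2 * (T + 1))) = 1 / (T + 1) := by field_simp
      have h6 : windowEnergy q a r = ∫ x in a..(a + 1), bump a x * (‖dx q x r‖ ^ 2 + ‖q x r‖ ^ 6) :=
        rfl
      rw [← h6]
      linarith
    have iW := ((continuousOn_windowEnergy hs ha0 ht0).intervalIntegrable_of_Icc
      (μ := volume) ht).const_mul (1 / (C + 1))
    have hint : ∫ r in t0..t1, ∫ x in a..(a + 1), bump a x * G x r ≤
        ∫ r in t0..t1, (1 / (C + 1) * windowEnergy q a r + 1 / (T + 1)) := by
      refine integral_mono_on ht ?_ (iW.add intervalIntegrable_const) hslice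
      refine ContinuousOn.intervalIntegrable_of_Icc ht ?_
      refine continuousOn_integral_of_continuousOn (F := fun r x => bump a x * G x r) hab ?_
      exact (cb.mul cG).comp (f := fun p : ℝ × ℝ => (p.2, p.1)) (by fun_prop)
        fun p hp => ⟨hp.2, hp.1⟩
    refine hint.trans ?_
    rw [intervalIntegral.integral_add iW intervalIntegrable_const,
      intervalIntegral.integral_const_mul, intervalIntegral.integral_const, smul_eq_mul]
    have h7 : 1 / (C + 1) * (∫ r in t0..t1, windowEnergy q a r) ≤ 1 / (C + 1) * C := by gcongr
    have h8 : 1 / (C + 1) * C ≤ 1 := by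
      rw [one_div_mul_eq_div, div_le_one (by positivity)]; linarith
    have h9 : T * (1 / (T + 1)) ≤ 1 := by rw [mul_one_div, div_le_one (by positivity)]; linarith
    linarith
  obtain ⟨X, hX, hgX⟩ : ∃ X ∈ Icc a (a + 1), ∫ r in t0..t1, G X r ≤ 3 := by
    by_contra hcon
    push Not at hcon
    have h1 : ∫ x in a..(a + 1), bump a x * 3 ≤ ∫ x in a..(a + 1), bump a x * ∫ r in t0..t1, G x r := by
      refine integral_mono_on hab
        (((continuous_bump a).mul continuous_const).intervalIntegrable _ _) ?_ fun x hx =>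
        mul_le_mul_of_nonneg_left (hcon x hx).le (bump_nonneg a x)
      exact ((continuous_bump a).continuousOn.mul cg).intervalIntegrable_of_Icc hab
    rw [intervalIntegral.integral_mul_const, integral_bump] at h1
    linarith
  have hXo : 0 < X := ha0.trans_le hX.1
  have subt : Icc t0 t1 ⊆ Ioi 0 := fun y hy => ht0.trans_le hy.1
  have k1 := (hs.continuousOn_t hXo).mono subt
  have k2 := (hs.dx.continuousOn_t hXo).mono subt
  have d1 : ContinuousOn (fun r => ‖dx q X r‖ ^ 2 + ‖q X r‖ ^ 6) (Icc t0 t1) :=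
    (k2.norm.pow 2).add (k1.norm.pow 6)
  have d2 : ContinuousOn (fun r => ‖q X r‖ ^ 2) (Icc t0 t1) := k1.norm.pow 2
  have e3 : ∫ r in t0..t1, G X r = (∫ r in t0..t1, (‖dx q X r‖ ^ 2 + ‖q X r‖ ^ 6)) / (C + 1) +
      (∫ r in t0..t1, ‖q X r‖ ^ 2) / δ' := by
    rw [← intervalIntegral.integral_div, ← intervalIntegral.integral_div,
      ← intervalIntegral.integral_add]
    · exact (d1.div_const _).intervalIntegrable_of_Icc ht
    · exact (d2.div_const _).intervalIntegrable_of_Icc ht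
  have p1 : 0 ≤ (∫ r in t0..t1, (‖dx q X r‖ ^ 2 + ‖q X r‖ ^ 6)) / (C + 1) :=
    div_nonneg (intervalIntegral.integral_nonneg ht fun _ _ => by positivity) (by positivity)
  have p2 : 0 ≤ (∫ r in t0..t1, ‖q X r‖ ^ 2) / δ' :=
    div_nonneg (intervalIntegral.integral_nonneg ht fun _ _ => by positivity) (by positivity)
  rw [e3] at hgX
  refine ⟨X, hxa.trans hX.1, (le_max_left _ _).trans hX.1, ?_, ?_⟩
  · have : (∫ r in t0..t1, (‖dx q X r‖ ^ 2 + ‖q X r‖ ^ 6)) / (C + 1) ≤ 3 := by linarith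
    rwa [div_le_iff₀ (by positivity)] at this
  · have : (∫ r in t0..t1, ‖q X r‖ ^ 2) / δ' ≤ 3 := by linarith
    rw [div_le_iff₀ (by positivity), hδ'] at this
    linarith

/-! ### Propagation of the Jost solution in time -/

lemma forward_gronwall {E E' c P : ℝ → ℝ} {a b : ℝ} (hab : a ≤ b)
    (hE : ContinuousOn E (Icc a b)) (hE' : ∀ x ∈ Ioo a b, HasDerivAt E (E' x) x)
    (hP : ContinuousOn P (Icc a b)) (hP' : ∀ x ∈ Ioo a b, HasDerivAt P (c x) x)
    (h : ∀ x ∈ Ioo a b, E' x ≤ c x * E x) :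
    E b ≤ E a * Real.exp (P b - P a) := by
  have hder : ∀ x ∈ Ioo a b, HasDerivAt (fun x => E x * Real.exp (-P x))
      (E' x * Real.exp (-P x) + E x * (Real.exp (-P x) * -c x)) x := fun x hx =>
    (hE' x hx).fun_mul (hP' x hx).fun_neg.exp
  have hanti : AntitoneOn (fun x => E x * Real.exp (-P x)) (Icc a b) := by
    refine antitoneOn_of_deriv_nonpos (convex_Icc a b)
      (hE.mul (Real.continuous_exp.comp_continuousOn hP.neg)) ?_ ?_
    · rw [interior_Icc]
      exact fun x hx => (hder x hx).differentiableAt.differentiableWithinAt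
    · rw [interior_Icc]
      intro x hx
      rw [(hder x hx).deriv]
      have h1 := mul_le_mul_of_nonneg_right (h x hx) (Real.exp_pos (-P x)).le
      linarith
  have h1 := hanti (left_mem_Icc.2 hab) (right_mem_Icc.2 hab) hab
  simp only at h1
  have h2 := mul_le_mul_of_nonneg_right h1 (Real.exp_pos (P b)).le
  rw [mul_assoc, ← Real.exp_add, neg_add_cancel, Real.exp_zero, mul_one, mul_assoc,
    ← Real.exp_add] at h2
  rwa [show P b - P a = -P a + P b by ring]

lemma hasDerivAt_primitive {f : ℝ → ℝ} {a b : ℝ} (hf : ContinuousOn f (Icc a b)) {x : ℝ}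
    (hx : x ∈ Ioo a b) : HasDerivAt (fun x => ∫ y in a..x, f y) (f x) x := by
  exact integral_hasDerivAt_right
    ((hf.mono (Icc_subset_Icc_right hx.2.le)).intervalIntegrable_of_Icc hx.1.le)
    ((hf.mono Ioo_subset_Icc_self).stronglyMeasurableAtFilter isOpen_Ioo x hx)
    (hf.continuousAt (Icc_mem_nhds hx.1 hx.2))

lemma continuousOn_primitive_Icc {f : ℝ → ℝ} {a b : ℝ} (hab : a ≤ b)
    (hf : ContinuousOn f (Icc a b)) :
    ContinuousOn (fun x => ∫ y in a..x, f y) (Icc a b) := by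
  have := continuousOn_primitive_interval' (μ := volume)
      ((uIcc_of_le hab ▸ hf).intervalIntegrable) left_mem_uIcc
  rwa [uIcc_of_le hab] at this

lemma HasDerivWithinAt.hasDerivAt_Ioo {f : ℝ → ℂ} {f' : ℂ} {a b x : ℝ}
    (h : HasDerivWithinAt f f' (Icc a b) x) (hx : x ∈ Ioo a b) : HasDerivAt f f' x :=
  h.hasDerivAt (Icc_mem_nhds hx.1 hx.2)

/-- Energy bound for a linear system with coefficients bounded by `β`. -/
lemma linear_energy {a11 a12 a21 a22 y1 y2 : ℝ → ℂ} {β : ℝ → ℝ} {a b : ℝ} (hab : a ≤ b)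
    (hβ : ContinuousOn β (Icc a b))
    (hy : LinSys a11 a12 a21 a22 y1 y2 (Icc a b))
    (hb : ∀ t ∈ Icc a b, ‖a11 t‖ ≤ β t ∧ ‖a12 t‖ ≤ β t ∧ ‖a21 t‖ ≤ β t ∧ ‖a22 t‖ ≤ β t) :
    ‖y1 b‖ ^ 2 + ‖y2 b‖ ^ 2 ≤ (‖y1 a‖ ^ 2 + ‖y2 a‖ ^ 2) * Real.exp (4 * ∫ t in a..b, β t) := by
  obtain ⟨c1, c2⟩ := hy.continuousOn
  have key := forward_gronwall (E := fun t => ‖y1 t‖ ^ 2 + ‖y2 t‖ ^ 2)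
    (P := fun t => 4 * ∫ s in a..t, β s) (c := fun t => 4 * β t) hab
    ((c1.norm.pow 2).add (c2.norm.pow 2))
    (fun t ht => (hasDerivAt_norm_sq ((hy t (Ioo_subset_Icc_self ht)).1.hasDerivAt_Ioo ht)).fun_add
      (hasDerivAt_norm_sq ((hy t (Ioo_subset_Icc_self ht)).2.hasDerivAt_Ioo ht)))
    (continuousOn_const.mul (continuousOn_primitive_Icc hab hβ))
    (fun t ht => (hasDerivAt_primitive hβ ht).const_mul 4) ?_
  · simpa using key
  · intro t ht
    obtain ⟨k1, k2, k3, k4⟩ := hb t (Ioo_subset_Icc_self ht)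
    have hβ0 : 0 ≤ β t := (norm_nonneg _).trans k1
    have r : ∀ {u c d z w : ℂ}, ‖c‖ ≤ β t → ‖d‖ ≤ β t → (conj u * (c * z + d * w)).re ≤
        ‖u‖ * (β t * ‖z‖ + β t * ‖w‖) := by
      intro u c d z w hc hd
      refine (re_le_norm _).trans ?_
      rw [norm_mul, RCLike.norm_conj]
      gcongr
      refine (norm_add_le _ _).trans ?_
      rw [norm_mul, norm_mul]
      gcongr
    have r1 := r (u := y1 t) (z := y1 t) (w := y2 t) k1 k2
    have r2 := r (u := y2 t) (z := y1 t) (w := y2 t) k3 k4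
    have : 0 ≤ β t * (‖y1 t‖ - ‖y2 t‖) ^ 2 := by positivity
    linarith

lemma hasDerivAt_exp_mul (a : ℂ) (t : ℝ) :
    HasDerivAt (fun s : ℝ => exp (a * s)) (exp (a * t) * a) t := by
  simpa using (((hasDerivAt_id t).ofReal_comp).const_mul a).cexp

/-- The Wronskian of two solutions of the `x`-system. -/
lemma wronskian_decay {l : ℂ} {f₁ f₂ g1 g2 : ℝ → ℂ} {a11 a12 a21 a22 : ℝ → ℂ} {a b : ℝ}
    (hab : a ≤ b) (htr : ∀ x ∈ Icc a b, a11 x + a22 x = -(2 * I * l))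
    (hf : LinSys a11 a12 a21 a22 f₁ f₂ (Icc a b)) (hg : LinSys a11 a12 a21 a22 g1 g2 (Icc a b)) :
    ‖f₁ a * g2 a - f₂ a * g1 a‖ =
      ‖f₁ b * g2 b - f₂ b * g1 b‖ * Real.exp (-(2 * l.im * (b - a))) := by
  set W : ℝ → ℂ := fun x => (f₁ x * g2 x - f₂ x * g1 x) * exp (2 * I * l * x) with hW
  have hd : ∀ x ∈ Icc a b, HasDerivWithinAt W 0 (Icc a b) x := by
    intro x hx
    refine ((((hf x hx).1.fun_mul (hg x hx).2).fun_sub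
      ((hf x hx).2.fun_mul (hg x hx).1)).fun_mul
      (hasDerivAt_exp_mul (2 * I * l) x).hasDerivWithinAt).congr_deriv ?_
    have : a11 x = -(2 * I * l) - a22 x := by rw [← htr x hx]; ring
    rw [this]
    ring
  have hc := constant_of_derivWithin_zero (a := a) (b := b) (f := W)
    (fun z hz => (hd z hz).differentiableWithinAt)
    (fun z hz => (hd z (Ico_subset_Icc_self hz)).derivWithin
      (uniqueDiffOn_Icc (hz.1.trans_lt hz.2) z (Ico_subset_Icc_self hz))) b ⟨hab, le_rfl⟩
  have hn : ∀ x : ℝ, ‖W x‖ = ‖f₁ x * g2 x - f₂ x * g1 x‖ * Real.exp (-(2 * l.im * x)) := by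
    intro x
    rw [hW, norm_mul, norm_exp]
    congr 2
    simp
  have h1 := congrArg norm hc
  rw [hn, hn] at h1
  rw [show -(2 * l.im * (b - a)) = -(2 * l.im * b) - -(2 * l.im * a) by ring, Real.exp_sub,
    ← mul_div_assoc, h1, mul_div_cancel_right₀ _ (Real.exp_pos _).ne']

section


/-- Growth factor controlling the time connection. -/
def growth (q : ℝ → ℝ → ℂ) (x t : ℝ) : ℝ := 1 + ‖q x t‖ ^ 2 + (‖dx q x t‖ ^ 2 + ‖q x t‖ ^ 6)

lemma norm_laxB22_le (l : ℂ) (x t : ℝ) : ‖laxB22 q l x t‖ ≤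
    ‖l‖ * ‖q x t‖ ^ 2 + ‖q x t‖ * ‖dx q x t‖ + 1 / 4 * ‖q x t‖ ^ 4 := by
  rw [laxB22]
  refine (norm_add₃_le).trans ?_
  have h1 : ‖I * l * (q x t * conj (q x t))‖ = ‖l‖ * ‖q x t‖ ^ 2 := by
    simp only [norm_mul, norm_I, RCLike.norm_conj]; ring
  have h2 : ‖-(1 / 2) * (dx q x t * conj (q x t) + -1 * (q x t * conj (dx q x t)))‖ ≤
      ‖q x t‖ * ‖dx q x t‖ := by
    rw [norm_mul]
    have := norm_add_le (dx q x t * conj (q x t)) (-1 * (q x t * conj (dx q x t)))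
    simp only [norm_mul, norm_neg, norm_one, RCLike.norm_conj] at this
    have e : ‖(-(1 / 2) : ℂ)‖ = 1 / 2 := by norm_num
    rw [e]
    linarith
  have h3 : ‖-(I / 4) * ((q x t * conj (q x t)) * (q x t * conj (q x t)))‖ =
      1 / 4 * ‖q x t‖ ^ 4 := by
    simp only [norm_mul, norm_neg, norm_div, norm_I, RCLike.norm_conj, norm_ofNat]
    ring
  rw [h1, h3]
  linarith

lemma norm_laxB21_le (l : ℂ) (x t : ℝ) : ‖laxB21 q l x t‖ ≤
    2 * ‖l‖ ^ 2 * ‖q x t‖ + ‖l‖ * ‖dx q x t‖ := by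
  rw [laxB21]
  refine (norm_add_le _ _).trans_eq ?_
  simp only [norm_mul, norm_neg, norm_pow, norm_I, RCLike.norm_conj, norm_ofNat]
  ring

lemma laxB_bound (l : ℂ) (x t : ℝ) : ‖laxB11 q l x t‖ ≤ 5 * (1 + ‖l‖) ^ 2 * growth q x t ∧
    ‖laxB12 q l x t‖ ≤ 5 * (1 + ‖l‖) ^ 2 * growth q x t ∧
    ‖laxB21 q l x t‖ ≤ 5 * (1 + ‖l‖) ^ 2 * growth q x t ∧
    ‖laxB22 q l x t‖ ≤ 5 * (1 + ‖l‖) ^ 2 * growth q x t := by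
  set Q := ‖q x t‖ with hQ
  set D := ‖dx q x t‖ with hD
  set L := ‖l‖ with hL
  have hQ0 : 0 ≤ Q := norm_nonneg _
  have hD0 : 0 ≤ D := norm_nonneg _
  have hL0 : 0 ≤ L := norm_nonneg _
  have hg : growth q x t = 1 + Q ^ 2 + (D ^ 2 + Q ^ 6) := rfl
  set s := growth q x t with hs
  have hs0 : 0 ≤ s := by rw [hg]; positivity
  have p1 : 1 ≤ s := by rw [hg]; nlinarith [sq_nonneg Q, sq_nonneg D, pow_nonneg hQ0 6]
  have p2 : Q ≤ s := by rw [hg]; nlinarith [sq_nonneg (Q - 1), sq_nonneg D, pow_nonneg hQ0 6]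
  have p3 : D ≤ s := by rw [hg]; nlinarith [sq_nonneg (D - 1), sq_nonneg Q, pow_nonneg hQ0 6]
  have p4 : Q ^ 2 ≤ s := by rw [hg]; nlinarith [sq_nonneg D, pow_nonneg hQ0 6]
  have p5 : Q * D ≤ s := by
    rw [hg]; nlinarith [sq_nonneg (Q - D), pow_nonneg hQ0 6, sq_nonneg Q, sq_nonneg D]
  have p6 : Q ^ 4 ≤ s := by
    have : 0 ≤ (Q - Q ^ 3) ^ 2 := sq_nonneg _
    rw [hg]; nlinarith [sq_nonneg Q, sq_nonneg D, pow_nonneg hQ0 6]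
  have b22 : ‖laxB22 q l x t‖ ≤ L * s + s + 1 / 4 * s := by
    refine (norm_laxB22_le l x t).trans ?_
    gcongr
  have e : (1 + L) ^ 2 * s = s + 2 * (L * s) + L ^ 2 * s := by ring
  have q1 : 0 ≤ L * s := by positivity
  have q2 : 0 ≤ L ^ 2 * s := by positivity
  have q3 : L ^ 2 ≤ L ^ 2 * s := le_mul_of_one_le_right (sq_nonneg _) p1
  refine ⟨?_, ?_, ?_, ?_⟩
  · have : ‖laxB11 q l x t‖ ≤ 4 * L ^ 2 + ‖laxB22 q l x t‖ := by
      rw [laxB11]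
      refine (norm_add_le _ _).trans_eq ?_
      simp [hL]
    linarith
  · have : ‖laxB12 q l x t‖ ≤ 2 * L * Q + D := by
      rw [laxB12]
      refine (norm_add_le _ _).trans_eq ?_
      simp [hL, hQ, hD]
    have h2 : L * Q ≤ L * s := by gcongr
    linarith
  · have := norm_laxB21_le (q := q) l x t
    have h2 : L ^ 2 * Q ≤ L ^ 2 * s := by gcongr
    have h3 : L * D ≤ L * s := by gcongr
    linarith
  · linarith

lemma norm_laxB21_sq_le (l : ℂ) (x t : ℝ) :
    ‖laxB21 q l x t‖ ^ 2 ≤ 8 * (1 + ‖l‖) ^ 4 * growth q x t := by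
  have hb := norm_laxB21_le (q := q) l x t
  rw [growth]
  set Q := ‖q x t‖
  set D := ‖dx q x t‖
  have h0 : 0 ≤ ‖l‖ * Q := by positivity
  have h1 : 0 ≤ ‖l‖ * D := by positivity
  have h2 : 0 ≤ ‖l‖ ^ 2 * D := by positivity
  have h3 : 0 ≤ 2 * Q + D := by positivity
  calc ‖laxB21 q l x t‖ ^ 2 ≤ ((1 + ‖l‖) ^ 2 * (2 * Q + D)) ^ 2 := by gcongr; linarith
    _ = (1 + ‖l‖) ^ 4 * (2 * Q + D) ^ 2 := by ring
    _ ≤ (1 + ‖l‖) ^ 4 * (8 * (1 + Q ^ 2 + (D ^ 2 + Q ^ 6))) := by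
        gcongr
        linarith [sq_nonneg (2 * Q - D), sq_nonneg D, show 0 ≤ Q ^ 6 by positivity]
    _ = _ := by ring

/-- The part of the fluxes that is small far away. -/
def flux (q : ℝ → ℝ → ℂ) (x t : ℝ) : ℝ := ‖q x t‖ ^ 2 + ‖q x t‖ * ‖dx q x t‖ + ‖q x t‖ ^ 4

lemma norm_laxB22_le_flux (l : ℂ) (x t : ℝ) : ‖laxB22 q l x t‖ ≤ (‖l‖ + 1) * flux q x t := by
  refine (norm_laxB22_le l x t).trans ?_
  have h1 : 0 ≤ ‖l‖ * (‖q x t‖ * ‖dx q x t‖ + ‖q x t‖ ^ 4) := by positivity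
  rw [flux]
  linarith [sq_nonneg ‖q x t‖, pow_nonneg (norm_nonneg (q x t)) 4]

lemma GISol.jost_bdd (hq : GISol q) {t : ℝ} (ht : 0 < t) : ∃ C, 0 ≤ C ∧ ∀ x, 0 < x → ∀ l ∈ UHPc,
    ‖giJ1 q l x t‖ ≤ C ∧ ‖giJ2 q l x t‖ ≤ C := by
  obtain ⟨C, hC, h⟩ := hq.jost_bound ht
  refine ⟨C + 1, by positivity, fun x hx l hl => ?_⟩
  obtain ⟨h1, -, h2⟩ := h x hx l hl
  have h3 : C / (1 + x) ≤ C := div_le_self hC (by linarith)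
  refine ⟨by linarith, ?_⟩
  have := norm_add_le (giJ2 q l x t - 1) 1
  simp only [sub_add_cancel, norm_one] at this
  linarith

lemma laxA_trace (l : ℂ) (x t : ℝ) :
    laxA11 q l x t + laxA22 q x t = -(2 * I * l) := by
  simp only [laxA11, laxA22]; ring

end

lemma continuousOn_growth (hs : SmoothQ q) {x a b : ℝ} (hx : 0 < x) (ha : 0 < a) :
    ContinuousOn (growth q x) (Icc a b) ∧ ContinuousOn (flux q x) (Icc a b) := by
  have sub : Icc a b ⊆ Ioi 0 := fun t ht => ha.trans_le ht.1
  have k1 := ((hs.continuousOn_t hx).mono sub).norm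
  have k2 := ((hs.dx.continuousOn_t hx).mono sub).norm
  exact ⟨(continuousOn_const.add (k1.pow 2)).add ((k2.pow 2).add (k1.pow 6)),
    ((k1.pow 2).add (k1.mul k2)).add (k1.pow 4)⟩

/-- Along suitable vertical lines tending to infinity the growth factor stays bounded in mean and
the fluxes tend to zero in mean. -/
lemma GISol.exists_far_lines (hq : GISol q) {x0 t0 t1 : ℝ} (hx0 : 0 < x0) (ht0 : 0 < t0)
    (ht : t0 ≤ t1) (h : ContinuousOn (tailMass q x0) (Icc t0 t1)) :
    ∃ C, 0 ≤ C ∧ ∃ X : ℕ → ℝ, (∀ n, x0 ≤ X n) ∧ Tendsto X atTop atTop ∧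
      (∀ n, ∫ r in t0..t1, growth q (X n) r ≤ C) ∧
      ∀ n : ℕ, ∫ r in t0..t1, flux q (X n) r ≤ C * (1 / (n + 1 : ℝ)) := by
  obtain ⟨C, hC, hgood⟩ := hq.exists_good_line hx0 ht0 ht h
  choose X hX0 hXn hXC hXδ using fun n : ℕ => hgood ((1 / (n + 1 : ℝ)) ^ 2) (by positivity) n
  refine ⟨t1 - t0 + 3 + C, by linarith, X, hX0,
    tendsto_atTop_mono hXn tendsto_natCast_atTop_atTop, fun n => ?_, fun n => ?_⟩
  all_goals
    have hXp := hx0.trans_le (hX0 n)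
    have sub : Icc t0 t1 ⊆ Ioi 0 := fun t ht => ht0.trans_le ht.1
    have k1 := ((hq.smooth.continuousOn_t hXp).mono sub).norm
    have k2 := ((hq.smooth.dx.continuousOn_t hXp).mono sub).norm
    have i1 := (k1.fun_pow 2).intervalIntegrable_of_Icc (μ := volume) ht
    have i2 := ((k2.fun_pow 2).fun_add (k1.fun_pow 6)).intervalIntegrable_of_Icc (μ := volume) ht
    have e1 := hXC n
    have e2 := hXδ n
    have hm : (1 : ℝ) ≤ n + 1 := by linarith [n.cast_nonneg (α := ℝ)]
    set m : ℝ := n + 1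
  · have h1 : (1 / m) ^ 2 ≤ 1 := pow_le_one₀ (by positivity) ((div_le_one (by linarith)).2 hm)
    have : ∫ r in t0..t1, growth q (X n) r = (t1 - t0) + (∫ r in t0..t1, ‖q (X n) r‖ ^ 2) +
        ∫ r in t0..t1, (‖dx q (X n) r‖ ^ 2 + ‖q (X n) r‖ ^ 6) := by
      simp only [growth]
      rw [intervalIntegral.integral_add (intervalIntegrable_const.add i1) i2,
        intervalIntegral.integral_add intervalIntegrable_const i1, intervalIntegral.integral_const]
      simp
    linarith
  · have h1 : ∫ r in t0..t1, flux q (X n) r ≤ ∫ r in t0..t1, (3 * m * ‖q (X n) r‖ ^ 2 +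
        1 / m * (‖dx q (X n) r‖ ^ 2 + ‖q (X n) r‖ ^ 6)) := by
      refine integral_mono_on ht
        ((continuousOn_growth hq.smooth hXp ht0).2.intervalIntegrable_of_Icc ht)
        ((i1.const_mul _).add (i2.const_mul _)) fun r _ => ?_
      rw [flux]
      set Q := ‖q (X n) r‖
      have am : ∀ b, Q * b ≤ m * Q ^ 2 + 1 / m * b ^ 2 := fun b => by
        have h1 : 0 ≤ 1 / m * (m * Q - b) ^ 2 := by positivity
        have h2 : 1 / m * (m * Q - b) ^ 2 = m * Q ^ 2 - 2 * (Q * b) + 1 / m * b ^ 2 := by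
          field_simp; ring
        have h3 : 0 ≤ m * Q ^ 2 + 1 / m * b ^ 2 := by positivity
        linarith
      linarith [am ‖dx q (X n) r‖, am (Q ^ 3), le_mul_of_one_le_left (sq_nonneg Q) hm]
    rw [intervalIntegral.integral_add (i1.const_mul _) (i2.const_mul _),
      intervalIntegral.integral_const_mul, intervalIntegral.integral_const_mul] at h1
    have h2 : 3 * m * (∫ r in t0..t1, ‖q (X n) r‖ ^ 2) ≤ 3 * m * (1 / m) ^ 2 := by gcongr
    have h3 : 1 / m * (∫ r in t0..t1, (‖dx q (X n) r‖ ^ 2 + ‖q (X n) r‖ ^ 6)) ≤ 1 / m * C := by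
      gcongr
    have h4 : 3 * m * (1 / m) ^ 2 = 3 * (1 / m) := by field_simp
    have h5 : 0 ≤ (t1 - t0) * (1 / m) := mul_nonneg (by linarith) (by positivity)
    linarith

lemma exists_mul_of_det_eq_zero {a b y z : ℂ} (h : y * b - z * a = 0) (h0 : ¬ (a = 0 ∧ b = 0)) :
    ∃ k, y = k * a ∧ z = k * b := by
  by_cases hb : b = 0
  · have ha : a ≠ 0 := fun ha => h0 ⟨ha, hb⟩
    exact ⟨y / a, by field_simp, by simp_all⟩
  · exact ⟨z / b, by field_simp; linear_combination h, by field_simp⟩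

lemma norm_sub_le_integral {f f' : ℝ → ℂ} {g : ℝ → ℝ} {a b t : ℝ}
    (hf : ∀ t ∈ Icc a b, HasDerivWithinAt f (f' t) (Icc a b) t) (hf' : ContinuousOn f' (Icc a b))
    (hg : ContinuousOn g (Icc a b)) (h : ∀ t ∈ Icc a b, ‖f' t‖ ≤ g t) (ht : t ∈ Icc a b) :
    ‖f t - f a‖ ≤ ∫ r in a..b, g r := by
  have sub : Icc a t ⊆ Icc a b := Icc_subset_Icc_right ht.2
  rw [← intervalIntegral.integral_eq_sub_of_hasDerivAt_of_le ht.1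
    (fun r hr => ((hf r (sub hr)).mono sub).continuousWithinAt)
    (fun r hr => ((hf r (sub (Ioo_subset_Icc_self hr))).mono sub).hasDerivAt_Ioo hr)
    ((hf'.mono sub).intervalIntegrable_of_Icc ht.1)]
  refine (intervalIntegral.norm_integral_le_of_norm_le ht.1 (Eventually.of_forall fun r hr =>
    h r (sub (Ioc_subset_Icc_self hr))) ((hg.mono sub).intervalIntegrable_of_Icc ht.1)).trans ?_
  refine integral_mono_interval le_rfl ht.1 ht.2 ?_
    (hg.intervalIntegrable_of_Icc (ht.1.trans ht.2))
  filter_upwards [self_mem_ae_restrict measurableSet_Ioc] with r hr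
  exact (norm_nonneg _).trans (h r (Ioc_subset_Icc_self hr))

/-- Propagation in the open half plane: the solution of the `t`-system issuing from the Jost
solution is the Jost solution. -/
lemma GISol.propagate_UHP (hq : GISol q) {x0 t0 t1 : ℝ} (hx0 : 0 < x0) (ht0 : 0 < t0)
    (ht : t0 ≤ t1) (h : ContinuousOn (tailMass q x0) (Icc t0 t1)) {l : ℂ} (hl : l ∈ UHP)
    {y1 y2 : ℝ → ℂ} (hy1 : y1 t0 = giJ1 q l x0 t0) (hy2 : y2 t0 = giJ2 q l x0 t0)
    (hy : LinSys (laxB11 q l x0) (laxB12 q l x0) (laxB21 q l x0) (laxB22 q l x0) y1 y2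
      (Icc t0 t1)) : ∀ t ∈ Icc t0 t1, y1 t = giJ1 q l x0 t ∧ y2 t = giJ2 q l x0 t := by
  have hs := hq.smooth
  have hl' := UHP_subset hl
  have him : 0 < l.im := hl
  have hlo := left_mem_Icc.2 ht
  have hpos : ∀ t ∈ Icc t0 t1, 0 < t := fun t ht => ht0.trans_le ht.1
  obtain ⟨C, hC, X, hX0, hXlim, hXC, hXf⟩ := hq.exists_far_lines hx0 ht0 ht h
  have hXpos : ∀ n, 0 < X n := fun n => hx0.trans_le (hX0 n)
  have hXm : ∀ n, X n ∈ Icc x0 (X n) := fun n => ⟨hX0 n, le_rfl⟩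
  choose F1 F2 hF0 hFx hFt using fun n =>
    (hq.zeroCurv l).extend_flow (a := t0) (b := t1) (X := X n) hx0 ht0 (hX0 n) hy
  have hsys := fun n => hFt n (X n) (hXm n)
  have cF := fun n => (hsys n).continuousOn
  have gI := fun n => (continuousOn_growth hs (b := t1) (hXpos n) ht0)
  -- at the initial time the flow is the Jost solution
  have hinit : ∀ n, F1 n (X n) t0 = giJ1 q l (X n) t0 ∧ F2 n (X n) t0 = giJ2 q l (X n) t0 :=
    fun n => (hFx n t0 hlo).unique (contOn_A hs l ht0 hx0) (hq.jost_within hl' ht0 hx0)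
      ((hF0 n t0 hlo).1.trans hy1) ((hF0 n t0 hlo).2.trans hy2) (X n) (hXm n)
  -- uniform bound along the good lines
  obtain ⟨Cj, hCj, hCjb⟩ := hq.jost_bdd ht0
  set c := 5 * (1 + ‖l‖) ^ 2 with hc
  set M := (2 * Cj ^ 2) * Real.exp (4 * (c * C)) with hM
  have hM0 : 0 ≤ M := by positivity
  have hbound : ∀ n, ∀ t ∈ Icc t0 t1, ‖F1 n (X n) t‖ ^ 2 + ‖F2 n (X n) t‖ ^ 2 ≤ M := by
    intro n t htt
    have subt : Icc t0 t ⊆ Icc t0 t1 := Icc_subset_Icc_right htt.2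
    refine (linear_energy (β := fun s => c * growth q (X n) s) htt.1
      (continuousOn_const.mul ((gI n).1.mono subt)) ((hsys n).mono subt)
      (fun s _ => laxB_bound l (X n) s)).trans ?_
    rw [(hinit n).1, (hinit n).2, intervalIntegral.integral_const_mul]
    obtain ⟨j1, j2⟩ := hCjb (X n) (hXpos n) l hl'
    have h4 : ∫ s in t0..t, growth q (X n) s ≤ C :=
      (integral_mono_interval le_rfl htt.1 htt.2 (Eventually.of_forall fun s => by
        simp only [growth, Pi.zero_apply]; positivity)
        ((gI n).1.intervalIntegrable_of_Icc ht)).trans (hXC n)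
    have h5 : ‖giJ1 q l (X n) t0‖ ^ 2 + ‖giJ2 q l (X n) t0‖ ^ 2 ≤ 2 * Cj ^ 2 := by
      rw [two_mul]; gcongr
    rw [hM]
    gcongr
  set N := M + 1 with hN
  have hN1 : ∀ n, ∀ t ∈ Icc t0 t1, ‖F1 n (X n) t‖ ≤ N := fun n t htt => by
    nlinarith [hbound n t htt, sq_nonneg ‖F2 n (X n) t‖, sq_nonneg (‖F1 n (X n) t‖ - 1)]
  have hN2 : ∀ n, ∀ t ∈ Icc t0 t1, ‖F2 n (X n) t‖ ≤ N := fun n t htt => by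
    nlinarith [hbound n t htt, sq_nonneg ‖F1 n (X n) t‖, sq_nonneg (‖F2 n (X n) t‖ - 1)]
  -- the Wronskian vanishes
  have hdet : ∀ t ∈ Icc t0 t1, y1 t * giJ2 q l x0 t - y2 t * giJ1 q l x0 t = 0 := by
    intro t htt
    obtain ⟨D, hD, hDb⟩ := hq.jost_bdd (hpos t htt)
    have hlim : Tendsto (fun n => 2 * N * D * Real.exp (-(2 * l.im * (X n - x0)))) atTop (𝓝 0) := by
      have e1 : Tendsto (fun n => 2 * l.im * (X n - x0)) atTop atTop :=
        (tendsto_atTop_add_const_right _ (-x0) hXlim).const_mul_atTop (by positivity)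
      simpa using (Real.tendsto_exp_neg_atTop_nhds_zero.comp e1).const_mul (2 * N * D)
    refine norm_le_zero_iff.1 (ge_of_tendsto' hlim fun n => ?_)
    have h1 := wronskian_decay (hX0 n) (fun x _ => laxA_trace l x t) (hFx n t htt)
      (hq.jost_within hl' (hpos t htt) hx0)
    rw [(hF0 n t htt).1, (hF0 n t htt).2] at h1
    rw [h1]
    gcongr
    obtain ⟨j1, j2⟩ := hDb (X n) (hXpos n) l hl'
    refine (norm_sub_le _ _).trans ?_
    rw [norm_mul, norm_mul, mul_assoc 2, two_mul]
    have k1 := hN1 n t htt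
    have k2 := hN2 n t htt
    gcongr
  have hκ : ∀ t, ∃ k : ℂ, t ∈ Icc t0 t1 → y1 t = k * giJ1 q l x0 t ∧ y2 t = k * giJ2 q l x0 t := by
    intro t
    by_cases htt : t ∈ Icc t0 t1
    · obtain ⟨k, hk⟩ := exists_mul_of_det_eq_zero (hdet t htt)
        (hq.jost_ne_zero hl' hx0 (hpos t htt))
      exact ⟨k, fun _ => hk⟩
    · exact ⟨0, fun h => absurd h htt⟩
  choose κ hκ using hκ
  have hFκ : ∀ t ∈ Icc t0 t1, ∀ n, F1 n (X n) t = κ t * giJ1 q l (X n) t ∧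
      F2 n (X n) t = κ t * giJ2 q l (X n) t := by
    intro t htt n
    have hj := hq.jost_within hl' (hpos t htt) hx0 (b := X n)
    exact (hFx n t htt).unique (z1 := fun x => κ t * giJ1 q l x t)
      (z2 := fun x => κ t * giJ2 q l x t) (contOn_A hs l (hpos t htt) hx0)
      (fun x hx => ⟨((hj x hx).1.const_mul (κ t)).congr_deriv (by ring),
        ((hj x hx).2.const_mul (κ t)).congr_deriv (by ring)⟩)
      ((hF0 n t htt).1.trans (hκ t htt).1) ((hF0 n t htt).2.trans (hκ t htt).2) (X n) (hXm n)
  have hF1lim : ∀ t ∈ Icc t0 t1, Tendsto (fun n => F1 n (X n) t) atTop (𝓝 0) := fun t htt => by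
    simpa [hFκ t htt] using ((hq.tendsto_jost (hpos t htt) hl').1.comp hXlim).const_mul (κ t)
  have hF2lim : ∀ t ∈ Icc t0 t1, Tendsto (fun n => F2 n (X n) t) atTop (𝓝 (κ t)) := fun t htt => by
    simpa [hFκ t htt] using ((hq.tendsto_jost (hpos t htt) hl').2.comp hXlim).const_mul (κ t)
  -- the variation of the second component tends to zero
  have hJ : Tendsto (fun n => ∫ r in t0..t1, ‖F1 n (X n) r‖ ^ 2) atTop (𝓝 0) := by
    have hm : ∀ {r}, r ∈ uIoc t0 t1 → r ∈ Icc t0 t1 := fun hr =>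
      Ioc_subset_Icc_self (by rwa [uIoc_of_le ht] at hr)
    simpa using intervalIntegral.tendsto_integral_filter_of_dominated_convergence (μ := volume)
      (a := t0) (b := t1) (l := atTop) (F := fun n r => ‖F1 n (X n) r‖ ^ 2) (f := fun _ => (0 : ℝ))
      (fun _ => N ^ 2) (Eventually.of_forall fun n =>
        (((cF n).1.norm.pow 2).mono fun r hr => hm hr).aestronglyMeasurable measurableSet_uIoc)
      (Eventually.of_forall fun n => Eventually.of_forall fun r hr => by
        rw [Real.norm_eq_abs, abs_of_nonneg (by positivity)]
        have := hN1 n r (hm hr)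
        gcongr) (by simp)
      (Eventually.of_forall fun r hr => by simpa using (hF1lim r (hm hr)).norm.pow 2)
  set K := 8 * (1 + ‖l‖) ^ 4 with hK
  have hle : ∀ t ∈ Icc t0 t1, ∀ n : ℕ, ‖F2 n (X n) t - F2 n (X n) t0‖ ≤
      √(K * C * ∫ r in t0..t1, ‖F1 n (X n) r‖ ^ 2) +
        N * (‖l‖ + 1) * (C * (1 / (n + 1 : ℝ))) := by
    intro t htt n
    obtain ⟨-, -, b3, b4⟩ := contOn_B hs l (b := t1) (hXpos n) ht0
    have c1 := b3.norm.fun_mul (cF n).1.norm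
    have c2 := (gI n).2.fun_const_smul (N * (‖l‖ + 1))
    refine (norm_sub_le_integral (fun r hr => (hsys n r hr).2)
      ((b3.mul (cF n).1).add (b4.mul (cF n).2)) (c1.fun_add c2) (fun r hr => ?_) htt).trans ?_
    · refine (norm_add_le _ _).trans ?_
      simp only [norm_mul, smul_eq_mul]
      have h1 := mul_le_mul (norm_laxB22_le_flux (q := q) l (X n) r) (hN2 n r hr) (norm_nonneg _)
        ((norm_nonneg _).trans (norm_laxB22_le_flux (q := q) l (X n) r))
      linarith
    · rw [intervalIntegral.integral_add (c1.intervalIntegrable_of_Icc ht)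
        (c2.intervalIntegrable_of_Icc ht), intervalIntegral.integral_smul, smul_eq_mul]
      refine add_le_add (Real.le_sqrt_of_sq_le ((sq_integral_mul_le ht b3.norm
        (cF n).1.norm).trans ?_)) (by have := hXf n; gcongr)
      gcongr
      · exact intervalIntegral.integral_nonneg ht fun _ _ => by positivity
      · refine (integral_mono_on ht ((b3.norm.pow 2).intervalIntegrable_of_Icc ht)
          (((gI n).1.fun_const_smul K).intervalIntegrable_of_Icc ht)
          fun r _ => norm_laxB21_sq_le l (X n) r).trans ?_
        rw [intervalIntegral.integral_smul, smul_eq_mul]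
        have := hXC n
        gcongr
  have hκ1 : ∀ t ∈ Icc t0 t1, κ t = κ t0 := by
    intro t htt
    have h1 := (Real.continuous_sqrt.tendsto _).comp (hJ.const_mul (K * C))
    have h2 := ((tendsto_one_div_add_atTop_nhds_zero_nat (𝕜 := ℝ)).const_mul C).const_mul
      (N * (‖l‖ + 1))
    have := le_of_tendsto_of_tendsto' ((hF2lim t htt).sub (hF2lim t0 hlo)).norm (h1.add h2)
      (hle t htt)
    rwa [mul_zero, mul_zero, mul_zero, Real.sqrt_zero, add_zero, norm_le_zero_iff,
      sub_eq_zero] at this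
  have hκ0 : κ t0 = 1 := by
    obtain ⟨h1, h2⟩ := hκ t0 hlo
    rw [hy1] at h1
    rw [hy2] at h2
    by_contra hk
    exact hq.jost_ne_zero hl' hx0 ht0
      ⟨by_contra fun h => hk (right_eq_mul₀ h |>.1 h1), by_contra fun h => hk (right_eq_mul₀ h |>.1 h2)⟩
  intro t htt
  obtain ⟨h1, h2⟩ := hκ t htt
  rw [hκ1 t htt, hκ0, one_mul] at h1 h2
  exact ⟨h1, h2⟩

lemma exists_laxB_le (hs : SmoothQ q) {x a b R : ℝ} (hx : 0 < x) (ha : 0 < a) (hR : 0 ≤ R) :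
    ∃ M, 0 ≤ M ∧ ∀ l : ℂ, ‖l‖ ≤ R → ∀ t ∈ Icc a b,
      ‖laxB11 q l x t‖ ≤ M ∧ ‖laxB12 q l x t‖ ≤ M ∧ ‖laxB21 q l x t‖ ≤ M ∧
      ‖laxB22 q l x t‖ ≤ M := by
  obtain ⟨G, hG⟩ := isCompact_Icc.exists_bound_of_continuousOn
    (continuousOn_growth hs (b := b) hx ha).1
  refine ⟨5 * (1 + R) ^ 2 * max G 0, by positivity, fun l hl t ht => ?_⟩
  have hg := (le_abs_self _).trans ((hG t ht).trans (le_max_left G 0))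
  have : 5 * (1 + ‖l‖) ^ 2 * growth q x t ≤ 5 * (1 + R) ^ 2 * max G 0 := by
    refine mul_le_mul (by gcongr) hg ?_ (by positivity)
    simp only [growth]; positivity
  obtain ⟨h1, h2, h3, h4⟩ := laxB_bound (q := q) l x t
  exact ⟨h1.trans this, h2.trans this, h3.trans this, h4.trans this⟩

/-- Where the mass is continuous, the Jost solutions obey the `t`-part of the Lax pair. -/
theorem GISol.jost_t_system (hq : GISol q) {x0 t0 t1 : ℝ} (hx0 : 0 < x0) (ht0 : 0 < t0)
    (ht : t0 ≤ t1) (h : ContinuousOn (tailMass q x0) (Icc t0 t1)) {l : ℂ} (hl : l ∈ UHPc) :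
    LinSys (laxB11 q l x0) (laxB12 q l x0) (laxB21 q l x0) (laxB22 q l x0) (giJ1 q l x0)
      (giJ2 q l x0) (Icc t0 t1) := by
  have hs := hq.smooth
  have : (𝓝[UHP] l).NeBot := mem_closure_iff_nhdsWithin_neBot.1
    (by rw [UHP, Complex.closure_setOfPred_lt_im]; exact hl)
  have c := fun {f : ℝ → ℝ → ℂ} (hf : SmoothQ f) => ((hf.continuousOn_t hx0).mono
    fun t (h : t ∈ Icc t0 t1) => ht0.trans_le h.1).comp (s := (univ : Set ℂ) ×ˢ Icc t0 t1)
    continuousOn_snd fun p hp => hp.2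
  have c1 : ContinuousOn (fun p : ℂ × ℝ => q x0 p.2) (univ ×ˢ Icc t0 t1) := c hs
  have c2 : ContinuousOn (fun p : ℂ × ℝ => dx q x0 p.2) (univ ×ˢ Icc t0 t1) := c hs.dx
  have c0 : ContinuousOn (fun p : ℂ × ℝ => p.1) (univ ×ˢ Icc t0 t1) := continuousOn_fst
  obtain ⟨k1, k2, k3, k4⟩ := c0.bdB c1 c2
  have ev := fun {f : ℂ × ℝ → ℂ} {ε : ℝ} (hε : 0 < ε) (hf : ContinuousOn f
    (univ ×ˢ Icc t0 t1)) => (eventually_norm_sub_le (f := fun l t => f (l, t)) isCompact_Icc hf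
    (mem_univ l) hε).filter_mono (nhdsWithin_mono l (subset_univ UHP))
  refine LinSys.limit (F := 𝓝[UHP] l) (a11 := (laxB11 q · x0)) (a12 := (laxB12 q · x0))
    (a21 := (laxB21 q · x0)) (a22 := (laxB22 q · x0)) (y1 := (giJ1 q · x0)) (y2 := (giJ2 q · x0))
    ht (contOn_B hs l hx0 ht0) (fun ε hε => ?_) ?_ fun t htt => ?_
  · filter_upwards [ev hε k1, ev hε k2, ev hε k3, ev hε k4] with l' h1 h2 h3 h4 t ht
    exact ⟨h1 t ht, h2 t ht, h3 t ht, h4 t ht⟩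
  · filter_upwards [self_mem_nhdsWithin] with l' hl'
    obtain ⟨y1, y2, h1, h2, hy⟩ := (contOn_B hs l' hx0 ht0).exists_sol (left_mem_Icc.2 ht)
      (giJ1 q l' x0 t0) (giJ2 q l' x0 t0)
    exact hy.congr (hq.propagate_UHP hx0 ht0 ht h hl' h1 h2 hy)
  · obtain ⟨r1, r2, -⟩ := hq.jost_regular hx0 (ht0.trans_le htt.1)
    exact ⟨(r1 l hl).mono_left (nhdsWithin_mono l UHP_subset),
      (r2 l hl).mono_left (nhdsWithin_mono l UHP_subset)⟩

/-- The balance of mass to the right of `x0`. -/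
theorem GISol.mass_balance (hq : GISol q) {x0 t0 t1 : ℝ} (hx0 : 0 < x0) (ht0 : 0 < t0)
    (ht : t0 ≤ t1) (h : ContinuousOn (tailMass q x0) (Icc t0 t1)) :
    tailMass q x0 t1 - tailMass q x0 t0 = ∫ r in t0..t1, (massFlux q x0 r).re := by
  have hs := hq.smooth
  obtain ⟨C, hC, X, hX0, hXlim, -, hXf⟩ := hq.exists_far_lines hx0 ht0 ht h
  have hXpos : ∀ n, 0 < X n := fun n => hx0.trans_le (hX0 n)
  have hpos1 : 0 < t1 := ht0.trans_le ht
  have sub : Icc t0 t1 ⊆ Ioi 0 := fun t ht => ht0.trans_le ht.1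
  have hF : ∀ x, 0 < x → ContinuousOn (fun r => massFlux q x r) (Icc t0 t1) := fun x hx =>
    ((smooth_massFlux hs).continuousOn_t hx).mono sub
  have hFi : ∀ x, 0 < x → IntervalIntegrable (fun r => massFlux q x r) volume t0 t1 :=
    fun x hx => (hF x hx).intervalIntegrable_of_Icc ht
  have hbal : ∀ n, (((∫ z in x0..X n, ‖q z t1‖ ^ 2) - ∫ z in x0..X n, ‖q z t0‖ ^ 2 : ℝ) : ℂ) =
      (∫ r in t0..t1, massFlux q x0 r) - ∫ r in t0..t1, massFlux q (X n) r := by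
    intro n
    have hb := balance_law (smooth_rhoC hs) (smooth_massFlux hs) hq.mass_law (w := fun _ => 1)
      (w' := fun _ => 0) (fun x => hasDerivAt_const x 1) continuous_const hx0 (hX0 n) ht0 ht
    simp only [ofReal_one, one_mul, ofReal_zero, zero_mul,
      intervalIntegral.integral_zero, add_zero, rhoC_eq] at hb
    rw [intervalIntegral.integral_sub (hFi x0 hx0) (hFi (X n) (hXpos n))] at hb
    rw [← hb, intervalIntegral.integral_ofReal, intervalIntegral.integral_ofReal]
    push_cast
    rfl
  -- the flux at the far lines tends to zero
  have hfar : ∀ n : ℕ, ‖∫ r in t0..t1, massFlux q (X n) r‖ ≤ 2 * (C * (1 / (n + 1 : ℝ))) := by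
    intro n
    have := hXf n
    refine (intervalIntegral.norm_integral_le_of_norm_le ht (g := fun r => 2 * flux q (X n) r)
      (Eventually.of_forall fun r hr => ?_) (((continuousOn_growth hs (hXpos n)
        ht0).2.intervalIntegrable_of_Icc ht).const_mul 2)).trans ?_
    · rw [massFlux, flux]
      refine (norm_add_le _ _).trans ?_
      simp only [norm_mul, norm_rhoC, norm_ofNat, norm_div, norm_one]
      linarith [norm_momC_le (q := q) (X n) r, sq_nonneg ‖q (X n) r‖,
        pow_nonneg (norm_nonneg (q (X n) r)) 4]
    · rw [intervalIntegral.integral_const_mul]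
      gcongr
  have hfar0 : Tendsto (fun n => ∫ r in t0..t1, massFlux q (X n) r) atTop (𝓝 0) :=
    squeeze_zero_norm hfar (by simpa using
      ((tendsto_one_div_add_atTop_nhds_zero_nat (𝕜 := ℝ)).const_mul C).const_mul 2)
  have hwin : ∀ t, 0 < t → Tendsto (fun n => ∫ z in x0..X n, ‖q z t‖ ^ 2) atTop
      (𝓝 (tailMass q x0 t)) := fun t htp =>
    intervalIntegral_tendsto_integral_Ioi x0 (hq.integrable_mass hx0.le htp) hXlim
  have l1 : Tendsto (fun n => (((∫ z in x0..X n, ‖q z t1‖ ^ 2) -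
      ∫ z in x0..X n, ‖q z t0‖ ^ 2 : ℝ) : ℂ)) atTop
      (𝓝 ((tailMass q x0 t1 - tailMass q x0 t0 : ℝ) : ℂ)) :=
    (continuous_ofReal.tendsto _).comp ((hwin t1 hpos1).sub (hwin t0 ht0))
  have l2 := hfar0.const_sub (∫ r in t0..t1, massFlux q x0 r)
  have e := tendsto_nhds_unique l1 (l2.congr fun n => (hbal n).symm)
  have e' := congrArg Complex.re e
  rw [ofReal_re, sub_zero] at e'
  rw [e']
  exact (reCLM.intervalIntegral_comp_comm (hFi x0 hx0)).symm

lemma norm_le_of_decaying_source {z r : ℝ → ℂ} {l : ℂ} (hl : l ∈ UHPc) {x0 K : ℝ} (hx0 : 0 < x0)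
    (hz : ∀ x, x0 ≤ x → HasDerivAt z (-(2 * I * l) * z x + r x) x)
    (hr : ∀ x, x0 ≤ x → ‖r x‖ ≤ K / (1 + x) ^ 2) (hlim : Tendsto z atTop (𝓝 0)) :
    ‖z x0‖ ≤ K := by
  have him : 0 ≤ l.im := hl
  have hK : 0 ≤ K := by
    have h := (norm_nonneg _).trans (hr x0 le_rfl)
    have h2 : 0 < (1 + x0) ^ 2 := by positivity
    by_contra hc
    exact absurd h (not_le.2 (div_neg_of_neg_of_pos (not_le.1 hc) h2))
  set e : ℝ → ℂ := fun x => exp (2 * I * l * ((x - x0 : ℝ) : ℂ)) with he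
  have hed : ∀ x, HasDerivAt e (e x * (2 * I * l)) x := fun x =>
    (hasDerivAt_exp_mul (2 * I * l) (x - x0)).comp_sub_const x x0
  have hen : ∀ x, x0 ≤ x → ‖e x‖ ≤ 1 := by
    intro x hx
    rw [he, norm_exp]
    refine Real.exp_le_one_iff.2 ?_
    have : (2 * I * l * ((x - x0 : ℝ) : ℂ)).re = -(2 * l.im * (x - x0)) := by simp [mul_re, mul_im]
    rw [this]
    have : 0 ≤ l.im * (x - x0) := mul_nonneg him (by linarith)
    linarith
  have hw : ∀ x, x0 ≤ x → HasDerivAt (fun x => e x * z x) (e x * r x) x := fun x hx =>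
    ((hed x).fun_mul (hz x hx)).congr_deriv (by ring)
  have hB : ∀ x, x0 ≤ x → HasDerivAt (fun x => K / (1 + x0) - K / (1 + x)) (K / (1 + x) ^ 2) x := by
    intro x hx
    have h1 : (1 : ℝ) + x ≠ 0 := by linarith
    have h2 := (((hasDerivAt_id' x).const_add 1).fun_inv h1).const_mul K
    refine ((h2.const_sub (K / (1 + x0))).congr_deriv (by field_simp)).congr_of_eventuallyEq ?_
    exact Eventually.of_forall fun y => by simp [div_eq_mul_inv]
  have hmain : ∀ x, x0 ≤ x → ‖e x * z x - e x0 * z x0‖ ≤ K := by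
    intro x hx
    have h1 := image_norm_le_of_norm_deriv_right_le_deriv_boundary'
      (f := fun y => e y * z y - e x0 * z x0) (f' := fun y => e y * r y) (a := x0) (b := x)
      (B := fun y => K / (1 + x0) - K / (1 + y)) (B' := fun y => K / (1 + y) ^ 2)
      (fun y hy => ((hw y hy.1).sub_const _).continuousAt.continuousWithinAt)
      (fun y hy => ((hw y hy.1).sub_const _).hasDerivWithinAt) (by simp)
      (fun y hy => (hB y hy.1).continuousAt.continuousWithinAt)
      (fun y hy => (hB y hy.1).hasDerivWithinAt)
      (fun y hy => by
        rw [norm_mul]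
        calc ‖e y‖ * ‖r y‖ ≤ 1 * ‖r y‖ := by gcongr; exact hen y hy.1
          _ ≤ _ := by rw [one_mul]; exact hr y hy.1)
    have h2 := h1 (right_mem_Icc.2 hx)
    have h3 : 0 ≤ K / (1 + x) := div_nonneg hK (by linarith)
    have h4 : K / (1 + x0) ≤ K := div_le_self hK (by linarith)
    exact h2.trans (by linarith)
  have hlim2 : Tendsto (fun x => e x * z x) atTop (𝓝 0) := by
    refine squeeze_zero_norm' ?_ (tendsto_zero_iff_norm_tendsto_zero.1 hlim)
    filter_upwards [eventually_ge_atTop x0] with x hx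
    rw [norm_mul]
    exact mul_le_of_le_one_left (norm_nonneg _) (hen x hx)
  have h5 := (hlim2.sub_const (e x0 * z x0)).norm
  have h6 := le_of_tendsto h5 (by
    filter_upwards [eventually_ge_atTop x0] with x hx using hmain x hx)
  simpa [he] using h6

/-- Large `l` asymptotics of the Jost solutions at a fixed time. -/
lemma GISol.jost_asymptotics (hq : GISol q) {t : ℝ} (ht : 0 < t) :
    ∃ C, 0 ≤ C ∧ ∀ x0, 0 < x0 → ∀ l ∈ UHPc, 1 ≤ ‖l‖ → ‖l‖ * ‖giJ1 q l x0 t‖ ≤ C ∧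
      ‖l‖ * ‖akJ2 q l x0 t - 1‖ ≤ C ∧
      ‖l ^ 2 * (giJ1 q l x0 t - (l⁻¹ * (-(I / 2) * q x0 t) +
        l⁻¹ ^ 2 * (1 / 4 * dx q x0 t)) * akJ2 q l x0 t)‖ ≤ C := by
  obtain ⟨C, hC, hu, hv, hux, huxx⟩ := hq.exists_decay ht
  obtain ⟨D, hD, hj⟩ := hq.jost_bound ht
  have hdecay : ∀ {w : ℝ → ℂ}, Decay C w → ∀ x, 0 < x → ‖w x‖ ≤ C := fun hw x hx =>
    (hw.bound x hx).trans (div_le_self hC (one_le_pow₀ (by linarith)))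
  have hdiv : ∀ {w : ℝ → ℂ}, Decay C w → Tendsto w atTop (𝓝 0) := by
    intro w hw
    have hlim : Tendsto (fun x : ℝ => C / (1 + x)) atTop (𝓝 0) :=
      tendsto_const_nhds.div_atTop (tendsto_atTop_add_const_left _ _ tendsto_id)
    refine squeeze_zero_norm' ?_ hlim
    filter_upwards [eventually_gt_atTop 0] with x hx
    refine (hw.bound x hx).trans ?_
    gcongr
    nlinarith
  have hY1 : ∀ l ∈ UHPc, ∀ x, 0 < x → ‖giJ1 q l x t‖ ≤ D := fun l hl x hx =>
    (hj x hx l hl).1.trans (div_le_self hD (by linarith))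
  have hY2 : ∀ l ∈ UHPc, ∀ x, 0 < x → ‖akJ2 q l x t‖ ≤ D + 1 := fun l hl x hx => by
    have h1 := (hj x hx l hl).2.1.trans (div_le_self hD (by linarith))
    have h2 := norm_le_insert' (akJ2 q l x t) 1
    rw [norm_one] at h2
    linarith
  have I2 : I ^ 2 = -1 := I_sq
  have hs := hq.smooth
  set K1 := C * (1 + C ^ 2) * (D + 1) + C * C * (D + C * (D + 1)) with hK₁
  set K2 := C * (1 + C ^ 2) * (D + 1) + C * C * K1 with hK₂
  set K3 := K1 + C * (D + 1) with hK3
  have hK10 : 0 ≤ K1 := by positivity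
  have hK20 : 0 ≤ K2 := by positivity
  have hK30 : 0 ≤ K3 := by positivity
  have hK40 : 0 ≤ K3 * C := by positivity
  have main : ∀ x0, 0 < x0 → ∀ l ∈ UHPc, 1 ≤ ‖l‖ → ‖l‖ * ‖giJ1 q l x0 t‖ ≤ K3 ∧
      ‖l‖ * ‖akJ2 q l x0 t - 1‖ ≤ K3 * C ∧
      ‖l ^ 2 * (giJ1 q l x0 t - (l⁻¹ * (-(I / 2) * q x0 t) +
        l⁻¹ ^ 2 * (1 / 4 * dx q x0 t)) * akJ2 q l x0 t)‖ ≤ K2 := by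
    intro x0 hx0 l hl hl1
    have hlo : l ≠ 0 := by rintro rfl; simp at hl1; linarith
    have hκ : ‖l⁻¹‖ ≤ 1 := by rw [norm_inv]; exact inv_le_one_of_one_le₀ hl1
    set h : ℝ → ℂ := fun x => -(I / 2) * q x t + l⁻¹ * (1 / 4 * dx q x t) with hh
    set h' : ℝ → ℂ := fun x => -(I / 2) * dx q x t + l⁻¹ * (1 / 4 * dx (dx q) x t) with hh'
    set S : ℝ → ℂ := fun x => 1 / 4 * dx (dx q) x t + gaugeV q x t * h x ^ 2 with hS
    set Z : ℝ → ℂ := fun x => l * giJ1 q l x t - h x * akJ2 q l x t with hZ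
    have hhd : ∀ x, 0 < x → HasDerivAt h (h' x) x := fun x hx =>
      ((hs.hasDerivAt_x hx ht).const_mul _).fun_add
        (((hs.dx.hasDerivAt_x hx ht).const_mul _).const_mul _)
    have hhC : ∀ x, 0 < x → ‖h x‖ ≤ C := by
      intro x hx
      refine (norm_add_le _ _).trans ?_
      simp only [norm_mul, norm_neg, norm_div, norm_I, norm_ofNat, norm_one]
      have e1 : ‖q x t‖ ≤ C := hdecay hu x hx
      have e2 : ‖dx q x t‖ ≤ C := hdecay hux x hx
      have e3 : ‖l⁻¹‖ * (1 / 4 * ‖dx q x t‖) ≤ 1 * (1 / 4 * C) := by gcongr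
      linarith
    have hSC : ∀ x, 0 < x → ‖S x‖ ≤ C * (1 + C ^ 2) / (1 + x) ^ 2 := by
      intro x hx
      refine (norm_add_le _ _).trans ?_
      simp only [norm_mul, norm_div, norm_ofNat, norm_one, norm_pow]
      have e1 : ‖dx (dx q) x t‖ ≤ C / (1 + x) ^ 2 := huxx.bound x hx
      have e2 : ‖gaugeV q x t‖ ≤ C / (1 + x) ^ 2 := hv.bound x hx
      have e3 : ‖gaugeV q x t‖ * ‖h x‖ ^ 2 ≤ C / (1 + x) ^ 2 * C ^ 2 := by
        have := hhC x hx
        gcongr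
      have e4 : 0 ≤ C / (1 + x) ^ 2 := by positivity
      have e5 : C * (1 + C ^ 2) / (1 + x) ^ 2 = C / (1 + x) ^ 2 + C / (1 + x) ^ 2 * C ^ 2 := by ring
      linarith
    have hκZ : ∀ x, l⁻¹ * Z x = giJ1 q l x t - l⁻¹ * h x * akJ2 q l x t := by
      intro x; simp only [hZ]; field_simp
    have hZd : ∀ x, 0 < x → HasDerivAt Z (-(2 * I * l) * Z x +
        (-(l⁻¹ * S x * akJ2 q l x t) - h x * gaugeV q x t * (l⁻¹ * Z x))) x := by
      intro x hx
      obtain ⟨d1, d2⟩ := hq.hasDerivAt_akns hl hx ht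
      refine ((d1.const_mul l).fun_sub ((hhd x hx).fun_mul d2)).congr_deriv ?_
      simp only [hZ, hS, hh, hh']
      field_simp
      ring_nf
      simp only [I2]
      ring
    have hZbd : ∀ x, 0 < x → ‖l⁻¹ * Z x‖ ≤ D + C * (D + 1) := by
      intro x hx
      rw [hκZ]
      refine (norm_sub_le _ _).trans (add_le_add (hY1 l hl x hx) ?_)
      rw [norm_mul, norm_mul]
      have e1 := hhC x hx
      have e2 := hY2 l hl x hx
      calc ‖l⁻¹‖ * ‖h x‖ * ‖akJ2 q l x t‖ ≤ 1 * C * (D + 1) := by gcongr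
        _ = _ := by ring
    have j1 := (hq.tendsto_jost ht hl).1
    have j2 : Tendsto (fun x => akJ2 q l x t - 1) atTop (𝓝 0) := by
      have hlim : Tendsto (fun x : ℝ => D / (1 + x)) atTop (𝓝 0) :=
        tendsto_const_nhds.div_atTop (tendsto_atTop_add_const_left _ _ tendsto_id)
      refine squeeze_zero_norm' ?_ hlim
      filter_upwards [eventually_gt_atTop 0] with x hx using (hj x hx l hl).2.1
    have hlim0 : Tendsto h atTop (𝓝 0) := by
      have := ((hdiv hu).const_mul (-(I / 2))).add (((hdiv hux).const_mul (1 / 4)).const_mul l⁻¹)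
      simp only [mul_zero, add_zero] at this
      exact this
    have hZ0 : Tendsto Z atTop (𝓝 0) := by
      have j2' := j2.add_const 1
      simp only [sub_add_cancel] at j2'
      have := (j1.const_mul l).sub (hlim0.mul j2')
      simpa using this
    have bvh : ∀ x, 0 < x → ‖h x * gaugeV q x t‖ ≤ C * C / (1 + x) ^ 2 := by
      intro x hx
      rw [norm_mul, mul_div_assoc]
      exact mul_le_mul (hhC x hx) (hv.bound x hx) (norm_nonneg _) hC
    have bS : ∀ x, 0 < x → ‖S x * akJ2 q l x t‖ ≤
        C * (1 + C ^ 2) * (D + 1) / (1 + x) ^ 2 := by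
      intro x hx
      rw [norm_mul, mul_div_right_comm]
      exact mul_le_mul (hSC x hx) (hY2 l hl x hx) (norm_nonneg _) (by positivity)
    have bZ : ∀ x, 0 < x → ‖Z x‖ ≤ K1 := by
      intro x hx
      refine norm_le_of_decaying_source hl hx (fun y hy => hZd y (hx.trans_le hy)) ?_ hZ0
      intro y hy
      have hy0 := hx.trans_le hy
      refine (norm_sub_le _ _).trans ?_
      rw [norm_neg, mul_assoc, norm_mul, norm_mul (h y * _), hK₁, add_div]
      refine add_le_add ?_ ?_
      · calc ‖l⁻¹‖ * ‖S y * akJ2 q l y t‖ ≤ 1 * ‖S y * akJ2 q l y t‖ := by gcongr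
          _ ≤ _ := by rw [one_mul]; exact bS y hy0
      · rw [mul_div_right_comm]
        exact mul_le_mul (bvh y hy0) (hZbd y hy0) (norm_nonneg _) (by positivity)
    have bP : ‖l * Z x0‖ ≤ K2 := by
      refine norm_le_of_decaying_source (z := fun x => l * Z x)
        (r := fun x => -(S x * akJ2 q l x t) - h x * gaugeV q x t * Z x) hl hx0
        (fun y hy => ((hZd y (hx0.trans_le hy)).const_mul l).congr_deriv (by field_simp)) ?_
        (by simpa using hZ0.const_mul l)
      intro y hy
      have hy0 := hx0.trans_le hy
      refine (norm_sub_le _ _).trans ?_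
      rw [norm_neg, norm_mul (h y * _), hK₂, add_div]
      refine add_le_add (bS y hy0) ?_
      rw [mul_div_right_comm]
      exact mul_le_mul (bvh y hy0) (bZ y hy0) (norm_nonneg _) (by positivity)
    have bY : ∀ x, 0 < x → ‖l * giJ1 q l x t‖ ≤ K3 := by
      intro x hx
      have e : l * giJ1 q l x t = Z x + h x * akJ2 q l x t := by simp only [hZ]; ring
      rw [e]
      refine (norm_add_le _ _).trans (add_le_add (bZ x hx) ?_)
      rw [norm_mul]
      exact mul_le_mul (hhC x hx) (hY2 l hl x hx) (norm_nonneg _) hC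
    refine ⟨by rw [← norm_mul]; exact bY x0 hx0, ?_, ?_⟩
    · rw [← norm_mul]
      refine norm_le_of_decaying_source (z := fun x => l * (akJ2 q l x t - 1))
        (r := fun x => l * giJ1 q l x t * gaugeV q x t) (l := 0) (by simp [UHPc]) hx0
        (fun y hy => ((((hq.hasDerivAt_akns hl (hx0.trans_le hy) ht).2).sub_const 1).const_mul
          l).congr_deriv (by ring)) ?_ (by simpa using j2.const_mul l)
      intro y hy
      have hy0 := hx0.trans_le hy
      rw [norm_mul, mul_div_assoc]
      exact mul_le_mul (bY y hy0) (hv.bound y hy0) (norm_nonneg _) hK30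
    · refine le_of_eq_of_le ?_ bP
      congr 1
      simp only [hZ, hh]
      field_simp
  refine ⟨K3 + K3 * C + K2, by positivity, fun x0 hx0 l hl hl1 => ?_⟩
  obtain ⟨m1, m2, m3⟩ := main x0 hx0 l hl hl1
  exact ⟨by linarith, by linarith, by linarith⟩

/-- Two-sided energy bound for a linear system with bounded coefficients. -/
lemma linear_energy_two_sided {a11 a12 a21 a22 y1 y2 : ℝ → ℂ} {a b M : ℝ}
    (hy : LinSys a11 a12 a21 a22 y1 y2 (Icc a b))
    (hb : ∀ t ∈ Icc a b, ‖a11 t‖ ≤ M ∧ ‖a12 t‖ ≤ M ∧ ‖a21 t‖ ≤ M ∧ ‖a22 t‖ ≤ M)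
    {s t : ℝ} (hs : s ∈ Icc a b) (ht : t ∈ Icc a b) :
    ‖y1 t‖ ^ 2 + ‖y2 t‖ ^ 2 ≤ (‖y1 s‖ ^ 2 + ‖y2 s‖ ^ 2) * Real.exp (4 * (M * (b - a))) := by
  have hM : 0 ≤ M := (norm_nonneg _).trans (hb s hs).1
  rcases le_total s t with hst | hst
  · have sub : Icc s t ⊆ Icc a b := Icc_subset_Icc hs.1 ht.2
    refine (linear_energy (β := fun _ => M) hst continuousOn_const (hy.mono sub)
      fun r hr => hb r (sub hr)).trans ?_
    rw [intervalIntegral.integral_const, smul_eq_mul, mul_comm (t - s)]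
    have : t - s ≤ b - a := by linarith [hs.1, ht.2]
    gcongr
  · have sub : Icc t s ⊆ Icc a b := Icc_subset_Icc ht.1 hs.2
    have hy := hy.mono sub
    have map : ∀ r ∈ Icc (-s) (-t), -r ∈ Icc t s := fun r hr =>
      ⟨by linarith [hr.2], by linarith [hr.1]⟩
    have hneg : ∀ r ∈ Icc (-s) (-t), HasDerivWithinAt (fun r : ℝ => -r) (-1) (Icc (-s) (-t)) r :=
      fun r _ => (hasDerivAt_neg r).hasDerivWithinAt
    have := linear_energy (β := fun _ => M) (y1 := fun r => y1 (-r)) (y2 := fun r => y2 (-r))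
      (a11 := fun r => -a11 (-r)) (a12 := fun r => -a12 (-r)) (a21 := fun r => -a21 (-r))
      (a22 := fun r => -a22 (-r)) (neg_le_neg hst) continuousOn_const
      (fun r hr => ⟨((hy _ (map r hr)).1.scomp r (hneg r hr) map).congr_deriv (by simp),
        ((hy _ (map r hr)).2.scomp r (hneg r hr) map).congr_deriv (by simp)⟩)
      (fun r hr => by simp only [norm_neg]; exact hb _ (sub (map r hr)))
    simp only [neg_neg] at this
    refine this.trans ?_
    rw [intervalIntegral.integral_const, smul_eq_mul, mul_comm (-t - -s)]
    have : -t - -s ≤ b - a := by linarith [hs.2, ht.1]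
    gcongr

lemma LinSys.lipschitz {a11 a12 a21 a22 y1 y2 : ℝ → ℂ} {S : Set ℝ} {M C : ℝ}
    (hy : LinSys a11 a12 a21 a22 y1 y2 S) (hS : Convex ℝ S)
    (hb : ∀ t ∈ S, ‖a11 t‖ ≤ M ∧ ‖a12 t‖ ≤ M ∧ ‖a21 t‖ ≤ M ∧ ‖a22 t‖ ≤ M)
    (hC : ∀ t ∈ S, ‖y1 t‖ ≤ C ∧ ‖y2 t‖ ≤ C) {s t : ℝ} (hs : s ∈ S) (ht : t ∈ S) :
    ‖y1 t - y1 s‖ ≤ (M * C + M * C) * |t - s| ∧ ‖y2 t - y2 s‖ ≤ (M * C + M * C) * |t - s| := by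
  have hM : 0 ≤ M := (norm_nonneg _).trans (hb s hs).1
  have e : ∀ r ∈ S, ∀ α β : ℂ, ‖α‖ ≤ M → ‖β‖ ≤ M → ‖α * y1 r + β * y2 r‖ ≤ M * C + M * C := by
    intro r hr α β hα hβ
    obtain ⟨c1, c2⟩ := hC r hr
    refine (norm_add_le _ _).trans ?_
    rw [norm_mul, norm_mul]
    gcongr
  exact ⟨hS.norm_image_sub_le_of_norm_hasDerivWithin_le (fun r hr => (hy r hr).1)
      (fun r hr => e r hr _ _ (hb r hr).1 (hb r hr).2.1) hs ht,
    hS.norm_image_sub_le_of_norm_hasDerivWithin_le (fun r hr => (hy r hr).2)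
      (fun r hr => e r hr _ _ (hb r hr).2.2.1 (hb r hr).2.2.2) hs ht⟩

/-- The `t`-part of the Lax pair in the AKNS gauge. -/
lemma GISol.akns_t_system (hq : GISol q) {x0 t0 t1 : ℝ} (hx0 : 0 < x0) (ht0 : 0 < t0)
    (ht : t0 ≤ t1) (h : ContinuousOn (tailMass q x0) (Icc t0 t1)) {l : ℂ} (hl : l ∈ UHPc) :
    LinSys (fun t => -(4 * I * l ^ 2) - I * q x0 t * gaugeV q x0 t)
      (fun t => 2 * l * q x0 t + I * dx q x0 t)
      (fun t => 2 * l * gaugeV q x0 t - I * dx (gaugeV q) x0 t)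
      (fun t => I * q x0 t * gaugeV q x0 t) (giJ1 q l x0) (akJ2 q l x0) (Icc t0 t1) := by
  have hs := hq.smooth
  have I2 : I ^ 2 = -1 := I_sq
  have I3 : I ^ 3 = -I := by rw [pow_succ, I2]; ring
  intro t htt
  have htp := ht0.trans_le htt.1
  obtain ⟨h1, h2⟩ := hq.jost_t_system hx0 ht0 ht h hl t htt
  have hvx : dx (gaugeV q) x0 t = -(I / 2) * conj (dx (dx q) x0 t) +
      -(1 / 4) * (dx q x0 t * conj (q x0 t) ^ 2 +
        q x0 t * (2 * conj (q x0 t) * conj (dx q x0 t))) := by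
    have d0 := hs.hasDerivAt_x hx0 htp
    have d1 := (hs.dx.hasDerivAt_x hx0 htp).conjC
    have d2 := d0.conjC
    refine HasDerivAt.deriv (((d1.const_mul _).fun_add
      ((d0.fun_mul (d2.fun_pow 2)).const_mul _)).congr_deriv ?_)
    simp
  have hqt := (hs.hasDerivAt_t hx0 htp).conjC.hasDerivWithinAt (s := Icc t0 t1)
  rw [hq.conj_eq hx0 htp] at hqt
  have e : akJ2 q l x0 = fun s => giJ2 q l x0 s -
      I / 2 * (conj (q x0 s) * giJ1 q l x0 s) := by
    funext s; simp only [giJ2]; ring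
  refine ⟨h1.congr_deriv ?_, ?_⟩
  · simp only [laxB11, laxB12, laxB22, gaugeV, giJ2]
    ring_nf; simp only [I2]; ring
  · rw [e]
    refine (h2.fun_sub ((hqt.fun_mul h1).const_mul (I / 2))).congr_deriv ?_
    simp only [hvx, laxB11, laxB12, laxB21, laxB22, gaugeV, giJ2]
    ring_nf; simp only [I2, I3]; ring_nf

/-- Third coefficient of the large `l` expansion. -/
def wkb3 (q : ℝ → ℝ → ℂ) (x t : ℝ) : ℂ := 1 / 8 * dt q x t + I / 8 * (q x t * q x t * gaugeV q x t)

lemma GISol.smooth_wkb3 (hq : GISol q) : SmoothQ (wkb3 q) := (SmoothQ.const_mul _ hq.smooth.dt).add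
    (SmoothQ.const_mul _ ((hq.smooth.mul hq.smooth).mul hq.smooth_gaugeV))

lemma exists_bound_of_continuous {E : Type*} [NormedAddCommGroup E] [ProperSpace E] {Φ : E → ℂ}
    (hΦ : Continuous Φ) (R : ℝ) : ∃ C, 0 ≤ C ∧ ∀ p, ‖p‖ ≤ R → ‖Φ p‖ ≤ C := by
  obtain ⟨C, hC⟩ := (isCompact_closedBall (0 : E) R).exists_bound_of_continuousOn hΦ.continuousOn
  exact ⟨max C 0, le_max_right _ _, fun p hp => (hC p (by simpa using hp)).trans (le_max_left _ _)⟩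

lemma le_add_one_of_sq_add_sq_le {x y c : ℝ} (h : x ^ 2 + y ^ 2 ≤ c) : x ≤ c + 1 ∧ y ≤ c + 1 :=
  ⟨by nlinarith [sq_nonneg (x - 1)], by nlinarith [sq_nonneg (y - 1)]⟩

set_option maxHeartbeats 1000000 in
/-- Uniform in time large `l` bounds for the Jost solutions on the real line. -/
lemma GISol.jost_wkb (hq : GISol q) {x0 A B K : ℝ} (hx0 : 0 < x0) (hA : 0 < A) (hK : 0 ≤ K) :
    ∃ C, 0 ≤ C ∧ ∀ a b, A ≤ a → b ≤ B → ContinuousOn (tailMass q x0) (Icc a b) →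
      ∀ s ∈ Icc a b, ∀ l : ℝ, 1 ≤ ‖(l : ℂ)‖ → ‖(l : ℂ)‖ * ‖giJ1 q l x0 s‖ ≤ K →
      ‖(l : ℂ)‖ * ‖akJ2 q l x0 s - 1‖ ≤ K →
      ‖(l : ℂ) ^ 2 * (giJ1 q l x0 s - ((l : ℂ)⁻¹ * (-(I / 2) * q x0 s) +
        (l : ℂ)⁻¹ ^ 2 * (1 / 4 * dx q x0 s)) * akJ2 q l x0 s)‖ ≤ K →
      ∀ t ∈ Icc a b, ‖(l : ℂ)‖ * ‖giJ1 q l x0 t‖ ≤ C ∧ ‖(l : ℂ)‖ * ‖akJ2 q l x0 t - 1‖ ≤ C := by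
  have hs := hq.smooth
  have hv := hq.smooth_gaugeV
  have hg := hq.smooth_wkb3
  have I2 : I ^ 2 = -1 := I_sq
  have I3 : I ^ 3 = -I := by rw [pow_succ, I2]; ring
  obtain ⟨R1, _, hR1⟩ := hs.exists_bound_t (d := B) hx0 hA
  obtain ⟨R2, _, hR2⟩ := hs.dx.exists_bound_t (d := B) hx0 hA
  obtain ⟨R3, _, hR3⟩ := hv.exists_bound_t (d := B) hx0 hA
  obtain ⟨R4, _, hR4⟩ := hv.dx.exists_bound_t (d := B) hx0 hA
  obtain ⟨R5, _, hR5⟩ := hs.dx.dt.exists_bound_t (d := B) hx0 hA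
  obtain ⟨R6, _, hR6⟩ := hg.exists_bound_t (d := B) hx0 hA
  obtain ⟨R7, _, hR7⟩ := hg.dt.exists_bound_t (d := B) hx0 hA
  set R := 1 + R1 + R2 + R3 + R4 + R5 + R6 + R7 with hR
  have hR0 : 0 ≤ R := by positivity
  -- the coefficients of the diagonalised system
  let H : ℂ × ℂ × ℂ × ℂ × ℂ × ℂ × ℂ × ℂ → ℂ := fun ⟨κ, u, ux, _, _, _, g, _⟩ =>
    -(I / 2) * u + κ * (1 / 4 * ux) + κ ^ 2 * g
  let Φ11 : ℂ × ℂ × ℂ × ℂ × ℂ × ℂ × ℂ × ℂ → ℂ := fun ⟨κ, u, ux, v, vx, _, g, _⟩ =>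
    -(I * u * v) + (-(2 * v) + I * κ * vx) * (-(I / 2) * u + κ * (1 / 4 * ux) + κ ^ 2 * g)
  let Φ12 : ℂ × ℂ × ℂ × ℂ × ℂ × ℂ × ℂ × ℂ → ℂ := fun ⟨κ, u, ux, v, vx, uxt, g, gt⟩ =>
    (-(1 / 4) * uxt - I / 4 * (vx * u ^ 2)) +
    κ * (-(2 * I * u * v * g) - gt - 2 * v * (1 / 16 * ux ^ 2 - I * u * g) + 1 / 4 * vx * u * ux) +
    κ ^ 2 * (-(v * ux * g) + I * vx * (1 / 16 * ux ^ 2 - I * u * g)) +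
    κ ^ 3 * (-(2 * v * g ^ 2) + I / 2 * vx * ux * g) +
    κ ^ 4 * (I * vx * g ^ 2)
  let Φ21 : ℂ × ℂ × ℂ × ℂ × ℂ × ℂ × ℂ × ℂ → ℂ := fun ⟨κ, _, _, v, vx, _, _, _⟩ => 2 * v - I * κ * vx
  let Φ22 : ℂ × ℂ × ℂ × ℂ × ℂ × ℂ × ℂ × ℂ → ℂ := fun ⟨κ, u, ux, v, vx, _, g, _⟩ =>
    2 * v * (1 / 4 * ux + κ * g) - I * vx * (-(I / 2) * u + κ * (1 / 4 * ux) + κ ^ 2 * g)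
  obtain ⟨N0, _, hN0⟩ := exists_bound_of_continuous (Φ := H) (by fun_prop) R
  obtain ⟨N1, _, hN1⟩ := exists_bound_of_continuous (Φ := Φ11) (by fun_prop) R
  obtain ⟨N2, _, hN2⟩ := exists_bound_of_continuous (Φ := Φ12) (by fun_prop) R
  obtain ⟨N3, _, hN3⟩ := exists_bound_of_continuous (Φ := Φ21) (by fun_prop) R
  obtain ⟨N4, _, hN4⟩ := exists_bound_of_continuous (Φ := Φ22) (by fun_prop) R
  set N := N0 + N1 + N2 + N3 + N4 with hN
  have hNp : 0 ≤ N := by positivity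
  set W := ((K + R * (K + 1)) ^ 2 + (K + 1) ^ 2) * Real.exp (4 * (N * (B - A))) + 1 with hW
  have hW0 : 0 ≤ W := by positivity
  refine ⟨W + N * W + (K + 2 * N * W * |B - A|), by positivity, ?_⟩
  intro a b hAa hbB hm s hs' l hl1 k1 k2 k3 t htt
  have hab : a ≤ b := hs'.1.trans hs'.2
  have ha : 0 < a := hA.trans_le hAa
  have hlc : (l : ℂ) ∈ UHPc := by simp [UHPc]
  have hlo : (l : ℂ) ≠ 0 := by intro h0; rw [h0] at hl1; simp at hl1; linarith
  have hln : 0 < ‖(l : ℂ)‖ := by linarith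
  have hκ : ‖(l : ℂ)⁻¹‖ ≤ 1 := by rw [norm_inv]; exact inv_le_one_of_one_le₀ hl1
  set P : ℝ → ℂ × ℂ × ℂ × ℂ × ℂ × ℂ × ℂ × ℂ := fun r => ((l : ℂ)⁻¹, q x0 r, dx q x0 r,
    gaugeV q x0 r, dx (gaugeV q) x0 r, dt (dx q) x0 r, wkb3 q x0 r, dt (wkb3 q) x0 r) with hP
  have hAB : ∀ r ∈ Icc a b, r ∈ Icc A B := fun r hr => ⟨hAa.trans hr.1, hr.2.trans hbB⟩
  have hPR : ∀ r ∈ Icc a b, ‖P r‖ ≤ R := by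
    intro r hr
    have hr' := hAB r hr
    have e1 := hR1 r hr'
    have e2 := hR2 r hr'
    have e3 := hR3 r hr'
    have e4 := hR4 r hr'
    have e5 := hR5 r hr'
    have e6 := hR6 r hr'
    have e7 := hR7 r hr'
    simp only [hP, Prod.norm_mk, max_le_iff]
    refine ⟨?_, ?_, ?_, ?_, ?_, ?_, ?_, ?_⟩ <;> linarith
  have hsys := hq.akns_t_system hx0 ha hab hm hlc
  set e : ℝ → ℂ := fun r => exp (((4 * l ^ 2 * r : ℝ) : ℂ) * I) with he
  have hen : ∀ r, ‖e r‖ = 1 := fun r => Complex.norm_exp_ofReal_mul_I _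
  have hei : ∀ r, ‖(e r)⁻¹‖ = 1 := fun r => by rw [norm_inv, hen, inv_one]
  have he0 : ∀ r, e r ≠ 0 := fun r => exp_ne_zero _
  have hed : ∀ r, HasDerivAt e (e r * (4 * I * (l : ℂ) ^ 2)) r := by
    intro r
    have h1 : HasDerivAt (fun r : ℝ => ((4 * l ^ 2 * r : ℝ) : ℂ) * I)
        (4 * I * (l : ℂ) ^ 2) r := by
      have := (((hasDerivAt_id r).const_mul (4 * l ^ 2)).ofReal_comp).mul_const I
      refine this.congr_deriv ?_
      push_cast; ring
    exact h1.cexp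
  set p : ℝ → ℂ := fun r => (l : ℂ) ^ 2 * giJ1 q l x0 r - l * (H (P r) * akJ2 q l x0 r) with hp
  have hHd : ∀ r ∈ Icc a b, HasDerivWithinAt (fun r => H (P r)) (-(I / 2) * dt q x0 r +
      (l : ℂ)⁻¹ * (1 / 4 * dt (dx q) x0 r) + (l : ℂ)⁻¹ ^ 2 * dt (wkb3 q) x0 r) (Icc a b) r := by
    intro r hr
    have hr0 : 0 < r := ha.trans_le hr.1
    exact ((((hs.hasDerivAt_t hx0 hr0).const_mul _).fun_add
      (((hs.dx.hasDerivAt_t hx0 hr0).const_mul _).const_mul _)).fun_add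
      ((hg.hasDerivAt_t hx0 hr0).const_mul _)).hasDerivWithinAt
  have hsys' : LinSys (fun r => Φ11 (P r)) (fun r => e r * Φ12 (P r))
      (fun r => (l : ℂ)⁻¹ * (e r)⁻¹ * Φ21 (P r)) (fun r => (l : ℂ)⁻¹ * Φ22 (P r))
      (fun r => e r * p r) (akJ2 q l x0) (Icc a b) := by
    intro r hr
    obtain ⟨d1, d2⟩ := hsys r hr
    have hut : dt q x0 r = 8 * wkb3 q x0 r - I * (q x0 r * q x0 r * gaugeV q x0 r) := by
      rw [wkb3]; ring
    have he0r := he0 r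
    refine ⟨((hed r).hasDerivWithinAt.fun_mul ((d1.const_mul ((l : ℂ) ^ 2)).fun_sub
      (((hHd r hr).fun_mul d2).const_mul (l : ℂ)))).congr_deriv ?_, d2.congr_deriv ?_⟩
    · rw [hut]
      simp only [hp, H, Φ11, Φ12, hP]
      field_simp
      ring_nf; simp only [I2, I3]; ring_nf
    · simp only [hp, H, Φ21, Φ22, hP]
      field_simp
      ring_nf
  have hbd : ∀ r ∈ Icc a b, ‖Φ11 (P r)‖ ≤ N ∧ ‖e r * Φ12 (P r)‖ ≤ N ∧
      ‖(l : ℂ)⁻¹ * (e r)⁻¹ * Φ21 (P r)‖ ≤ N ∧ ‖(l : ℂ)⁻¹ * Φ22 (P r)‖ ≤ N := by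
    intro r hr
    have e1 := hN1 _ (hPR r hr)
    have e2 := hN2 _ (hPR r hr)
    have e3 := hN3 _ (hPR r hr)
    have e4 := hN4 _ (hPR r hr)
    refine ⟨by linarith, by rw [norm_mul, hen, one_mul]; linarith, ?_, ?_⟩
    · rw [norm_mul, norm_mul, hei, mul_one]
      have := mul_le_mul hκ e3 (norm_nonneg _) (by norm_num)
      linarith
    · rw [norm_mul]
      have := mul_le_mul hκ e4 (norm_nonneg _) (by norm_num)
      linarith
  have hY2s : ‖akJ2 q l x0 s‖ ≤ K + 1 := by
    have h1 := norm_le_insert' (akJ2 q l x0 s) 1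
    rw [norm_one] at h1
    have h2 : ‖akJ2 q l x0 s - 1‖ ≤ ‖(l : ℂ)‖ * ‖akJ2 q l x0 s - 1‖ :=
      le_mul_of_one_le_left (norm_nonneg _) hl1
    linarith
  have hps : ‖p s‖ ≤ K + R * (K + 1) := by
    have ep : p s = (l : ℂ) ^ 2 * (giJ1 q l x0 s - ((l : ℂ)⁻¹ * (-(I / 2) * q x0 s) +
        (l : ℂ)⁻¹ ^ 2 * (1 / 4 * dx q x0 s)) * akJ2 q l x0 s) -
        (l : ℂ)⁻¹ * wkb3 q x0 s * akJ2 q l x0 s := by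
      simp only [hp, H, hP]
      field_simp
      ring
    rw [ep]
    refine (norm_sub_le _ _).trans (add_le_add k3 ?_)
    rw [norm_mul, norm_mul]
    have e6 := hR6 s (hAB s hs')
    calc ‖(l : ℂ)⁻¹‖ * ‖wkb3 q x0 s‖ * ‖akJ2 q l x0 s‖ ≤ 1 * R * (K + 1) := by
          gcongr; linarith
      _ = _ := by ring
  have hen2 : ∀ r ∈ Icc a b, ‖p r‖ ≤ W ∧ ‖akJ2 q l x0 r‖ ≤ W := by
    intro r hr
    have h1 := linear_energy_two_sided hsys' hbd hs' hr
    simp only [norm_mul, hen, one_mul] at h1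
    have h2 : (‖p s‖ ^ 2 + ‖akJ2 q l x0 s‖ ^ 2) * Real.exp (4 * (N * (b - a))) ≤ W - 1 := by
      rw [hW, add_sub_cancel_right]
      have : b - a ≤ B - A := by linarith
      gcongr
    simpa using le_add_one_of_sq_add_sq_le (h1.trans h2)
  have hlκ : ‖(l : ℂ)‖ * ‖(l : ℂ)⁻¹‖ = 1 := by rw [norm_inv]; field_simp
  have hvar : ‖(l : ℂ)‖ * ‖akJ2 q l x0 t - akJ2 q l x0 s‖ ≤ 2 * N * W * |B - A| := by
    have h1 := (convex_Icc a b).norm_image_sub_le_of_norm_hasDerivWithin_le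
      (C := ‖(l : ℂ)⁻¹‖ * (2 * N * W)) (fun r hr => (hsys' r hr).2) (fun r hr => ?_) hs' htt
    · have h2 : ‖t - s‖ ≤ |B - A| := by
        rw [Real.norm_eq_abs, abs_le]
        have := le_abs_self (B - A)
        constructor <;> linarith [hs'.1, hs'.2, htt.1, htt.2]
      calc _ ≤ ‖(l : ℂ)‖ * (‖(l : ℂ)⁻¹‖ * (2 * N * W) * |B - A|) := by
            gcongr; exact h1.trans (by gcongr)
        _ = ‖(l : ℂ)‖ * ‖(l : ℂ)⁻¹‖ * (2 * N * W * |B - A|) := by ring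
        _ = _ := by rw [hlκ, one_mul]
    · have e3 := hN3 _ (hPR r hr)
      have e4 := hN4 _ (hPR r hr)
      obtain ⟨w1, w2⟩ := hen2 r hr
      refine (norm_add_le _ _).trans ?_
      simp only [norm_mul, hen, hei, mul_one, one_mul]
      have f1 : ‖Φ21 (P r)‖ * ‖p r‖ ≤ N * W := by gcongr; linarith
      have f2 : ‖Φ22 (P r)‖ * ‖akJ2 q l x0 r‖ ≤ N * W := by gcongr; linarith
      calc _ = ‖(l : ℂ)⁻¹‖ * (‖Φ21 (P r)‖ * ‖p r‖ + ‖Φ22 (P r)‖ * ‖akJ2 q l x0 r‖) := by ring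
        _ ≤ ‖(l : ℂ)⁻¹‖ * (2 * N * W) := by gcongr; linarith
  obtain ⟨w1, w2⟩ := hen2 t htt
  have hNW : 0 ≤ N * W := by positivity
  have hBA : 0 ≤ 2 * N * W * |B - A| := by positivity
  constructor
  · have e1 : (l : ℂ) * giJ1 q l x0 t = (l : ℂ)⁻¹ * p t + H (P t) * akJ2 q l x0 t := by
      simp only [hp]; field_simp; ring
    rw [← norm_mul, e1]
    refine (norm_add_le _ _).trans ?_
    rw [norm_mul, norm_mul]
    have f1 : ‖(l : ℂ)⁻¹‖ * ‖p t‖ ≤ 1 * W := by gcongr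
    have f2 : ‖H (P t)‖ * ‖akJ2 q l x0 t‖ ≤ N * W := by
      have := hN0 _ (hPR t htt)
      gcongr; linarith
    linarith
  · have e1 : akJ2 q l x0 t - 1 = (akJ2 q l x0 t - akJ2 q l x0 s) +
        (akJ2 q l x0 s - 1) := by ring
    rw [e1]
    have f1 := mul_le_mul_of_nonneg_left (norm_add_le (akJ2 q l x0 t - akJ2 q l x0 s)
      (akJ2 q l x0 s - 1)) hln.le
    linarith

/-- Phragmén–Lindelöf principle for bounded functions on the closed upper half plane. -/
lemma norm_le_of_bounded_UHPc {f : ℂ → ℂ} (hc : ContinuousOn f UHPc) (hd : DifferentiableOn ℂ f UHP)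
    {M C : ℝ} (hM : ∀ l ∈ UHPc, ‖f l‖ ≤ M) (hr : ∀ x : ℝ, ‖f x‖ ≤ C) : ∀ l ∈ UHPc, ‖f l‖ ≤ C := by
  intro l hl
  have him : ∀ z : ℂ, (I * z).im = z.re := fun z => by simp
  have hcl : closure {z : ℂ | 0 < z.re} = {z : ℂ | 0 ≤ z.re} := closure_setOfPred_lt_re 0
  have hdc : DiffContOnCl ℂ (fun z => f (I * z)) {z : ℂ | 0 < z.re} := by
    constructor
    · refine hd.comp (by fun_prop) fun z hz => ?_
      change 0 < (I * z).im
      rw [him]; exact hz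
    · rw [hcl]
      refine hc.comp (by fun_prop) fun z hz => ?_
      change 0 ≤ (I * z).im
      rw [him]; exact hz
  have hbd : ∀ z : ℂ, 0 ≤ z.re → ‖f (I * z)‖ ≤ M := fun z hz => hM _ (by
    change 0 ≤ (I * z).im
    rw [him]; exact hz)
  have := PhragmenLindelof.right_half_plane_of_bounded_on_real (f := fun z => f (I * z))
    (C := C) (z := -I * l) hdc ⟨1, by norm_num, 0, ?_⟩ ?_ ?_ ?_
  · have e : I * (-I * l) = l := by
      rw [← mul_assoc, mul_neg, I_mul_I]; ring
    simpa only [e] using this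
  · refine Asymptotics.IsBigO.of_bound M ?_
    filter_upwards [mem_inf_of_right (mem_principal_self _)] with z hz
    simp only [zero_mul, Real.exp_zero, norm_one, mul_one]
    exact hbd z (le_of_lt hz)
  · refine isBoundedUnder_of_eventually_le (a := M) ?_
    filter_upwards [eventually_ge_atTop 0] with x hx
    exact hbd x (by simpa using hx)
  · intro x
    have e : I * (x * I) = ((-x : ℝ) : ℂ) := by rw [mul_comm, mul_assoc, I_mul_I]; push_cast; ring
    rw [e]; exact hr _
  · have : 0 ≤ l.im := hl
    simpa using this

lemma GISol.akns_regular (hq : GISol q) {x t : ℝ} (hx : 0 < x) (ht : 0 < t) :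
    ContinuousOn (fun l => akJ2 q l x t) UHPc ∧
    DifferentiableOn ℂ (fun l => akJ2 q l x t) UHP := by
  obtain ⟨r1, r2, r3, r4⟩ := hq.jost_regular hx ht
  have e : (fun l => akJ2 q l x t) = fun l => giJ2 q l x t -
      I / 2 * conj (q x t) * giJ1 q l x t := by
    funext l; simp only [giJ2]; ring
  rw [e]
  exact ⟨r2.sub (continuousOn_const.mul r1), r4.sub (r3.const_mul _)⟩

lemma GISol.akns_bdd (hq : GISol q) {t : ℝ} (ht : 0 < t) : ∃ C, 0 ≤ C ∧ ∀ x, 0 < x → ∀ l ∈ UHPc,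
    ‖giJ1 q l x t‖ ≤ C ∧ ‖akJ2 q l x t - 1‖ ≤ C := by
  obtain ⟨C, hC, h⟩ := hq.jost_bound ht
  refine ⟨C, hC, fun x hx l hl => ?_⟩
  obtain ⟨h1, h2, -⟩ := h x hx l hl
  have h3 : C / (1 + x) ≤ C := div_le_self hC (by linarith)
  exact ⟨h1.trans h3, h2.trans h3⟩

/-- Bounds on the Jost solutions that are uniform in time along intervals of continuity of the
mass. -/
lemma GISol.jost_uniform (hq : GISol q) {x0 A B s : ℝ} (hx0 : 0 < x0) (hA : 0 < A) (hs : A ≤ s) :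
    ∃ C, 0 ≤ C ∧ ∀ a b, A ≤ a → b ≤ B → ContinuousOn (tailMass q x0) (Icc a b) →
      s ∈ Icc a b → ∀ t ∈ Icc a b, ∀ l ∈ UHPc, ‖l + I‖ * ‖giJ1 q l x0 t‖ ≤ C ∧
        ‖l + I‖ * ‖akJ2 q l x0 t - 1‖ ≤ C := by
  have hsm := hq.smooth
  have hs0 : 0 < s := hA.trans_le hs
  obtain ⟨K, hK, hKb⟩ := hq.jost_asymptotics hs0
  replace hKb := hKb x0 hx0
  obtain ⟨C1, hC₁, hwkb⟩ := hq.jost_wkb (B := B) hx0 hA hK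
  obtain ⟨D, hD, hDb⟩ := hq.jost_bdd hs0
  obtain ⟨M, hM, hMb⟩ := exists_laxB_le hsm (b := B) hx0 hA zero_le_one
  obtain ⟨Q, hQ, hQb⟩ := hsm.exists_bound_t (d := B) hx0 hA
  set W := (D ^ 2 + D ^ 2) * Real.exp (4 * (M * (B - A))) + 1 with hW
  have hW0 : 0 ≤ W := by positivity
  have hI : ∀ l : ℂ, ‖l + I‖ ≤ ‖l‖ + 1 := fun l => by simpa using norm_add_le l I
  refine ⟨2 * C1 + 2 * (W + Q * W + 1), by positivity, ?_⟩
  intro a b ha hb hm hsab t htt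
  have ha0 := hA.trans_le ha
  have hab := hsab.1.trans hsab.2
  have htp : 0 < t := ha0.trans_le htt.1
  have hQW : 0 ≤ Q * W := by positivity
  have hreal : ∀ l : ℝ, ‖(l : ℂ) + I‖ * ‖giJ1 q l x0 t‖ ≤ 2 * C1 + 2 * (W + Q * W + 1) ∧
      ‖(l : ℂ) + I‖ * ‖akJ2 q l x0 t - 1‖ ≤ 2 * C1 + 2 * (W + Q * W + 1) := by
    intro l
    have hlc : (l : ℂ) ∈ UHPc := by simp [UHPc]
    rcases le_total 1 ‖(l : ℂ)‖ with hl | hl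
    · obtain ⟨k1, k2, k3⟩ := hKb l hlc hl
      obtain ⟨w1, w2⟩ := hwkb a b ha hb hm s hsab l hl k1 k2 k3 t htt
      have h2 : ‖(l : ℂ) + I‖ ≤ 2 * ‖(l : ℂ)‖ := (hI l).trans (by linarith)
      have f1 := mul_le_mul_of_nonneg_right h2 (norm_nonneg (giJ1 q l x0 t))
      have f2 := mul_le_mul_of_nonneg_right h2 (norm_nonneg (akJ2 q l x0 t - 1))
      constructor <;> linarith
    · have h2 : ‖(l : ℂ) + I‖ ≤ 2 := (hI l).trans (by linarith)
      have h1 := linear_energy_two_sided (hq.jost_t_system hx0 ha0 hab hm hlc)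
        (fun r hr => hMb l hl r ⟨ha.trans hr.1, hr.2.trans hb⟩) hsab htt
      obtain ⟨d1, d2⟩ := hDb x0 hx0 l hlc
      have h3 : (‖giJ1 q l x0 s‖ ^ 2 + ‖giJ2 q l x0 s‖ ^ 2) *
          Real.exp (4 * (M * (b - a))) ≤ (D ^ 2 + D ^ 2) * Real.exp (4 * (M * (B - A))) := by
        gcongr
      obtain ⟨e1, e2⟩ := le_add_one_of_sq_add_sq_le (h1.trans h3)
      have e3 : ‖akJ2 q l x0 t - 1‖ ≤ W + Q * W + 1 := by
        have e : akJ2 q l x0 t = giJ2 q l x0 t -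
            I / 2 * conj (q x0 t) * giJ1 q l x0 t := by
          simp only [giJ2]; ring
        rw [e]
        refine (norm_sub_le _ _).trans ?_
        rw [norm_one]
        refine add_le_add ((norm_sub_le _ _).trans (add_le_add e2 ?_)) le_rfl
        simp only [norm_mul, norm_div, norm_I, norm_ofNat, RCLike.norm_conj]
        have := hQb t ⟨ha.trans htt.1, htt.2.trans hb⟩
        calc 1 / 2 * ‖q x0 t‖ * ‖giJ1 q l x0 t‖ ≤ 1 / 2 * Q * W := by gcongr
          _ ≤ Q * W := by linarith
      have f1 := mul_le_mul h2 e1 (norm_nonneg _) zero_le_two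
      have f2 := mul_le_mul h2 e3 (norm_nonneg _) zero_le_two
      constructor <;> linarith
  obtain ⟨r1, -, r3, -⟩ := hq.jost_regular hx0 htp
  obtain ⟨r2, r4⟩ := hq.akns_regular hx0 htp
  obtain ⟨K', hK', hKb'⟩ := hq.jost_asymptotics htp
  replace hKb' := hKb' x0 hx0
  obtain ⟨D', hD', hDb'⟩ := hq.akns_bdd htp
  have hglob : ∀ l ∈ UHPc, ‖(l + I) * giJ1 q l x0 t‖ ≤ 2 * K' + 2 * D' ∧
      ‖(l + I) * (akJ2 q l x0 t - 1)‖ ≤ 2 * K' + 2 * D' := by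
    intro l hl
    rw [norm_mul, norm_mul]
    rcases le_total 1 ‖l‖ with h1 | h1
    · obtain ⟨k1, k2, -⟩ := hKb' l hl h1
      have h2 : ‖l + I‖ ≤ 2 * ‖l‖ := (hI l).trans (by linarith)
      have f1 := mul_le_mul_of_nonneg_right h2 (norm_nonneg (giJ1 q l x0 t))
      have f2 := mul_le_mul_of_nonneg_right h2 (norm_nonneg (akJ2 q l x0 t - 1))
      constructor <;> linarith
    · have h2 : ‖l + I‖ ≤ 2 := (hI l).trans (by linarith)
      obtain ⟨d1, d2⟩ := hDb' x0 hx0 l hl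
      have f1 := mul_le_mul h2 d1 (norm_nonneg _) zero_le_two
      have f2 := mul_le_mul h2 d2 (norm_nonneg _) zero_le_two
      constructor <;> linarith
  intro l hl
  rw [← norm_mul, ← norm_mul]
  have cI : ContinuousOn (fun l : ℂ => l + I) UHPc := by fun_prop
  have dI : DifferentiableOn ℂ (fun l : ℂ => l + I) UHP := by fun_prop
  exact ⟨norm_le_of_bounded_UHPc (cI.mul r1) (dI.mul r3) (fun l hl => (hglob l hl).1)
      (fun x => (norm_mul _ _).trans_le (hreal x).1) l hl,
    norm_le_of_bounded_UHPc (cI.mul (r2.sub continuousOn_const)) (dI.mul (r4.sub_const 1))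
      (fun l hl => (hglob l hl).2) (fun x => (norm_mul _ _).trans_le (hreal x).2) l hl⟩

/-- If the second component of the Jost solution has positive real part for all `l ≥ 0`, then the
mass is recovered from its value at `l = 0`. -/
lemma GISol.tailMass_eq_arg (hq : GISol q) {x0 t : ℝ} (hx0 : 0 < x0) (ht : 0 < t)
    (h : ∀ l : ℝ, 0 ≤ l → 0 < (giJ2 q l x0 t).re) :
    tailMass q x0 t = -2 * (giJ2 q (0 : ℝ) x0 t).arg := by
  have hs := hq.smooth
  obtain ⟨C, hC, hu, -⟩ := hq.exists_decay ht
  obtain ⟨K, hK, hasy⟩ := hq.jost_asymptotics ht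
  obtain ⟨D, hD, hDb⟩ := hq.jost_bdd ht
  have hmem : ∀ l : ℝ, (l : ℂ) ∈ UHPc := fun l => by simp [UHPc]
  have hn1 : ∀ l : ℝ, 0 ≤ l → ∀ x, 0 < x → 1 ≤ ‖giJ2 q l x t‖ := by
    intro l hl x hx
    have h1 := hq.jost_real hx ht l
    have h2 : 0 ≤ l * ‖giJ1 q l x t‖ ^ 2 := by positivity
    nlinarith [norm_nonneg (giJ2 q l x t)]
  have hne : ∀ l : ℝ, 0 ≤ l → ∀ x, 0 < x → giJ2 q l x t ≠ 0 := by
    intro l hl x hx h0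
    have := hn1 l hl x hx
    rw [h0, norm_zero] at this; linarith
  set f : ℝ → ℝ → ℂ := fun l x => I / 2 * (q x t * conj (q x t)) +
    l * conj (q x t) * (giJ1 q l x t / giJ2 q l x t) with hf
  have hlog : ∀ l : ℝ, 0 ≤ l → ∀ x, 0 < x → HasDerivAt (fun y => giJ2 q l y t)
      (f l x * giJ2 q l x t) x := by
    intro l hl x hx
    refine (hq.hasDerivAt_x (hmem l) hx ht).2.congr_deriv ?_
    have := hne l hl x hx
    simp only [hf, laxA21, laxA22]
    field_simp
    ring
  have hbound : ∀ l : ℝ, 0 ≤ l → ∀ x, 0 < x → ‖f l x‖ ≤ (C + K + D) * ‖q x t‖ := by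
    intro l hl x hx
    have h1 : ‖(l : ℂ)‖ * ‖giJ1 q l x t‖ ≤ K + D := by
      rcases le_total 1 ‖(l : ℂ)‖ with h2 | h2
      · linarith [(hasy x hx l (hmem l) h2).1]
      · have := mul_le_mul h2 (hDb x hx l (hmem l)).1 (norm_nonneg _) zero_le_one
        linarith
    have h2 : ‖(l : ℂ)‖ * (‖giJ1 q l x t‖ / ‖giJ2 q l x t‖) ≤ K + D := by
      rw [← mul_div_assoc]
      exact (div_le_self (by positivity) (hn1 l hl x hx)).trans h1
    have h3 : ‖q x t‖ ≤ C := (hu.bound x hx).trans (div_le_self hC (one_le_pow₀ (by linarith)))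
    refine (norm_add_le _ _).trans ?_
    simp only [norm_mul, norm_div, norm_I, norm_ofNat, RCLike.norm_conj]
    have h4 : ‖q x t‖ * ‖q x t‖ ≤ C * ‖q x t‖ := by gcongr
    have h5 := mul_le_mul_of_nonneg_right h2 (norm_nonneg (q x t))
    have h6 : 0 ≤ C * ‖q x t‖ := by positivity
    nlinarith
  have hcx : ∀ l : ℝ, 0 ≤ l → ContinuousOn (f l) (Ioi 0) := by
    intro l hl
    have c1 := hs.continuousOn_x ht
    have c2 : ContinuousOn (fun x => conj (q x t)) (Ioi 0) := hs.conjQ.continuousOn_x ht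
    have c3 : ContinuousOn (fun x => giJ1 q l x t) (Ioi 0) := fun x hx =>
      (hq.hasDerivAt_x (hmem l) hx ht).1.continuousAt.continuousWithinAt
    have c4 : ContinuousOn (fun x => giJ2 q l x t) (Ioi 0) := fun x hx =>
      (hq.hasDerivAt_x (hmem l) hx ht).2.continuousAt.continuousWithinAt
    exact (continuousOn_const.mul (c1.mul c2)).add
      ((continuousOn_const.mul c2).mul (c3.div c4 fun x hx => hne l hl x hx))
  have hsub : Ioi x0 ⊆ Ioi (0 : ℝ) := Ioi_subset_Ioi hx0.le
  have hmeas : ∀ l : ℝ, 0 ≤ l → AEStronglyMeasurable (f l) (volume.restrict (Ioi x0)) :=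
    fun l hl => ((hcx l hl).mono hsub).aestronglyMeasurable measurableSet_Ioi
  have hdom : IntegrableOn (fun x => (C + K + D) * ‖q x t‖) (Ioi x0) :=
    ((hu.integrableOn hC hx0.le).norm).const_mul _
  have hint : ∀ l : ℝ, 0 ≤ l → IntegrableOn (f l) (Ioi x0) := fun l hl =>
    hdom.mono' (hmeas l hl) (by
      filter_upwards [self_mem_ae_restrict measurableSet_Ioi] with x hx
      exact hbound l hl x (hsub hx))
  set J : ℝ → ℂ := fun l => ∫ x in Ioi x0, f l x with hJ
  have hexp : ∀ l : ℝ, 0 ≤ l → giJ2 q l x0 t = exp (-J l) := by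
    intro l hl
    have hprim : ∀ X, x0 ≤ X → giJ2 q l X t =
        giJ2 q l x0 t * exp (∫ x in x0..X, f l x) := by
      intro X hX
      have hP : ∀ y, x0 ≤ y → HasDerivAt (fun y => ∫ x in x0..y, f l x) (f l y) y := by
        intro y hy
        have hy0 := hx0.trans_le hy
        refine integral_hasDerivAt_right ?_ ?_ ?_
        · refine ContinuousOn.intervalIntegrable ((hcx l hl).mono ?_)
          rw [uIcc_of_le hy]
          exact fun z hz => hx0.trans_le hz.1
        · exact (hcx l hl).stronglyMeasurableAtFilter isOpen_Ioi y hy0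
        · exact (hcx l hl).continuousAt (isOpen_Ioi.mem_nhds hy0)
      have hder : ∀ y, x0 ≤ y → HasDerivAt (fun y => giJ2 q l y t *
          exp (-∫ x in x0..y, f l x)) 0 y := fun y hy =>
        ((hlog l hl y (hx0.trans_le hy)).fun_mul (hP y hy).fun_neg.cexp).congr_deriv (by ring)
      have hcon := constant_of_has_deriv_right_zero
        (f := fun y => giJ2 q l y t * exp (-∫ x in x0..y, f l x)) (a := x0) (b := X)
        (fun y hy => (hder y hy.1).continuousAt.continuousWithinAt)
        (fun y hy => (hder y hy.1).hasDerivWithinAt) X (right_mem_Icc.2 hX)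
      simp only [intervalIntegral.integral_same, neg_zero, exp_zero, mul_one] at hcon
      rw [← hcon, mul_assoc, ← exp_add]
      simp
    have l1 := (hq.tendsto_jost ht (hmem l)).2
    have l2 := intervalIntegral_tendsto_integral_Ioi x0 (hint l hl) tendsto_id
    have l3 : Tendsto (fun X => giJ2 q l x0 t * exp (∫ x in x0..X, f l x)) atTop
        (𝓝 (giJ2 q l x0 t * exp (J l))) :=
      ((Complex.continuous_exp.tendsto _).comp l2).const_mul _
    have l4 := tendsto_nhds_unique (l1.congr' (by
      filter_upwards [eventually_ge_atTop x0] with X hX using hprim X hX)) l3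
    rw [Complex.exp_neg]
    exact eq_inv_of_mul_eq_one_left l4.symm
  have hJc : ContinuousOn J (Ici 0) := by
    intro l0 hl0
    refine tendsto_integral_filter_of_dominated_convergence (fun x => (C + K + D) * ‖q x t‖) ?_ ?_
      hdom ?_
    · filter_upwards [self_mem_nhdsWithin] with l hl using hmeas l hl
    · filter_upwards [self_mem_nhdsWithin] with l hl
      filter_upwards [self_mem_ae_restrict measurableSet_Ioi] with x hx
      exact hbound l hl x (hsub hx)
    · filter_upwards [self_mem_ae_restrict measurableSet_Ioi] with x hx
      have hxo : 0 < x := hsub hx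
      obtain ⟨r1, r2, -⟩ := hq.jost_regular hxo ht
      have hof : ContinuousWithinAt (fun l : ℝ => (l : ℂ)) (Ici 0) l0 :=
        continuous_ofReal.continuousWithinAt
      have c1 : ContinuousWithinAt (fun l : ℝ => giJ1 q l x t) (Ici 0) l0 :=
        (r1 l0 (hmem l0)).comp hof fun l _ => hmem l
      have c2 : ContinuousWithinAt (fun l : ℝ => giJ2 q l x t) (Ici 0) l0 :=
        (r2 l0 (hmem l0)).comp hof fun l _ => hmem l
      exact (continuousWithinAt_const.add ((hof.mul continuousWithinAt_const).mul
        (c1.div c2 (hne l0 hl0 x hxo)))).tendsto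
  have hJ0 : Tendsto J atTop (𝓝 0) := by
    have : (0 : ℂ) = ∫ x in Ioi x0, (0 : ℂ) := by simp
    rw [this]
    refine tendsto_integral_filter_of_dominated_convergence (fun x => (C + K + D) * ‖q x t‖) ?_ ?_
      hdom ?_
    · filter_upwards [eventually_ge_atTop 0] with l hl using hmeas l hl
    · filter_upwards [eventually_ge_atTop 0] with l hl
      filter_upwards [self_mem_ae_restrict measurableSet_Ioi] with x hx
      exact hbound l hl x (hsub hx)
    · filter_upwards [self_mem_ae_restrict measurableSet_Ioi] with x hx
      have hxo : 0 < x := hsub hx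
      have hinv : Tendsto (fun l : ℝ => K * l⁻¹) atTop (𝓝 0) := by
        simpa using tendsto_inv_atTop_zero.const_mul K
      have hcinv : Tendsto (fun l : ℝ => (l : ℂ)⁻¹) atTop (𝓝 0) := by
        have := (continuous_ofReal.tendsto 0).comp tendsto_inv_atTop_zero
        simpa [Function.comp_def] using this
      have yi : Tendsto (fun l : ℝ => akJ2 q l x t) atTop (𝓝 1) := by
        rw [tendsto_iff_norm_sub_tendsto_zero]
        refine squeeze_zero' (Eventually.of_forall fun _ => norm_nonneg _) ?_ hinv
        filter_upwards [eventually_ge_atTop 1] with l hl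
        have hl' : ‖(l : ℂ)‖ = l := by rw [norm_real, Real.norm_eq_abs, abs_of_nonneg (by linarith)]
        have := (hasy x hxo l (hmem l) (by rw [hl']; exact hl)).2.1
        rw [hl'] at this
        rw [← div_eq_mul_inv, le_div_iff₀ (by linarith)]
        linarith
      have yj : Tendsto (fun l : ℝ => (l : ℂ) * (giJ1 q l x t - ((l : ℂ)⁻¹ *
          (-(I / 2) * q x t) + (l : ℂ)⁻¹ ^ 2 * (1 / 4 * dx q x t)) *
          akJ2 q l x t)) atTop (𝓝 0) := by
        refine squeeze_zero_norm' ?_ hinv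
        filter_upwards [eventually_ge_atTop 1] with l hl
        have hl' : ‖(l : ℂ)‖ = l := by rw [norm_real, Real.norm_eq_abs, abs_of_nonneg (by linarith)]
        have := (hasy x hxo l (hmem l) (by rw [hl']; exact hl)).2.2
        rw [pow_two, mul_assoc, norm_mul, hl'] at this
        rw [← div_eq_mul_inv, le_div_iff₀ (by linarith)]
        linarith
      have y3 : Tendsto (fun l : ℝ => (l : ℂ) * giJ1 q l x t) atTop
          (𝓝 (-(I / 2) * q x t)) := by
        have := yj.add (((hcinv.mul_const (1 / 4 * dx q x t)).const_add (-(I / 2) * q x t)).mul yi)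
        simp only [zero_mul, add_zero, mul_one, zero_add] at this
        refine this.congr' ?_
        filter_upwards [eventually_ge_atTop 1] with l hl
        have : (l : ℂ) ≠ 0 := by
          have : l ≠ 0 := by linarith
          exact_mod_cast this
        field_simp
        ring
      have y4 : Tendsto (fun l : ℝ => giJ1 q l x t) atTop (𝓝 0) := by
        have := hcinv.mul y3
        rw [zero_mul] at this
        refine this.congr' ?_
        filter_upwards [eventually_ge_atTop 1] with l hl
        have : (l : ℂ) ≠ 0 := by
          have : l ≠ 0 := by linarith
          exact_mod_cast this
        field_simp
      have y5 : Tendsto (fun l : ℝ => giJ2 q l x t) atTop (𝓝 1) := by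
        have := yi.add (y4.const_mul (I / 2 * conj (q x t)))
        simp only [mul_zero, add_zero] at this
        exact this
      have := (((y3.div y5 one_ne_zero).const_mul (conj (q x t))).const_add
        (I / 2 * (q x t * conj (q x t))))
      have e : I / 2 * (q x t * conj (q x t)) + conj (q x t) * (-(I / 2) * q x t / 1) = 0 := by ring
      rw [e] at this
      refine this.congr fun l => ?_
      simp only [hf, Pi.div_apply]
      ring
  -- the lifted argument stays in the principal strip
  have him : ∀ l : ℝ, 0 ≤ l → |(J l).im| ≠ Real.pi / 2 := by
    intro l hl habs
    have h1 := h l hl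
    rw [hexp l hl, Complex.exp_re, neg_im, Real.cos_neg, ← Real.cos_abs, habs,
      Real.cos_pi_div_two, mul_zero] at h1
    exact lt_irrefl _ h1
  have hsmall : |(J 0).im| < Real.pi / 2 := by
    by_contra hc
    push Not at hc
    have l1 : Tendsto (fun l => |(J l).im|) atTop (𝓝 0) := by
      have := ((continuous_im.tendsto 0).comp hJ0).abs
      simpa [Function.comp_def] using this
    obtain ⟨l, hlo, hl⟩ := ((eventually_ge_atTop 0).and
      (l1.eventually (gt_mem_nhds (half_pos Real.pi_pos)))).exists
    have hc' : ContinuousOn (fun l => |(J l).im|) (Icc 0 l) :=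
      ((continuous_im.comp_continuousOn hJc).abs).mono fun y hy => hy.1
    obtain ⟨l', hl', he⟩ := intermediate_value_Icc' hlo hc' ⟨hl.le, hc⟩
    exact him l' hl'.1 he
  have hJm : J 0 = ((tailMass q x0 t / 2 : ℝ) : ℂ) * I := by
    simp only [hJ, hf, ofReal_zero, zero_mul, add_zero, tailMass]
    rw [integral_const_mul]
    have : ∀ x, q x t * conj (q x t) = ((‖q x t‖ ^ 2 : ℝ) : ℂ) := fun x => rhoC_eq x t
    simp only [this]
    have e : ∫ x in Ioi x0, ((‖q x t‖ ^ 2 : ℝ) : ℂ) = ((∫ x in Ioi x0, ‖q x t‖ ^ 2 : ℝ) : ℂ) :=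
      integral_ofReal
    rw [e]
    push_cast
    ring
  have hJim : (J 0).im = tailMass q x0 t / 2 := by rw [hJm]; simp
  rw [hexp 0 le_rfl, Complex.arg_exp, neg_im, toIocMod_eq_self _ |>.2]
  · rw [hJim]; ring
  · rw [abs_lt] at hsmall
    constructor <;> linarith [Real.pi_pos]

/-- A locally uniformly Lipschitz family converges locally uniformly at a limit point. -/
lemma exists_limit_of_lipschitz {f : ℂ → ℝ → ℂ} {S : Set ℝ} {a : ℝ} [(𝓝[S] a).NeBot]
    (h : ∀ R, 0 ≤ R → ∃ L, 0 ≤ L ∧ ∀ l ∈ UHPc, ‖l‖ ≤ R → ∀ s ∈ S, ∀ t ∈ S,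
      ‖f l s - f l t‖ ≤ L * |s - t|) :
    ∃ g : ℂ → ℂ, (∀ R, 0 ≤ R → ∃ L, 0 ≤ L ∧ ∀ l ∈ UHPc, ‖l‖ ≤ R → ∀ t ∈ S,
        ‖f l t - g l‖ ≤ L * |t - a|) ∧
      (∀ l ∈ UHPc, Tendsto (f l) (𝓝[S] a) (𝓝 (g l))) ∧
      TendstoLocallyUniformlyOn (fun t l => f l t) g (𝓝[S] a) UHPc := by
  have hex : ∀ l ∈ UHPc, ∃ g, Tendsto (f l) (𝓝[S] a) (𝓝 g) := by
    intro l hl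
    obtain ⟨L, hL, hLb⟩ := h ‖l‖ (norm_nonneg l)
    have : LipschitzOnWith ⟨L, hL⟩ (f l) S := LipschitzOnWith.of_dist_le_mul fun s hs t ht => by
      rw [dist_eq_norm]; exact hLb l hl le_rfl s hs t ht
    exact cauchy_map_iff_exists_tendsto.1
      ((cauchy_nhds.mono (g := 𝓝[S] a) inf_le_left).map_of_le this.uniformContinuousOn inf_le_right)
  choose! g hg using hex
  have hb : ∀ R, 0 ≤ R → ∃ L, 0 ≤ L ∧ ∀ l ∈ UHPc, ‖l‖ ≤ R → ∀ t ∈ S,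
      ‖f l t - g l‖ ≤ L * |t - a| := by
    intro R hR
    obtain ⟨L, hL, hLb⟩ := h R hR
    refine ⟨L, hL, fun l hl hlR t ht => le_of_tendsto_of_tendsto ((hg l hl).const_sub (f l t)).norm
      (((tendsto_id.mono_left inf_le_left).const_sub t).abs.const_mul L) ?_⟩
    filter_upwards [self_mem_nhdsWithin] with s hs using hLb l hl hlR t ht s hs
  refine ⟨g, hb, hg, ?_⟩
  rw [Metric.tendstoLocallyUniformlyOn_iff]
  intro ε hε l hl
  obtain ⟨L, hL, hLb⟩ := hb (‖l‖ + 1) (by positivity)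
  refine ⟨Metric.ball l 1 ∩ UHPc, inter_mem (mem_nhdsWithin_of_mem_nhds
    (Metric.ball_mem_nhds l one_pos)) self_mem_nhdsWithin, ?_⟩
  have h1 : Tendsto (fun t => L * |t - a|) (𝓝 a) (𝓝 0) := by
    have : Continuous fun t => L * |t - a| := by fun_prop
    simpa using this.tendsto a
  filter_upwards [(h1.mono_left nhdsWithin_le_nhds).eventually (gt_mem_nhds hε),
    self_mem_nhdsWithin] with t ht htS l' hl'
  rw [dist_comm, dist_eq_norm]
  refine (hLb l' hl'.2 ?_ t htS).trans_lt ht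
  have := norm_le_insert' l' l
  linarith [mem_ball_iff_norm.1 hl'.1]

/-- Comparison of the Jost solutions at two times through their Wronskian. -/
lemma GISol.wronskian_compare (hq : GISol q) {l : ℂ} (hl : l ∈ UHPc) {x0 X t a N ε : ℝ}
    (hx0 : 0 < x0) (hX : x0 ≤ X) (ht : 0 < t) (ha : 0 < a)
    (hN : ∀ x ∈ Icc x0 X, ‖giJ1 q l x t‖ ≤ N ∧ ‖giJ2 q l x t‖ ≤ N ∧
      ‖giJ1 q l x a‖ ≤ N ∧ ‖giJ2 q l x a‖ ≤ N)
    (hε : ∀ x ∈ Icc x0 X, ‖laxA11 q l x t - laxA11 q l x a‖ ≤ ε ∧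
      ‖laxA12 q x t - laxA12 q x a‖ ≤ ε ∧ ‖laxA21 q l x t - laxA21 q l x a‖ ≤ ε ∧
      ‖laxA22 q x t - laxA22 q x a‖ ≤ ε) :
    ‖giJ1 q l x0 t * giJ2 q l x0 a - giJ2 q l x0 t * giJ1 q l x0 a‖ ≤
      2 * N ^ 2 * Real.exp (-(2 * l.im * (X - x0))) + 4 * N ^ 2 * ε * (X - x0) := by
  have hN0 : 0 ≤ N := (norm_nonneg _).trans (hN x0 (left_mem_Icc.2 hX)).1
  have hε0 : 0 ≤ ε := (norm_nonneg _).trans (hε x0 (left_mem_Icc.2 hX)).1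
  set W : ℝ → ℂ := fun x => giJ1 q l x t * giJ2 q l x a - giJ2 q l x t * giJ1 q l x a with hW
  set e : ℝ → ℂ := fun x => exp (2 * I * l * ((x - x0 : ℝ) : ℂ)) with he
  have hed : ∀ x, HasDerivAt e (e x * (2 * I * l)) x := fun x =>
    (hasDerivAt_exp_mul (2 * I * l) (x - x0)).comp_sub_const x x0
  have hen : ∀ x, ‖e x‖ = Real.exp (-(2 * l.im * (x - x0))) := by
    intro x
    rw [he, norm_exp]
    congr 1
    simp [mul_re, mul_im]
  have hen1 : ∀ x ∈ Icc x0 X, ‖e x‖ ≤ 1 := by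
    intro x hx
    rw [hen, Real.exp_le_one_iff]
    have him : 0 ≤ l.im := hl
    have : 0 ≤ l.im * (x - x0) := mul_nonneg him (by linarith [hx.1])
    linarith
  have hωd : ∀ x ∈ Icc x0 X, HasDerivWithinAt (fun x => e x * W x) (e x *
      (giJ2 q l x a * ((laxA11 q l x t - laxA11 q l x a) * giJ1 q l x t +
        (laxA12 q x t - laxA12 q x a) * giJ2 q l x t) -
      giJ1 q l x a * ((laxA21 q l x t - laxA21 q l x a) * giJ1 q l x t +
        (laxA22 q x t - laxA22 q x a) * giJ2 q l x t))) (Icc x0 X) x := by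
    intro x hx
    have hxo := hx0.trans_le hx.1
    obtain ⟨d1, d2⟩ := hq.hasDerivAt_x hl hxo ht
    obtain ⟨c1, c2⟩ := hq.hasDerivAt_x hl hxo ha
    refine (((hed x).fun_mul ((d1.fun_mul c2).fun_sub (d2.fun_mul c1))).congr_deriv ?_).hasDerivWithinAt
    simp only [laxA11, laxA12, laxA21, laxA22]
    ring
  have hmain := (convex_Icc x0 X).norm_image_sub_le_of_norm_hasDerivWithin_le (C := 4 * N ^ 2 * ε)
    hωd (fun x hx => ?_) (right_mem_Icc.2 hX) (left_mem_Icc.2 hX)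
  · have e0 : e x0 * W x0 = W x0 := by simp [he]
    rw [e0, Real.norm_eq_abs, abs_sub_comm, abs_of_nonneg (by linarith : (0 : ℝ) ≤ X - x0)] at hmain
    have h2 : ‖e X * W X‖ ≤ 2 * N ^ 2 * Real.exp (-(2 * l.im * (X - x0))) := by
      rw [norm_mul, hen, mul_comm]
      gcongr
      obtain ⟨n1, n2, n3, n4⟩ := hN X (right_mem_Icc.2 hX)
      refine (norm_sub_le _ _).trans ?_
      rw [norm_mul, norm_mul]
      have f1 := mul_le_mul n1 n4 (norm_nonneg _) hN0
      have f2 := mul_le_mul n2 n3 (norm_nonneg _) hN0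
      nlinarith
    calc ‖W x0‖ = ‖(W x0 - e X * W X) + e X * W X‖ := by rw [sub_add_cancel]
      _ ≤ _ := (norm_add_le _ _).trans (by linarith)
  · obtain ⟨n1, n2, n3, n4⟩ := hN x hx
    obtain ⟨e1, e2, e3, e4⟩ := hε x hx
    have key : ∀ (α β : ℂ), ‖α‖ ≤ ε → ‖β‖ ≤ ε →
        ‖α * giJ1 q l x t + β * giJ2 q l x t‖ ≤ 2 * (ε * N) := by
      intro α β hα hβ
      refine (norm_add_le _ _).trans ?_
      rw [norm_mul, norm_mul]
      have f1 := mul_le_mul hα n1 (norm_nonneg _) hε0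
      have f2 := mul_le_mul hβ n2 (norm_nonneg _) hε0
      linarith
    rw [norm_mul]
    refine (mul_le_of_le_one_left (norm_nonneg _) (hen1 x hx)).trans ?_
    refine (norm_sub_le _ _).trans ?_
    rw [norm_mul, norm_mul]
    have f1 := mul_le_mul n4 (key _ _ e1 e2) (norm_nonneg _) hN0
    have f2 := mul_le_mul n3 (key _ _ e3 e4) (norm_nonneg _) hN0
    nlinarith

lemma closure_UHP : UHPc ⊆ closure UHP := by
  intro l hl
  have hl' : 0 ≤ l.im := hl
  refine mem_closure_of_tendsto (f := fun n : ℕ => l + (1 / ((n : ℝ) + 1) : ℝ) * I)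
    (b := atTop) ?_ (Eventually.of_forall fun n => ?_)
  · have h1 := (continuous_ofReal.tendsto 0).comp (tendsto_one_div_add_atTop_nhds_zero_nat (𝕜 := ℝ))
    have := (h1.mul_const I).const_add l
    simpa [Function.comp_def] using this
  · change 0 < (l + (1 / ((n : ℝ) + 1) : ℝ) * I).im
    have h4 : (0 : ℝ) < 1 / ((n : ℝ) + 1) := by positivity
    simp only [add_im, im_ofReal_mul, I_im, mul_one]
    linarith

/-- A zero-free bounded function on the upper half plane, unimodular on the real line and tending to
one at infinity, is one. -/
lemma eq_one_of_unimodular {κ : ℂ → ℂ} (hc : ContinuousOn κ UHPc) (hd : DifferentiableOn ℂ κ UHP)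
    (h0 : ∀ l ∈ UHPc, κ l ≠ 0) (hr : ∀ x : ℝ, ‖κ x‖ = 1) {C : ℝ}
    (hC : ∀ l ∈ UHPc, ‖l + I‖ * ‖κ l - 1‖ ≤ C) : ∀ l ∈ UHPc, κ l = 1 := by
  have hI : ∀ l ∈ UHPc, 1 ≤ ‖l + I‖ := by
    intro l hl
    have hl' : 0 ≤ l.im := hl
    refine le_trans ?_ (abs_im_le_norm _)
    simp only [add_im, I_im]
    rw [abs_of_nonneg (by linarith)]; linarith
  have hC0 : 0 ≤ C := le_trans (by positivity) (hC 0 (by simp [UHPc]))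
  have hbd : ∀ l ∈ UHPc, ‖κ l‖ ≤ C + 1 := by
    intro l hl
    have h1 := norm_le_insert' (κ l) 1
    rw [norm_one] at h1
    have h2 := hC l hl
    have h3 : ‖κ l - 1‖ ≤ ‖l + I‖ * ‖κ l - 1‖ := le_mul_of_one_le_left (norm_nonneg _) (hI l hl)
    linarith
  have hle : ∀ l ∈ UHPc, ‖κ l‖ ≤ 1 := norm_le_of_bounded_UHPc hc hd hbd fun x => (hr x).le
  have hci : ContinuousOn (fun l => (κ l)⁻¹) UHPc := hc.inv₀ h0
  have hdi : DifferentiableOn ℂ (fun l => (κ l)⁻¹) UHP := hd.inv fun l hl => h0 l (UHP_subset hl)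
  have hcl : IsClosed UHPc := isClosed_Ici.preimage continuous_im
  obtain ⟨M, hM⟩ := ((isCompact_closedBall (0 : ℂ) (2 * C + 1)).inter_left
    hcl).exists_bound_of_continuousOn (hci.mono inter_subset_left)
  have hbdi : ∀ l ∈ UHPc, ‖(κ l)⁻¹‖ ≤ max M 2 := by
    intro l hl
    rcases le_or_gt ‖l‖ (2 * C + 1) with h | h
    · exact (hM l ⟨hl, by simpa using h⟩).trans (le_max_left _ _)
    · refine le_trans ?_ (le_max_right _ _)
      have h1 : 2 * C ≤ ‖l + I‖ := by
        have := norm_sub_le (l + I) I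
        rw [add_sub_cancel_right, norm_I] at this
        linarith
      have h1' := hI l hl
      have h2 := hC l hl
      have h3 : ‖κ l - 1‖ ≤ 1 / 2 := by
        by_contra hc
        push Not at hc
        rcases hC0.eq_or_lt with h | h
        · nlinarith
        · nlinarith [mul_lt_mul_of_pos_left hc (by linarith : 0 < ‖l + I‖)]
      have h4 : 1 / 2 ≤ ‖κ l‖ := by
        have := norm_sub_le (κ l) (κ l - 1)
        rw [sub_sub_cancel, norm_one] at this
        linarith
      rw [norm_inv]
      exact inv_le_of_inv_le₀ (by norm_num) (by linarith)
  have hge : ∀ l ∈ UHPc, ‖(κ l)⁻¹‖ ≤ 1 := norm_le_of_bounded_UHPc hci hdi hbdi fun x => by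
    rw [norm_inv, hr, inv_one]
  have hone : ∀ l ∈ UHPc, ‖κ l‖ = 1 := by
    intro l hl
    refine le_antisymm (hle l hl) ?_
    have h1 := hge l hl
    rw [norm_inv] at h1
    exact (inv_le_one₀ (norm_pos_iff.2 (h0 l hl))).1 h1
  have hIU : I ∈ UHP := by simp [UHP]
  have hconv : IsPreconnected UHP := (convex_halfSpace_im_gt 0).isPreconnected
  have hconst : EqOn κ (Function.const ℂ (κ I)) UHP :=
    Complex.eqOn_of_isPreconnected_of_isMaxOn_norm hconv isOpen_UHP hd hIU
      (fun l hl => by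
        simp only [Function.comp_apply, mem_ofPred_eq]
        rw [hone l (UHP_subset hl), hone _ (UHP_subset hIU)])
  have hk : κ I = 1 := by
    have hle : ∀ n : ℕ, ‖κ I - 1‖ ≤ C * (1 / ((n : ℝ) + 1)) := by
      intro n
      have hn : (((n : ℝ) + 1 : ℝ) : ℂ) * I ∈ UHP := by
        change 0 < ((((n : ℝ) + 1 : ℝ) : ℂ) * I).im
        rw [im_ofReal_mul, I_im, mul_one]; positivity
      have h1 := hC _ (UHP_subset hn)
      rw [hconst hn, Function.const_apply] at h1
      have h2 : (n : ℝ) + 1 ≤ ‖(((n : ℝ) + 1 : ℝ) : ℂ) * I + I‖ := by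
        refine le_trans ?_ (abs_im_le_norm _)
        rw [add_im, im_ofReal_mul, I_im, mul_one]
        refine le_trans ?_ (le_abs_self _)
        linarith
      rw [mul_one_div, le_div_iff₀ (by positivity), mul_comm]
      exact (mul_le_mul_of_nonneg_right h2 (norm_nonneg _)).trans h1
    have hlim := (tendsto_one_div_add_atTop_nhds_zero_nat (𝕜 := ℝ)).const_mul C
    rw [mul_zero] at hlim
    have := ge_of_tendsto' hlim hle
    rwa [norm_le_zero_iff, sub_eq_zero] at this
  have heq : EqOn κ (fun _ => 1) UHP := fun l hl => by rw [hconst hl]; exact hk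
  exact heq.of_subset_closure hc continuousOn_const UHP_subset closure_UHP

lemma GISol.tailMass_lip (hq : GISol q) {x0 A B : ℝ} (hx0 : 0 < x0) (hA : 0 < A) :
    ∃ F, 0 ≤ F ∧ ∀ a b, A ≤ a → a ≤ b → b ≤ B → ContinuousOn (tailMass q x0) (Icc a b) →
      |tailMass q x0 b - tailMass q x0 a| ≤ F * (b - a) := by
  obtain ⟨F, hF, hFb⟩ := (smooth_massFlux hq.smooth).exists_bound_t (d := B) hx0 hA
  refine ⟨F, hF, fun a b ha hab hb h => ?_⟩
  rw [hq.mass_balance hx0 (hA.trans_le ha) hab h, ← Real.norm_eq_abs]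
  have := intervalIntegral.norm_integral_le_of_norm_le_const (a := a) (b := b) (C := F)
    (f := fun r => (massFlux q x0 r).re) (fun r hr => ?_)
  · rwa [abs_of_nonneg (by linarith : (0 : ℝ) ≤ b - a)] at this
  · rw [uIoc_of_le hab] at hr
    exact (abs_re_le_norm _).trans (hFb r ⟨ha.trans hr.1.le, hr.2.trans hb⟩)

lemma exists_laxA_lip (hs : SmoothQ q) {x0 X A B : ℝ} (l : ℂ) (hx0 : 0 < x0) (hA : 0 < A) :
    ∃ C, 0 ≤ C ∧ ∀ x ∈ Icc x0 X, ∀ s ∈ Icc A B, ∀ t ∈ Icc A B,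
      ‖laxA11 q l x t - laxA11 q l x s‖ ≤ C * |t - s| ∧
      ‖laxA12 q x t - laxA12 q x s‖ ≤ C * |t - s| ∧
      ‖laxA21 q l x t - laxA21 q l x s‖ ≤ C * |t - s| ∧
      ‖laxA22 q x t - laxA22 q x s‖ ≤ C * |t - s| := by
  obtain ⟨Ci, h1, H1⟩ := (smooth_laxA11 (l := l) hs).lip_t (b := X) (d := B) hx0 hA
  obtain ⟨Cv, h2, H2⟩ := (smooth_laxA12 hs).lip_t (b := X) (d := B) hx0 hA
  obtain ⟨C3, h3, H3⟩ := (smooth_laxA21 (l := l) hs).lip_t (b := X) (d := B) hx0 hA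
  obtain ⟨C4, h4, H4⟩ := (smooth_laxA22 hs).lip_t (b := X) (d := B) hx0 hA
  refine ⟨Ci + Cv + C3 + C4, by positivity, fun x hx s hs t ht => ⟨?_, ?_, ?_, ?_⟩⟩
  · exact (H1 x hx s hs t ht).trans (by gcongr; linarith)
  · exact (H2 x hx s hs t ht).trans (by gcongr; linarith)
  · exact (H3 x hx s hs t ht).trans (by gcongr; linarith)
  · exact (H4 x hx s hs t ht).trans (by gcongr; linarith)

lemma one_le_norm_add_I {l : ℂ} (hl : l ∈ UHPc) : 1 ≤ ‖l + I‖ := by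
  have hl' : 0 ≤ l.im := hl
  refine le_trans ?_ (abs_im_le_norm _)
  simp only [add_im, I_im]
  rw [abs_of_nonneg (by linarith)]; linarith

/-- Uniform bounds in the GI gauge. -/
lemma GISol.jost_uniform' (hq : GISol q) {x0 A B s : ℝ} (hx0 : 0 < x0) (hA : 0 < A) (hs : A ≤ s) :
    ∃ C, 0 ≤ C ∧ ∀ a b, A ≤ a → b ≤ B → ContinuousOn (tailMass q x0) (Icc a b) →
      s ∈ Icc a b → ∀ t ∈ Icc a b, ∀ l ∈ UHPc, ‖giJ1 q l x0 t‖ ≤ C ∧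
        ‖giJ2 q l x0 t‖ ≤ C ∧ ‖l + I‖ * ‖giJ2 q l x0 t - 1‖ ≤ C := by
  obtain ⟨C, hC, h⟩ := hq.jost_uniform (B := B) hx0 hA hs
  obtain ⟨Q, hQ, hQb⟩ := hq.smooth.exists_bound_t (d := B) hx0 hA
  have hQC : 0 ≤ Q * C := by positivity
  refine ⟨C + Q * C + 1, by positivity, fun a b ha hb hm hsab t ht l hl => ?_⟩
  obtain ⟨h1, h2⟩ := h a b ha hb hm hsab t ht l hl
  have hI := one_le_norm_add_I hl
  have e1 : ‖l + I‖ * ‖giJ2 q l x0 t - 1‖ ≤ C + Q * C := by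
    have e : giJ2 q l x0 t - 1 = (akJ2 q l x0 t - 1) +
        I / 2 * conj (q x0 t) * giJ1 q l x0 t := by
      simp only [giJ2]; ring
    rw [e]
    refine (mul_le_mul_of_nonneg_left (norm_add_le _ _) (norm_nonneg _)).trans ?_
    rw [mul_add]
    refine add_le_add h2 ?_
    simp only [norm_mul, norm_div, norm_I, norm_ofNat, RCLike.norm_conj]
    have hq' := hQb t ⟨ha.trans ht.1, ht.2.trans hb⟩
    calc _ = 1 / 2 * ‖q x0 t‖ * (‖l + I‖ * ‖giJ1 q l x0 t‖) := by ring
      _ ≤ 1 / 2 * Q * C := by gcongr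
      _ ≤ Q * C := by linarith
  have e2 : ‖giJ1 q l x0 t‖ ≤ ‖l + I‖ * ‖giJ1 q l x0 t‖ := le_mul_of_one_le_left (norm_nonneg _) hI
  have e3 : ‖giJ2 q l x0 t - 1‖ ≤ ‖l + I‖ * ‖giJ2 q l x0 t - 1‖ :=
    le_mul_of_one_le_left (norm_nonneg _) hI
  have e4 := norm_le_insert' (giJ2 q l x0 t) 1
  rw [norm_one] at e4
  exact ⟨by linarith, by linarith, by linarith⟩

lemma mem_uIcc_or {s a t r : ℝ} (ht : t ∈ uIcc s a) (hr : r ∈ uIcc s a) :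
    r ∈ uIcc s t ∨ t ∈ uIcc s r := by
  rw [mem_uIcc] at *
  rw [mem_uIcc]
  grind

/-- Continuity of the Jost solutions and of the mass up to the end of an interval of continuity of
the mass, far to the right. -/
lemma GISol.gap_closure_far (hq : GISol q) {x0 s a : ℝ} (hx0 : 0 < x0) (hs : 0 < s) (ha : 0 < a)
    (hsa : s ≠ a)
    (hgap : ∀ t ∈ uIcc s a \ {a}, ContinuousOn (tailMass q x0) (uIcc s t))
    (hnear : ∀ l ∈ UHPc, ‖giJ2 q l x0 a - 1‖ ≤ 1 / 4) :
    Tendsto (tailMass q x0) (𝓝[uIcc s a \ {a}] a) (𝓝 (tailMass q x0 a)) := by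
  have hsm := hq.smooth
  set S := uIcc s a \ {a} with hS
  set A := min s a with hAdef
  set B := max s a with hBdef
  have hA : 0 < A := lt_min hs ha
  have hS_Icc : ∀ t ∈ S, t ∈ Icc A B := fun t ht => ht.1
  have hpos : ∀ t ∈ S, 0 < t := fun t ht => hA.trans_le (hS_Icc t ht).1
  have haI : a ∈ Icc A B := right_mem_uIcc
  have hlow : ∀ t ∈ S, A ≤ min s t := fun t ht => le_min (min_le_left _ _) (hS_Icc t ht).1
  have hupp : ∀ t ∈ S, max s t ≤ B := fun t ht => max_le (le_max_left _ _) (hS_Icc t ht).2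
  have : (𝓝[S] a).NeBot := by
    have := isPreconnected_uIcc.preperfect_of_nontrivial ⟨s, left_mem_uIcc, a, right_mem_uIcc, hsa⟩
      a right_mem_uIcc
    rwa [AccPt, ← nhdsWithin_inter', inter_comm] at this
  -- uniform bounds
  obtain ⟨C, hC, hCb'⟩ := hq.jost_uniform' (B := B) hx0 hA (min_le_left s a)
  have hCb : ∀ t ∈ S, ∀ l ∈ UHPc, ‖giJ1 q l x0 t‖ ≤ C ∧
      ‖giJ2 q l x0 t‖ ≤ C ∧ ‖l + I‖ * ‖giJ2 q l x0 t - 1‖ ≤ C := fun t ht =>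
    hCb' (min s t) (max s t) (hlow t ht) (hupp t ht) (hgap t ht) left_mem_uIcc t right_mem_uIcc
  have hlip : ∀ R, 0 ≤ R → ∃ L, 0 ≤ L ∧ ∀ l ∈ UHPc, ‖l‖ ≤ R → ∀ t ∈ S, ∀ t' ∈ S,
      ‖giJ1 q l x0 t - giJ1 q l x0 t'‖ ≤ L * |t - t'| ∧
      ‖giJ2 q l x0 t - giJ2 q l x0 t'‖ ≤ L * |t - t'| := by
    intro R hR
    obtain ⟨M, hM, hMb⟩ := exists_laxB_le hsm (b := B) hx0 hA hR
    refine ⟨M * C + M * C, by positivity, fun l hl hlR => ?_⟩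
    have key : ∀ t ∈ S, ∀ t' ∈ uIcc s t,
        ‖giJ1 q l x0 t - giJ1 q l x0 t'‖ ≤ (M * C + M * C) * |t - t'| ∧
        ‖giJ2 q l x0 t - giJ2 q l x0 t'‖ ≤ (M * C + M * C) * |t - t'| := by
      intro t ht t' ht'
      exact (hq.jost_t_system hx0 (hA.trans_le (hlow t ht)) min_le_max (hgap t ht) hl).lipschitz
        (convex_Icc _ _) (fun r hr => hMb l hlR r ⟨(hlow t ht).trans hr.1, hr.2.trans (hupp t ht)⟩)
        (fun r hr => (hCb' (min s t) (max s t) (hlow t ht) (hupp t ht) (hgap t ht) left_mem_uIcc r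
          hr l hl).imp_right And.left) ht' right_mem_uIcc
    intro t ht t' ht'
    rcases mem_uIcc_or ht.1 ht'.1 with h | h
    · exact key t ht t' h
    · have := key t' ht' t h
      rw [abs_sub_comm, norm_sub_rev, norm_sub_rev (giJ2 q l x0 t)]
      exact this
  obtain ⟨g1, -, hg1, v1⟩ := exists_limit_of_lipschitz (f := fun l => giJ1 q l x0) (S := S) (a := a) fun R hR =>
    (hlip R hR).imp fun L h => ⟨h.1, fun l hl hlR t ht t' ht' => (h.2 l hl hlR t ht t' ht').1⟩
  obtain ⟨g2, hgb, hg2, v2⟩ := exists_limit_of_lipschitz (f := fun l => giJ2 q l x0) (S := S) (a := a) fun R hR =>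
    (hlip R hR).imp fun L h => ⟨h.1, fun l hl hlR t ht t' ht' => (h.2 l hl hlR t ht t' ht').2⟩
  have hreg := (eventually_mem_nhdsWithin (a := a) (s := S)).mono fun t ht =>
    hq.jost_regular hx0 (hpos t ht)
  have cg1 : ContinuousOn g1 UHPc := v1.continuousOn (hreg.mono fun t h => h.1).frequently
  have cg2 : ContinuousOn g2 UHPc := v2.continuousOn (hreg.mono fun t h => h.2.1).frequently
  have dg2 : DifferentiableOn ℂ g2 UHP :=
    (v2.mono UHP_subset).differentiableOn (hreg.mono fun t h => h.2.2.2) isOpen_UHP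
  obtain ⟨ca1, ca2, -, da2⟩ := hq.jost_regular hx0 ha
  -- the Wronskian with the Jost solution at the end vanishes
  have hWU : ∀ l ∈ UHP, g1 l * giJ2 q l x0 a = g2 l * giJ1 q l x0 a := by
    intro l hl
    have hl' := UHP_subset hl
    have him : 0 < l.im := hl
    have hlpos : 0 < ‖l‖ := him.trans_le ((le_abs_self _).trans (abs_im_le_norm l))
    obtain ⟨F, hF, hFb⟩ := hq.tailMass_lip (B := B) hx0 hA
    set m := tailMass q x0 s + F * (B - A) + tailMass q x0 a with hm
    have hAB : 0 ≤ B - A := by linarith [haI.1, haI.2]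
    have hmt : ∀ t ∈ S, tailMass q x0 t ≤ m := by
      intro t ht
      have h1 : |tailMass q x0 t - tailMass q x0 s| ≤ F * (B - A) := by
        have h2 := hFb _ _ (hlow t ht) min_le_max (hupp t ht) (hgap t ht)
        have h3 : F * (max s t - min s t) ≤ F * (B - A) := by
          have := hlow t ht
          have := hupp t ht
          gcongr
        rcases le_total s t with h | h
        · rw [min_eq_left h, max_eq_right h] at h2 h3
          exact h2.trans h3
        · rw [min_eq_right h, max_eq_left h] at h2 h3
          rw [abs_sub_comm]
          exact h2.trans h3
      have h4 := tailMass_nonneg q x0 a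
      linarith [(abs_le.1 h1).2]
    have hma : tailMass q x0 a ≤ m := by
      have h4 := tailMass_nonneg q x0 s
      have : 0 ≤ F * (B - A) := by positivity
      linarith
    set E := Real.exp (‖l‖ / l.im * m) with hE
    set N := E / ‖l‖ + 1 + (E + 1) with hN
    have hE0 : 0 < E := Real.exp_pos _
    have hEl : 0 < E / ‖l‖ := by positivity
    have hNb : ∀ t, 0 < t → tailMass q x0 t ≤ m → ∀ x, x0 ≤ x →
        ‖giJ1 q l x t‖ ≤ N ∧ ‖giJ2 q l x t‖ ≤ N := by
      intro t ht hmt x hx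
      have h1 := hq.jost_energy hl (hx0.trans_le hx) ht
      have h2 : Real.exp (‖l‖ / l.im * tailMass q x t) ≤ E := by
        have := hq.tailMass_anti hx0.le hx ht
        rw [hE]
        gcongr
        linarith
      have h3 : ‖giJ1 q l x t‖ ^ 2 ≤ E / ‖l‖ := by
        rw [le_div_iff₀ hlpos]
        nlinarith [sq_nonneg ‖giJ2 q l x t‖]
      have h4 : ‖giJ2 q l x t‖ ^ 2 ≤ E := by
        have : 0 ≤ ‖l‖ * ‖giJ1 q l x t‖ ^ 2 := by positivity
        linarith
      exact ⟨by nlinarith [sq_nonneg (‖giJ1 q l x t‖ - 1)],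
        by nlinarith [sq_nonneg (‖giJ2 q l x t‖ - 1)]⟩
    have hX : ∀ k : ℕ, ‖g1 l * giJ2 q l x0 a - g2 l * giJ1 q l x0 a‖ ≤
        2 * N ^ 2 * Real.exp (-(2 * l.im * k)) := by
      intro k
      have hxk : x0 ≤ x0 + k := by linarith [k.cast_nonneg (α := ℝ)]
      obtain ⟨D, hD, hDb⟩ := exists_laxA_lip hsm (X := x0 + k) (B := B) l hx0 hA
      have h1 : ∀ᶠ t in 𝓝[S] a, ‖giJ1 q l x0 t * giJ2 q l x0 a - giJ2 q l x0 t * giJ1 q l x0 a‖ ≤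
          2 * N ^ 2 * Real.exp (-(2 * l.im * k)) + 4 * N ^ 2 * (D * |t - a|) * k := by
        filter_upwards [self_mem_nhdsWithin] with t ht
        have := hq.wronskian_compare hl' hx0 hxk (hpos t ht) ha
          (fun x hx => ⟨(hNb _ (hpos t ht) (hmt t ht) x hx.1).1,
            (hNb _ (hpos t ht) (hmt t ht) x hx.1).2, hNb _ ha hma x hx.1⟩)
          (fun x hx => hDb x hx a haI t (hS_Icc t ht))
        rwa [add_sub_cancel_left] at this
      have h2 := (((hg1 l hl').mul_const (giJ2 q l x0 a)).sub
        ((hg2 l hl').mul_const (giJ1 q l x0 a))).norm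
      have h3 := ((((((tendsto_id.mono_left (nhdsWithin_le_nhds (a := a) (s := S))).sub_const a).abs.const_mul D).const_mul (4 * N ^ 2)).mul_const
        (k : ℝ)).const_add (2 * N ^ 2 * Real.exp (-(2 * l.im * k))))
      simp only [sub_self, abs_zero, mul_zero, zero_mul, add_zero] at h3
      exact le_of_tendsto_of_tendsto h2 h3 h1
    have hlim : Tendsto (fun k : ℕ => 2 * N ^ 2 * Real.exp (-(2 * l.im * k))) atTop (𝓝 0) := by
      have e1 : Tendsto (fun k : ℕ => 2 * l.im * (k : ℝ)) atTop atTop :=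
        tendsto_natCast_atTop_atTop.const_mul_atTop (by positivity)
      have := (Real.tendsto_exp_neg_atTop_nhds_zero.comp e1).const_mul (2 * N ^ 2)
      simpa [Function.comp_def] using this
    have := ge_of_tendsto' hlim hX
    rwa [norm_le_zero_iff, sub_eq_zero] at this
  have hW : ∀ l ∈ UHPc, g1 l * giJ2 q l x0 a = g2 l * giJ1 q l x0 a :=
    EqOn.of_subset_closure hWU (cg1.mul ca2) (cg2.mul ca1) UHP_subset closure_UHP
  have hne : ∀ l ∈ UHPc, giJ2 q l x0 a ≠ 0 := by
    intro l hl h0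
    have := hnear l hl
    rw [h0] at this
    norm_num at this
  have hg0 : ∀ l ∈ UHPc, g2 l ≠ 0 := by
    intro l hl h2
    have h1 : g1 l = 0 := by
      have := hW l hl
      rw [h2, zero_mul, mul_eq_zero] at this
      exact this.resolve_right (hne l hl)
    obtain ⟨M, hM, hMb⟩ := exists_laxB_le hsm (b := B) hx0 hA (norm_nonneg l)
    have h3 : ∀ᶠ t in 𝓝[S] a, ‖giJ1 q l x0 s‖ ^ 2 + ‖giJ2 q l x0 s‖ ^ 2 ≤
        (‖giJ1 q l x0 t‖ ^ 2 + ‖giJ2 q l x0 t‖ ^ 2) * Real.exp (4 * (M * (B - A))) := by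
      filter_upwards [self_mem_nhdsWithin] with t ht
      refine (linear_energy_two_sided (hq.jost_t_system hx0 (hA.trans_le (hlow _ ht)) min_le_max
        (hgap _ ht) hl) (fun r hr => hMb l le_rfl r ⟨(hlow _ ht).trans hr.1,
          hr.2.trans (hupp _ ht)⟩) right_mem_uIcc left_mem_uIcc).trans ?_
      have e1 := hlow _ ht
      have e2 := hupp _ ht
      gcongr
    have h4 := ((((hg1 l hl).norm.pow 2).add ((hg2 l hl).norm.pow 2)).mul_const
      (Real.exp (4 * (M * (B - A)))))
    have h5 := ge_of_tendsto h4 h3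
    rw [h1, h2, norm_zero] at h5
    have h6 := sq_nonneg ‖giJ1 q l x0 s‖
    have h7 := sq_nonneg ‖giJ2 q l x0 s‖
    norm_num at h5
    refine hq.jost_ne_zero hl hx0 hs ⟨?_, ?_⟩
    · exact norm_eq_zero.1 (pow_eq_zero_iff two_ne_zero |>.1 (by linarith))
    · exact norm_eq_zero.1 (pow_eq_zero_iff two_ne_zero |>.1 (by linarith))
  have hκ : ∀ l ∈ UHPc, g2 l / giJ2 q l x0 a = 1 := by
    obtain ⟨Ca, hCa, hCab⟩ := hq.jost_uniform' (B := B) hx0 hA (min_le_right s a)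
    have hCa' := hCab a a haI.1 haI.2 (by rw [Icc_self]; exact continuousOn_singleton _ _)
      (left_mem_Icc.2 le_rfl) a (left_mem_Icc.2 le_rfl)
    refine eq_one_of_unimodular (C := 2 * (C + Ca)) (cg2.div ca2 hne)
      (dg2.div da2 fun l hl => hne l (UHP_subset hl))
      (fun l hl => div_ne_zero (hg0 l hl) (hne l hl)) (fun x => ?_) fun l hl => ?_
    · have hx : (x : ℂ) ∈ UHPc := by simp [UHPc]
      have h1 := ((hg2 x hx).norm.pow 2).sub (((hg1 x hx).norm.pow 2).const_mul x)
      have h2 : ∀ᶠ t in 𝓝[S] a, 1 = ‖giJ2 q x x0 t‖ ^ 2 - x * ‖giJ1 q x x0 t‖ ^ 2 := by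
        filter_upwards [self_mem_nhdsWithin] with t ht using (hq.jost_real hx0 (hpos t ht) x).symm
      have h3 := tendsto_nhds_unique h1 (tendsto_const_nhds.congr' h2)
      have h4 := hq.jost_real hx0 ha x
      have hn := hne x hx
      set k := g2 x / giJ2 q x x0 a with hk
      have e2 : g2 x = k * giJ2 q x x0 a := by rw [hk]; field_simp
      have e1 : g1 x = k * giJ1 q x x0 a := by rw [hk]; field_simp; exact hW x hx
      rw [e1, e2, norm_mul, norm_mul] at h3
      have h5 : ‖k‖ ^ 2 = 1 := by
        have : ‖k‖ ^ 2 * (‖giJ2 q x x0 a‖ ^ 2 - x * ‖giJ1 q x x0 a‖ ^ 2) = 1 := by rw [← h3]; ring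
        rwa [h4, mul_one] at this
      exact (pow_eq_one_iff_of_nonneg (norm_nonneg _) two_ne_zero).1 h5
    · have hn := hne l hl
      have h1 : ‖l + I‖ * ‖g2 l - 1‖ ≤ C :=
        le_of_tendsto (((hg2 l hl).sub_const 1).norm.const_mul _)
          (eventually_mem_nhdsWithin.mono fun t ht => (hCb t ht l hl).2.2)
      have h2 := (hCa' l hl).2.2
      have h3 : 1 / 2 ≤ ‖giJ2 q l x0 a‖ := by
        have := norm_sub_le (giJ2 q l x0 a) (giJ2 q l x0 a - 1)
        rw [sub_sub_cancel, norm_one] at this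
        linarith [hnear l hl]
      have e : g2 l / giJ2 q l x0 a - 1 =
          ((g2 l - 1) - (giJ2 q l x0 a - 1)) / giJ2 q l x0 a := by
        field_simp; ring
      rw [e, norm_div, ← mul_div_assoc, div_le_iff₀ (by linarith)]
      have h4 := mul_le_mul_of_nonneg_left (norm_sub_le (g2 l - 1) (giJ2 q l x0 a - 1))
        (norm_nonneg (l + I))
      nlinarith
  have hgG : ∀ l ∈ UHPc, g2 l = giJ2 q l x0 a := fun l hl =>
    (div_eq_one_iff_eq (hne l hl)).1 (hκ l hl)
  have hmem : ∀ l : ℝ, (l : ℂ) ∈ UHPc := fun l => by simp [UHPc]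
  -- convergence of the Jost solutions, uniformly for `l ≥ 0`
  obtain ⟨L, hL, hLb⟩ := hgb (2 * C + 1) (by positivity)
  have hre_of : ∀ z : ℂ, ‖z - 1‖ ≤ 1 / 2 → 0 < z.re := by
    intro z hz
    have h1 := (abs_le.1 ((abs_re_le_norm (z - 1)).trans hz)).1
    rw [sub_re, Complex.one_re] at h1
    linarith
  have hnear_t : ∀ᶠ t in 𝓝[S] a, L * |t - a| < 1 / 4 := by
    have : Tendsto (fun t => L * |t - a|) (𝓝 a) (𝓝 0) := by
      have h : Continuous fun t => L * |t - a| := by fun_prop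
      simpa using h.tendsto a
    exact (this.mono_left nhdsWithin_le_nhds).eventually (gt_mem_nhds (by norm_num))
  have hre : ∀ᶠ t in 𝓝[S] a, ∀ l : ℝ, 0 ≤ l → 0 < (giJ2 q l x0 t).re := by
    filter_upwards [hnear_t, self_mem_nhdsWithin] with t ht htS l hl
    refine hre_of _ ?_
    rcases le_or_gt ‖(l : ℂ)‖ (2 * C + 1) with h | h
    · have h1 := hLb l (hmem l) h t htS
      rw [hgG l (hmem l)] at h1
      have h2 := hnear l (hmem l)
      calc ‖giJ2 q l x0 t - 1‖ = ‖(giJ2 q l x0 t - giJ2 q l x0 a) +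
            (giJ2 q l x0 a - 1)‖ := by rw [sub_add_sub_cancel]
        _ ≤ _ := (norm_add_le _ _).trans (by linarith)
    · have h1 := (hCb t htS l (hmem l)).2.2
      have h2 : 2 * C ≤ ‖(l : ℂ) + I‖ := by
        have := norm_sub_le ((l : ℂ) + I) I
        rw [add_sub_cancel_right, norm_I] at this
        linarith
      have h3 := one_le_norm_add_I (hmem l)
      by_contra hc
      push Not at hc
      rcases hC.eq_or_lt with h | h
      · nlinarith
      · nlinarith [mul_lt_mul_of_pos_left hc (by linarith : 0 < ‖(l : ℂ) + I‖)]
  have hrea : ∀ l : ℝ, 0 ≤ l → 0 < (giJ2 q l x0 a).re := fun l _ =>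
    hre_of _ ((hnear l (hmem l)).trans (by norm_num))
  rw [hq.tailMass_eq_arg hx0 ha hrea]
  have hG0 := hg2 _ (hmem 0)
  rw [hgG _ (hmem 0)] at hG0
  have harg := (Complex.continuousAt_arg (Or.inl (hrea 0 le_rfl))).tendsto.comp hG0
  refine (harg.const_mul (-2)).congr' ?_
  filter_upwards [hre, self_mem_nhdsWithin] with t ht htS
  exact (hq.tailMass_eq_arg hx0 (hpos t htS) ht).symm

/-- Continuity of the mass up to the end of an interval of continuity of the mass. -/
theorem GISol.gap_closure (hq : GISol q) {x0 s a : ℝ} (hx0 : 0 < x0) (hs : 0 < s) (ha : 0 < a)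
    (hsa : s ≠ a)
    (hgap : ∀ t ∈ uIcc s a \ {a}, ContinuousOn (tailMass q x0) (uIcc s t)) :
    Tendsto (tailMass q x0) (𝓝[uIcc s a \ {a}] a) (𝓝 (tailMass q x0 a)) := by
  obtain ⟨C, hC, hj⟩ := hq.jost_bound ha
  set X := x0 + 4 * C with hX
  have hXx : x0 ≤ X := by linarith
  have hXo : 0 < X := hx0.trans_le hXx
  have hA : 0 < min s a := lt_min hs ha
  have hmin : ∀ t ∈ uIcc s a \ {a}, 0 < min s t := fun t ht =>
    hA.trans_le (le_min (min_le_left _ _) ht.1.1)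
  have hfar := hq.gap_closure_far hXo hs ha hsa
    (fun t ht => hq.continuousOn_tailMass hx0 hXx (hmin t ht) (hgap t ht)) (fun l hl => by
      refine (hj X hXo l hl).2.2.trans ?_
      rw [div_le_iff₀ (by linarith)]
      linarith)
  have hwin := (hq.continuousOn_windowMass (t1 := max s a) hx0 hXx hA a
    (right_mem_uIcc (a := s) (b := a))).mono_left (nhdsWithin_mono a
      (sdiff_subset : uIcc s a \ {a} ⊆ uIcc s a))
  have := hwin.add hfar
  rw [← hq.tailMass_sub hx0.le hXx ha] at this
  refine this.congr' ?_
  filter_upwards [self_mem_nhdsWithin] with t ht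
  exact (hq.tailMass_sub hx0.le hXx (hA.trans_le ht.1.1)).symm

lemma GISol.abs_tailMass_sub_le (hq : GISol q) {x0 A B : ℝ} (hx0 : 0 < x0) (hA : 0 < A) :
    ∃ F, 0 ≤ F ∧ ∀ t ∈ Icc A B, ∀ e ∈ Icc A B,
      (∀ s ∈ uIcc t e \ {e}, ContinuousAt (tailMass q x0) s) →
      |tailMass q x0 t - tailMass q x0 e| ≤ F * |t - e| := by
  obtain ⟨F, hF, hFb⟩ := hq.tailMass_lip (B := B) hx0 hA
  refine ⟨F, hF, fun t ht e he hcont => ?_⟩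
  rcases eq_or_ne t e with rfl | hte
  · simp
  have htS : t ∈ uIcc t e \ {e} := ⟨left_mem_uIcc, hte⟩
  have hsub : ∀ s ∈ uIcc t e \ {e}, uIcc t s ⊆ uIcc t e \ {e} := by
    rintro s ⟨hs, hse⟩ r hr
    refine ⟨uIcc_subset_uIcc_left hs hr, ?_⟩
    rintro rfl
    refine hse ?_
    rcases le_total t r with h | h
    · rw [uIcc_of_le h] at hs
      rw [uIcc_of_le hs.1] at hr
      exact le_antisymm hs.2 hr.2
    · rw [uIcc_of_ge h] at hs
      rw [uIcc_of_ge hs.2] at hr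
      exact le_antisymm hr.1 hs.1
  have hgap : ∀ s ∈ uIcc t e \ {e}, ContinuousOn (tailMass q x0) (uIcc t s) := fun s hs r hr =>
    (hcont r (hsub s hs hr)).continuousWithinAt
  have hlim := hq.gap_closure hx0 (hA.trans_le ht.1) (hA.trans_le he.1) hte hgap
  have hne : (𝓝[uIcc t e \ {e}] e).NeBot := by
    rcases lt_or_gt_of_ne hte with h | h
    · refine (right_nhdsWithin_Ioo_neBot h).mono (nhdsWithin_mono e fun s hs => ⟨?_, hs.2.ne⟩)
      rw [uIcc_of_le h.le]; exact Ioo_subset_Icc_self hs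
    · refine (left_nhdsWithin_Ioo_neBot h).mono (nhdsWithin_mono e fun s hs => ⟨?_, hs.1.ne'⟩)
      rw [uIcc_of_ge h.le]; exact Ioo_subset_Icc_self hs
  have h1 := (hlim.const_sub (tailMass q x0 t)).abs
  have h2 : Tendsto (fun s => F * |t - s|) (𝓝[uIcc t e \ {e}] e) (𝓝 (F * |t - e|)) := by
    have : Continuous fun s => F * |t - s| := by fun_prop
    exact (this.tendsto e).mono_left nhdsWithin_le_nhds
  refine le_of_tendsto_of_tendsto h1 h2 ?_
  filter_upwards [self_mem_nhdsWithin] with s hs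
  have hsI : s ∈ Icc A B := by
    have h := hs.1
    exact ⟨(le_min ht.1 he.1).trans h.1, h.2.trans (max_le ht.2 he.2)⟩
  have h3 := hFb (min t s) (max t s) (le_min ht.1 hsI.1) min_le_max (max_le ht.2 hsI.2) (hgap s hs)
  rcases le_total t s with h | h
  · rw [min_eq_left h, max_eq_right h] at h3
    rw [abs_sub_comm, abs_sub_comm t, abs_of_nonneg (by linarith : 0 ≤ s - t)]
    exact h3
  · rw [min_eq_right h, max_eq_left h] at h3
    rw [abs_of_nonneg (by linarith : 0 ≤ t - s)]
    exact h3

/-- On a set of times where the solution is uniformly bounded by `N / (1 + x)`, the mass is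
continuous. -/
lemma GISol.tailMass_continuousOn_of_bound (hq : GISol q) {x0 N : ℝ} (hx0 : 0 < x0) {T : Set ℝ}
    (hT : T ⊆ Ioi 0) (hN : ∀ t ∈ T, ∀ x, 0 < x → (1 + x) * ‖q x t‖ ≤ N) :
    ContinuousOn (tailMass q x0) T := by
  intro s hs
  have hN0 : 0 ≤ N := le_trans (by positivity) (hN s hs 1 one_pos)
  have hdom : IntegrableOn (fun x : ℝ => N ^ 2 / (1 + x) ^ 2) (Ioi x0) := by
    have hd : Decay (N ^ 2) (fun x : ℝ => ((N ^ 2 / (1 + x) ^ 2 : ℝ) : ℂ)) := by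
      refine ⟨ContinuousOn.aestronglyMeasurable ?_ measurableSet_Ioi, fun x hx => ?_⟩
      · refine continuous_ofReal.comp_continuousOn ?_
        refine continuousOn_const.div (by fun_prop) fun x hx => ?_
        have : (0 : ℝ) < x := hx
        positivity
      · rw [norm_real, Real.norm_eq_abs, abs_of_nonneg (by positivity)]
    have h1 := (hd.integrableOn (sq_nonneg N) hx0.le).norm
    refine h1.congr ?_
    filter_upwards with x
    rw [norm_real, Real.norm_eq_abs, abs_of_nonneg (by positivity)]
  refine tendsto_integral_filter_of_dominated_convergence _ ?_ ?_ hdom ?_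
  · filter_upwards [self_mem_nhdsWithin] with t ht
    exact (hq.integrable_mass hx0.le (hT ht)).aestronglyMeasurable
  · filter_upwards [self_mem_nhdsWithin] with t ht
    filter_upwards [self_mem_ae_restrict measurableSet_Ioi] with x hx
    have hxo : 0 < x := hx0.trans hx
    have h1 := hN t ht x hxo
    rw [Real.norm_eq_abs, abs_of_nonneg (by positivity), le_div_iff₀ (by positivity), ← mul_pow,
      mul_comm]
    gcongr
  · filter_upwards [self_mem_ae_restrict measurableSet_Ioi] with x hx
    have hxo : 0 < x := hx0.trans hx
    exact ((hq.smooth.hasDerivAt_t hxo (hT hs)).continuousAt.norm.pow 2).tendsto.mono_left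
      nhdsWithin_le_nhds

/-- The mass to the right of any positive point is a continuous function of time. -/
theorem GISol.continuousOn_mass (hq : GISol q) {x0 : ℝ} (hx0 : 0 < x0) :
    ContinuousOn (tailMass q x0) (Ioi 0) := by
  set m := tailMass q x0 with hm
  set Z : Set ℝ := {t | ¬ ∀ᶠ s in 𝓝 t, ContinuousAt m s} with hZ
  have hZc : IsClosed Z := by
    rw [← isOpen_compl_iff]
    have : Zᶜ = {t | ∀ᶠ s in 𝓝 t, ContinuousAt m s} := by ext t; simp [hZ]
    rw [this]
    exact isOpen_setOfPred_eventually_nhds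
  set E : Set ℝ := Ioi 0 ∩ Z with hE
  suffices hempty : E = ∅ by
    intro t ht
    have h1 : t ∉ Z := fun h => by
      have : t ∈ E := ⟨ht, h⟩
      rw [hempty] at this; exact this
    have h2 : ∀ᶠ s in 𝓝 t, ContinuousAt m s := not_not.1 h1
    exact h2.self_of_nhds.continuousWithinAt
  by_contra hne
  have hne' : E.Nonempty := nonempty_iff_ne_empty.2 hne
  have hlc : IsLocallyClosed E := isOpen_Ioi.isLocallyClosed.inter hZc.isLocallyClosed
  have : LocallyCompactSpace E := hlc.locallyCompactSpace
  have : Nonempty E := hne'.to_subtype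
  set K : ℕ → Set E := fun N => {t | ∀ x : ℝ, 0 < x → (1 + x) * ‖q x t‖ ≤ N} with hK
  have hKc : ∀ N, IsClosed (K N) := by
    intro N
    have : K N = ⋂ x ∈ Ioi (0 : ℝ), {t : E | (1 + x) * ‖q x t‖ ≤ N} := by ext t; simp [hK]
    rw [this]
    refine isClosed_biInter fun x hx => ?_
    refine isClosed_le ?_ continuous_const
    have h1 : Continuous fun t : E => q x t :=
      (hq.smooth.continuousOn_t hx).comp_continuous continuous_subtype_val fun t => t.2.1
    exact continuous_const.mul h1.norm
  have hKu : ⋃ N, K N = univ := by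
    refine eq_univ_of_forall fun t => ?_
    obtain ⟨C, hC, hb⟩ := hq.decay t t.2.1
    obtain ⟨N, hN⟩ := exists_nat_ge C
    refine mem_iUnion.2 ⟨N, fun x hx => le_trans ?_ hN⟩
    have h1 := (hb x hx).1
    calc (1 + x) * ‖q x t‖ ≤ (1 + x) * (C / (1 + x) ^ 2) := by gcongr
      _ = C / (1 + x) := by field_simp
      _ ≤ C := div_le_self hC (by linarith)
  obtain ⟨N, hN⟩ := nonempty_interior_of_iUnion_of_closed hKc hKu
  obtain ⟨t1, ht₁⟩ := hN
  have hnb : K N ∈ 𝓝 t1 := mem_interior_iff_mem_nhds.1 ht₁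
  rw [nhds_subtype_eq_comap, Filter.mem_comap] at hnb
  obtain ⟨V, hV, hVK⟩ := hnb
  have ht10 : (0 : ℝ) < t1 := t1.2.1
  obtain ⟨ε, hε, hεV⟩ := Metric.mem_nhds_iff.1 (inter_mem hV (Ioi_mem_nhds ht10))
  set A : ℝ := t1 - ε / 2 with hA'
  set B : ℝ := t1 + ε / 2 with hB'
  have hIV : Icc A B ⊆ V ∩ Ioi 0 := fun t ht => hεV (by
    rw [Metric.mem_ball, Real.dist_eq, abs_lt]
    constructor <;> linarith [ht.1, ht.2])
  have hA : 0 < A := (hIV (left_mem_Icc.2 (by linarith))).2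
  have hrel : ContinuousOn m (E ∩ Icc A B) := by
    refine hq.tailMass_continuousOn_of_bound (N := N) hx0 (fun t ht => ht.1.1) fun t ht => ?_
    have : (⟨t, ht.1⟩ : E) ∈ K N := hVK (hIV ht.2).1
    exact this
  obtain ⟨F, hF, hFb⟩ := hq.abs_tailMass_sub_le (B := B) hx0 hA
  have hcont : ∀ s ∈ Ioo A B, ContinuousAt m s := by
    intro s hs
    by_cases hsE : s ∈ E
    · rw [Metric.continuousAt_iff]
      intro η hη
      have h1 := hrel s ⟨hsE, Ioo_subset_Icc_self hs⟩
      rw [Metric.continuousWithinAt_iff] at h1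
      obtain ⟨δ, hδ, h1⟩ := h1 (η / 2) (half_pos hη)
      obtain ⟨ρ, hρ, hρI⟩ := Metric.isOpen_iff.1 isOpen_Ioo s hs
      refine ⟨min (min δ ρ) (η / (2 * (F + 1))), by positivity, fun t ht => ?_⟩
      have ht1 : dist t s < δ := ht.trans_le ((min_le_left _ _).trans (min_le_left _ _))
      have ht2 : t ∈ Ioo A B := hρI (ht.trans_le ((min_le_left _ _).trans (min_le_right _ _)))
      have ht3 : dist t s < η / (2 * (F + 1)) := ht.trans_le (min_le_right _ _)
      -- the point of `E` closest to `t` between `s` and `t`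
      have hsubI : uIcc s t ⊆ Icc A B := fun r hr =>
        ⟨(le_min hs.1.le ht2.1.le).trans hr.1, hr.2.trans (max_le hs.2.le ht2.2.le)⟩
      have hcomp : IsCompact (E ∩ uIcc s t) := by
        have : E ∩ uIcc s t = uIcc s t ∩ Z := by
          ext r
          constructor
          · rintro ⟨h, h'⟩; exact ⟨h', h.2⟩
          · rintro ⟨h, h'⟩; exact ⟨⟨hA.trans_le (hsubI h).1, h'⟩, h⟩
        rw [this]
        exact isCompact_uIcc.inter_right hZc
      have hnon : (E ∩ uIcc s t).Nonempty := ⟨s, hsE, left_mem_uIcc⟩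
      obtain ⟨e, heE, heI, hfree⟩ : ∃ e, e ∈ E ∧ e ∈ uIcc s t ∧ ∀ r ∈ uIcc t e \ {e}, r ∉ E := by
        rcases le_total s t with h | h
        · obtain ⟨e, he, hmax⟩ := hcomp.exists_isGreatest hnon
          have he2 := he.2
          rw [uIcc_of_le h] at he2
          refine ⟨e, he.1, he.2, fun r hr hrE => hr.2 ?_⟩
          have hr1 := hr.1
          rw [uIcc_of_ge he2.2] at hr1
          refine le_antisymm (hmax ⟨hrE, ?_⟩) hr1.1
          rw [uIcc_of_le h]; exact ⟨he2.1.trans hr1.1, hr1.2⟩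
        · obtain ⟨e, he, hmin⟩ := hcomp.exists_isLeast hnon
          have he2 := he.2
          rw [uIcc_of_ge h] at he2
          refine ⟨e, he.1, he.2, fun r hr hrE => hr.2 ?_⟩
          have hr1 := hr.1
          rw [uIcc_of_le he2.1] at hr1
          refine le_antisymm hr1.2 (hmin ⟨hrE, ?_⟩)
          rw [uIcc_of_ge h]; exact ⟨hr1.1, hr1.2.trans he2.2⟩
      have hgood : ∀ r ∈ uIcc t e \ {e}, ContinuousAt m r := by
        intro r hr
        have hr0 : r ∈ Icc A B := hsubI (uIcc_subset_uIcc right_mem_uIcc heI hr.1)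
        have : r ∉ Z := fun h => hfree r hr ⟨hA.trans_le hr0.1, h⟩
        exact (not_not.1 this : ∀ᶠ s in 𝓝 r, ContinuousAt m s).self_of_nhds
      have k1 := hFb t (Ioo_subset_Icc_self ht2) e (hsubI heI) hgood
      have hes : dist e s ≤ dist t s := by
        rw [Real.dist_eq, Real.dist_eq]
        exact abs_sub_left_of_mem_uIcc heI
      have hte : |t - e| ≤ dist t s := by
        rw [Real.dist_eq, abs_sub_comm]
        have := abs_sub_right_of_mem_uIcc heI
        rwa [abs_sub_comm t s, abs_sub_comm e t, abs_sub_comm s t]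
      have k2 := h1 ⟨heE, hsubI heI⟩ (hes.trans_lt ht1)
      rw [Real.dist_eq] at k2 ⊢
      have k3 : F * |t - e| < η / 2 := by
        rw [lt_div_iff₀ (by positivity)] at ht3
        have h0 := abs_nonneg (t - e)
        nlinarith [dist_nonneg (x := t) (y := s)]
      calc |m t - m s| ≤ |m t - m e| + |m e - m s| := abs_sub_le _ _ _
        _ < η := by linarith
    · have hs0 : 0 < s := hA.trans hs.1
      have : s ∉ Z := fun h => hsE ⟨hs0, h⟩
      exact (not_not.1 this : ∀ᶠ r in 𝓝 s, ContinuousAt m r).self_of_nhds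
  exact t1.2.2 (by
    filter_upwards [Ioo_mem_nhds (show A < t1 by linarith) (show (t1 : ℝ) < B by linarith)] with s hs
    exact hcont s hs)

lemma iteratedDerivWithin_Ici_eq {u : ℝ → ℂ} {m : ℕ} {x : ℝ} (hx : 0 < x) :
    iteratedDerivWithin m u (Ici 0) x = iteratedDeriv m u x := by
  have h : Ici (0 : ℝ) =ᶠ[𝓝 x] univ := eventuallyEq_univ.2 (Ici_mem_nhds hx)
  rw [← iteratedDerivWithin_univ, iteratedDerivWithin, iteratedDerivWithin,
    iteratedFDerivWithin_congr_set h]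

lemma IsSchwartzHalfLine.decay {u : ℝ → ℂ} (h : IsSchwartzHalfLine u) (m : ℕ) :
    ∃ C, 0 ≤ C ∧ ∀ x, 0 < x → ‖iteratedDeriv m u x‖ ≤ C / (1 + x) ^ 2 := by
  obtain ⟨C0, h0⟩ := h.2 0 m
  obtain ⟨Cv, h2⟩ := h.2 2 m
  have hC : 0 ≤ C0 := le_trans (by positivity) (h0 0 le_rfl)
  have hC' : 0 ≤ Cv := le_trans (by positivity) (h2 0 le_rfl)
  refine ⟨2 * C0 + 2 * Cv, by positivity, fun x hx => ?_⟩
  have e0 := h0 x hx.le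
  have e2 := h2 x hx.le
  rw [iteratedDerivWithin_Ici_eq hx] at e0 e2
  rw [pow_zero, abs_one, one_mul] at e0
  rw [abs_of_nonneg (by positivity)] at e2
  rw [le_div_iff₀ (by positivity)]
  nlinarith [norm_nonneg (iteratedDeriv m u x), sq_nonneg (1 - x)]

/-- A quarter plane solution restricted to the open quadrant. -/
lemma IsGIQuarterPlaneSolution.gISol (h : IsGIQuarterPlaneSolution q) : GISol q := by
  have hs : SmoothQ q := h.smooth.mono (prod_mono Ioi_subset_Ici_self Ioi_subset_Ici_self)
  have hdd : ∀ x t, 0 < x → 0 < t → iteratedDeriv 2 (fun y => q y t) x = dx (dx q) x t := by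
    intro x t _ _
    rw [iteratedDeriv_succ, iteratedDeriv_one]
    rfl
  refine ⟨hs, fun t ht => ?_, fun x t hx ht => ?_⟩
  · obtain ⟨C0, c0, h0⟩ := (h.schwartz t ht.le).decay 0
    obtain ⟨Ci, c1, h1⟩ := (h.schwartz t ht.le).decay 1
    obtain ⟨Cv, c2, h2⟩ := (h.schwartz t ht.le).decay 2
    refine ⟨C0 + Ci + Cv, by positivity, fun x hx => ⟨?_, ?_, ?_⟩⟩
    · have := h0 x hx
      rw [iteratedDeriv_zero] at this
      refine this.trans ?_
      gcongr; linarith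
    · have := h1 x hx
      rw [iteratedDeriv_one] at this
      refine this.trans ?_
      gcongr; linarith
    · have := h2 x hx
      rw [hdd x t hx ht] at this
      refine this.trans ?_
      gcongr; linarith
  · have e := h.equation x t hx ht
    rw [GIEquationAt, hdd x t hx ht, (hs.hasDerivAt_x hx ht).conjC.deriv] at e
    change I * dt q x t + _ + _ + _ = 0 at e
    have hn : (‖q x t‖ : ℂ) ^ 4 = (q x t * conj (q x t)) ^ 2 := by
      rw [mul_conj, normSq_eq_norm_sq]; push_cast; ring
    rw [hn] at e
    linear_combination -I * e + dt q x t * I_sq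

/-- The `x`-derivative extends continuously to the closed quadrant. -/
lemma IsGIQuarterPlaneSolution.exists_boundary_derivative (h : IsGIQuarterPlaneSolution q) :
    ∃ Q : ℝ × ℝ → ℂ, ContinuousOn Q (Ici 0 ×ˢ Ici 0) ∧
      (∀ x t, 0 < x → 0 < t → Q (x, t) = dx q x t) ∧
      ∀ t, 0 ≤ t → Q (0, t) = derivWithin (fun x => q x t) (Ici 0) 0 := by
  set D : Set (ℝ × ℝ) := Ici 0 ×ˢ Ici 0 with hD
  set F : ℝ × ℝ → ℂ := fun p => q p.1 p.2 with hF
  have hu : UniqueDiffOn ℝ D := (uniqueDiffOn_Ici 0).prod (uniqueDiffOn_Ici 0)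
  have hder : ∀ x t, 0 ≤ x → 0 ≤ t → HasDerivWithinAt (fun y => q y t)
      (fderivWithin ℝ F D (x, t) (1, 0)) (Ici 0) x := by
    intro x t hx ht
    have h1 : HasFDerivWithinAt F (fderivWithin ℝ F D (x, t)) D (x, t) :=
      ((h.smooth (x, t) ⟨hx, ht⟩).differentiableWithinAt (by simp)).hasFDerivWithinAt
    have h2 : HasDerivWithinAt (fun y : ℝ => (y, t)) (1, 0) (Ici 0) x :=
      ((hasDerivAt_id x).prodMk (hasDerivAt_const x t)).hasDerivWithinAt
    have h3 : MapsTo (fun y : ℝ => (y, t)) (Ici 0) D := fun y hy => mk_mem_prod hy ht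
    exact h1.comp_hasDerivWithinAt x h2 h3
  refine ⟨fun p => fderivWithin ℝ F D p (1, 0), ?_, fun x t hx ht => ?_, fun t ht => ?_⟩
  · exact (h.smooth.continuousOn_fderivWithin hu (by simp)).clm_apply continuousOn_const
  · exact ((hder x t hx.le ht.le).hasDerivAt (Ici_mem_nhds hx)).deriv.symm
  · exact ((hder 0 t le_rfl ht).derivWithin (uniqueDiffOn_Ici 0 0 self_mem_Ici)).symm

/-- Uniform convergence to the boundary values on compact time intervals. -/
lemma eventually_boundary {f : ℝ × ℝ → ℂ} (hf : ContinuousOn f (Ici 0 ×ˢ Ici 0)) {a b ε : ℝ}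
    (ha : 0 ≤ a) (hε : 0 < ε) :
    ∀ᶠ x in 𝓝[>] 0, ∀ t ∈ Icc a b, ‖f (x, t) - f (0, t)‖ ≤ ε :=
  (eventually_norm_sub_le (f := fun x t => f (x, t)) isCompact_Icc
    (hf.mono (prod_mono_right fun _ h => ha.trans h.1)) self_mem_Ici hε).filter_mono
    (nhdsWithin_mono 0 Ioi_subset_Ici_self)

lemma GISol.exists_laxA_le (hq : GISol q) {t R : ℝ} (ht : 0 < t) (hR : 0 ≤ R) :
    ∃ M, 0 ≤ M ∧ ∀ l : ℂ, ‖l‖ ≤ R → ∀ x, 0 < x → ‖laxA11 q l x t‖ ≤ M ∧ ‖laxA12 q x t‖ ≤ M ∧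
      ‖laxA21 q l x t‖ ≤ M ∧ ‖laxA22 q x t‖ ≤ M := by
  obtain ⟨C, hC, hd⟩ := hq.decay t ht
  refine ⟨2 * R + C * C + C + R * C, by positivity, fun l hl x hx => ?_⟩
  have hqC : ‖q x t‖ ≤ C := (hd x hx).1.trans (div_le_self hC (by nlinarith))
  have hqq : ‖q x t‖ * ‖q x t‖ ≤ C * C := by gcongr
  have hlq : ‖l‖ * ‖q x t‖ ≤ R * C := by gcongr
  have p1 : 0 ≤ C * C := by positivity
  have p2 : 0 ≤ R * C := by positivity
  refine ⟨(norm_add_le _ _).trans ?_, ?_, ?_, ?_⟩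
  all_goals simp only [laxA12, laxA21, laxA22, norm_neg, norm_mul, norm_div, norm_I,
    norm_ofNat, RCLike.norm_conj]
  all_goals linarith

/-- The Jost solutions are Lipschitz up to the boundary at a fixed time. -/
lemma GISol.jost_lipschitz (hq : GISol q) {t R : ℝ} (ht : 0 < t) (hR : 0 ≤ R) :
    ∃ L, 0 ≤ L ∧ ∀ l ∈ UHPc, ‖l‖ ≤ R → ∀ x ∈ Ioi (0 : ℝ), ∀ y ∈ Ioi (0 : ℝ),
      ‖giJ1 q l x t - giJ1 q l y t‖ ≤ L * |x - y| ∧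
      ‖giJ2 q l x t - giJ2 q l y t‖ ≤ L * |x - y| := by
  obtain ⟨C, hC, hJ⟩ := hq.jost_bdd ht
  obtain ⟨M, hM, hMb⟩ := hq.exists_laxA_le ht hR
  refine ⟨M * C + M * C, by positivity, fun l hl hlR x hx y hy => ?_⟩
  exact LinSys.lipschitz (fun r hr => ⟨(hq.hasDerivAt_x hl hr ht).1.hasDerivWithinAt,
    (hq.hasDerivAt_x hl hr ht).2.hasDerivWithinAt⟩) (convex_Ioi _) (hMb l hlR)
    (fun r hr => hJ r hr l hl) hy hx

/-- The boundary traces of the Jost solutions. -/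
lemma GISol.exists_boundary_jost (hq : GISol q) :
    ∃ φ1 φ2 : ℝ → ℂ → ℂ, ∀ t, 0 < t → (∀ l ∈ UHPc,
      Tendsto (fun x => giJ1 q l x t) (𝓝[>] 0) (𝓝 (φ1 t l)) ∧
      Tendsto (fun x => giJ2 q l x t) (𝓝[>] 0) (𝓝 (φ2 t l))) ∧
      DifferentiableOn ℂ (φ1 t) UHP ∧ DifferentiableOn ℂ (φ2 t) UHP := by
  suffices ∀ t, ∃ φ1 φ2 : ℂ → ℂ, 0 < t → (∀ l ∈ UHPc,
      Tendsto (fun x => giJ1 q l x t) (𝓝[>] 0) (𝓝 (φ1 l)) ∧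
      Tendsto (fun x => giJ2 q l x t) (𝓝[>] 0) (𝓝 (φ2 l))) ∧
      DifferentiableOn ℂ φ1 UHP ∧ DifferentiableOn ℂ φ2 UHP by
    choose φ1 φ2 h using this
    exact ⟨φ1, φ2, h⟩
  intro t
  by_cases ht : 0 < t
  · obtain ⟨g1, -, h1, v1⟩ := exists_limit_of_lipschitz (f := fun l x => giJ1 q l x t) (S := Ioi 0)
      (a := 0) fun R hR => (hq.jost_lipschitz ht hR).imp fun L h =>
        ⟨h.1, fun l hl hlR x hx y hy => (h.2 l hl hlR x hx y hy).1⟩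
    obtain ⟨g2, -, h2, v2⟩ := exists_limit_of_lipschitz (f := fun l x => giJ2 q l x t) (S := Ioi 0)
      (a := 0) fun R hR => (hq.jost_lipschitz ht hR).imp fun L h =>
        ⟨h.1, fun l hl hlR x hx y hy => (h.2 l hl hlR x hx y hy).2⟩
    have hreg := (eventually_mem_nhdsWithin (a := (0 : ℝ)) (s := Ioi 0)).mono fun x hx =>
      (hq.jost_regular hx ht).2.2
    exact ⟨g1, g2, fun _ => ⟨fun l hl => ⟨h1 l hl, h2 l hl⟩,
      (v1.mono UHP_subset).differentiableOn (hreg.mono fun _ h => h.1) isOpen_UHP,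
      (v2.mono UHP_subset).differentiableOn (hreg.mono fun _ h => h.2) isOpen_UHP⟩⟩
  · exact ⟨0, 0, fun h => absurd h ht⟩

lemma GISol.boundary_jost_ne_zero (hq : GISol q) {l g1 g2 : ℂ} {t : ℝ} (hl : l ∈ UHPc) (ht : 0 < t)
    (h₁ : Tendsto (fun x => giJ1 q l x t) (𝓝[>] 0) (𝓝 g1))
    (h₂ : Tendsto (fun x => giJ2 q l x t) (𝓝[>] 0) (𝓝 g2)) : ¬ (g1 = 0 ∧ g2 = 0) := by
  rintro ⟨rfl, rfl⟩
  obtain ⟨M, hM, hMb⟩ := hq.exists_laxA_le ht (norm_nonneg l)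
  refine hq.jost_ne_zero hl one_pos ht ?_
  have h3 : ‖giJ1 q l 1 t‖ ^ 2 + ‖giJ2 q l 1 t‖ ^ 2 ≤
      (‖(0 : ℂ)‖ ^ 2 + ‖(0 : ℂ)‖ ^ 2) * Real.exp (4 * M) := by
    refine ge_of_tendsto (((h₁.norm.pow 2).add (h₂.norm.pow 2)).mul_const _) ?_
    filter_upwards [Ioo_mem_nhdsGT one_pos] with x hx
    have := linear_energy_two_sided (a := x) (b := 1) (M := M)
      (fun y hy => ⟨(hq.hasDerivAt_x hl (hx.1.trans_le hy.1) ht).1.hasDerivWithinAt,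
        (hq.hasDerivAt_x hl (hx.1.trans_le hy.1) ht).2.hasDerivWithinAt⟩)
      (fun y hy => hMb l le_rfl y (hx.1.trans_le hy.1)) (left_mem_Icc.2 hx.2.le)
      (right_mem_Icc.2 hx.2.le)
    refine this.trans ?_
    gcongr
    nlinarith [hx.1]
  simp only [norm_zero, ne_eq, OfNat.ofNat_ne_zero, not_false_eq_true, zero_pow, add_zero,
    zero_mul] at h3
  have p1 := sq_nonneg ‖giJ1 q l 1 t‖
  have p2 := sq_nonneg ‖giJ2 q l 1 t‖
  exact ⟨norm_eq_zero.1 (pow_eq_zero_iff two_ne_zero |>.1 (by linarith)),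
    norm_eq_zero.1 (pow_eq_zero_iff two_ne_zero |>.1 (by linarith))⟩

/-- The boundary traces obey the `t`-part of the Lax pair. -/
theorem GISol.boundary_t_system (hq : GISol q) {Q : ℝ × ℝ → ℂ}
    (hc : ContinuousOn (fun p : ℝ × ℝ => q p.1 p.2) (Ici 0 ×ˢ Ici 0))
    (hQ : ContinuousOn Q (Ici 0 ×ˢ Ici 0)) (hQq : ∀ x t, 0 < x → 0 < t → Q (x, t) = dx q x t)
    {l : ℂ} (hl : l ∈ UHPc) {φ1 φ2 : ℝ → ℂ}
    (h₁ : ∀ t, 0 < t → Tendsto (fun x => giJ1 q l x t) (𝓝[>] 0) (𝓝 (φ1 t)))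
    (h₂ : ∀ t, 0 < t → Tendsto (fun x => giJ2 q l x t) (𝓝[>] 0) (𝓝 (φ2 t))) {t : ℝ}
    (ht : 0 < t) :
    HasDerivAt φ1 (bdB11 l (q 0 t) (Q (0, t)) * φ1 t + bdB12 l (q 0 t) (Q (0, t)) * φ2 t) t ∧
    HasDerivAt φ2 (bdB21 l (q 0 t) (Q (0, t)) * φ1 t + bdB22 l (q 0 t) (Q (0, t)) * φ2 t) t := by
  set a := t / 2 with ha'
  set b := 2 * t with hb'
  have ha : 0 < a := by positivity
  have hab : a ≤ b := by rw [ha', hb']; linarith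
  obtain ⟨c1, c2, c3, c4⟩ := (continuousOn_const (c := l)).bdB hc hQ
  have hline : ∀ {f : ℝ × ℝ → ℂ}, ContinuousOn f (Ici 0 ×ˢ Ici 0) →
      ContinuousOn (fun s => f (0, s)) (Icc a b) := fun hf =>
    hf.comp (by fun_prop) fun s hs => mk_mem_prod self_mem_Ici (ha.le.trans hs.1)
  have hL := LinSys.limit (F := 𝓝[>] 0) hab ⟨hline c1, hline c2, hline c3, hline c4⟩
    (fun ε hε => ?_) (a11 := laxB11 q l) (a12 := laxB12 q l) (a21 := laxB21 q l)
    (a22 := laxB22 q l) (y1 := giJ1 q l) (y2 := giJ2 q l) (z1 := φ1) (z2 := φ2) ?_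
    fun s hs => ⟨h₁ s (ha.trans_le hs.1), h₂ s (ha.trans_le hs.1)⟩
  · have htI : Icc a b ∈ 𝓝 t := Icc_mem_nhds (by rw [ha']; linarith) (by rw [hb']; linarith)
    obtain ⟨yi, yj⟩ := hL t (mem_of_mem_nhds htI)
    exact ⟨yi.hasDerivAt htI, yj.hasDerivAt htI⟩
  · filter_upwards [eventually_boundary c1 ha.le hε, eventually_boundary c2 ha.le hε,
      eventually_boundary c3 ha.le hε, eventually_boundary c4 ha.le hε, self_mem_nhdsWithin]
      with x k1 k2 k3 k4 hx r hr
    have k := And.intro (k1 r hr) (And.intro (k2 r hr) (And.intro (k3 r hr) (k4 r hr)))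
    rwa [hQq x r hx (ha.trans_le hr.1)] at k
  · filter_upwards [self_mem_nhdsWithin] with x hx
    exact hq.jost_t_system hx ha hab ((hq.continuousOn_mass hx).mono fun r hr =>
      ha.trans_le hr.1) hl

/-- At most linear growth in time of the boundary traces in the energy norm. -/
lemma GISol.boundary_energy (hq : GISol q) {Q : ℝ × ℝ → ℂ}
    (hc : ContinuousOn (fun p : ℝ × ℝ => q p.1 p.2) (Ici 0 ×ˢ Ici 0))
    (hQ : ContinuousOn Q (Ici 0 ×ˢ Ici 0)) (hQq : ∀ x t, 0 < x → 0 < t → Q (x, t) = dx q x t)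
    {T U W : ℝ} (hT : 0 < T) (hU : ∀ t, T ≤ t → ‖q 0 t‖ ≤ U) (hW : ∀ t, T ≤ t → ‖Q (0, t)‖ ≤ W) :
    ∃ m F, 0 ≤ F ∧ ∀ l ∈ UHP, ∀ t, T ≤ t → ∀ g1 g2 : ℂ,
      Tendsto (fun x => giJ1 q l x t) (𝓝[>] 0) (𝓝 g1) →
      Tendsto (fun x => giJ2 q l x t) (𝓝[>] 0) (𝓝 g2) →
      ‖g2‖ ^ 2 + ‖l‖ * ‖g1‖ ^ 2 ≤ Real.exp (‖l‖ / l.im * (m + F * t)) := by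
  have hU0 : 0 ≤ U := (norm_nonneg _).trans (hU T le_rfl)
  have hW0 : 0 ≤ W := (norm_nonneg _).trans (hW T le_rfl)
  set F := 2 * ((U + 1) * (W + 1)) + 1 / 2 * ((U + 1) ^ 2 * (U + 1) ^ 2) with hF
  have hF0 : 0 ≤ F := by positivity
  refine ⟨tailMass q 0 T, F, hF0, fun l hl t ht g1 g2 h₁ h₂ => ?_⟩
  have him : 0 < l.im := hl
  refine le_of_tendsto ((h₂.norm.pow 2).add ((h₁.norm.pow 2).const_mul _)) ?_
  filter_upwards [eventually_boundary (a := T) (b := t) hc hT.le one_pos,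
    eventually_boundary (a := T) (b := t) hQ hT.le one_pos, self_mem_nhdsWithin] with x k1 k2 hx
  rw [mem_Ioi] at hx
  refine (hq.jost_energy hl hx (hT.trans_le ht)).trans (Real.exp_le_exp.2 ?_)
  refine mul_le_mul_of_nonneg_left ?_ (by positivity)
  have hb := hq.mass_balance hx hT ht ((hq.continuousOn_mass hx).mono fun r hr => hT.trans_le hr.1)
  have hm := hq.tailMass_anti le_rfl hx.le hT
  have hflux : ‖∫ r in T..t, (massFlux q x r).re‖ ≤ F * |t - T| := by
    refine intervalIntegral.norm_integral_le_of_norm_le_const fun r hr => ?_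
    rw [uIoc_of_le ht] at hr
    have hr' : r ∈ Icc T t := Ioc_subset_Icc_self hr
    refine (abs_re_le_norm _).trans ?_
    have q1 : ‖q x r‖ ≤ U + 1 := by
      have h1 := k1 r hr'
      have h2 := norm_le_insert' (q x r) (q 0 r)
      linarith [hU r hr'.1]
    have q2 : ‖dx q x r‖ ≤ W + 1 := by
      have h1 := k2 r hr'
      rw [hQq x r hx (hT.trans_le hr'.1)] at h1
      have h2 := norm_le_insert' (dx q x r) (Q (0, r))
      linarith [hW r hr'.1]
    rw [massFlux]
    refine (norm_add_le _ _).trans ?_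
    rw [norm_mul, norm_mul, norm_mul, norm_rhoC]
    simp only [norm_div, norm_one, norm_ofNat]
    have := norm_momC_le (q := q) x r
    have : ‖momC q x r‖ ≤ (U + 1) * (W + 1) := this.trans (by gcongr)
    rw [hF]
    gcongr
  rw [Real.norm_eq_abs, abs_of_nonneg (by linarith : 0 ≤ t - T)] at hflux
  have := (abs_le.1 hflux).2
  nlinarith

lemma bdB_gauge (l u w e : ℂ) (he : e * conj e = 1) :
    bdB11 l (e * u) (e * w) = bdB11 l u w ∧ bdB12 l (e * u) (e * w) = e * bdB12 l u w ∧
    bdB21 l (e * u) (e * w) = conj e * bdB21 l u w ∧ bdB22 l (e * u) (e * w) = bdB22 l u w := by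
  have h22 : bdB22 l (e * u) (e * w) = bdB22 l u w := by
    simp only [bdB22, map_mul]
    linear_combination (I * l * (u * conj u) - 1 / 2 * (w * conj u - u * conj w) -
      I / 4 * (u * conj u) ^ 2 * (e * conj e + 1)) * he
  refine ⟨by rw [bdB11, h22, bdB11], ?_, ?_, h22⟩
  · simp only [bdB12]; ring
  · simp only [bdB21, map_mul]; ring

/-- The `t`-part of the Lax pair at the boundary, in a frame in which it is asymptotically
autonomous. -/
structure AsymptoticLax (α ω : ℝ) (c : ℂ) (T K m F : ℝ) (u w : ℝ → ℂ) (ψ1 ψ2 : ℂ → ℝ → ℂ) :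
    Prop where
  T_pos : 0 < T
  K_nonneg : 0 ≤ K
  u_sub : ∀ t, T ≤ t → ‖u t - α‖ ≤ K / t ^ 2
  w_sub : ∀ t, T ≤ t → ‖w t - c‖ ≤ K / t ^ 2
  diff1 : ∀ t, T ≤ t → DifferentiableOn ℂ (fun l => ψ1 l t) UHP
  diff2 : ∀ t, T ≤ t → DifferentiableOn ℂ (fun l => ψ2 l t) UHP
  ode1 : ∀ l ∈ UHP, ∀ t, T ≤ t → HasDerivAt (ψ1 l)
    ((bdB11 l (u t) (w t) + (2 * I * l ^ 2 - I * ω / 2)) * ψ1 l t + bdB12 l (u t) (w t) * ψ2 l t) t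
  ode2 : ∀ l ∈ UHP, ∀ t, T ≤ t → HasDerivAt (ψ2 l) (bdB21 l (u t) (w t) * ψ1 l t +
      (bdB22 l (u t) (w t) + (2 * I * l ^ 2 + I * ω / 2)) * ψ2 l t) t
  ne_zero : ∀ l ∈ UHP, ∀ t, T ≤ t → ¬ (ψ1 l t = 0 ∧ ψ2 l t = 0)
  energy : ∀ l ∈ UHP, ∀ t, T ≤ t → ‖ψ2 l t‖ ^ 2 + ‖l‖ * ‖ψ1 l t‖ ^ 2 ≤
    Real.exp (-(8 * l.re * l.im * t) + ‖l‖ / l.im * (m + F * t))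

lemma norm_exp_mul_I (ω t : ℝ) : ‖exp (I * ω * t)‖ = 1 := by
  rw [norm_exp]
  simp

lemma exists_bound_of_isBigO {f : ℝ → ℂ} (h : f =O[atTop] fun t : ℝ => t ^ (-(5 / 2) : ℝ)) :
    ∃ K, 0 ≤ K ∧ ∀ᶠ t in atTop, ‖f t‖ ≤ K / t ^ 2 := by
  obtain ⟨K, hK, hb⟩ := h.exists_nonneg
  refine ⟨K, hK, ?_⟩
  filter_upwards [hb.bound, eventually_ge_atTop 1] with t ht h1
  refine ht.trans ?_
  have h0 : 0 < t := by linarith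
  rw [Real.norm_eq_abs, abs_of_nonneg (by positivity), div_eq_mul_inv]
  refine mul_le_mul_of_nonneg_left ?_ hK
  rw [← Real.rpow_natCast, ← Real.rpow_neg h0.le]
  exact Real.rpow_le_rpow_of_exponent_le h1 (by norm_num)

/-- An admissible triple gives rise to an asymptotically autonomous boundary Lax system. -/
theorem IsGIAdmissible.exists_asymptoticLax {α ω : ℝ} {c : ℂ} (h : IsGIAdmissible α ω c) :
    ∃ T K m F u w ψ1 ψ2, AsymptoticLax α ω c T K m F u w ψ1 ψ2 := by
  obtain ⟨-, q, hsol, hu, hw⟩ := h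
  have hq := hsol.gISol
  obtain ⟨Q, hQ, hQq, hQ0⟩ := hsol.exists_boundary_derivative
  have hc := hsol.smooth.continuousOn
  obtain ⟨Ki, hK1, hu⟩ := exists_bound_of_isBigO hu
  obtain ⟨Kj, hK2, hw⟩ := exists_bound_of_isBigO hw
  obtain ⟨T, hT⟩ := (hu.and (hw.and (eventually_ge_atTop (1 : ℝ)))).exists_forall_of_atTop
  have hT1 : 1 ≤ T := (hT T le_rfl).2.2
  have hT0 : 0 < T := by linarith
  obtain ⟨φ1, φ2, hφ⟩ := hq.exists_boundary_jost
  have hlim := fun l hl t ht => (hφ t ht).1 l hl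
  set e : ℝ → ℂ := fun t => exp (I * ω * t) with he
  have hen : ∀ t, ‖e t‖ = 1 := norm_exp_mul_I ω
  have hee : ∀ t, e t * conj (e t) = 1 := fun t => by rw [mul_conj, normSq_eq_norm_sq, hen]; simp
  set u : ℝ → ℂ := fun t => conj (e t) * q 0 t with hu'
  set w : ℝ → ℂ := fun t => conj (e t) * Q (0, t) with hw'
  have hqu : ∀ t, q 0 t = e t * u t := fun t => by simp only [hu']; rw [← mul_assoc, hee, one_mul]
  have hQw : ∀ t, Q (0, t) = e t * w t := fun t => by
    simp only [hw']; rw [← mul_assoc, hee, one_mul]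
  have hdev : ∀ t (z a : ℂ), ‖conj (e t) * z - a‖ = ‖z - a * e t‖ := fun t z a => by
    have : conj (e t) * z - a = conj (e t) * (z - a * e t) := by linear_combination a * hee t
    rw [this, norm_mul, RCLike.norm_conj, hen, one_mul]
  have husub : ∀ t, T ≤ t → ‖u t - α‖ ≤ (Ki + Kj) / t ^ 2 := by
    intro t ht
    rw [hdev]
    refine (hT t ht).1.trans ?_
    gcongr; linarith
  have hwsub : ∀ t, T ≤ t → ‖w t - c‖ ≤ (Ki + Kj) / t ^ 2 := by
    intro t ht
    rw [hdev, hQ0 t (hT0.le.trans ht)]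
    refine (hT t ht).2.1.trans ?_
    gcongr; linarith
  have hle1 : ∀ t, T ≤ t → (Ki + Kj) / t ^ 2 ≤ Ki + Kj := fun t ht =>
    div_le_self (by positivity) (by nlinarith)
  obtain ⟨m, F, hF, hen'⟩ := hq.boundary_energy hc hQ hQq hT0 (U := Ki + Kj + ‖(α : ℂ)‖)
    (W := Ki + Kj + ‖c‖) (fun t ht => by
      have h1 := norm_le_insert' (u t) α
      rw [hqu, norm_mul, hen, one_mul]
      linarith [husub t ht, hle1 t ht]) (fun t ht => by
      have h1 := norm_le_insert' (w t) c
      rw [hQw, norm_mul, hen, one_mul]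
      linarith [hwsub t ht, hle1 t ht])
  set a1 : ℂ → ℂ := fun l => 2 * I * l ^ 2 - I * ω / 2 with ha1
  set a2 : ℂ → ℂ := fun l => 2 * I * l ^ 2 + I * ω / 2 with ha2
  have hre : ∀ l : ℂ, (a1 l).re = -(4 * l.re * l.im) ∧ (a2 l).re = -(4 * l.re * l.im) := by
    intro l
    have h2 : (2 * I * l ^ 2).re = -(4 * l.re * l.im) := by
      simp only [pow_two, mul_re, mul_im, I_re, I_im, re_ofNat, im_ofNat]
      ring
    have h3 : (I * ω / 2).re = 0 := by simp
    simp only [ha1, ha2, add_re, sub_re, h2, h3]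
    exact ⟨sub_zero _, add_zero _⟩
  have hne : ∀ (a : ℂ) (t : ℝ), ‖exp (a * t)‖ = Real.exp (a.re * t) := fun a t => by
    rw [norm_exp]; simp
  refine ⟨T, Ki + Kj, m, F, u, w, fun l t => exp (a1 l * t) * φ1 t l,
    fun l t => exp (a2 l * t) * φ2 t l, hT0, by positivity, husub, hwsub, ?_, ?_, ?_, ?_,
    ?_, ?_⟩
  · intro t ht
    have : Differentiable ℂ fun l : ℂ => exp (a1 l * t) := by simp only [ha1]; fun_prop
    exact this.differentiableOn.mul (hφ t (hT0.trans_le ht)).2.1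
  · intro t ht
    have : Differentiable ℂ fun l : ℂ => exp (a2 l * t) := by simp only [ha2]; fun_prop
    exact this.differentiableOn.mul (hφ t (hT0.trans_le ht)).2.2
  · intro l hl t ht
    have hl' := UHP_subset hl
    have ho := (hq.boundary_t_system hc hQ hQq hl' (φ1 := (φ1 · l)) (φ2 := (φ2 · l))
      (fun t ht => (hlim l hl' t ht).1)
      (fun t ht => (hlim l hl' t ht).2) (hT0.trans_le ht)).1
    obtain ⟨gi, gj, -, -⟩ := bdB_gauge l (u t) (w t) (e t) (hee t)
    rw [hqu, hQw, gi, gj] at ho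
    have hexp : exp (a1 l * t) * e t = exp (a2 l * t) := by
      rw [he, ← exp_add]
      congr 1
      simp only [ha1, ha2]; ring
    refine ((hasDerivAt_exp_mul (a1 l) t).fun_mul ho).congr_deriv ?_
    rw [← hexp]
    simp only [ha1]
    ring
  · intro l hl t ht
    have hl' := UHP_subset hl
    have ho := (hq.boundary_t_system hc hQ hQq hl' (φ1 := (φ1 · l)) (φ2 := (φ2 · l))
      (fun t ht => (hlim l hl' t ht).1)
      (fun t ht => (hlim l hl' t ht).2) (hT0.trans_le ht)).2
    obtain ⟨-, -, g3, g4⟩ := bdB_gauge l (u t) (w t) (e t) (hee t)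
    rw [hqu, hQw, g3, g4] at ho
    have hexp : exp (a2 l * t) * conj (e t) = exp (a1 l * t) := by
      have h1 : exp (a1 l * t) * e t = exp (a2 l * t) := by
        rw [he, ← exp_add]
        congr 1
        simp only [ha1, ha2]; ring
      rw [← h1, mul_assoc, hee, mul_one]
    refine ((hasDerivAt_exp_mul (a2 l) t).fun_mul ho).congr_deriv ?_
    rw [← hexp]
    simp only [ha2]
    ring
  · rintro l hl t ht ⟨h1, h2⟩
    have hl' := UHP_subset hl
    have hto := hT0.trans_le ht
    exact hq.boundary_jost_ne_zero hl' hto (hlim l hl' t hto).1 (hlim l hl' t hto).2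
      ⟨(mul_eq_zero.1 h1).resolve_left (exp_ne_zero _),
        (mul_eq_zero.1 h2).resolve_left (exp_ne_zero _)⟩
  · intro l hl t ht
    have hl' := UHP_subset hl
    have hto := hT0.trans_le ht
    have h1 := hen' l hl t ht _ _ (hlim l hl' t hto).1 (hlim l hl' t hto).2
    rw [norm_mul, norm_mul, hne, hne, (hre l).1, (hre l).2, mul_pow, mul_pow, Real.exp_add]
    have h2 : Real.exp (-(8 * l.re * l.im * t)) = Real.exp (-(4 * l.re * l.im) * t) ^ 2 := by
      rw [← Real.exp_nat_mul]; congr 1; push_cast; ring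
    rw [h2]
    calc _ = Real.exp (-(4 * l.re * l.im) * t) ^ 2 *
          (‖φ2 t l‖ ^ 2 + ‖l‖ * ‖φ1 t l‖ ^ 2) := by ring
      _ ≤ _ := by gcongr

section

section abstract_levinson

variable {ι : Type*} [Fintype ι] {f g : ι → ℝ → ℂ} {a : ι → ℂ} {T C : ℝ}

lemma hasDerivAt_energy (hf : ∀ i t, T ≤ t → HasDerivAt (f i) (a i * f i t + g i t) t) {t : ℝ}
    (ht : T ≤ t) :
    HasDerivAt (fun s => ∑ i, ‖f i s‖ ^ 2) (∑ i, 2 * (conj (f i t) * (a i * f i t + g i t)).re) t :=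
  HasDerivAt.fun_sum fun i _ => hasDerivAt_norm_sq (hf i t ht)

lemma re_conj_mul_le (z a w : ℂ) :
    |(conj z * (a * z + w)).re - a.re * ‖z‖ ^ 2| ≤ ‖z‖ * ‖w‖ := by
  have : (conj z * (a * z + w)).re - a.re * ‖z‖ ^ 2 = (conj z * w).re := by
    have e : conj z * (a * z + w) = a * ((‖z‖ ^ 2 : ℝ) : ℂ) + conj z * w := by
      rw [← normSq_eq_norm_sq, ← mul_conj]; ring
    rw [e, add_re, re_mul_ofReal, add_sub_cancel_left]
  rw [this]
  refine (abs_re_le_norm _).trans ?_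
  rw [norm_mul, RCLike.norm_conj]

lemma energy_deriv_sub_le (hg : ∀ i t, T ≤ t → ‖g i t‖ ≤ C / t ^ 2 * ∑ j, ‖f j t‖) (hT : 0 < T)
    (hC : 0 ≤ C) {t : ℝ} (ht : T ≤ t) :
    |(∑ i, 2 * (conj (f i t) * (a i * f i t + g i t)).re) - ∑ i, 2 * ((a i).re * ‖f i t‖ ^ 2)| ≤
      2 * Fintype.card ι * C / t ^ 2 * ∑ i, ‖f i t‖ ^ 2 := by
  have hto : 0 < t := hT.trans_le ht
  rw [← Finset.sum_sub_distrib]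
  refine (Finset.abs_sum_le_sum_abs _ _).trans ?_
  calc ∑ i, |2 * (conj (f i t) * (a i * f i t + g i t)).re - 2 * ((a i).re * ‖f i t‖ ^ 2)|
      ≤ ∑ i, 2 * (‖f i t‖ * (C / t ^ 2 * ∑ j, ‖f j t‖)) := by
        refine Finset.sum_le_sum fun i _ => ?_
        rw [← mul_sub, abs_mul, abs_two]
        gcongr
        refine (re_conj_mul_le _ _ _).trans ?_
        gcongr
        exact hg i t ht
    _ = 2 * (C / t ^ 2) * (∑ j, ‖f j t‖) ^ 2 := by rw [← Finset.mul_sum, ← Finset.sum_mul]; ring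
    _ ≤ 2 * (C / t ^ 2) * (Fintype.card ι * ∑ i, ‖f i t‖ ^ 2) := by
        gcongr
        exact sq_sum_le_card_mul_sum_sq
    _ = _ := by ring

lemma hasDerivAt_neg_div (k : ℝ) {t : ℝ} (ht : t ≠ 0) :
    HasDerivAt (fun s => -(k / s)) (k / t ^ 2) t := by
  have := ((hasDerivAt_inv ht).const_mul (-k))
  refine (this.congr_deriv ?_).congr_of_eventuallyEq ?_
  · field_simp
  · filter_upwards with s
    rw [div_eq_mul_inv, neg_mul]

/-- Solutions of an integrable perturbation of a decaying diagonal system are bounded. -/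
lemma levinson_bound (hT : 0 < T) (hC : 0 ≤ C)
    (hf : ∀ i t, T ≤ t → HasDerivAt (f i) (a i * f i t + g i t) t) (ha : ∀ i, (a i).re ≤ 0)
    (hg : ∀ i t, T ≤ t → ‖g i t‖ ≤ C / t ^ 2 * ∑ j, ‖f j t‖) {t : ℝ} (ht : T ≤ t) :
    ∑ i, ‖f i t‖ ^ 2 ≤ (∑ i, ‖f i T‖ ^ 2) * Real.exp (2 * Fintype.card ι * C / T) := by
  have h := forward_gronwall (E := fun t => ∑ i, ‖f i t‖ ^ 2)
    (P := fun s => -(2 * Fintype.card ι * C / s)) (c := fun s => 2 * Fintype.card ι * C / s ^ 2) ht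
    (fun s hs => (hasDerivAt_energy hf hs.1).continuousAt.continuousWithinAt)
    (fun s hs => hasDerivAt_energy hf hs.1.le)
    (fun s hs => (hasDerivAt_neg_div _ (hT.trans_le hs.1).ne').continuousAt.continuousWithinAt)
    (fun s hs => hasDerivAt_neg_div _ (hT.trans hs.1).ne') fun s hs => ?_
  · refine h.trans ?_
    have : 0 ≤ 2 * Fintype.card ι * C / t := by have := hT.trans_le ht; positivity
    gcongr
    linarith
  · have h1 := (abs_le.1 (energy_deriv_sub_le (a := a) hg hT hC hs.1.le)).2
    have h2 : ∑ i, 2 * ((a i).re * ‖f i s‖ ^ 2) ≤ 0 :=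
      Finset.sum_nonpos fun i _ => by nlinarith [ha i, sq_nonneg ‖f i s‖]
    linarith

/-- In the oscillatory case the solutions are also bounded from below. -/
lemma levinson_bound_below (hT : 0 < T) (hC : 0 ≤ C)
    (hf : ∀ i t, T ≤ t → HasDerivAt (f i) (a i * f i t + g i t) t) (ha : ∀ i, (a i).re = 0)
    (hg : ∀ i t, T ≤ t → ‖g i t‖ ≤ C / t ^ 2 * ∑ j, ‖f j t‖) {t : ℝ} (ht : T ≤ t) :
    ∑ i, ‖f i T‖ ^ 2 ≤ (∑ i, ‖f i t‖ ^ 2) * Real.exp (2 * Fintype.card ι * C / T) := by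
  have h := backward_gronwall (E := fun t => ∑ i, ‖f i t‖ ^ 2) (R := 0)
    (P := fun s => -(2 * Fintype.card ι * C / s)) (c := fun s => 2 * Fintype.card ι * C / s ^ 2) ht
    (fun s hs => (hasDerivAt_energy hf hs.1).continuousAt.continuousWithinAt)
    (fun s hs => hasDerivAt_energy hf hs.1.le)
    (fun s hs => (hasDerivAt_neg_div _ (hT.trans_le hs.1).ne').continuousAt.continuousWithinAt)
    (fun s hs => hasDerivAt_neg_div _ (hT.trans hs.1).ne') fun s hs => ?_
  · rw [add_zero, add_zero] at h
    refine h.trans ?_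
    have : 0 ≤ 2 * Fintype.card ι * C / t := by have := hT.trans_le ht; positivity
    gcongr
    linarith
  · have h1 := (abs_le.1 (energy_deriv_sub_le (a := a) hg hT hC hs.1.le)).1
    have h2 : ∑ i, 2 * ((a i).re * ‖f i s‖ ^ 2) = 0 :=
      Finset.sum_eq_zero fun i _ => by rw [ha]; ring
    rw [add_zero]
    linarith

/-- The non-decaying components converge at the rate `1 / t`. -/
lemma levinson_cauchy (hT : 0 < T) (hC : 0 ≤ C)
    (hf : ∀ i t, T ≤ t → HasDerivAt (f i) (a i * f i t + g i t) t) (ha : ∀ i, (a i).re ≤ 0)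
    (hg : ∀ i t, T ≤ t → ‖g i t‖ ≤ C / t ^ 2 * ∑ j, ‖f j t‖) {i : ι} (hi : a i = 0) {s t : ℝ}
    (hs : T ≤ s) (hst : s ≤ t) :
    ‖f i t - f i s‖ ≤ C * (Fintype.card ι + (∑ i, ‖f i T‖ ^ 2) *
      Real.exp (2 * Fintype.card ι * C / T)) / s := by
  set W := ∑ i, ‖f i T‖ ^ 2 with hW
  set D := C * (Fintype.card ι + W * Real.exp (2 * Fintype.card ι * C / T)) with hD
  have hD0 : 0 ≤ D := by positivity
  have hs0 := hT.trans_le hs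
  have key : ∀ r ∈ Icc s t, ‖f i r - f i s‖ ≤ D / s + -(D / r) := by
    refine image_norm_le_of_norm_deriv_right_le_deriv_boundary' (f' := fun r => g i r)
      (B' := fun r => D / r ^ 2) ?_ ?_ ?_ ?_ ?_ ?_
    · exact fun r hr => ((hf i r (hs.trans hr.1)).continuousAt.sub
        continuousAt_const).continuousWithinAt
    · intro r hr
      have := (hf i r (hs.trans hr.1)).sub_const (f i s)
      rw [hi, zero_mul, zero_add] at this
      exact this.hasDerivWithinAt
    · rw [sub_self, norm_zero, add_neg_cancel]
    · exact fun r hr => (((hasDerivAt_neg_div D (hs0.trans_le hr.1).ne').const_add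
        (D / s))).continuousAt.continuousWithinAt
    · exact fun r hr => ((hasDerivAt_neg_div D (hs0.trans_le hr.1).ne').const_add
        (D / s)).hasDerivWithinAt
    · intro r hr
      have hr0 := hs0.trans_le hr.1
      refine (hg i r (hs.trans hr.1)).trans ?_
      have h1 := levinson_bound hT hC hf ha hg (hs.trans hr.1)
      have h2 : ∑ j, ‖f j r‖ ≤ ∑ j : ι, (1 + ‖f j r‖ ^ 2) :=
        Finset.sum_le_sum fun j _ => by nlinarith [sq_nonneg (‖f j r‖ - 1)]
      rw [Finset.sum_add_distrib, Finset.sum_const, nsmul_eq_mul, mul_one, Finset.card_univ] at h2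
      rw [hD, mul_div_right_comm]
      gcongr
      linarith
  have h1 := key t ⟨hst, le_rfl⟩
  have h2 : 0 ≤ D / t := by have := hs0.trans_le hst; positivity
  linarith

end abstract_levinson

end

section

lemma bdB_sub_le {l u w a c : ℂ} {R B δ : ℝ} (hl : ‖l‖ ≤ R) (hu : ‖u‖ ≤ B) (hw : ‖w‖ ≤ B)
    (ha : ‖a‖ ≤ B) (hc : ‖c‖ ≤ B) (hua : ‖u - a‖ ≤ δ) (hwc : ‖w - c‖ ≤ δ) :
    ‖bdB11 l u w - bdB11 l a c‖ ≤ (2 * R * B + 2 * B + B ^ 3 + 2 * R ^ 2 + 3 * R + 1) * δ ∧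
    ‖bdB12 l u w - bdB12 l a c‖ ≤ (2 * R * B + 2 * B + B ^ 3 + 2 * R ^ 2 + 3 * R + 1) * δ ∧
    ‖bdB21 l u w - bdB21 l a c‖ ≤ (2 * R * B + 2 * B + B ^ 3 + 2 * R ^ 2 + 3 * R + 1) * δ ∧
    ‖bdB22 l u w - bdB22 l a c‖ ≤ (2 * R * B + 2 * B + B ^ 3 + 2 * R ^ 2 + 3 * R + 1) * δ := by
  have hR : 0 ≤ R := (norm_nonneg _).trans hl
  have hB : 0 ≤ B := (norm_nonneg _).trans hu
  have hδ : 0 ≤ δ := (norm_nonneg _).trans hua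
  have hbil : ∀ {x y x' y' : ℂ}, ‖x‖ ≤ B → ‖y'‖ ≤ B → ‖x - x'‖ ≤ δ → ‖y - y'‖ ≤ δ →
      ‖x * conj y - x' * conj y'‖ ≤ 2 * B * δ := by
    intro x y x' y' hx hy' h1 h2
    have e : x * conj y - x' * conj y' = x * conj (y - y') + (x - x') * conj y' := by
      rw [map_sub]; ring
    rw [e]
    refine (norm_add_le _ _).trans ?_
    simp only [norm_mul, RCLike.norm_conj]
    nlinarith [mul_le_mul hx h2 (norm_nonneg _) hB, mul_le_mul h1 hy' (norm_nonneg _) hδ]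
  have h1 := hbil hu ha hua hua
  have h2 := hbil hw ha hwc hua
  have h3 := hbil hu hc hua hwc
  have h4 : ‖(u * conj u) * (u * conj u) - (a * conj a) * (a * conj a)‖ ≤ 4 * B ^ 3 * δ := by
    have e : (u * conj u) * (u * conj u) - (a * conj a) * (a * conj a) =
        (u * conj u + a * conj a) * (u * conj u - a * conj a) := by ring
    rw [e, norm_mul]
    have h5 : ‖u * conj u + a * conj a‖ ≤ B * B + B * B := by
      refine (norm_add_le _ _).trans ?_
      simp only [norm_mul, RCLike.norm_conj]
      gcongr
    calc _ ≤ (B * B + B * B) * (2 * B * δ) := by gcongr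
      _ = _ := by ring
  have p1 : 0 ≤ R * δ := by positivity
  have p2 : 0 ≤ R ^ 2 * δ := by positivity
  have p3 : 0 ≤ B * δ := by positivity
  have p4 : 0 ≤ B ^ 3 * δ := by positivity
  have p5 : 0 ≤ R * B * δ := by positivity
  have h22 : ‖bdB22 l u w - bdB22 l a c‖ ≤ (2 * R * B + 2 * B + B ^ 3) * δ := by
    have e : bdB22 l u w - bdB22 l a c = I * l * (u * conj u - a * conj a) +
        (-(1 / 2) * ((w * conj u - c * conj a) - (u * conj w - a * conj c)) +
        -(I / 4) * ((u * conj u) * (u * conj u) - (a * conj a) * (a * conj a))) := by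
      simp only [bdB22]; ring
    rw [e]
    refine (norm_add_le _ _).trans ((add_le_add_right (norm_add_le _ _) _).trans ?_)
    simp only [norm_mul, norm_neg, norm_div, norm_I, norm_ofNat, norm_one, one_mul]
    have h5 := norm_sub_le (w * conj u - c * conj a) (u * conj w - a * conj c)
    have h6 : ‖l‖ * ‖u * conj u - a * conj a‖ ≤ R * (2 * B * δ) := by gcongr
    linarith
  have hcu : ‖conj u - conj a‖ ≤ δ := by rw [← map_sub, RCLike.norm_conj]; exact hua
  have hcw : ‖conj w - conj c‖ ≤ δ := by rw [← map_sub, RCLike.norm_conj]; exact hwc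
  refine ⟨?_, ?_, ?_, by linarith⟩
  · have e : bdB11 l u w - bdB11 l a c = -(bdB22 l u w - bdB22 l a c) := by
      simp only [bdB11]; ring
    rw [e, norm_neg]
    linarith
  · have e : bdB12 l u w - bdB12 l a c = 2 * l * (u - a) + I * (w - c) := by
      simp only [bdB12]; ring
    rw [e]
    refine (norm_add_le _ _).trans ?_
    simp only [norm_mul, norm_I, norm_ofNat, one_mul]
    have h6 : 2 * ‖l‖ * ‖u - a‖ ≤ 2 * R * δ := by gcongr
    linarith
  · have e : bdB21 l u w - bdB21 l a c = 2 * l ^ 2 * (conj u - conj a) +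
        -(I * l) * (conj w - conj c) := by
      simp only [bdB21]; ring
    rw [e]
    refine (norm_add_le _ _).trans ?_
    simp only [norm_mul, norm_neg, norm_pow, norm_I, norm_ofNat, one_mul]
    have h6 : 2 * ‖l‖ ^ 2 * ‖conj u - conj a‖ ≤ 2 * R ^ 2 * δ := by gcongr
    have h7 : ‖l‖ * ‖conj w - conj c‖ ≤ R * δ := by gcongr
    linarith

/-- The entries `-bgM, bgβ, bgγ, bgM` of the matrix of the limiting system. -/
def bgM (α ω : ℝ) (c l : ℂ) : ℂ := 2 * I * l ^ 2 + I * ω / 2 + bdB22 l α c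

def bgβ (α : ℝ) (c l : ℂ) : ℂ := bdB12 l α c

def bgγ (α : ℝ) (c l : ℂ) : ℂ := bdB21 l α c

/-- The determinant of the limiting system. -/
def bgP (α ω : ℝ) (c l : ℂ) : ℂ := -(bgM α ω c l ^ 2 + bgβ α c l * bgγ α c l)

/-- The components along the growing direction. -/
def grow1 (α ω : ℝ) (c l S z1 z2 : ℂ) : ℂ := (S - bgM α ω c l) * z1 + bgβ α c l * z2

def grow2 (α ω : ℝ) (c l S z1 z2 : ℂ) : ℂ := bgγ α c l * z1 + (S + bgM α ω c l) * z2

lemma grow_identities (α ω : ℝ) (c l S z1 z2 : ℂ) :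
    grow1 α ω c l S z1 z2 - grow1 α ω c l (-S) z1 z2 = 2 * S * z1 ∧
    grow2 α ω c l S z1 z2 - grow2 α ω c l (-S) z1 z2 = 2 * S * z2 := by
  simp only [grow1, grow2]
  constructor <;> ring

lemma exists_bg_le (α ω : ℝ) (c : ℂ) {R : ℝ} (hR : 0 ≤ R) :
    ∃ N, 0 ≤ N ∧ ∀ l S : ℂ, ‖l‖ ≤ R → ‖S‖ ≤ R → ∀ z1 z2 : ℂ,
      ‖grow1 α ω c l S z1 z2‖ ≤ N * (‖z1‖ + ‖z2‖) ∧
      ‖grow2 α ω c l S z1 z2‖ ≤ N * (‖z1‖ + ‖z2‖) := by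
  set B := ‖(α : ℂ)‖ + ‖c‖ with hB
  have h1 : ‖(α : ℂ)‖ ≤ B := by rw [hB]; linarith [norm_nonneg c]
  have h2 : ‖c‖ ≤ B := by rw [hB]; linarith [norm_nonneg (α : ℂ)]
  have hB0 : 0 ≤ B := by positivity
  set k := (2 * R * B + 2 * B + B ^ 3 + 2 * R ^ 2 + 3 * R + 1) * B with hk
  have hk0 : 0 ≤ k := by positivity
  refine ⟨R + 2 * R ^ 2 + |ω| / 2 + k, by positivity, fun l S hl hS z1 z2 => ?_⟩
  obtain ⟨-, j2, j3, j4⟩ := bdB_sub_le (a := 0) (c := 0) hl h1 h2 (by simpa) (by simpa)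
    (by simpa using h1) (by simpa using h2)
  have hm : ‖bgM α ω c l‖ ≤ 2 * R ^ 2 + |ω| / 2 + k := by
    have e : bdB22 l α c - bdB22 l 0 0 = bdB22 l α c := by simp [bdB22]
    rw [e] at j4
    rw [bgM]
    refine (norm_add_le _ _).trans (add_le_add ((norm_add_le _ _).trans ?_) j4)
    simp only [norm_mul, norm_pow, norm_div, norm_I, norm_ofNat, one_mul, mul_one,
      norm_real, Real.norm_eq_abs]
    gcongr
  have hb : ‖bgβ α c l‖ ≤ k := by
    have e : bdB12 l α c - bdB12 l 0 0 = bdB12 l α c := by simp [bdB12]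
    rwa [e] at j2
  have hg : ‖bgγ α c l‖ ≤ k := by
    have e : bdB21 l α c - bdB21 l 0 0 = bdB21 l α c := by simp [bdB21]
    rwa [e] at j3
  have hω : 0 ≤ |ω| := abs_nonneg ω
  have hR2 : 0 ≤ R ^ 2 := by positivity
  have comb : ∀ x y : ℂ, ‖x‖ ≤ R + 2 * R ^ 2 + |ω| / 2 + k → ‖y‖ ≤ R + 2 * R ^ 2 + |ω| / 2 + k →
      ‖x * z1 + y * z2‖ ≤ (R + 2 * R ^ 2 + |ω| / 2 + k) * (‖z1‖ + ‖z2‖) := by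
    intro x y hx hy
    refine (norm_add_le _ _).trans ?_
    rw [norm_mul, norm_mul, mul_add]
    gcongr
  exact ⟨comb _ _ ((norm_sub_le _ _).trans (by linarith)) (by linarith),
    comb _ _ (by linarith) ((norm_add_le _ _).trans (by linarith))⟩

variable {α ω : ℝ} {c : ℂ} {T K m F : ℝ} {u w : ℝ → ℂ} {ψ1 ψ2 : ℂ → ℝ → ℂ}

/-- The perturbation is integrable in time. -/
lemma AsymptoticLax.exists_perturbation (h : AsymptoticLax α ω c T K m F u w ψ1 ψ2) {R : ℝ}
    (hR : 0 ≤ R) : ∃ k, 0 ≤ k ∧ ∀ l ∈ UHP, ‖l‖ ≤ R → ∃ ρ1 ρ2 : ℝ → ℂ, ∀ t, T ≤ t →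
      HasDerivAt (ψ1 l) (-bgM α ω c l * ψ1 l t + bgβ α c l * ψ2 l t + ρ1 t) t ∧
      HasDerivAt (ψ2 l) (bgγ α c l * ψ1 l t + bgM α ω c l * ψ2 l t + ρ2 t) t ∧
      ‖ρ1 t‖ ≤ k / t ^ 2 * (‖ψ1 l t‖ + ‖ψ2 l t‖) ∧ ‖ρ2 t‖ ≤ k / t ^ 2 * (‖ψ1 l t‖ + ‖ψ2 l t‖) := by
  have hT := h.T_pos
  have hK := h.K_nonneg
  set B := ‖(α : ℂ)‖ + ‖c‖ + K / T ^ 2 with hB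
  have hKT : 0 ≤ K / T ^ 2 := by positivity
  have h1 : ‖(α : ℂ)‖ ≤ B := by rw [hB]; linarith [norm_nonneg c]
  have h2 : ‖c‖ ≤ B := by rw [hB]; linarith [norm_nonneg (α : ℂ)]
  have hB0 : 0 ≤ B := by positivity
  set k := (2 * R * B + 2 * B + B ^ 3 + 2 * R ^ 2 + 3 * R + 1) with hk
  refine ⟨k * K, by positivity, fun l hl hlR => ?_⟩
  refine ⟨fun t => (bdB11 l (u t) (w t) - bdB11 l α c) * ψ1 l t +
      (bdB12 l (u t) (w t) - bdB12 l α c) * ψ2 l t,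
    fun t => (bdB21 l (u t) (w t) - bdB21 l α c) * ψ1 l t +
      (bdB22 l (u t) (w t) - bdB22 l α c) * ψ2 l t, fun t ht => ?_⟩
  have hle : K / t ^ 2 ≤ K / T ^ 2 := by gcongr
  have hu : ‖u t‖ ≤ B := by
    have e := norm_le_insert' (u t) α
    rw [hB]; linarith [norm_nonneg c, h.u_sub t ht]
  have hw : ‖w t‖ ≤ B := by
    have e := norm_le_insert' (w t) c
    rw [hB]; linarith [norm_nonneg (α : ℂ), h.w_sub t ht]
  obtain ⟨j1, j2, j3, j4⟩ := bdB_sub_le hlR hu hw h1 h2 (h.u_sub t ht) (h.w_sub t ht)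
  have comb : ∀ x y : ℂ, ‖x‖ ≤ k * (K / t ^ 2) → ‖y‖ ≤ k * (K / t ^ 2) →
      ‖x * ψ1 l t + y * ψ2 l t‖ ≤ k * K / t ^ 2 * (‖ψ1 l t‖ + ‖ψ2 l t‖) := by
    intro x y hx hy
    refine (norm_add_le _ _).trans ?_
    rw [norm_mul, norm_mul, mul_add, mul_div_assoc]
    gcongr
  refine ⟨(h.ode1 l hl t ht).congr_deriv ?_, (h.ode2 l hl t ht).congr_deriv ?_, comb _ _ j1 j2,
    comb _ _ j3 j4⟩
  · simp only [bgM, bgβ, bdB11]; ring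
  · simp only [bgM, bgγ]; ring

set_option maxHeartbeats 1000000 in
/-- Asymptotic integration of the boundary Lax system. -/
theorem AsymptoticLax.levinson (h : AsymptoticLax α ω c T K m F u w ψ1 ψ2) {R s0 : ℝ}
    (hR : 0 ≤ R) (hs₀ : 0 < s0) : ∃ C, 0 ≤ C ∧ ∀ l ∈ UHP, ‖l‖ ≤ R → ∀ S : ℂ, S ^ 2 = -bgP α ω c l →
      0 ≤ S.re → s0 ≤ ‖S‖ → ‖S‖ ≤ R → ‖ψ1 l T‖ ≤ R → ‖ψ2 l T‖ ≤ R →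
      (∀ s t, T ≤ s → s ≤ t → ‖exp (-S * t) * grow1 α ω c l S (ψ1 l t) (ψ2 l t) -
          exp (-S * s) * grow1 α ω c l S (ψ1 l s) (ψ2 l s)‖ ≤ C / s ∧
        ‖exp (-S * t) * grow2 α ω c l S (ψ1 l t) (ψ2 l t) -
          exp (-S * s) * grow2 α ω c l S (ψ1 l s) (ψ2 l s)‖ ≤ C / s) ∧
      (S.re = 0 → ∀ t, T ≤ t → ‖ψ1 l T‖ ^ 2 + ‖ψ2 l T‖ ^ 2 ≤
        C * (‖ψ1 l t‖ ^ 2 + ‖ψ2 l t‖ ^ 2)) := by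
  have hT := h.T_pos
  obtain ⟨k, hk, hpert⟩ := h.exists_perturbation hR
  obtain ⟨N, hN, hbg⟩ := exists_bg_le α ω c hR
  set C₀ := N * (2 * k / s0) with hC₀
  have hC00 : 0 ≤ C₀ := by positivity
  set W0 := 4 * (2 * N * R) ^ 2 with hW₀
  set X := Real.exp (2 * Fintype.card (Fin 4) * C₀ / T) with hX
  have hXo : 0 < X := Real.exp_pos _
  set C1 := C₀ * (Fintype.card (Fin 4) + W0 * X) with hC₁
  set C2 := 1 / s0 ^ 2 * (8 * N ^ 2 * X) with hC₂
  have hC10 : 0 ≤ C1 := by positivity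
  have hC20 : 0 ≤ C2 := by positivity
  refine ⟨C1 + C2, by positivity, fun l hl hlR S hS hre hs hSR hψ1 hψ2 => ?_⟩
  obtain ⟨ρ1, ρ2, hρ⟩ := hpert l hl hlR
  have hS0 : 0 < ‖S‖ := hs₀.trans_le hs
  have hSP : S ^ 2 = bgM α ω c l ^ 2 + bgβ α c l * bgγ α c l := by rw [hS, bgP, neg_neg]
  set e : ℝ → ℂ := fun t => exp (-S * t) with he
  have hed : ∀ t, HasDerivAt e (e t * -S) t := hasDerivAt_exp_mul (-S)
  have hen : ∀ t, ‖e t‖ = Real.exp (-S.re * t) := fun t => by simp only [he]; rw [norm_exp]; simp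
  set f : Fin 4 → ℝ → ℂ := ![fun t => e t * grow1 α ω c l S (ψ1 l t) (ψ2 l t),
    fun t => e t * grow2 α ω c l S (ψ1 l t) (ψ2 l t),
    fun t => e t * grow1 α ω c l (-S) (ψ1 l t) (ψ2 l t),
    fun t => e t * grow2 α ω c l (-S) (ψ1 l t) (ψ2 l t)] with hf
  set g : Fin 4 → ℝ → ℂ := ![fun t => e t * grow1 α ω c l S (ρ1 t) (ρ2 t),
    fun t => e t * grow2 α ω c l S (ρ1 t) (ρ2 t),
    fun t => e t * grow1 α ω c l (-S) (ρ1 t) (ρ2 t),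
    fun t => e t * grow2 α ω c l (-S) (ρ1 t) (ρ2 t)] with hg
  set a : Fin 4 → ℂ := ![0, 0, -2 * S, -2 * S] with ha
  have hfd : ∀ i t, T ≤ t → HasDerivAt (f i) (a i * f i t + g i t) t := by
    intro i t ht
    obtain ⟨d1, d2, -, -⟩ := hρ t ht
    fin_cases i
    · refine ((hed t).fun_mul ((d1.const_mul (S - bgM α ω c l)).fun_add
        (d2.const_mul (bgβ α c l)))).congr_deriv ?_
      simp only [hf, hg, ha, grow1, Matrix.cons_val, Fin.zero_eta]
      linear_combination -e t * ψ1 l t * hSP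
    · refine ((hed t).fun_mul ((d1.const_mul (bgγ α c l)).fun_add
        (d2.const_mul (S + bgM α ω c l)))).congr_deriv ?_
      simp only [hf, hg, ha, grow2, Matrix.cons_val, Fin.mk_one]
      linear_combination -e t * ψ2 l t * hSP
    · refine ((hed t).fun_mul ((d1.const_mul (-S - bgM α ω c l)).fun_add
        (d2.const_mul (bgβ α c l)))).congr_deriv ?_
      simp only [hf, hg, ha, grow1, Matrix.cons_val, Fin.reduceFinMk]
      linear_combination -e t * ψ1 l t * hSP
    · refine ((hed t).fun_mul ((d1.const_mul (bgγ α c l)).fun_add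
        (d2.const_mul (-S + bgM α ω c l)))).congr_deriv ?_
      simp only [hf, hg, ha, grow2, Matrix.cons_val, Fin.reduceFinMk]
      linear_combination -e t * ψ2 l t * hSP
  have har : ∀ i, (a i).re ≤ 0 := by
    intro i
    fin_cases i <;> simp [ha, hre]
  have hnS : ‖-S‖ ≤ R := by rwa [norm_neg]
  have hcomp : ∀ t (z1 z2 : ℂ) (i : Fin 4), ‖e t * (![grow1 α ω c l S z1 z2, grow2 α ω c l S z1 z2,
      grow1 α ω c l (-S) z1 z2, grow2 α ω c l (-S) z1 z2] i)‖ ≤ ‖e t‖ * (N * (‖z1‖ + ‖z2‖)) := by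
    intro t z1 z2 i
    rw [norm_mul]
    refine mul_le_mul_of_nonneg_left ?_ (norm_nonneg _)
    obtain ⟨b1, b2⟩ := hbg l S hlR hSR z1 z2
    obtain ⟨b3, b4⟩ := hbg l (-S) hlR hnS z1 z2
    fin_cases i
    exacts [b1, b2, b3, b4]
  have hf_le : ∀ t i, ‖f i t‖ ≤ ‖e t‖ * (N * (‖ψ1 l t‖ + ‖ψ2 l t‖)) := by
    intro t i
    have := hcomp t (ψ1 l t) (ψ2 l t) i
    fin_cases i <;> exact this
  have hψ : ∀ t, 2 * s0 * (‖e t‖ * ‖ψ1 l t‖) ≤ ‖f 0 t‖ + ‖f 2 t‖ ∧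
      2 * s0 * (‖e t‖ * ‖ψ2 l t‖) ≤ ‖f 1 t‖ + ‖f 3 t‖ := by
    intro t
    obtain ⟨i1, i2⟩ := grow_identities α ω c l S (ψ1 l t) (ψ2 l t)
    have e1 : 2 * S * (e t * ψ1 l t) = f 0 t - f 2 t := by
      simp only [hf, Matrix.cons_val]; linear_combination -e t * i1
    have e2 : 2 * S * (e t * ψ2 l t) = f 1 t - f 3 t := by
      simp only [hf, Matrix.cons_val]; linear_combination -e t * i2
    have key : ∀ z x y : ℂ, 2 * S * (e t * z) = x - y → 2 * s0 * (‖e t‖ * ‖z‖) ≤ ‖x‖ + ‖y‖ := by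
      intro z x y hxy
      refine le_trans ?_ (norm_sub_le x y)
      rw [← hxy, norm_mul, norm_mul, norm_mul, norm_ofNat]
      gcongr
    exact ⟨key _ _ _ e1, key _ _ _ e2⟩
  have hgb : ∀ i t, T ≤ t → ‖g i t‖ ≤ C₀ / t ^ 2 * ∑ j, ‖f j t‖ := by
    intro i t ht
    have hto := hT.trans_le ht
    obtain ⟨-, -, r1, r2⟩ := hρ t ht
    obtain ⟨p1, p2⟩ := hψ t
    have h1 : ‖g i t‖ ≤ ‖e t‖ * (N * (‖ρ1 t‖ + ‖ρ2 t‖)) := by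
      have := hcomp t (ρ1 t) (ρ2 t) i
      fin_cases i <;> exact this
    refine h1.trans ?_
    have h2 : ‖e t‖ * (‖ψ1 l t‖ + ‖ψ2 l t‖) ≤ 1 / s0 * ∑ j, ‖f j t‖ := by
      rw [Fin.sum_univ_four, div_mul_eq_mul_div, one_mul, le_div_iff₀ hs₀]
      linarith [norm_nonneg (f 0 t), norm_nonneg (f 1 t), norm_nonneg (f 2 t), norm_nonneg (f 3 t)]
    calc ‖e t‖ * (N * (‖ρ1 t‖ + ‖ρ2 t‖))
        ≤ ‖e t‖ * (N * (k / t ^ 2 * (‖ψ1 l t‖ + ‖ψ2 l t‖) + k / t ^ 2 * (‖ψ1 l t‖ + ‖ψ2 l t‖))) := by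
          gcongr
      _ = N * (2 * k / t ^ 2) * (‖e t‖ * (‖ψ1 l t‖ + ‖ψ2 l t‖)) := by ring
      _ ≤ N * (2 * k / t ^ 2) * (1 / s0 * ∑ j, ‖f j t‖) := by gcongr
      _ = _ := by rw [hC₀]; field_simp
  constructor
  · intro s t hs hst
    have hs0 := hT.trans_le hs
    have hW : ∑ i, ‖f i T‖ ^ 2 ≤ W0 := by
      have h1 : ∀ i, ‖f i T‖ ^ 2 ≤ (2 * N * R) ^ 2 := by
        intro i
        have h2 := hf_le T i
        have h3 : ‖e T‖ ≤ 1 := by rw [hen, Real.exp_le_one_iff]; nlinarith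
        have h4 : ‖f i T‖ ≤ 2 * N * R := h2.trans (by
          calc _ ≤ 1 * (N * (R + R)) := by gcongr
            _ = _ := by ring)
        gcongr
      refine (Finset.sum_le_sum fun i _ => h1 i).trans ?_
      simp [hW₀]
    have hfin : C₀ * (Fintype.card (Fin 4) + (∑ i, ‖f i T‖ ^ 2) * X) / s ≤ (C1 + C2) / s := by
      have h1 : C₀ * (Fintype.card (Fin 4) + (∑ i, ‖f i T‖ ^ 2) * X) ≤ C1 := by rw [hC₁]; gcongr
      gcongr
      linarith
    have k0 := levinson_cauchy hT hC00 hfd har hgb (i := 0) rfl hs hst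
    have k1 := levinson_cauchy hT hC00 hfd har hgb (i := 1) rfl hs hst
    exact ⟨k0.trans hfin, k1.trans hfin⟩
  · intro hre0 t ht
    have har0 : ∀ i, (a i).re = 0 := by
      intro i
      fin_cases i <;> simp [ha, hre0]
    have he1 : ∀ t, ‖e t‖ = 1 := fun t => by rw [hen, hre0]; simp
    have h1 := levinson_bound_below hT hC00 hfd har0 hgb ht
    obtain ⟨p1, p2⟩ := hψ T
    rw [he1, one_mul] at p1 p2
    have h2 : ∑ i, ‖f i t‖ ^ 2 ≤ 8 * N ^ 2 * (‖ψ1 l t‖ ^ 2 + ‖ψ2 l t‖ ^ 2) := by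
      have h3 : ∀ i, ‖f i t‖ ^ 2 ≤ 2 * N ^ 2 * (‖ψ1 l t‖ ^ 2 + ‖ψ2 l t‖ ^ 2) := by
        intro i
        have h4 := hf_le t i
        rw [he1, one_mul] at h4
        calc ‖f i t‖ ^ 2 ≤ (N * (‖ψ1 l t‖ + ‖ψ2 l t‖)) ^ 2 := by gcongr
          _ = N ^ 2 * (‖ψ1 l t‖ + ‖ψ2 l t‖) ^ 2 := by ring
          _ ≤ N ^ 2 * (2 * (‖ψ1 l t‖ ^ 2 + ‖ψ2 l t‖ ^ 2)) := by
              gcongr; nlinarith [sq_nonneg (‖ψ1 l t‖ - ‖ψ2 l t‖)]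
          _ = _ := by ring
      refine (Finset.sum_le_sum fun i _ => h3 i).trans ?_
      rw [Finset.sum_const, Finset.card_univ, Fintype.card_fin, nsmul_eq_mul]
      push_cast
      exact le_of_eq (by ring)
    have h5 : s0 ^ 2 * (‖ψ1 l T‖ ^ 2 + ‖ψ2 l T‖ ^ 2) ≤ ∑ i, ‖f i T‖ ^ 2 := by
      rw [Fin.sum_univ_four]
      have key : ∀ z x y : ℝ, 0 ≤ z → 0 ≤ x → 0 ≤ y → 2 * s0 * z ≤ x + y →
          s0 ^ 2 * z ^ 2 ≤ x ^ 2 + y ^ 2 := by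
        intro z x y hz hx hy hxy
        have h6 : (2 * s0 * z) ^ 2 ≤ (x + y) ^ 2 := by gcongr
        nlinarith [sq_nonneg (x - y), sq_nonneg (s0 * z)]
      have k1 := key _ _ _ (norm_nonneg _) (norm_nonneg _) (norm_nonneg _) p1
      have k2 := key _ _ _ (norm_nonneg _) (norm_nonneg _) (norm_nonneg _) p2
      linarith
    have h6 : ‖ψ1 l T‖ ^ 2 + ‖ψ2 l T‖ ^ 2 ≤ C2 * (‖ψ1 l t‖ ^ 2 + ‖ψ2 l t‖ ^ 2) := by
      have h7 : s0 ^ 2 * (‖ψ1 l T‖ ^ 2 + ‖ψ2 l T‖ ^ 2) ≤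
          8 * N ^ 2 * (‖ψ1 l t‖ ^ 2 + ‖ψ2 l t‖ ^ 2) * X :=
        h5.trans (h1.trans (by gcongr))
      rw [hC₂, div_mul_eq_mul_div, one_mul, div_mul_eq_mul_div, le_div_iff₀ (by positivity)]
      linarith
    refine h6.trans ?_
    gcongr
    linarith

end

section

/-- A sequence of holomorphic functions which is locally uniformly Cauchy at the rate `1 / t` has a
holomorphic limit. -/
lemma exists_holomorphic_limit {Ω : Set ℂ} (hΩ : IsOpen Ω) {f : ℝ → ℂ → ℂ} {T : ℝ}
    (hf : ∀ t, T ≤ t → DifferentiableOn ℂ (f t) Ω)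
    (hc : ∀ z ∈ Ω, ∃ C, 0 ≤ C ∧ ∀ᶠ l in 𝓝 z, ∀ s t, T ≤ s → s ≤ t → ‖f t l - f s l‖ ≤ C / s) :
    ∃ g : ℂ → ℂ, DifferentiableOn ℂ g Ω ∧ ∀ l ∈ Ω, Tendsto (fun t => f t l) atTop (𝓝 (g l)) := by
  have hlim : ∀ l, ∃ g, l ∈ Ω → Tendsto (fun t => f t l) atTop (𝓝 g) := by
    intro l
    by_cases hl : l ∈ Ω
    · obtain ⟨C, hC, h⟩ := hc l hl
      have h := h.self_of_nhds
      have : CauchySeq fun t => f t l := by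
        rw [Metric.cauchySeq_iff']
        intro ε hε
        refine ⟨max (max T 1) ((C + 1) / ε), fun t ht => ?_⟩
        set s := max (max T 1) ((C + 1) / ε) with hs
        have hs1 : 1 ≤ s := (le_max_right _ _).trans (le_max_left _ _)
        rw [dist_eq_norm]
        refine (h s t ((le_max_left _ _).trans (le_max_left _ _)) ht).trans_lt ?_
        have hs2 : (C + 1) / ε ≤ s := le_max_right _ _
        rw [div_le_iff₀ hε] at hs2
        rw [div_lt_iff₀ (by linarith)]
        linarith
      obtain ⟨g, hg⟩ := cauchySeq_tendsto_of_complete this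
      exact ⟨g, fun _ => hg⟩
    · exact ⟨0, fun h => absurd h hl⟩
  choose g hg using hlim
  refine ⟨g, ?_, hg⟩
  have hu : TendstoLocallyUniformlyOn f g atTop Ω := by
    rw [Metric.tendstoLocallyUniformlyOn_iff]
    intro ε hε z hz
    obtain ⟨C, hC, h⟩ := hc z hz
    refine ⟨_, inter_mem (mem_nhdsWithin_of_mem_nhds h) self_mem_nhdsWithin, ?_⟩
    filter_upwards [eventually_ge_atTop T, eventually_gt_atTop ((C + 1) / ε),
      eventually_gt_atTop 0] with s hs hs2 hs0 l hl
    have h1 : ‖g l - f s l‖ ≤ C / s := by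
      refine le_of_tendsto ((hg l hl.2).sub_const _).norm ?_
      filter_upwards [eventually_ge_atTop s] with t ht using hl.1 s t hs ht
    rw [dist_eq_norm]
    refine h1.trans_lt ?_
    rw [div_lt_iff₀ hε] at hs2
    rw [div_lt_iff₀ hs0]
    linarith
  refine hu.differentiableOn ?_ hΩ
  filter_upwards [eventually_ge_atTop T] with t ht using hf t ht

/-- The principal square root. -/
def csqrt (z : ℂ) : ℂ := z ^ (2⁻¹ : ℂ)

lemma csqrt_sq (z : ℂ) : csqrt z ^ 2 = z := Complex.cpow_ofNat_inv_pow z 2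

lemma csqrt_re_pos {z : ℂ} (hz : z ∈ slitPlane) : 0 < (csqrt z).re := by
  rw [csqrt, Complex.cpow_inv_two_re]
  apply Real.sqrt_pos.2
  have h1 := abs_re_le_norm z
  have h2 := neg_abs_le z.re
  rcases hz with h | h
  · have := norm_nonneg z; positivity
  · have h3 : |z.re| < ‖z‖ := Complex.abs_re_lt_norm.2 h
    linarith

lemma csqrt_of_sq {z S : ℂ} (hS : S ^ 2 = z) (hre : 0 < S.re) : csqrt z = S := by
  rw [← hS, csqrt, Complex.sq_cpow_two_inv hre]

variable {α ω : ℝ} {c : ℂ} {T K m F : ℝ} {u w : ℝ → ℂ} {ψ1 ψ2 : ℂ → ℝ → ℂ}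

lemma differentiable_bgM : Differentiable ℂ (bgM α ω c) := by unfold bgM bdB22; fun_prop

lemma differentiable_bgβ : Differentiable ℂ (bgβ α c) := by unfold bgβ bdB12; fun_prop

lemma differentiable_bgγ : Differentiable ℂ (bgγ α c) := by unfold bgγ bdB21; fun_prop

lemma differentiable_bgP : Differentiable ℂ (bgP α ω c) :=
  ((differentiable_bgM.pow 2).add (differentiable_bgβ.mul differentiable_bgγ)).neg

/-- The part of the upper half plane where the growth rate is well defined. -/
def growthDomain (α ω : ℝ) (c : ℂ) : Set ℂ := UHP ∩ {l | -bgP α ω c l ∈ slitPlane}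

lemma isOpen_growthDomain : IsOpen (growthDomain α ω c) :=
  isOpen_UHP.inter (Complex.isOpen_slitPlane.preimage differentiable_bgP.continuous.neg)

/-- The rescaled growing components. -/
def scaled1 (α ω : ℝ) (c : ℂ) (ψ1 ψ2 : ℂ → ℝ → ℂ) (t : ℝ) (l S : ℂ) : ℂ :=
  exp (-S * t) * grow1 α ω c l S (ψ1 l t) (ψ2 l t)

def scaled2 (α ω : ℝ) (c : ℂ) (ψ1 ψ2 : ℂ → ℝ → ℂ) (t : ℝ) (l S : ℂ) : ℂ :=
  exp (-S * t) * grow2 α ω c l S (ψ1 l t) (ψ2 l t)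

/-- Local uniformity in asymptotic integration. -/
lemma AsymptoticLax.levinson_nhds (h : AsymptoticLax α ω c T K m F u w ψ1 ψ2) {z S0 : ℂ}
    (hz : z ∈ UHP) (hS₀ : S0 ≠ 0) :
    ∃ C, 0 ≤ C ∧ ∀ᶠ p : ℂ × ℂ in 𝓝 (z, S0), p.2 ^ 2 = -bgP α ω c p.1 → 0 ≤ p.2.re →
      (∀ s t, T ≤ s → s ≤ t →
        ‖scaled1 α ω c ψ1 ψ2 t p.1 p.2 - scaled1 α ω c ψ1 ψ2 s p.1 p.2‖ ≤ C / s ∧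
        ‖scaled2 α ω c ψ1 ψ2 t p.1 p.2 - scaled2 α ω c ψ1 ψ2 s p.1 p.2‖ ≤ C / s) ∧
      (p.2.re = 0 → ∀ t, T ≤ t → ‖ψ1 p.1 T‖ ^ 2 + ‖ψ2 p.1 T‖ ^ 2 ≤
        C * (‖ψ1 p.1 t‖ ^ 2 + ‖ψ2 p.1 t‖ ^ 2)) := by
  have hS0' : 0 < ‖S0‖ := norm_pos_iff.2 hS₀
  set R := ‖z‖ + ‖S0‖ + ‖ψ1 z T‖ + ‖ψ2 z T‖ + 1 with hR
  have n1 := norm_nonneg z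
  have n2 := norm_nonneg (ψ1 z T)
  have n3 := norm_nonneg (ψ2 z T)
  obtain ⟨C, hC, hCb⟩ := h.levinson (R := R) (s0 := ‖S0‖ / 2) (by positivity) (by positivity)
  refine ⟨C, hC, ?_⟩
  have c1 : ContinuousAt (fun l => ψ1 l T) z :=
    ((h.diff1 T le_rfl).differentiableAt (isOpen_UHP.mem_nhds hz)).continuousAt
  have c2 : ContinuousAt (fun l => ψ2 l T) z :=
    ((h.diff2 T le_rfl).differentiableAt (isOpen_UHP.mem_nhds hz)).continuousAt
  have f1 : ∀ᶠ l in 𝓝 z, l ∈ UHP ∧ ‖l‖ < R ∧ ‖ψ1 l T‖ < R ∧ ‖ψ2 l T‖ < R := by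
    refine (isOpen_UHP.eventually_mem hz).and
      ((continuous_norm.continuousAt.eventually (gt_mem_nhds ?_)).and
      ((c1.norm.eventually (gt_mem_nhds ?_)).and (c2.norm.eventually (gt_mem_nhds ?_))))
    all_goals linarith
  have f2 : ∀ᶠ S in 𝓝 S0, ‖S0‖ / 2 < ‖S‖ ∧ ‖S‖ < R := by
    refine (continuous_norm.continuousAt.eventually (lt_mem_nhds ?_)).and
      (continuous_norm.continuousAt.eventually (gt_mem_nhds ?_))
    all_goals linarith
  rw [nhds_prod_eq]
  filter_upwards [f1.prod_mk f2] with p hp hpS hre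
  exact hCb p.1 hp.1.1 hp.1.2.1.le p.2 hpS hre hp.2.1.le hp.2.2.le hp.1.2.2.1.le hp.1.2.2.2.le

/-- The growth coefficients are holomorphic functions of the spectral parameter. -/
lemma AsymptoticLax.exists_growth (h : AsymptoticLax α ω c T K m F u w ψ1 ψ2) :
    ∃ L1 L2 : ℂ → ℂ, DifferentiableOn ℂ L1 (growthDomain α ω c) ∧
      DifferentiableOn ℂ L2 (growthDomain α ω c) ∧ ∀ l ∈ growthDomain α ω c,
        Tendsto (fun t => scaled1 α ω c ψ1 ψ2 t l (csqrt (-bgP α ω c l))) atTop (𝓝 (L1 l)) ∧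
        Tendsto (fun t => scaled2 α ω c ψ1 ψ2 t l (csqrt (-bgP α ω c l))) atTop (𝓝 (L2 l)) := by
  have hsub : growthDomain α ω c ⊆ UHP := inter_subset_left
  have dS : DifferentiableOn ℂ (fun l => csqrt (-bgP α ω c l)) (growthDomain α ω c) := by
    intro l hl
    exact ((differentiable_bgP l).neg.cpow_const hl.2).differentiableWithinAt
  have dm : DifferentiableOn ℂ (bgM α ω c) (growthDomain α ω c) :=
    differentiable_bgM.differentiableOn
  have dβ : DifferentiableOn ℂ (bgβ α c) (growthDomain α ω c) := differentiable_bgβ.differentiableOn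
  have dγ : DifferentiableOn ℂ (bgγ α c) (growthDomain α ω c) := differentiable_bgγ.differentiableOn
  have hcau : ∀ z ∈ growthDomain α ω c, ∃ C, 0 ≤ C ∧ ∀ᶠ l in 𝓝 z, ∀ s t, T ≤ s → s ≤ t →
      ‖scaled1 α ω c ψ1 ψ2 t l (csqrt (-bgP α ω c l)) -
        scaled1 α ω c ψ1 ψ2 s l (csqrt (-bgP α ω c l))‖ ≤ C / s ∧
      ‖scaled2 α ω c ψ1 ψ2 t l (csqrt (-bgP α ω c l)) -
        scaled2 α ω c ψ1 ψ2 s l (csqrt (-bgP α ω c l))‖ ≤ C / s := by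
    intro z hz
    have hne : csqrt (-bgP α ω c z) ≠ 0 := by
      intro h0
      have := csqrt_re_pos hz.2
      rw [h0] at this
      exact lt_irrefl _ this
    obtain ⟨C, hC, hev⟩ := h.levinson_nhds (hsub hz) hne
    refine ⟨C, hC, ?_⟩
    have hcont : ContinuousAt (fun l => (l, csqrt (-bgP α ω c l))) z := continuousAt_id.prodMk
        ((dS z hz).differentiableAt (isOpen_growthDomain.mem_nhds hz)).continuousAt
    filter_upwards [hcont.eventually hev, isOpen_growthDomain.mem_nhds hz] with l hl hlΩ
    exact (hl (csqrt_sq _) (csqrt_re_pos hlΩ.2).le).1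
  obtain ⟨L1, d1, ti⟩ := exists_holomorphic_limit (T := T) isOpen_growthDomain
    (f := fun t l => scaled1 α ω c ψ1 ψ2 t l (csqrt (-bgP α ω c l)))
    (fun t ht => by
      have e1 := (h.diff1 t ht).mono hsub
      have e2 := (h.diff2 t ht).mono hsub
      exact ((dS.neg.mul_const (t : ℂ)).cexp).mul (((dS.sub dm).mul e1).add (dβ.mul e2)))
    (fun z hz => by
      obtain ⟨C, hC, hev⟩ := hcau z hz
      exact ⟨C, hC, hev.mono fun l hl s t hs hst => (hl s t hs hst).1⟩)
  obtain ⟨L2, d2, t2⟩ := exists_holomorphic_limit (T := T) isOpen_growthDomain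
    (f := fun t l => scaled2 α ω c ψ1 ψ2 t l (csqrt (-bgP α ω c l)))
    (fun t ht => by
      have e1 := (h.diff1 t ht).mono hsub
      have e2 := (h.diff2 t ht).mono hsub
      exact ((dS.neg.mul_const (t : ℂ)).cexp).mul ((dγ.mul e1).add ((dS.add dm).mul e2)))
    (fun z hz => by
      obtain ⟨C, hC, hev⟩ := hcau z hz
      exact ⟨C, hC, hev.mono fun l hl s t hs hst => (hl s t hs hst).2⟩)
  exact ⟨L1, L2, d1, d2, fun l hl => ⟨ti l hl, t2 l hl⟩⟩

/-- Where the frame stays bounded, the growing components vanish in the limit. -/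
lemma AsymptoticLax.tendsto_scaled_zero (h : AsymptoticLax α ω c T K m F u w ψ1 ψ2) {l S : ℂ}
    (hl : l ∈ UHP) (hS : 0 < S.re) (hF : F * ‖l‖ ≤ 8 * (l.re * l.im ^ 2)) :
    Tendsto (fun t => scaled1 α ω c ψ1 ψ2 t l S) atTop (𝓝 0) ∧
    Tendsto (fun t => scaled2 α ω c ψ1 ψ2 t l S) atTop (𝓝 0) := by
  have him : 0 < l.im := hl
  have hlpos : 0 < ‖l‖ := him.trans_le ((le_abs_self _).trans (abs_im_le_norm l))
  obtain ⟨N, hN, hbg⟩ := exists_bg_le α ω c (R := ‖l‖ + ‖S‖) (by positivity)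
  set X := Real.exp (‖l‖ / l.im * m) with hX
  set W := 2 + X + X / ‖l‖ with hW
  have hψ : ∀ t, T ≤ t → ‖ψ1 l t‖ + ‖ψ2 l t‖ ≤ W := by
    intro t ht
    have hto := h.T_pos.trans_le ht
    have h1 := h.energy l hl t ht
    have h2 : Real.exp (-(8 * l.re * l.im * t) + ‖l‖ / l.im * (m + F * t)) ≤ X := by
      apply Real.exp_le_exp.2
      have : ‖l‖ / l.im * (F * t) ≤ 8 * l.re * l.im * t := by
        rw [div_mul_eq_mul_div, div_le_iff₀ him]
        nlinarith
      rw [mul_add]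
      linarith
    have h3 : ‖ψ2 l t‖ ^ 2 ≤ X := by
      have : 0 ≤ ‖l‖ * ‖ψ1 l t‖ ^ 2 := by positivity
      linarith
    have h4 : ‖ψ1 l t‖ ^ 2 ≤ X / ‖l‖ := by
      rw [le_div_iff₀ hlpos]
      nlinarith [sq_nonneg ‖ψ2 l t‖]
    nlinarith [sq_nonneg (‖ψ1 l t‖ - 1), sq_nonneg (‖ψ2 l t‖ - 1)]
  have hdec : Tendsto (fun t : ℝ => Real.exp (-(S.re * t)) * (N * W)) atTop (𝓝 0) := by
    have h1 : Tendsto (fun t : ℝ => Real.exp (-(S.re * t))) atTop (𝓝 0) :=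
      Real.tendsto_exp_neg_atTop_nhds_zero.comp (tendsto_id.const_mul_atTop hS)
    simpa using h1.mul_const (N * W)
  have hen : ∀ t : ℝ, ‖exp (-S * t)‖ = Real.exp (-(S.re * t)) := fun t => by rw [norm_exp]; simp
  have hb : ∀ t, T ≤ t → ‖scaled1 α ω c ψ1 ψ2 t l S‖ ≤ Real.exp (-(S.re * t)) * (N * W) ∧
      ‖scaled2 α ω c ψ1 ψ2 t l S‖ ≤ Real.exp (-(S.re * t)) * (N * W) := by
    intro t ht
    obtain ⟨b1, b2⟩ := hbg l S (by linarith [norm_nonneg S]) (by linarith) (ψ1 l t) (ψ2 l t)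
    have h3 := hψ t ht
    rw [scaled1, scaled2, norm_mul, norm_mul, hen]
    exact ⟨by gcongr; exact b1.trans (by gcongr), by gcongr; exact b2.trans (by gcongr)⟩
  constructor
  · refine squeeze_zero_norm' ?_ hdec
    filter_upwards [eventually_ge_atTop T] with t ht using (hb t ht).1
  · refine squeeze_zero_norm' ?_ hdec
    filter_upwards [eventually_ge_atTop T] with t ht using (hb t ht).2

end

section

variable {α ω : ℝ} {c : ℂ} {T K m F : ℝ} {u w : ℝ → ℂ} {ψ1 ψ2 : ℂ → ℝ → ℂ}

lemma sq_mem_slitPlane_of_re_pos {S : ℂ} (hS : 0 < S.re) : S ^ 2 ∈ slitPlane := by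
  rw [mem_slitPlane_iff, pow_two, mul_re, mul_im]
  by_cases h : S.im = 0
  · left; rw [h]; nlinarith
  · right
    have : S.re * S.im + S.im * S.re = 2 * (S.re * S.im) := by ring
    rw [this]
    positivity

/-- A simple zero of the determinant on the boundary of a connected region, reaching the region
where the frame is bounded, is impossible. -/
theorem AsymptoticLax.no_simple_zero (h : AsymptoticLax α ω c T K m F u w ψ1 ψ2) {V : Set ℂ}
    (hV : IsPreconnected V) (hVΩ : V ⊆ growthDomain α ω c)
    (hbdd : ∀ κ : ℝ, ∃ l ∈ V, κ * ‖l‖ < l.re * l.im ^ 2) {z p' : ℂ} (hz : z ∈ closure V)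
    (hzU : z ∈ UHP) (hP : bgP α ω c z = 0) (hP' : HasDerivAt (bgP α ω c) p' z) (hp' : p' ≠ 0) :
    False := by
  set Ω := growthDomain α ω c with hΩ
  obtain ⟨L1, L2, dL1, dL2, hL⟩ := h.exists_growth
  -- the local inverse of the determinant
  have hstrict : HasStrictDerivAt (bgP α ω c) p' z := by
    have h1 := (differentiable_bgP (α := α) (ω := ω) (c := c)).analyticAt z |>.hasStrictDerivAt
    rwa [hP'.deriv] at h1
  obtain ⟨e, hze, he⟩ : ∃ e : OpenPartialHomeomorph ℂ ℂ, z ∈ e.source ∧ ∀ l, e l = bgP α ω c l :=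
    ⟨(hstrict.hasStrictFDerivAt_equiv hp').toOpenPartialHomeomorph _,
      (hstrict.hasStrictFDerivAt_equiv hp').mem_toOpenPartialHomeomorph_source, fun _ => rfl⟩
  have he0 : (0 : ℂ) ∈ e.target := by
    have := e.map_source hze
    rwa [he, hP] at this
  have hez : e.symm 0 = z := by rw [← hP, ← he, e.left_inv hze]
  obtain ⟨r, hr, hball⟩ : ∃ r, 0 < r ∧ ∀ p, ‖p‖ < r → p ∈ e.target ∧ e.symm p ∈ UHP := by
    have h1 : ∀ᶠ p in 𝓝 (0 : ℂ), p ∈ e.target ∧ e.symm p ∈ UHP := by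
      refine (e.open_target.eventually_mem he0).and ?_
      refine (e.symm.continuousAt (x := 0) he0).eventually ?_
      rw [hez]
      exact isOpen_UHP.eventually_mem hzU
    obtain ⟨r, hr, h2⟩ := Metric.eventually_nhds_iff.1 h1
    exact ⟨r, hr, fun p hp => h2 (by rwa [dist_zero_right])⟩
  set γ : ℂ → ℂ := fun S => e.symm (-S ^ 2) with hγ
  have hγn : ∀ {S : ℂ}, ‖S‖ < √r → ‖-S ^ 2‖ < r := by
    intro S hS
    rw [norm_neg, norm_pow]
    exact (Real.lt_sqrt (norm_nonneg S)).1 hS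
  have hγP : ∀ {S : ℂ}, ‖S‖ < √r → S ^ 2 = -bgP α ω c (γ S) := by
    intro S hS
    rw [← he, hγ, e.right_inv (hball _ (hγn hS)).1, neg_neg]
  have hγU : ∀ {S : ℂ}, ‖S‖ < √r → γ S ∈ UHP := fun hS => (hball _ (hγn hS)).2
  have hγc : ∀ {S : ℂ}, ‖S‖ < √r → ContinuousAt γ S := by
    intro S hS
    refine ContinuousAt.comp (f := fun S : ℂ => -S ^ 2)
      (e.symm.continuousAt (hball _ (hγn hS)).1) ?_
    fun_prop
  have hr' : 0 < √r := Real.sqrt_pos.2 hr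
  -- the slit disc
  set H : Set ℂ := {S | 0 < S.re} ∩ Metric.ball 0 (√r) with hH
  have hHn : ∀ S ∈ H, ‖S‖ < √r := fun S hS => mem_ball_zero_iff.1 hS.2
  have hHconv : Convex ℝ H := (convex_halfSpace_re_gt 0).inter (convex_ball _ _)
  set D : Set ℂ := γ '' H with hD
  have hDc : IsPreconnected D := hHconv.isPreconnected.image _ fun S hS =>
    (hγc (hHn S hS)).continuousWithinAt
  have hDΩ : D ⊆ Ω := by
    rintro l ⟨S, hS, rfl⟩
    refine ⟨hγU (hHn S hS), ?_⟩
    change -bgP α ω c (γ S) ∈ slitPlane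
    rw [← hγP (hHn S hS)]
    exact sq_mem_slitPlane_of_re_pos hS.1
  have hVD : (V ∩ D).Nonempty := by
    have hnb : ∀ᶠ l in 𝓝 z, l ∈ e.source ∧ ‖bgP α ω c l‖ < r := by
      refine (e.open_source.eventually_mem hze).and ?_
      refine differentiable_bgP.continuous.norm.continuousAt.eventually (gt_mem_nhds ?_)
      simpa only [hP, norm_zero] using hr
    obtain ⟨l, hl, hlV⟩ := (mem_closure_iff_nhds.1 hz _ hnb)
    refine ⟨l, hlV, csqrt (-bgP α ω c l), ⟨csqrt_re_pos (hVΩ hlV).2, ?_⟩, ?_⟩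
    · rw [mem_ball_zero_iff, Real.lt_sqrt (norm_nonneg _), ← norm_pow, csqrt_sq, norm_neg]
      exact hl.2
    · change e.symm (-csqrt (-bgP α ω c l) ^ 2) = l
      rw [csqrt_sq, neg_neg, ← he, e.left_inv hl.1]
  have hVDc : IsPreconnected (V ∪ D) := by
    obtain ⟨l, h1, h2⟩ := hVD
    exact hV.union l h1 h2 hDc
  -- vanishing of the growth coefficients
  obtain ⟨l0, hl0V, hl0⟩ := hbdd (F / 8)
  have hev : ∀ᶠ l in 𝓝 l0, L1 l = 0 ∧ L2 l = 0 := by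
    have h1 : ∀ᶠ l : ℂ in 𝓝 l0, F / 8 * ‖l‖ < l.re * l.im ^ 2 := by
      have c1 : Continuous fun l : ℂ => F / 8 * ‖l‖ := by fun_prop
      have c2 : Continuous fun l : ℂ => l.re * l.im ^ 2 := by fun_prop
      exact c1.continuousAt.eventually_lt c2.continuousAt hl0
    filter_upwards [h1, isOpen_growthDomain.mem_nhds (hVΩ hl0V)] with l hl hlΩ
    have h2 := h.tendsto_scaled_zero hlΩ.1 (csqrt_re_pos hlΩ.2) (by linarith)
    have h3 := hL l hlΩ
    exact ⟨tendsto_nhds_unique h3.1 h2.1, tendsto_nhds_unique h3.2 h2.2⟩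
  have hzero : ∀ l ∈ D, L1 l = 0 ∧ L2 l = 0 := by
    have hsub : V ∪ D ⊆ Ω := union_subset hVΩ hDΩ
    have ai : AnalyticOnNhd ℂ L1 (V ∪ D) := (dL1.analyticOnNhd isOpen_growthDomain).mono hsub
    have aj : AnalyticOnNhd ℂ L2 (V ∪ D) := (dL2.analyticOnNhd isOpen_growthDomain).mono hsub
    intro l hl
    exact ⟨ai.eqOn_zero_of_preconnected_of_eventuallyEq_zero hVDc (mem_union_left _ hl0V)
        (hev.mono fun l hl => hl.1) (mem_union_right _ hl),
      aj.eqOn_zero_of_preconnected_of_eventuallyEq_zero hVDc (mem_union_left _ hl0V)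
        (hev.mono fun l hl => hl.2) (mem_union_right _ hl)⟩
  -- both sides of the slit
  have hside : ∀ S0 : ℂ, S0 ≠ 0 → S0.re = 0 → ‖S0‖ < √r → ∃ C, 0 ≤ C ∧
      (∀ t, T ≤ t → ‖grow1 α ω c (γ S0) S0 (ψ1 (γ S0) t) (ψ2 (γ S0) t)‖ ≤ C / t ∧
        ‖grow2 α ω c (γ S0) S0 (ψ1 (γ S0) t) (ψ2 (γ S0) t)‖ ≤ C / t) ∧
      ∀ t, T ≤ t → ‖ψ1 (γ S0) T‖ ^ 2 + ‖ψ2 (γ S0) T‖ ^ 2 ≤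
        C * (‖ψ1 (γ S0) t‖ ^ 2 + ‖ψ2 (γ S0) t‖ ^ 2) := by
    intro S0 hS₀ hre hn
    obtain ⟨C, hC, hCev⟩ := h.levinson_nhds (hγU hn) hS₀
    refine ⟨C, hC, fun t ht => ?_, (hCev.self_of_nhds (hγP hn) hre.ge).2 hre⟩
    have hcont : ContinuousAt (fun S => (γ S, S)) S0 := (hγc hn).prodMk continuousAt_id
    have hne : (𝓝[{S : ℂ | 0 < S.re}] S0).NeBot := by
      rw [← mem_closure_iff_nhdsWithin_neBot, closure_setOfPred_lt_re]
      exact hre.ge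
    have hbound : ∀ᶠ S in 𝓝[{S : ℂ | 0 < S.re}] S0,
        ‖scaled1 α ω c ψ1 ψ2 t (γ S) S‖ ≤ C / t ∧ ‖scaled2 α ω c ψ1 ψ2 t (γ S) S‖ ≤ C / t := by
      have hball' : ∀ᶠ S in 𝓝 S0, ‖S‖ < √r :=
        continuous_norm.continuousAt.eventually (gt_mem_nhds hn)
      filter_upwards [(hcont.eventually hCev).filter_mono nhdsWithin_le_nhds,
        hball'.filter_mono nhdsWithin_le_nhds, self_mem_nhdsWithin] with S hS hSn hSre
      have hSre' : 0 < S.re := hSre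
      have h1 := (hS (hγP hSn) hSre'.le).1 t
      have hmem : γ S ∈ D := ⟨S, ⟨hSre', mem_ball_zero_iff.2 hSn⟩, rfl⟩
      have h2 := hL (γ S) (hDΩ hmem)
      rw [csqrt_of_sq (hγP hSn) hSre', (hzero _ hmem).1, (hzero _ hmem).2] at h2
      have key : ∀ {f : ℝ → ℂ}, Tendsto f atTop (𝓝 0) → (∀ s, t ≤ s → ‖f s - f t‖ ≤ C / t) →
          ‖f t‖ ≤ C / t := by
        intro f hf hb
        have h3 := (hf.sub_const (f t)).norm
        rw [zero_sub, norm_neg] at h3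
        refine le_of_tendsto h3 ?_
        filter_upwards [eventually_ge_atTop t] with s hs using hb s hs
      exact ⟨key h2.1 fun s hs => (h1 s ht hs).1, key h2.2 fun s hs => (h1 s ht hs).2⟩
    have dψ1 : ContinuousAt (fun S => ψ1 (γ S) t) S0 :=
      ContinuousAt.comp (f := γ) (g := fun l => ψ1 l t)
        ((h.diff1 t ht).differentiableAt (isOpen_UHP.mem_nhds (hγU hn))).continuousAt (hγc hn)
    have dψ2 : ContinuousAt (fun S => ψ2 (γ S) t) S0 :=
      ContinuousAt.comp (f := γ) (g := fun l => ψ2 l t)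
        ((h.diff2 t ht).differentiableAt (isOpen_UHP.mem_nhds (hγU hn))).continuousAt (hγc hn)
    have dm : ContinuousAt (fun S => bgM α ω c (γ S)) S0 :=
      differentiable_bgM.continuous.continuousAt.comp (hγc hn)
    have dβ : ContinuousAt (fun S => bgβ α c (γ S)) S0 :=
      differentiable_bgβ.continuous.continuousAt.comp (hγc hn)
    have dγ : ContinuousAt (fun S => bgγ α c (γ S)) S0 :=
      differentiable_bgγ.continuous.continuousAt.comp (hγc hn)
    have dexp : ContinuousAt (fun S : ℂ => exp (-S * t)) S0 := by fun_prop
    have hexp : ‖exp (-S0 * t)‖ = 1 := by rw [norm_exp]; simp [hre]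
    have l1 := le_of_tendsto ((dexp.mul (((continuousAt_id.sub dm).mul dψ1).add
      (dβ.mul dψ2))).norm.tendsto.mono_left nhdsWithin_le_nhds) (hbound.mono fun S hS => hS.1)
    have l2 := le_of_tendsto ((dexp.mul ((dγ.mul dψ1).add
      ((continuousAt_id.add dm).mul dψ2))).norm.tendsto.mono_left nhdsWithin_le_nhds)
      (hbound.mono fun S hS => hS.2)
    simp only [Pi.mul_apply, norm_mul, hexp, one_mul] at l1 l2
    exact ⟨l1, l2⟩
  set σ := √r / 2 with hσ
  have hσ0 : 0 < σ := by positivity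
  set S0 : ℂ := σ * I with hS₀
  have hS0n : ‖S0‖ = σ := by rw [hS₀, norm_mul, norm_I, mul_one, norm_real,
    Real.norm_eq_abs, abs_of_pos hσ0]
  have hS00 : S0 ≠ 0 := norm_pos_iff.1 (by rw [hS0n]; exact hσ0)
  have hS0re : S0.re = 0 := by simp [hS₀]
  have hlt : ‖S0‖ < √r := by rw [hS0n, hσ]; linarith
  have hγneg : γ (-S0) = γ S0 := by simp only [hγ, neg_sq]
  obtain ⟨C1, hC₁, b₁, low⟩ := hside S0 hS00 hS0re hlt
  obtain ⟨C2, hC₂, b₂, -⟩ := hside (-S0) (neg_ne_zero.2 hS00) (by simp [hS0re]) (by rwa [norm_neg])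
  rw [hγneg] at b₂
  set l := γ S0 with hl
  have hdec : ∀ t, T ≤ t → ‖ψ1 l t‖ ≤ (C1 + C2) / (2 * σ) / t ∧
      ‖ψ2 l t‖ ≤ (C1 + C2) / (2 * σ) / t := by
    intro t ht
    have hto := h.T_pos.trans_le ht
    obtain ⟨i1, i2⟩ := grow_identities α ω c l S0 (ψ1 l t) (ψ2 l t)
    have key : ∀ x y z : ℂ, x - y = 2 * S0 * z → ‖x‖ ≤ C1 / t → ‖y‖ ≤ C2 / t →
        ‖z‖ ≤ (C1 + C2) / (2 * σ) / t := by
      intro x y z hxy hx hy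
      have h1 := norm_sub_le x y
      rw [hxy, norm_mul, norm_mul, norm_ofNat, hS0n] at h1
      rw [le_div_iff₀ hto, le_div_iff₀ (by positivity)]
      have h2 : 2 * σ * ‖z‖ ≤ (C1 + C2) / t := by rw [add_div]; linarith
      rw [le_div_iff₀ hto] at h2
      linarith
    exact ⟨key _ _ _ i1 (b₁ t ht).1 (b₂ t ht).1, key _ _ _ i2 (b₁ t ht).2 (b₂ t ht).2⟩
  set Y := (C1 + C2) / (2 * σ) with hY
  have hY0 : 0 ≤ Y := by positivity
  have hlimY : Tendsto (fun t : ℝ => C1 * ((Y / t) ^ 2 + (Y / t) ^ 2)) atTop (𝓝 0) := by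
    have h1 : Tendsto (fun t : ℝ => Y / t) atTop (𝓝 0) := tendsto_const_nhds.div_atTop tendsto_id
    simpa using ((h1.pow 2).add (h1.pow 2)).const_mul C1
  have hfin : ‖ψ1 l T‖ ^ 2 + ‖ψ2 l T‖ ^ 2 ≤ 0 := by
    refine ge_of_tendsto hlimY ?_
    filter_upwards [eventually_ge_atTop T] with t ht
    have hto := h.T_pos.trans_le ht
    refine (low t ht).trans ?_
    obtain ⟨d1, d2⟩ := hdec t ht
    gcongr
  have p1 := sq_nonneg ‖ψ1 l T‖
  have p2 := sq_nonneg ‖ψ2 l T‖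
  exact h.ne_zero l (hγU hlt) T le_rfl
    ⟨norm_eq_zero.1 (pow_eq_zero_iff two_ne_zero |>.1 (by linarith)),
    norm_eq_zero.1 (pow_eq_zero_iff two_ne_zero |>.1 (by linarith))⟩

end

section

variable {α ω : ℝ} {c : ℂ} {T K m F : ℝ} {u w : ℝ → ℂ} {ψ1 ψ2 : ℂ → ℝ → ℂ}

/-- The linear coefficient of the determinant. -/
def bgB (α ω : ℝ) (c : ℂ) : ℝ := α ^ 2 * ω - α ^ 6 / 2 - 2 * α ^ 3 * c.im - ‖c‖ ^ 2

/-- The square root of the constant coefficient of the determinant. -/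
def bgE (α ω : ℝ) (c : ℂ) : ℝ := ω / 2 - α ^ 4 / 4 - α * c.im

lemma bgP_eq_sub (l : ℂ) : bgP α ω c l = (2 * l ^ 2 + α ^ 2 * l + bgE α ω c) ^ 2 -
    l * (4 * α ^ 2 * l ^ 2 - 4 * α * c.im * l + (‖c‖ : ℂ) ^ 2) := by
  have h1 : c * conj c = (‖c‖ : ℂ) ^ 2 := by rw [mul_conj, normSq_eq_norm_sq]; push_cast; ring
  have h2 : c - conj c = 2 * c.im * I := by rw [Complex.sub_conj]; push_cast; ring
  have hm : bgM α ω c l = I * (2 * l ^ 2 + α ^ 2 * l + bgE α ω c) := by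
    simp only [bgM, bdB22, bgE, conj_ofReal]
    push_cast
    linear_combination (-(1 : ℂ) / 2 * α) * h2
  have hβγ : bgβ α c l * bgγ α c l = l * (4 * α ^ 2 * l ^ 2 - 4 * α * c.im * l + (‖c‖ : ℂ) ^ 2) := by
    simp only [bgβ, bgγ, bdB12, bdB21, conj_ofReal]
    linear_combination l * h1 + 2 * I * α * l ^ 2 * h2 -
      (l * (c * conj c) - 4 * α * c.im * l ^ 2) * I_sq
  rw [bgP, hm, hβγ]
  linear_combination -(2 * l ^ 2 + α ^ 2 * l + bgE α ω c) ^ 2 * I_sq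

lemma bgP_eq (l : ℂ) : bgP α ω c l = 4 * l ^ 4 + 2 * ω * l ^ 2 + bgB α ω c * l + bgE α ω c ^ 2 := by
  rw [bgP_eq_sub]
  have h1 : (bgB α ω c : ℂ) = 2 * α ^ 2 * bgE α ω c - (‖c‖ : ℂ) ^ 2 := by
    simp only [bgB, bgE]; push_cast; ring
  rw [h1]
  have h2 : (bgE α ω c : ℂ) = ω / 2 - α ^ 4 / 4 - α * c.im := by simp only [bgE]; push_cast; ring
  linear_combination 4 * l ^ 2 * h2

/-- The determinant is nonnegative on the negative half line. -/
lemma bgP_nonneg {s : ℝ} (hs : s ≤ 0) :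
    0 ≤ 4 * s ^ 4 + 2 * ω * s ^ 2 + bgB α ω c * s + bgE α ω c ^ 2 := by
  have e : 4 * s ^ 4 + 2 * ω * s ^ 2 + bgB α ω c * s + bgE α ω c ^ 2 =
      (2 * s ^ 2 + α ^ 2 * s + bgE α ω c) ^ 2 -
      s * ((2 * α * s - c.im) ^ 2 + c.re ^ 2) := by
    have h1 : ‖c‖ ^ 2 = c.re ^ 2 + c.im ^ 2 := by rw [← normSq_eq_norm_sq, normSq_apply]; ring
    simp only [bgB, bgE, h1]; ring
  rw [e]
  nlinarith [sq_nonneg (2 * s ^ 2 + α ^ 2 * s + bgE α ω c),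
    mul_nonneg (neg_nonneg.2 hs) (add_nonneg (sq_nonneg (2 * α * s - c.im)) (sq_nonneg c.re))]

lemma mem_growthDomain_of_im_ne {l : ℂ} (hl : 0 < l.im) (hP : (bgP α ω c l).im ≠ 0) :
    l ∈ growthDomain α ω c :=
  ⟨hl, by
    change -bgP α ω c l ∈ slitPlane
    rw [mem_slitPlane_iff, neg_im]
    exact Or.inr (neg_ne_zero.2 hP)⟩

lemma mem_closure_of_segment {V : Set ℂ} {z v : ℂ} {δ : ℝ} (hδ : 0 < δ)
    (h : ∀ ε : ℝ, 0 < ε → ε < δ → z + ε * v ∈ V) : z ∈ closure V := by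
  have h1 : Tendsto (fun ε : ℝ => z + ε * v) (𝓝[>] 0) (𝓝 z) := by
    have : Continuous fun ε : ℝ => z + ε * v := by fun_prop
    simpa using (this.tendsto 0).mono_left nhdsWithin_le_nhds
  refine mem_closure_of_tendsto h1 ?_
  filter_upwards [Ioo_mem_nhdsGT hδ] with ε hε using h ε hε.1 hε.2

lemma norm_le_re_add_im {l : ℂ} (h1 : 0 ≤ l.re) (h2 : 0 ≤ l.im) : ‖l‖ ≤ l.re + l.im := by
  have := Complex.norm_le_abs_re_add_abs_im l
  rwa [abs_of_nonneg h1, abs_of_nonneg h2] at this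

lemma isPreconnected_above (ω : ℝ) :
    IsPreconnected {l : ℂ | 0 < l.re ∧ 0 < l.im ∧ l.re ^ 2 + ω / 4 < l.im ^ 2} := by
  have hc : Convex ℝ (Ioi (0 : ℝ) ×ˢ Ioi (0 : ℝ)) := (convex_Ioi 0).prod (convex_Ioi 0)
  have hf : Continuous fun p : ℝ × ℝ =>
      (p.1 : ℂ) + √(max (p.1 ^ 2 + ω / 4) 0 + p.2) * I := by fun_prop
  have := hc.isPreconnected.image _ hf.continuousOn
  convert this using 1
  ext l
  constructor
  · rintro ⟨h1, h2, h3⟩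
    refine ⟨(l.re, l.im ^ 2 - max (l.re ^ 2 + ω / 4) 0), ⟨h1, ?_⟩, ?_⟩
    · simp only [mem_Ioi, sub_pos, max_lt_iff]
      exact ⟨h3, by positivity⟩
    · simp only [add_sub_cancel, Real.sqrt_sq h2.le]
      exact Complex.re_add_im l
  · rintro ⟨⟨ξ, s⟩, ⟨h1, h2⟩, rfl⟩
    simp only [mem_Ioi] at h1 h2
    have h4 : 0 < max (ξ ^ 2 + ω / 4) 0 + s := add_pos_of_nonneg_of_pos (le_max_right _ _) h2
    have h5 := le_max_left (ξ ^ 2 + ω / 4) 0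
    simp only [mem_ofPred_eq, add_re, ofReal_re, re_ofReal_mul, I_re,
      mul_zero, add_zero, add_im, ofReal_im, im_ofReal_mul, I_im,
      mul_one, zero_add, Real.sq_sqrt h4.le]
    exact ⟨h1, Real.sqrt_pos.2 h4, by linarith⟩

/-- The biquadratic case. -/
theorem AsymptoticLax.biquadratic (h : AsymptoticLax α ω c T K m F u w ψ1 ψ2)
    (hB : bgB α ω c = 0) : 4 * bgE α ω c ^ 2 = ω ^ 2 := by
  by_contra hne
  set E := bgE α ω c with hE
  have hPl : ∀ l, bgP α ω c l = 4 * (l ^ 2 + ω / 4) ^ 2 - (ω ^ 2 - 4 * E ^ 2 : ℝ) / 4 := by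
    intro l
    rw [bgP_eq, hB]; push_cast; ring
  have hPd : ∀ l, HasDerivAt (bgP α ω c) (16 * l * (l ^ 2 + ω / 4)) l := by
    intro l
    have h1 : HasDerivAt (fun l : ℂ => 4 * (l ^ 2 + ω / 4) ^ 2 - (ω ^ 2 - 4 * E ^ 2 : ℝ) / 4)
        (4 * (2 * (l ^ 2 + ω / 4) * (2 * l))) l := by
      have := ((((hasDerivAt_pow 2 l).add_const ((ω : ℂ) / 4)).fun_pow 2).const_mul 4).sub_const
        (((ω ^ 2 - 4 * E ^ 2 : ℝ) : ℂ) / 4)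
      refine this.congr_deriv ?_
      push_cast; ring
    rw [funext hPl]
    exact h1.congr_deriv (by ring)
  set V := {l : ℂ | 0 < l.re ∧ 0 < l.im ∧ l.re ^ 2 + ω / 4 < l.im ^ 2} with hV
  have hVΩ : V ⊆ growthDomain α ω c := by
    rintro l ⟨h1, h2, h3⟩
    refine mem_growthDomain_of_im_ne h2 ?_
    have e : (bgP α ω c l).im = 16 * (l.re * l.im) * (l.re ^ 2 - l.im ^ 2 + ω / 4) := by
      rw [hPl]
      have h4 : (((ω ^ 2 - 4 * E ^ 2 : ℝ) : ℂ) / 4).im = 0 := by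
        rw [show (((ω ^ 2 - 4 * E ^ 2 : ℝ) : ℂ) / 4) = ((ω ^ 2 - 4 * E ^ 2) / 4 : ℝ) by push_cast; ring]
        exact ofReal_im _
      have h5 : ((ω : ℂ) / 4) = ((ω / 4 : ℝ) : ℂ) := by push_cast; ring
      rw [sub_im, h4, h5]
      simp only [pow_two, mul_im, mul_re, add_re, add_im, ofReal_re, ofReal_im, re_ofNat, im_ofNat]
      ring
    rw [e]
    have : 0 < l.re * l.im := by positivity
    have h5 : l.re ^ 2 - l.im ^ 2 + ω / 4 < 0 := by linarith
    exact mul_ne_zero (by positivity) h5.ne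
  have hbdd : ∀ κ : ℝ, ∃ l ∈ V, κ * ‖l‖ < l.re * l.im ^ 2 := by
    intro κ
    set ξ := 2 * |κ| + 1 with hξ
    set η := ξ + |ω| + 1 with hη
    have p1 := abs_nonneg κ
    have p2 := abs_nonneg ω
    have hη1 : 1 ≤ η := by linarith
    refine ⟨⟨ξ, η⟩, ⟨by change 0 < ξ; linarith, by change 0 < η; linarith, ?_⟩, ?_⟩
    · change ξ ^ 2 + ω / 4 < η ^ 2
      rw [hη]
      nlinarith [le_abs_self ω, mul_nonneg p2 p2, mul_nonneg (by linarith : 0 ≤ ξ) p2]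
    · have h1 := norm_le_re_add_im (l := ⟨ξ, η⟩) (by change 0 ≤ ξ; linarith)
        (by change 0 ≤ η; linarith)
      change κ * ‖(⟨ξ, η⟩ : ℂ)‖ < ξ * η ^ 2
      change ‖(⟨ξ, η⟩ : ℂ)‖ ≤ ξ + η at h1
      calc κ * ‖(⟨ξ, η⟩ : ℂ)‖ ≤ |κ| * (ξ + η) := by
            refine (mul_le_mul_of_nonneg_right (le_abs_self κ) (norm_nonneg _)).trans ?_
            gcongr
        _ ≤ |κ| * (2 * η) := by gcongr; linarith
        _ < ξ * η := by nlinarith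
        _ ≤ ξ * η ^ 2 := by (gcongr; nlinarith)
  rcases lt_or_gt_of_ne hne with hlt | hgt
  · -- two negative roots
    have hω2 : 0 < ω ^ 2 := lt_of_le_of_lt (by positivity) hlt
    rcases le_or_gt ω 0 with hω | hω
    · have h1 := bgP_nonneg (α := α) (ω := ω) (c := c) (s := -√(-ω / 4))
        (neg_nonpos.2 (Real.sqrt_nonneg _))
      have h2 : √(-ω / 4) ^ 2 = -ω / 4 := Real.sq_sqrt (by linarith)
      rw [hB, ← hE] at h1
      have h3 : (-√(-ω / 4)) ^ 4 = (√(-ω / 4) ^ 2) ^ 2 := by ring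
      rw [h3, neg_sq, h2] at h1
      nlinarith
    · set d := √(ω ^ 2 - 4 * E ^ 2) / 4 with hd
      have hd0 : 0 < d := by have := Real.sqrt_pos.2 (sub_pos.2 hlt); positivity
      have hd2 : 16 * d ^ 2 = ω ^ 2 - 4 * E ^ 2 := by
        rw [hd, div_pow, Real.sq_sqrt (by linarith)]; ring
      set n := √(d + ω / 4) with hn
      have hn0 : 0 < n := Real.sqrt_pos.2 (by positivity)
      have hn2 : n ^ 2 = d + ω / 4 := Real.sq_sqrt (by positivity)
      have hz2 : ((n : ℂ) * I) ^ 2 + ω / 4 = -d := by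
        have h1 : ((n : ℂ)) ^ 2 = d + ω / 4 := by exact_mod_cast hn2
        rw [mul_pow, I_sq, h1]; ring
      refine h.no_simple_zero (isPreconnected_above ω) hVΩ hbdd (z := n * I)
        (mem_closure_of_segment (v := 1) (δ := min 1 d) (by positivity) fun ε h1 h2 => ?_) ?_ ?_
        (hPd _) ?_
      · refine ⟨by simpa using h1, by simpa using hn0, ?_⟩
        have h3 : ε < 1 := h2.trans_le (min_le_left _ _)
        have h4 : ε < d := h2.trans_le (min_le_right _ _)
        simp only [mul_one, add_re, mul_re, ofReal_re, I_re,
          mul_zero, ofReal_im, I_im, sub_self, zero_add, add_im,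
          mul_im, add_zero, hn2]
        nlinarith
      · change 0 < ((n : ℂ) * I).im
        simpa using hn0
      · rw [hPl, hz2, ← hd2]; push_cast; ring
      · rw [hz2]
        have h1 : (n : ℂ) ≠ 0 := by exact_mod_cast hn0.ne'
        have h2 : (d : ℂ) ≠ 0 := by exact_mod_cast hd0.ne'
        exact mul_ne_zero (mul_ne_zero (by norm_num) (mul_ne_zero h1 I_ne_zero)) (neg_ne_zero.2 h2)
  · set d := √(4 * E ^ 2 - ω ^ 2) / 4 with hd
    have hd0 : 0 < d := by have := Real.sqrt_pos.2 (sub_pos.2 hgt); positivity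
    have hd2 : 16 * d ^ 2 = 4 * E ^ 2 - ω ^ 2 := by
      rw [hd, div_pow, Real.sq_sqrt (by linarith)]; ring
    set μ : ℂ := ⟨-(ω / 4), d⟩ with hμ
    set z := csqrt μ with hz
    have hzμ : z ^ 2 = μ := csqrt_sq μ
    have hre : 0 < z.re := csqrt_re_pos (mem_slitPlane_iff.2 (Or.inr hd0.ne'))
    have hz_im : 2 * (z.re * z.im) = d := by
      have := congrArg Complex.im hzμ
      rw [pow_two, mul_im] at this
      change z.re * z.im + z.im * z.re = d at this
      linarith
    have hz_re : z.re ^ 2 - z.im ^ 2 = -(ω / 4) := by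
      have := congrArg Complex.re hzμ
      rw [pow_two, mul_re] at this
      change z.re * z.re - z.im * z.im = -(ω / 4) at this
      linarith
    have him : 0 < z.im := by
      by_contra hc
      push Not at hc
      nlinarith
    have hν : z ^ 2 + ω / 4 = d * I := by
      rw [hzμ]
      apply Complex.ext
      · have h5 : ((ω : ℂ) / 4) = ((ω / 4 : ℝ) : ℂ) := by push_cast; ring
        rw [h5]; simp [hμ]
      · have h5 : ((ω : ℂ) / 4) = ((ω / 4 : ℝ) : ℂ) := by push_cast; ring
        rw [h5]; simp [hμ]
    refine h.no_simple_zero (isPreconnected_above ω) hVΩ hbdd (z := z)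
      (mem_closure_of_segment (v := I) one_pos fun ε h1 _ => ?_) him ?_ (hPd _) ?_
    · refine ⟨by simpa using hre, by simp; linarith, ?_⟩
      simp only [add_re, re_ofReal_mul, I_re, mul_zero, add_zero,
        add_im, im_ofReal_mul, I_im, mul_one]
      nlinarith
    · rw [hPl, hν, mul_pow, I_sq]
      have : ((ω ^ 2 - 4 * E ^ 2 : ℝ) : ℂ) = -(16 * (d : ℂ) ^ 2) := by
        rw [show ω ^ 2 - 4 * E ^ 2 = -(16 * d ^ 2) by linarith]; push_cast; ring
      rw [this]; ring
    · rw [hν]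
      have h1 : z ≠ 0 := by intro h0; rw [h0] at hre; exact lt_irrefl _ hre
      have h2 : (d : ℂ) ≠ 0 := by exact_mod_cast hd0.ne'
      exact mul_ne_zero (mul_ne_zero (by norm_num) h1) (mul_ne_zero h2 I_ne_zero)

end

section

variable {α ω : ℝ} {c : ℂ} {T K m F : ℝ} {u w : ℝ → ℂ} {ψ1 ψ2 : ℂ → ℝ → ℂ}

lemma im_factored (p n l : ℂ) (hp : p.im = 0) (hn : n.im = 0) :
    (4 * (l - p) ^ 2 * ((l + p) ^ 2 + n)).im =
      8 * l.im * ((l.re - p.re) * (2 * l.re * (l.re + p.re) + n.re) - 2 * l.re * l.im ^ 2) := by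
  simp only [pow_two, mul_im, mul_re, add_re, add_im, sub_re, sub_im, re_ofNat, im_ofNat, hp, hn]
  ring

/-- A curve over a real interval. -/
lemma isPreconnected_curve {s : Set ℝ} (hs : Convex ℝ s) {f g : ℝ → ℝ} (hf : Continuous f)
    (hg : Continuous g) : IsPreconnected ((fun x => (⟨f x, g x⟩ : ℂ)) '' s) := by
  have : Continuous fun x => (⟨f x, g x⟩ : ℂ) :=
    Complex.equivRealProdCLM.symm.continuous.comp (hf.prodMk hg)
  exact hs.isPreconnected.image _ this.continuousOn

/-- A ray along which the frame becomes bounded. -/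
lemma exists_far_point {b : ℝ} (hb : 0 < b) (κ k x0 : ℝ) : ∃ x : ℝ, x0 ≤ x ∧ 0 < x ∧ 0 < b * x + k ∧
      κ * ‖(⟨x, b * x + k⟩ : ℂ)‖ < x * (b * x + k) ^ 2 := by
  set M := |κ| with hM
  have hM0 : 0 ≤ M := abs_nonneg κ
  set x := |x0| + 1 + (|k| + 1 + (M + 1)) * (1 / b) + 2 * M with hx
  have h1 : 0 ≤ (|k| + 1 + (M + 1)) * (1 / b) := by positivity
  have h0 := abs_nonneg x0
  have hx1 : 2 * M + 1 ≤ x := by linarith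
  have hbx : |k| + 1 + (M + 1) ≤ b * x := by
    have h2 : b * ((|k| + 1 + (M + 1)) * (1 / b)) = |k| + 1 + (M + 1) := by field_simp
    have h3 : (|k| + 1 + (M + 1)) * (1 / b) ≤ x := by linarith
    calc _ = b * ((|k| + 1 + (M + 1)) * (1 / b)) := h2.symm
      _ ≤ b * x := by gcongr
  set y := b * x + k with hy
  have hyM : M + 1 + 1 ≤ y := by linarith [neg_abs_le k]
  refine ⟨x, by linarith [le_abs_self x0], by linarith, by linarith, ?_⟩
  have h4 := norm_le_re_add_im (l := ⟨x, y⟩) (by change 0 ≤ x; linarith) (by change 0 ≤ y; linarith)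
  change ‖(⟨x, y⟩ : ℂ)‖ ≤ x + y at h4
  calc κ * ‖(⟨x, y⟩ : ℂ)‖ ≤ M * (x + y) := by
        refine (mul_le_mul_of_nonneg_right (le_abs_self κ) (norm_nonneg _)).trans ?_
        gcongr
    _ < x * y ^ 2 := by
        have h5 : M * x ≤ (y - 2) * x := by nlinarith
        have h6 : M * y ≤ (x - 1) * y / 2 := by nlinarith
        have h7 : 0 < x * y := by
          have : 0 < x := by linarith
          have : 0 < y := by linarith
          positivity
        nlinarith

/-- The case of a real double root `p` together with a pair of complex roots `-p ± i n`. -/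
theorem AsymptoticLax.double_root (h : AsymptoticLax α ω c T K m F u w ψ1 ψ2)
    {p n : ℝ} (hn : 0 < n) (hP : ∀ l, bgP α ω c l = 4 * (l - p) ^ 2 * ((l + p) ^ 2 + (n ^ 2 : ℝ))) :
    0 < p ∧ 2 * n ^ 2 ≤ p ^ 2 ∨ p = 0 := by
  have hgd : ∀ x y : ℝ, 0 < y → (x - p) * (2 * x * (x + p) + n ^ 2) - 2 * x * y ^ 2 ≠ 0 →
      (⟨x, y⟩ : ℂ) ∈ growthDomain α ω c := by
    intro x y hy hne
    refine mem_growthDomain_of_im_ne (l := ⟨x, y⟩) hy ?_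
    rw [hP, im_factored _ _ _ (ofReal_im _) (ofReal_im _)]
    exact mul_ne_zero (mul_ne_zero (by norm_num) hy.ne') hne
  set z : ℂ := ⟨-p, n⟩ with hz
  have hzp : z + p = n * I := by apply Complex.ext <;> simp [hz]
  have hPz : bgP α ω c z = 0 := by rw [hP, hzp, mul_pow, I_sq]; push_cast; ring
  have hPd : HasDerivAt (bgP α ω c) (8 * (z - p) ^ 2 * (n * I)) z := by
    rw [funext hP]
    have h1 := ((((hasDerivAt_id z).sub_const (p : ℂ)).fun_pow 2).const_mul 4).fun_mul
      ((((hasDerivAt_id z).add_const (p : ℂ)).fun_pow 2).add_const (((n ^ 2 : ℝ) : ℂ)))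
    refine h1.congr_deriv ?_
    simp only [id, hzp]
    push_cast
    linear_combination 4 * (2 * (z - p)) * (n : ℂ) ^ 2 * I_sq
  have hn0 : (n : ℂ) ≠ 0 := by exact_mod_cast hn.ne'
  have hPd0 : 8 * (z - p) ^ 2 * (n * I) ≠ 0 := by
    refine mul_ne_zero (mul_ne_zero (by norm_num) (pow_ne_zero 2 ?_)) (mul_ne_zero hn0 I_ne_zero)
    intro h0
    have := congrArg Complex.im h0
    simp [hz] at this
    exact hn.ne' this
  have hzU : z ∈ UHP := hn
  -- the vertical segment below the simple root
  set A := (fun y => (⟨-p, y⟩ : ℂ)) '' Ioo 0 n with hA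
  have hAc : IsPreconnected A := isPreconnected_curve (convex_Ioo 0 n) continuous_const continuous_id
  have hzA : z ∈ closure A := by
    refine mem_closure_of_segment (v := -I) hn fun ε h1 h2 =>
      ⟨n - ε, ⟨by linarith, by linarith⟩, ?_⟩
    apply Complex.ext <;> simp [hz]; ring
  rcases lt_trichotomy p 0 with hp | hp | hp
  · exfalso
    have hAΩ : A ⊆ growthDomain α ω c := by
      rintro l ⟨y, hy, rfl⟩
      refine hgd _ _ hy.1 (ne_of_gt ?_)
      nlinarith [mul_pos (neg_pos.2 hp) (sub_pos.2 (pow_lt_pow_left₀ hy.2 hy.1.le two_ne_zero))]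
    set D := (fun x => (⟨x, 1 / 2 * x + (n / 2 + p / 2)⟩ : ℂ)) '' Ici (-p) with hD
    have hDc : IsPreconnected D := isPreconnected_curve (convex_Ici _) continuous_id (by fun_prop)
    have hDΩ : D ⊆ growthDomain α ω c := by
      rintro l ⟨x, hx, rfl⟩
      have hx' : -p ≤ x := hx
      obtain ⟨d, hd⟩ : ∃ d, d = x + p := ⟨_, rfl⟩
      have hd0 : 0 ≤ d := by linarith
      have hy : 1 / 2 * x + (n / 2 + p / 2) = (n + d) / 2 := by rw [hd]; ring
      simp only [hy]
      refine hgd _ _ (by positivity) (ne_of_gt ?_)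
      obtain ⟨r, hr⟩ : ∃ r, r = -p := ⟨_, rfl⟩
      have hr0 : 0 < r := by linarith
      have hxr : x = r + d := by rw [hr, hd]; ring
      have hpr : p = -r := by rw [hr]; ring
      rw [hxr, hpr]
      have h1 : ((n + d) / 2) ^ 2 ≤ (n ^ 2 + d ^ 2) / 2 := by nlinarith [sq_nonneg (n - d)]
      have h2 : 2 * (r + d) * ((n + d) / 2) ^ 2 ≤ 2 * (r + d) * ((n ^ 2 + d ^ 2) / 2) := by gcongr
      have h3 : 0 < r * n ^ 2 := by positivity
      have h4 : 0 ≤ (r + d) * d * (4 * r + d) := by positivity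
      nlinarith
    have hmid : (⟨-p, n / 2⟩ : ℂ) ∈ A := ⟨n / 2, ⟨by positivity, by linarith⟩, rfl⟩
    have hmid' : (⟨-p, n / 2⟩ : ℂ) ∈ D := ⟨-p, self_mem_Ici, by apply Complex.ext <;> simp; ring⟩
    refine h.no_simple_zero (hAc.union _ hmid hmid' hDc) (union_subset hAΩ hDΩ) (fun κ => ?_)
      (closure_mono subset_union_left hzA) hzU hPz hPd hPd0
    obtain ⟨x, h1, -, -, h4⟩ := exists_far_point (b := 1 / 2) (by norm_num) κ (n / 2 + p / 2) (-p)
    exact ⟨_, Or.inr ⟨x, h1, rfl⟩, h4⟩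
  · exact Or.inr hp
  · refine Or.inl ⟨hp, ?_⟩
    by_contra hlt
    push Not at hlt
    have hAΩ : A ⊆ growthDomain α ω c := by
      rintro l ⟨y, hy, rfl⟩
      refine hgd _ _ hy.1 (ne_of_lt ?_)
      nlinarith [mul_pos hp (sub_pos.2 (pow_lt_pow_left₀ hy.2 hy.1.le two_ne_zero))]
    set k := n ^ 2 - p ^ 2 / 2 with hk
    have hk0 : 0 < k := by linarith
    set y0 := √k / 2 with hy₀
    have hy00 : 0 < y0 := by have := Real.sqrt_pos.2 hk0; positivity
    have hy02 : y0 ^ 2 = k / 4 := by rw [hy₀, div_pow, Real.sq_sqrt hk0.le]; norm_num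
    have hy0n : y0 < n := by
      refine lt_of_pow_lt_pow_left₀ 2 hn.le ?_
      rw [hy02, hk]; nlinarith [sq_nonneg p]
    set B := (fun x => (⟨x, y0⟩ : ℂ)) '' Icc (-p) 0 with hB
    have hBc : IsPreconnected B :=
      isPreconnected_curve (convex_Icc _ _) continuous_id continuous_const
    have hBΩ : B ⊆ growthDomain α ω c := by
      rintro l ⟨x, hx, rfl⟩
      refine hgd _ _ hy00 (ne_of_lt ?_)
      obtain ⟨s, hs⟩ : ∃ s, s = -x := ⟨_, rfl⟩
      have hs0 : 0 ≤ s := by linarith [hx.2]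
      have hsp : s ≤ p := by linarith [hx.1]
      have hxs : x = -s := by rw [hs]; ring
      rw [hxs, hy02]
      have h1 : k ≤ n ^ 2 - 2 * s * (p - s) := by rw [hk]; nlinarith [sq_nonneg (p - 2 * s)]
      have h2 : (s + p) * k ≤ (s + p) * (n ^ 2 - 2 * s * (p - s)) := by gcongr
      nlinarith [mul_pos hp hk0, mul_nonneg hs0 hk0.le]
    set C := (fun y => (⟨0, y⟩ : ℂ)) '' Ioi 0 with hC
    have hCc : IsPreconnected C := isPreconnected_curve (convex_Ioi _) continuous_const continuous_id
    have hCΩ : C ⊆ growthDomain α ω c := by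
      rintro l ⟨y, hy, rfl⟩
      refine hgd _ _ hy (ne_of_lt ?_)
      have : 0 < p * n ^ 2 := by positivity
      linarith
    set D := (fun x => (⟨x, 1 * x + (n + 1)⟩ : ℂ)) '' Ici 0 with hD
    have hDc : IsPreconnected D := isPreconnected_curve (convex_Ici _) continuous_id (by fun_prop)
    have hDΩ : D ⊆ growthDomain α ω c := by
      rintro l ⟨x, hx, rfl⟩
      have hx' : 0 ≤ x := hx
      refine hgd _ _ (by positivity) (ne_of_lt ?_)
      have h1 : 0 < p * n ^ 2 := by positivity
      have h2 : 0 ≤ x * p ^ 2 := by positivity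
      have h3 : 0 ≤ x ^ 2 * (n + 1) := by positivity
      have h4 : 0 ≤ x * (n ^ 2 + 4 * n + 2) := by positivity
      nlinarith
    have m1 : (⟨-p, y0⟩ : ℂ) ∈ A := ⟨y0, ⟨hy00, hy0n⟩, rfl⟩
    have m2 : (⟨-p, y0⟩ : ℂ) ∈ B := ⟨-p, ⟨le_rfl, by linarith⟩, rfl⟩
    have m3 : (⟨0, y0⟩ : ℂ) ∈ B := ⟨0, ⟨by linarith, le_rfl⟩, rfl⟩
    have m4 : (⟨0, y0⟩ : ℂ) ∈ C := ⟨y0, hy00, rfl⟩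
    have m5 : (⟨0, n + 1⟩ : ℂ) ∈ C := ⟨n + 1, by simp only [mem_Ioi]; linarith, rfl⟩
    have m6 : (⟨0, n + 1⟩ : ℂ) ∈ D := ⟨0, self_mem_Ici, by apply Complex.ext <;> simp⟩
    have hAB := hAc.union _ m1 m2 hBc
    have hABC := hAB.union _ (mem_union_right _ m3) m4 hCc
    have hABCD := hABC.union _ (mem_union_right _ m5) m6 hDc
    refine h.no_simple_zero hABCD
      (union_subset (union_subset (union_subset hAΩ hBΩ) hCΩ) hDΩ) (fun κ => ?_)
      (closure_mono (subset_union_left.trans (subset_union_left.trans subset_union_left)) hzA)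
      hzU hPz hPd hPd0
    obtain ⟨x, h1, -, -, h4⟩ := exists_far_point one_pos κ (n + 1) 0
    exact ⟨_, Or.inr ⟨x, h1, rfl⟩, h4⟩

end

section

variable {α ω : ℝ} {c : ℂ}

lemma case_biquadratic (hα : 0 < α)
    (hB : α ^ 6 - 2 * α ^ 2 * ω + 2 * ‖c‖ ^ 2 + 4 * α ^ 3 * c.im = 0)
    (hE : 4 * bgE α ω c ^ 2 = ω ^ 2) :
    (α ^ 4 / 16 ≤ ω ∧ (c = ((α * √(ω - α ^ 4 / 16) : ℝ) : ℂ) - ((α ^ 3 / 4 : ℝ) : ℂ) * I ∨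
       c = -((α * √(ω - α ^ 4 / 16) : ℝ) : ℂ) - ((α ^ 3 / 4 : ℝ) : ℂ) * I)) ∨
    (ω = -(α ^ 4 / 4) ∧ c = -((α ^ 3 / 2 : ℝ) : ℂ) * I) := by
  have hc : ‖c‖ ^ 2 = c.re ^ 2 + c.im ^ 2 := by rw [← normSq_eq_norm_sq, normSq_apply]; ring
  rw [hc] at hB
  have hfac : (2 * bgE α ω c - ω) * (2 * bgE α ω c + ω) = 0 := by linear_combination hE
  rcases mul_eq_zero.1 hfac with h | h
  · left
    have him : c.im = -(α ^ 3 / 4) := by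
      rw [bgE] at h
      have h1 : α * (c.im + α ^ 3 / 4) = 0 := by linear_combination -(1 / 2) * h
      have h2 := (mul_eq_zero.1 h1).resolve_left hα.ne'
      linarith
    have hre : c.re ^ 2 = α ^ 2 * (ω - α ^ 4 / 16) := by
      rw [him] at hB
      linear_combination (1 / 2) * hB
    have hω : 0 ≤ ω - α ^ 4 / 16 := by
      by_contra hneg
      push Not at hneg
      nlinarith [sq_nonneg c.re, mul_pos (pow_pos hα 2) (neg_pos.2 hneg)]
    refine ⟨by linarith, ?_⟩
    have hsq : c.re ^ 2 = (α * √(ω - α ^ 4 / 16)) ^ 2 := by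
      rw [mul_pow, Real.sq_sqrt hω, hre]
    rcases sq_eq_sq_iff_eq_or_eq_neg.1 hsq with h1 | h1
    · left
      rw [← h1]
      apply Complex.ext <;> simp only [sub_re, sub_im, ofReal_re,
        ofReal_im, re_ofReal_mul, im_ofReal_mul, I_re,
        I_im] <;> linarith
    · right
      rw [← neg_eq_iff_eq_neg.2 h1]
      apply Complex.ext <;> simp only [sub_re, sub_im, neg_re,
        neg_im, ofReal_re, ofReal_im, re_ofReal_mul,
        im_ofReal_mul, I_re, I_im] <;> linarith
  · right
    have him : α * c.im = ω - α ^ 4 / 4 := by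
      rw [bgE] at h
      linear_combination -(1 / 2) * h
    have hsum : (ω + α ^ 4 / 4) ^ 2 + (α * c.re) ^ 2 = 0 := by
      linear_combination (α ^ 2 / 2) * hB - (α * c.im + (ω - α ^ 4 / 4) + 2 * α ^ 4) * him
    have h1 : ω + α ^ 4 / 4 = 0 := by
      have := sq_nonneg (ω + α ^ 4 / 4)
      have := sq_nonneg (α * c.re)
      exact pow_eq_zero_iff two_ne_zero |>.1 (by linarith)
    have h2 : α * c.re = 0 := by
      have := sq_nonneg (ω + α ^ 4 / 4)
      have := sq_nonneg (α * c.re)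
      exact pow_eq_zero_iff two_ne_zero |>.1 (by linarith)
    have hre := (mul_eq_zero.1 h2).resolve_left hα.ne'
    have him' : c.im = -(α ^ 3 / 2) := by
      have h3 : α * (c.im + α ^ 3 / 2) = 0 := by linear_combination him + h1
      linarith [(mul_eq_zero.1 h3).resolve_left hα.ne']
    refine ⟨by linarith, ?_⟩
    apply Complex.ext <;> simp only [neg_re, neg_im, neg_mul,
      re_ofReal_mul, im_ofReal_mul, I_re, I_im] <;> linarith

theorem AsymptoticLax.case_double_root {T K m F : ℝ} {u w : ℝ → ℂ} {ψ1 ψ2 : ℂ → ℝ → ℂ}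
    (h : AsymptoticLax α ω c T K m F u w ψ1 ψ2) (hα : 0 < α) (hre : c.re = 0)
    (hy : c.im ^ 2 + α ^ 2 * ω = α ^ 6 / 2 + α ^ 3 * c.im) :
    (ω ≤ -(α ^ 4 / 4) ∧ c = ((α * (α ^ 2 / 2 - √(3 * α ^ 4 / 4 - ω)) : ℝ) : ℂ) * I) ∨
    (ω ≤ -(1 / 2) * (6 * √6 + 15) * α ^ 4 ∧
      c = ((α * (α ^ 2 / 2 + √(3 * α ^ 4 / 4 - ω)) : ℝ) : ℂ) * I) := by
  obtain ⟨p, hp⟩ : ∃ p, c.im = 2 * α * p := ⟨c.im / (2 * α), by field_simp⟩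
  have hω : ω = α ^ 4 / 2 + 2 * α ^ 2 * p - 4 * p ^ 2 := by
    rw [hp] at hy
    have h1 : α ^ 2 * (ω - (α ^ 4 / 2 + 2 * α ^ 2 * p - 4 * p ^ 2)) = 0 := by linear_combination hy
    linarith [(mul_eq_zero.1 h1).resolve_left (pow_pos hα 2).ne']
  have hc : ‖c‖ ^ 2 = (2 * α * p) ^ 2 := by rw [← normSq_eq_norm_sq, normSq_apply, hre, hp]; ring
  have hB : bgB α ω c = -(8 * p * (α ^ 4 / 4 + α ^ 2 * p)) := by rw [bgB, hc, hp, hω]; ring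
  have hE : bgE α ω c = -(p * (α ^ 2 + 2 * p)) := by rw [bgE, hp, hω]; ring
  have hsqrt : 3 * α ^ 4 / 4 - ω = (2 * p - α ^ 2 / 2) ^ 2 := by rw [hω]; ring
  have hcI : ∀ s : ℝ, 2 * p = s → c = ((α * s : ℝ) : ℂ) * I := by
    intro s hs
    apply Complex.ext <;> simp only [re_ofReal_mul, im_ofReal_mul, I_re, I_im]
    · linarith
    · rw [hp, ← hs]; ring
  have hα2 : 0 < α ^ 2 := by positivity
  rw [hsqrt, Real.sqrt_sq_eq_abs]
  rcases le_or_gt (α ^ 2 / 4 + p) 0 with hle | hgt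
  · left
    refine ⟨?_, hcI _ ?_⟩
    · rw [hω]
      nlinarith [mul_nonneg_of_nonpos_of_nonpos hle (by linarith : p - 3 * α ^ 2 / 4 ≤ 0)]
    · rw [abs_of_nonpos (by linarith)]; ring
  · set n := √(α ^ 2 * (α ^ 2 / 4 + p)) with hn
    have hn0 : 0 < n := Real.sqrt_pos.2 (by positivity)
    have hn2 : n ^ 2 = α ^ 2 * (α ^ 2 / 4 + p) := Real.sq_sqrt (by positivity)
    have hP : ∀ l, bgP α ω c l = 4 * (l - p) ^ 2 * ((l + p) ^ 2 + (n ^ 2 : ℝ)) := by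
      intro l
      rw [bgP_eq, hB, hE, hn2, hω]
      push_cast
      ring
    rcases h.double_root hn0 hP with ⟨hp0, hpn⟩ | hp0
    · right
      rw [hn2] at hpn
      have h6 : √6 ^ 2 = 6 := Real.sq_sqrt (by norm_num)
      have h60 : 0 ≤ √6 := Real.sqrt_nonneg 6
      have hpl : α ^ 2 * (1 + √6 / 2) ≤ p := by
        by_contra hc
        push Not at hc
        have h1 : 0 < α ^ 2 * (1 + √6 / 2) - p := by linarith
        have h2 : 0 < p - α ^ 2 * (1 - √6 / 2) := by
          have : 2 < √6 := by rw [Real.lt_sqrt (by norm_num)]; norm_num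
          nlinarith
        nlinarith [mul_pos h1 h2]
      refine ⟨?_, hcI _ ?_⟩
      · rw [hω]
        have h1 : 0 ≤ p - α ^ 2 * (1 + √6 / 2) := by linarith
        have h2 : 0 ≤ p + α ^ 2 * (1 / 2 + √6 / 2) := by positivity
        nlinarith [mul_nonneg h1 h2]
      · rw [abs_of_nonneg (by nlinarith)]; ring
    · exfalso
      have h1 := h.biquadratic (by rw [hB, hp0]; ring)
      rw [hE, hω, hp0] at h1
      have : 0 < α ^ 4 := by positivity
      nlinarith

end

end GerdjikovIvanov

theorem theorem2p4 (α ω : ℝ) (c : ℂ) (hα : 0 < α) :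
    (IsGIAdmissible α ω c →
      α ^ 6 - 2 * α ^ 2 * ω + 2 * ‖c‖ ^ 2 + 4 * α ^ 3 * c.im = 0 →
      ((α ^ 4 / 16 ≤ ω ∧
          (c = ((α * Real.sqrt (ω - α ^ 4 / 16) : ℝ) : ℂ) - ((α ^ 3 / 4 : ℝ) : ℂ) * Complex.I ∨
           c = -((α * Real.sqrt (ω - α ^ 4 / 16) : ℝ) : ℂ)
                - ((α ^ 3 / 4 : ℝ) : ℂ) * Complex.I)) ∨
        (ω = -(α ^ 4 / 4) ∧ c = -((α ^ 3 / 2 : ℝ) : ℂ) * Complex.I))) ∧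
    (IsGIAdmissible α ω c →
      c.re = 0 → c.im ^ 2 + α ^ 2 * ω = α ^ 6 / 2 + α ^ 3 * c.im →
      ((ω ≤ -(α ^ 4 / 4) ∧
          c = ((α * (α ^ 2 / 2 - Real.sqrt (3 * α ^ 4 / 4 - ω)) : ℝ) : ℂ) * Complex.I) ∨
        (ω ≤ -(1 / 2) * (6 * Real.sqrt 6 + 15) * α ^ 4 ∧
          c = ((α * (α ^ 2 / 2 + Real.sqrt (3 * α ^ 4 / 4 - ω)) : ℝ) : ℂ) * Complex.I))) := by
  refine ⟨fun hadm hB => ?_, fun hadm hre hy => ?_⟩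
  · obtain ⟨T, K, m, F, u, w, ψ₁, ψ₂, h⟩ := hadm.exists_asymptoticLax
    exact case_biquadratic hα hB (h.biquadratic (by rw [bgB]; linarith))
  · obtain ⟨T, K, m, F, u, w, ψ₁, ψ₂, h⟩ := hadm.exists_asymptoticLax
    exact h.case_double_root hα hre hy
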